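/- **Setting.** Let $0<\varepsilon_{\max}\le+\infty$ and let $g(\cdot,\varepsilon)=(g_1,g_2)(\cdot,\varepsilon):\mathbb R\to\mathbb R^2$, $0\le\varepsilon<\varepsilon_{\max}$, be curves, of class $C^3$ in $t$, whose $t$-derivatives of order $0,\dots,3$ are jointly continuous in $(t,\varepsilon)$ and have a jointly continuous derivative in $\varepsilon$. Write $g=g(\cdot,0)$ (the fixed boundary) and call $g(\cdot,\varepsilon)$ with $\varepsilon>0$ the free boundary. Assume that $g_1'>0$ and $g_1'g_2''-g_2'g_1''>0$ for every $\varepsilon$; that the strict epigraphs $\Xi_\varepsilon=\{(g_1(t,\varepsilon),y): t\in\mathbb R,\ y>g_2(t,\varepsilon)\}$ decrease in $\varepsilon$ and the curve $g(\cdot,\varepsilon)$ does not meet $\operatorname{cl}\Xi_{\varepsilon'}$ for $\varepsilon'>\varepsilon$; and that for $\varepsilon>0$ exactly two tangents to $g(\cdot,\varepsilon)$ pass through each point $g(t)$, each of these lines meeting the curve $g$ at a second point. The tangent whose tangency point $w_{\mathrm R}(t)$ has the smaller parameter is the right tangent ($\mathrm R$), the other one, with tangency point $w_{\mathrm L}(t)$,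 is the left tangent ($\mathrm L$). For $\sigma\in\{\mathrm R,\mathrm L\}$ let $S_\sigma(t)=[g(t),w_\sigma(t)]$, let $\kappa_\sigma(t)=\kappa_\sigma(t;\varepsilon)$ be the slope of $S_\sigma(t)$, and let $\lambda_\sigma$ be defined by $w_\sigma'=\lambda_\sigma\,(g-w_\sigma)$. Assume $\partial\kappa_\sigma/\partial\varepsilon\ne0$ for $\varepsilon>0$ and, for every $\varepsilon>0$ and $t_0\in\mathbb R$, $$(1+|w_{\mathrm R}(t)-g(t)|)\,e^{-\int_t^{t_0}\lambda_{\mathrm R}}\to0\ (t\to-\infty),\qquad (1+|w_{\mathrm L}(t)-g(t)|)\,e^{\int_{t_0}^t\lambda_{\mathrm L}}\to0\ (t\to+\infty).$$ Let $T_\varepsilon(t)$ be the closed curvilinear triangle bounded by $S_{\mathrm R}(t)$, $S_{\mathrm L}(t)$ and the arc of the free boundary between the tangency points, and let $\Omega_\varepsilon=\bigcup_{t}T_\varepsilon(t)$. **The boundary function.** For $f:\mathbb R\to\mathbb R$ put $\kappa_2=g_2'/g_1'$, $\kappa_3=f'/g_1'$, $\theta=\kappa_3'/\kappa_2'$ and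 $\gamma=(g_1,g_2,f)$ (all at $\varepsilon=0$). * *Condition reg*: $f\in C^2(\mathbb R)$, and $\theta$ is piecewise monotone with finitely many pieces. * *Condition sum*: for all $0<\varepsilon<\varepsilon_{\max}$ and $v\in\mathbb R$, $$\int_{-\infty}^v f'(x)\,e^{-\int_x^v\lambda_{\mathrm R}}\,dx>-\infty,\qquad \int_v^{+\infty}f'(x)\,e^{\int_v^x\lambda_{\mathrm L}}\,dx<+\infty$$ (that is, the negative part of the first integrand and the positive part of the second one are integrable). **Essential roots.** Essential roots of $\theta$ are closed intervals (possibly single points) $c_0<v_1<c_1<v_2<\dots<v_n<c_n$ ($n\ge0$), each being a maximal interval of constancy of $\theta$, such that $\theta$ is nondecreasing to the left of $c_0$ and between $v_k$ and $c_k$, and nonincreasing between $c_k$ and $v_{k+1}$ and to the right of $c_n$. The $v_k$ are bounded. It is allowed that $c_0=-\infty$ (then $\theta$ has no initial increasing or constant piece), that $c_n=+\infty$ (symmetrically), and that $c_0$, $c_n$ are closed rays or $c_0=\mathbb R$. Infinite $c_0$, $c_n$ (the values $\mp\infty$) count neither as points nor as intervals. **Bellman candidates.** A Bellman candidate on $\Omega_\varepsilon$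 is a continuous function $B:\Omega_\varepsilon\to\mathbb R$ with $B(g(t))=f(t)$ for all $t$, concave on every convex subset of $\Omega_\varepsilon$, such that $\Omega_\varepsilon$ is a finite union of subdomains (a subdomain is a connected nonempty open set together with a part of its boundary) on each of which $B$ is $C^1$ and either is affine or is such that the subdomain, up to points of the fixed boundary, is a union of disjoint nondegenerate segments along each of which the differential of $B$ is constant. **Figures and simple graphs.** The vertices of a simple graph are labelled by: angles $T_\varepsilon(u)$; multicups on an arc $g([l,r])$, $-\infty\le l<r\le+\infty$, that is, the part of $\Omega_\varepsilon$ to the right of $S_{\mathrm L}(l)$ and to the left of $S_{\mathrm R}(r)$, where the convex hull of the arc is not contained in $\Omega_\varepsilon$; long chords $[g(a),g(b)]\subset\Omega_\varepsilon$, $a<b$, tangent to the free boundary, with $$\det(\gamma'(b),\gamma'(a),\gamma(a)-\gamma(b))=0\quad(\text{cup equation for }(a,b))$$ and both differentials nonzero: $\det(\gamma'(a),\gamma'(b),\gamma''(a))\ne0\ne\det(\gamma'(b),\gamma'(a),\gamma''(b))$; origins $g(c)$ of cups; $-\infty$ and $+\infty$. The edges are labelled by: cups, i.e. the unions of chords $[g(s(t)),g(t)]\subset\Omega_\varepsilon$,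 $c\le t\le b$, where $c<b$, $s(c)=c$ ($c$ is the origin), and $s$ is continuous and strictly decreasing on $[c,b]$ and $C^1$ on $(c,b]$; and tangent domains of type $\sigma\in\{\mathrm R,\mathrm L\}$, i.e. the unions of $S_\sigma(t)$ over real $t\in[l,r]$, $-\infty\le l<r\le+\infty$. A cup goes from the long chord that is its upper chord to its origin. A right tangent domain over $[l,r]$ goes from a long chord with $b=l$, a multicup with right end $l$, or $-\infty$ (if $l=-\infty$), to an angle with $u=r$ or to $+\infty$ (if $r=+\infty$); a left tangent domain over $[l,r]$ goes from a long chord with $a=r$, a multicup with left end $r$, or $+\infty$ (if $r=+\infty$), to an angle with $u=l$ or to $-\infty$ (if $l=-\infty$). Each angle has exactly one incoming tangent domain of each type; each long chord has exactly one outgoing cup and one outgoing tangent domain of each type; each multicup has exactly one outgoing right (left) tangent domain if its right (left) end is finite; each origin has exactly one incoming edge; and each of $\mp\infty$, if present, has exactly one edge. A simple graph of a foliation of $\Omega_\varepsilon$ is a finite oriented graph with such labels, which is a tree without multiple edges when the orientation is dropped, has no oriented paths of length greater than one, and whose figures cover $\Omega_\varepsilon$ and have pairwise disjoint interiors. **The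 function generated by the graph** is the function $B$ on $\Omega_\varepsilon$ such that: * on a long chord, and on each chord of a cup, $B$ is affine with values $f$ at the endpoints; along a cup each pair $(s(t),t)$ satisfies the cup equation, and $(t-s(t))\det(\gamma'(t),\gamma'(s(t)),\gamma''(t))>0$ for $c<t<b$; * on a multicup $B$ is affine and equals $f$ on the arc; * on an angle $T_\varepsilon(u)$, $B$ is affine, $B(g(u))=f(u)$ and its linear part sends $g'(u)$ to $f'(u)$; * on a tangent domain of type $\sigma$ over $[l,r]$, $B(x)=f(t)+(x_1-g_1(t))\big(\kappa_3(t)+(\kappa_\sigma(t)-\kappa_2(t))\beta_2(t)\big)$ for $x\in S_\sigma(t)$, where, with $\rho=\kappa_2'/(\kappa_2-\kappa_\sigma)$, $$\beta_2(t)=e^{-\int_{t_0}^t\rho}\Big(\int_{t_0}^t e^{\int_{t_0}^x\rho}\,\frac{\kappa_3'(x)}{\kappa_2(x)-\kappa_\sigma(x)}\,dx+\beta_2(t_0)\Big)\qquad(t,t_0\in[l,r]),$$ and $\beta_2'<0$ on $(l,r)$ for $\sigma=\mathrm R$, $\beta_2'>0$ on $(l,r)$ for $\sigma=\mathrm L$;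 if the tangent domain comes from infinity ($\sigma=\mathrm R$, $l=-\infty$, $t_0=-\infty$, or $\sigma=\mathrm L$, $r=+\infty$, $t_0=+\infty$), then moreover $\beta_2(t)=\theta(t)-\int_{t_0}^t e^{-\int_x^t\rho}\,d\theta(x)$, a convergent improper integral. **Theorem.** Let $f$ satisfy Conditions reg and sum. Then essential roots of $\theta$ exist, and for any listing $c_0<v_1<c_1<\dots<v_n<c_n$ of them there is $\varepsilon_1\in(0,\varepsilon_{\max}]$, finite, such that for every $0<\varepsilon<\varepsilon_1$ there is a simple graph of a foliation of $\Omega_\varepsilon$ for which the generated function $B$ is a Bellman candidate on $\Omega_\varepsilon$ and is $C^1$-smooth on $\Omega_\varepsilon$ (up to the boundary). These graphs can be chosen so that for each such $\varepsilon$ * the origins of the cups are exactly those $c_i$ that are single (finite) points; * the multicups sit exactly on those $c_i$ that are nondegenerate intervals; * the vertices of the angles are the points $g(u_k)$ for some $u_1(\varepsilon)<\dots<u_n(\varepsilon)$; and, for each $k=1,\dots,n$, $u_k(\varepsilon)\to v_k$ as $\varepsilon\to0$ (if $v_k$ is an interval, this means that every neighbourhood of $v_k$ contains $u_k(\varepsilon)$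 for all sufficiently small $\varepsilon$). -/

import Mathlib

open Set Filter Topology MeasureTheory

namespace BellmanFoliation

noncomputable section

/-! ### The family of domains

`G ε t` is the point with parameter `t` of the curve with index `ε`; `G 0` is the fixed boundary
`g`, and `G ε` (with `ε > 0`) is the free boundary. -/

/-- The interval `[0, εmax)`; `εmax` may be `+∞`. -/
def paramSet (εmax : EReal) : Set ℝ := {ε | 0 ≤ ε ∧ (ε : EReal) < εmax}

/-- Real points between two extended real numbers, finite endpoints included. -/
def realIcc (l r : EReal) : Set ℝ := {t | l ≤ (t : EReal) ∧ (t : EReal) ≤ r}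

/-- Real points strictly between two extended real numbers. -/
def realIoo (l r : EReal) : Set ℝ := {t | l < (t : EReal) ∧ (t : EReal) < r}

/-- Strict epigraph `Ξ_ε` of the curve `G ε`. -/
def Xi (G : ℝ → ℝ → ℝ × ℝ) (ε : ℝ) : Set (ℝ × ℝ) :=
  {x | ∃ t, x.1 = (G ε t).1 ∧ (G ε t).2 < x.2}

/-- The line through `g(t)` and `G ε s` is tangent to the curve `G ε` at `G ε s`. -/
def Tangency (G : ℝ → ℝ → ℝ × ℝ) (ε t s : ℝ) : Prop :=
  ((G 0 t).2 - (G ε s).2) * (deriv (G ε) s).1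
    - ((G 0 t).1 - (G ε s).1) * (deriv (G ε) s).2 = 0

/-- Two kinds of tangents from a point of the fixed boundary. The tangent segment of type `R` lies
to the right of its tangency point, the one of type `L` lies to the left of it. -/
inductive Side
  | R
  | L

/-- Parameter of the tangency point of the tangent of the given type drawn from `g(t)`:
the smaller of the two tangency parameters for `R`, and the larger one for `L`. -/
def tpar (G : ℝ → ℝ → ℝ × ℝ) (ε : ℝ) : Side → ℝ → ℝ
  | Side.R, t => sInf {s | Tangency G ε t s}
  | Side.L, t => sSup {s | Tangency G ε t s}

/-- Tangency point `w(t; ε)`. -/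
def tpt (G : ℝ → ℝ → ℝ × ℝ) (ε : ℝ) (σ : Side) (t : ℝ) : ℝ × ℝ := G ε (tpar G ε σ t)

/-- Tangent segment `S(t; ε) = [g(t), w(t; ε)]`. -/
def tanSeg (G : ℝ → ℝ → ℝ × ℝ) (ε : ℝ) (σ : Side) (t : ℝ) : Set (ℝ × ℝ) :=
  segment ℝ (G 0 t) (tpt G ε σ t)

/-- Slope `κ(t; ε)` of the tangent segment. -/
def slope (G : ℝ → ℝ → ℝ × ℝ) (ε : ℝ) (σ : Side) (t : ℝ) : ℝ :=
  ((tpt G ε σ t).2 - (G 0 t).2) / ((tpt G ε σ t).1 - (G 0 t).1)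

/-- The scalar `λ(t; ε)` with `λ(t) (g(t) - w(t)) = w'(t)`; both vectors are parallel to the
(never vertical) tangent segment, so the first coordinates determine `λ`. -/
def lam (G : ℝ → ℝ → ℝ × ℝ) (ε : ℝ) (σ : Side) (t : ℝ) : ℝ :=
  (deriv (tpt G ε σ) t).1 / ((G 0 t).1 - (tpt G ε σ t).1)

/-- Closed curvilinear triangle `T_ε(t)` with vertex `g(t)`, bounded by the two tangent segments and
by the arc of the free boundary between the tangency points. -/
def curvTriangle (G : ℝ → ℝ → ℝ × ℝ) (ε t : ℝ) : Set (ℝ × ℝ) :=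
  ⋃ s ∈ Icc (tpar G ε Side.R t) (tpar G ε Side.L t), segment ℝ (G 0 t) (G ε s)

/-- The domain `Ω_ε`. -/
def Om (G : ℝ → ℝ → ℝ × ℝ) (ε : ℝ) : Set (ℝ × ℝ) := ⋃ t : ℝ, curvTriangle G ε t

/-- Standing assumptions on the family of curves. -/
structure AdmissibleFamily (εmax : EReal) (G : ℝ → ℝ → ℝ × ℝ) : Prop where
  εmax_pos : 0 < εmax
  /- each curve is `C³` in `t`, and the family is `C^{3,1}` in `(t, ε)` -/
  smooth : ∀ ε ∈ paramSet εmax, ContDiff ℝ 3 (G ε)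
  continuous_deriv : ∀ k ≤ 3, ContinuousOn
    (fun p : ℝ × ℝ => iteratedDeriv k (G p.1) p.2) (paramSet εmax ×ˢ univ)
  differentiable_param : ∀ k ≤ 3, ∀ ε ∈ paramSet εmax, ∀ t,
    DifferentiableWithinAt ℝ (fun e => iteratedDeriv k (G e) t) (paramSet εmax) ε
  continuous_mixed : ∀ k ≤ 3, ContinuousOn
    (fun p : ℝ × ℝ => derivWithin (fun e => iteratedDeriv k (G e) p.2) (paramSet εmax) p.1)
    (paramSet εmax ×ˢ univ)
  /- each curve is the graph of a strictly convex function -/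
  deriv_fst_pos : ∀ ε ∈ paramSet εmax, ∀ t, 0 < (deriv (G ε) t).1
  convexity : ∀ ε ∈ paramSet εmax, ∀ t,
    0 < (iteratedDeriv 2 (G ε) t).2 * (deriv (G ε) t).1
      - (deriv (G ε) t).2 * (iteratedDeriv 2 (G ε) t).1
  /- the epigraphs strictly decrease -/
  nested : ∀ ε₁ ∈ paramSet εmax, ∀ ε₂ ∈ paramSet εmax, ε₁ < ε₂ → Xi G ε₂ ⊆ Xi G ε₁
  separated : ∀ ε₁ ∈ paramSet εmax, ∀ ε₂ ∈ paramSet εmax, ε₁ < ε₂ →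
    ∀ t, G ε₁ t ∉ closure (Xi G ε₂)
  /- from each point of the fixed boundary there are two tangents to `Ξ_ε` -/
  two_tangents : ∀ ε ∈ paramSet εmax, 0 < ε → ∀ t, ∃ r l, r < l ∧ {s | Tangency G ε t s} = {r, l}
  /- and each of the two tangent lines meets the fixed boundary at a second point -/
  second_point : ∀ ε ∈ paramSet εmax, 0 < ε → ∀ (σ : Side) (t : ℝ), ∃ t', t' ≠ t ∧
    ∃ r : ℝ, G 0 t' = G 0 t + r • (tpt G ε σ t - G 0 t)
  slope_param : ∀ ε ∈ paramSet εmax, 0 < ε → ∀ (σ : Side) (t : ℝ),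
    deriv (fun e => slope G e σ t) ε ≠ 0
  /- behaviour at infinity; the choice of the norm on the plane is irrelevant here -/
  decay_right : ∀ ε ∈ paramSet εmax, 0 < ε → ∀ t₀ : ℝ, Tendsto
    (fun t => (1 + ‖tpt G ε Side.R t - G 0 t‖) * Real.exp (-∫ τ in t..t₀, lam G ε Side.R τ))
    atBot (𝓝 0)
  decay_left : ∀ ε ∈ paramSet εmax, 0 < ε → ∀ t₀ : ℝ, Tendsto
    (fun t => (1 + ‖tpt G ε Side.L t - G 0 t‖) * Real.exp (∫ τ in t₀..t, lam G ε Side.L τ))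
    atTop (𝓝 0)

/-! ### The boundary function -/

/-- `κ₂ = g₂' / g₁'`. -/
def kap2 (G : ℝ → ℝ → ℝ × ℝ) (t : ℝ) : ℝ := (deriv (G 0) t).2 / (deriv (G 0) t).1

/-- `κ₃ = f' / g₁'`. -/
def kap3 (G : ℝ → ℝ → ℝ × ℝ) (f : ℝ → ℝ) (t : ℝ) : ℝ := deriv f t / (deriv (G 0) t).1

/-- The function `κ₃' / κ₂'`; its derivative has the sign of the torsion of `γ = (g₁, g₂, f)`. -/
def tors (G : ℝ → ℝ → ℝ × ℝ) (f : ℝ → ℝ) (t : ℝ) : ℝ :=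
  deriv (kap3 G f) t / deriv (kap2 G) t

/-- Piecewise monotone, with finitely many intervals of monotonicity. -/
def PiecewiseMonotone (h : ℝ → ℝ) : Prop :=
  ∃ S : Finset ℝ, ∀ I : Set ℝ, I.OrdConnected → Disjoint I (S : Set ℝ) →
    MonotoneOn h I ∨ AntitoneOn h I

/-- The regularity condition on `f`. -/
def RegularityCondition (G : ℝ → ℝ → ℝ × ℝ) (f : ℝ → ℝ) : Prop :=
  ContDiff ℝ 2 f ∧ PiecewiseMonotone (tors G f)

/-- The summability condition on `f`. As `f'` changes sign finitely many times, the first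
integral is `> -∞` exactly when the negative part of the integrand has a finite integral, and the
second one is `< +∞` exactly when the positive part has a finite integral. -/
def SummabilityCondition (εmax : EReal) (G : ℝ → ℝ → ℝ × ℝ) (f : ℝ → ℝ) : Prop :=
  ∀ ε ∈ paramSet εmax, 0 < ε → ∀ v : ℝ,
    (∫⁻ τ in Iic v, ENNReal.ofReal
      (-(deriv f τ * Real.exp (-∫ s in τ..v, lam G ε Side.R s)))) < ⊤ ∧
    (∫⁻ τ in Ici v, ENNReal.ofReal
      (deriv f τ * Real.exp (∫ s in v..τ, lam G ε Side.L s))) < ⊤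

/-! ### Essential roots -/

/-- Endpoints of intervals `c₀ < v₁ < c₁ < ⋯ < vₙ < cₙ` (here `v` is indexed from zero, so that
the interval with index `k` of `v` is `v_{k+1}`). A one-point interval has equal endpoints;
`c₀ = -∞` is encoded by `cl 0 = cr 0 = ⊥`, and `cₙ = +∞` by `cl n = cr n = ⊤`. -/
structure RootSystem (n : ℕ) where
  cl : Fin (n + 1) → EReal
  cr : Fin (n + 1) → EReal
  vl : Fin n → ℝ
  vr : Fin n → ℝ

/-- `h` is constant on `I`. -/
def ConstOn (h : ℝ → ℝ) (I : Set ℝ) : Prop := ∀ s ∈ I, ∀ t ∈ I, h s = h t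

/-- The listed intervals are the essential roots of the measure `dh`: `h` is constant on each of
them and on no larger interval, `dh` changes its sign from plus to minus at each `c i`, and from
minus to plus at each `v k`. -/
structure RootSystem.IsEssential {n : ℕ} (R : RootSystem n) (h : ℝ → ℝ) : Prop where
  c_le : ∀ i, R.cl i ≤ R.cr i
  v_le : ∀ k, R.vl k ≤ R.vr k
  c_lt_v : ∀ k : Fin n, R.cr k.castSucc < (R.vl k : EReal)
  v_lt_c : ∀ k : Fin n, (R.vr k : EReal) < R.cl k.succ
  const_c : ∀ i, ConstOn h (realIcc (R.cl i) (R.cr i))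
  const_v : ∀ k, ConstOn h (Icc (R.vl k) (R.vr k))
  mono_first : MonotoneOn h (realIcc ⊥ (R.cl 0))
  anti_c_v : ∀ k : Fin n, AntitoneOn h (realIcc (R.cr k.castSucc) (R.vl k))
  mono_v_c : ∀ k : Fin n, MonotoneOn h (realIcc (R.vr k) (R.cl k.succ))
  anti_last : AntitoneOn h (realIcc (R.cr (Fin.last n)) ⊤)
  max_c_left : ∀ i, ∀ t : ℝ, (t : EReal) < R.cl i → ¬ ConstOn h (realIcc t (R.cl i))
  max_c_right : ∀ i, ∀ t : ℝ, R.cr i < (t : EReal) → ¬ ConstOn h (realIcc (R.cr i) t)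
  max_v_left : ∀ k, ∀ t, t < R.vl k → ¬ ConstOn h (Icc t (R.vl k))
  max_v_right : ∀ k, ∀ t, R.vr k < t → ¬ ConstOn h (Icc (R.vr k) t)

/-! ### Bellman candidates -/

/-- Concave on every convex subset. -/
def LocallyConcaveOn (Ω : Set (ℝ × ℝ)) (B : ℝ × ℝ → ℝ) : Prop :=
  ∀ K ⊆ Ω, Convex ℝ K → ConcaveOn ℝ K B

/-- An open connected set united with some part of its boundary. -/
def IsPlaneDomain (ω : Set (ℝ × ℝ)) : Prop :=
  ∃ U : Set (ℝ × ℝ), IsOpen U ∧ IsConnected U ∧ U ⊆ ω ∧ ω ⊆ closure U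

def AffineOnSet (B : ℝ × ℝ → ℝ) (ω : Set (ℝ × ℝ)) : Prop :=
  ∃ p q r : ℝ, ∀ x ∈ ω, B x = p + q * x.1 + r * x.2

/-- `ω` is foliated by disjoint segments along each of which the differential of `B` is constant.
The segments are nondegenerate; they have to cover `ω` except for points of the fixed boundary
(at the origin of a cup the chords shrink to a point of the fixed boundary). -/
def FoliatedBySegments (G : ℝ → ℝ → ℝ × ℝ) (B : ℝ × ℝ → ℝ) (ω : Set (ℝ × ℝ)) : Prop :=
  ∃ F : Set ((ℝ × ℝ) × (ℝ × ℝ)),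
    (∀ e ∈ F, e.1 ≠ e.2 ∧ segment ℝ e.1 e.2 ⊆ ω ∧
      ∃ D : (ℝ × ℝ) →L[ℝ] ℝ, ∀ x ∈ segment ℝ e.1 e.2, HasFDerivWithinAt B D ω x) ∧
    (∀ e ∈ F, ∀ e' ∈ F, e ≠ e' → Disjoint (segment ℝ e.1 e.2) (segment ℝ e'.1 e'.2)) ∧
    ω \ range (G 0) ⊆ ⋃ e ∈ F, segment ℝ e.1 e.2

/-- Bellman candidate on the whole domain `Ω_ε`. -/
def IsBellmanCandidate (G : ℝ → ℝ → ℝ × ℝ) (f : ℝ → ℝ) (ε : ℝ) (B : ℝ × ℝ → ℝ) : Prop :=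
  ContinuousOn B (Om G ε) ∧ LocallyConcaveOn (Om G ε) B ∧ (∀ t, B (G 0 t) = f t) ∧
  ∃ (N : ℕ) (ω : Fin N → Set (ℝ × ℝ)), Om G ε = ⋃ i, ω i ∧
    ∀ i, IsPlaneDomain (ω i) ∧ ContDiffOn ℝ 1 B (ω i) ∧
      (AffineOnSet B (ω i) ∨ FoliatedBySegments G B (ω i))

/-! ### Figures of a simple foliation -/

/-- Vertices: angles, multicups on a single arc (a segment, a ray or the whole line, `l < r`), and
fictitious vertices (long chords, origins of cups, the two infinities), with their numerical
parameters. -/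
inductive FVertex
  | angle (u : ℝ)
  | longChord (a b : ℝ)
  | origin (c : ℝ)
  | multicup (l r : EReal)
  | minusInf
  | plusInf

/-- Edges. `cup c b s` is the chordal domain formed by the chords `[g(s(t)), g(t)]`, `c ≤ t ≤ b`,
with origin `c` and upper chord `[g(s(b)), g(b)]`; `tangents σ l r` is the tangent domain formed
by the tangents of type `σ` drawn from the points `g(t)`, `l ≤ t ≤ r`. -/
inductive FEdge
  | cup (c b : ℝ) (s : ℝ → ℝ)
  | tangents (σ : Side) (l r : EReal)

def vertexRegion (G : ℝ → ℝ → ℝ × ℝ) (ε : ℝ) : FVertex → Set (ℝ × ℝ)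
  | FVertex.angle u => curvTriangle G ε u
  | FVertex.longChord a b => segment ℝ (G 0 a) (G 0 b)
  | FVertex.origin c => {G 0 c}
  /- the part of `Ω_ε` to the right of the left tangent at `g(l)` and to the left of the right
  tangent at `g(r)`: it is bounded by the arc of the fixed boundary over `[l, r]`, by these two
  border tangents and by an arc of the free boundary -/
  | FVertex.multicup l r =>
      (⋃ t ∈ realIcc l r, tanSeg G ε Side.L t) ∩ (⋃ t ∈ realIcc l r, tanSeg G ε Side.R t)
  | FVertex.minusInf => ∅
  | FVertex.plusInf => ∅

def edgeRegion (G : ℝ → ℝ → ℝ × ℝ) (ε : ℝ) : FEdge → Set (ℝ × ℝ)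
  | FEdge.cup c b s => ⋃ t ∈ Icc c b, segment ℝ (G 0 (s t)) (G 0 t)
  | FEdge.tangents σ l r => ⋃ t ∈ realIcc l r, tanSeg G ε σ t

/-- `γ(t)`, `γ'(t)` and `γ''(t)` for the curve `γ = (g₁, g₂, f)`. -/
def gam (G : ℝ → ℝ → ℝ × ℝ) (f : ℝ → ℝ) (t : ℝ) : Fin 3 → ℝ :=
  ![(G 0 t).1, (G 0 t).2, f t]

def gam1 (G : ℝ → ℝ → ℝ × ℝ) (f : ℝ → ℝ) (t : ℝ) : Fin 3 → ℝ :=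
  ![(deriv (G 0) t).1, (deriv (G 0) t).2, deriv f t]

def gam2 (G : ℝ → ℝ → ℝ × ℝ) (f : ℝ → ℝ) (t : ℝ) : Fin 3 → ℝ :=
  ![(iteratedDeriv 2 (G 0) t).1, (iteratedDeriv 2 (G 0) t).2, iteratedDeriv 2 f t]

/-- Determinant of the matrix with rows `x`, `y`, `z`. -/
def det3 (x y z : Fin 3 → ℝ) : ℝ := Matrix.det (Matrix.of ![x, y, z])

/-- The cup equation for the pair `(s, t)`. -/
def CupEquation (G : ℝ → ℝ → ℝ × ℝ) (f : ℝ → ℝ) (s t : ℝ) : Prop :=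
  det3 (gam1 G f t) (gam1 G f s) (gam G f s - gam G f t) = 0

/-- The expression `det(γ'(x), γ'(y), γ''(x)) / det(g'(x), g'(y))`. For `a < b` the left
differential of the chord `[g(a), g(b)]` is `differential a b`, and the right one is
`differential b a`. -/
def differential (G : ℝ → ℝ → ℝ × ℝ) (f : ℝ → ℝ) (x y : ℝ) : ℝ :=
  det3 (gam1 G f x) (gam1 G f y) (gam2 G f x) /
    ((deriv (G 0) x).1 * (deriv (G 0) y).2 - (deriv (G 0) x).2 * (deriv (G 0) y).1)

/-- Geometric conditions on the parameters of a vertex. A long chord is tangent to the free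
boundary and both its differentials are nonzero; the convex hull of the arc of a multicup is not
contained in `Ω_ε`. -/
def VertexAdmissible (G : ℝ → ℝ → ℝ × ℝ) (f : ℝ → ℝ) (ε : ℝ) : FVertex → Prop
  | FVertex.longChord a b => a < b ∧ segment ℝ (G 0 a) (G 0 b) ⊆ Om G ε ∧
      tpar G ε Side.L a = tpar G ε Side.R b ∧
      CupEquation G f a b ∧ differential G f a b ≠ 0 ∧ differential G f b a ≠ 0
  | FVertex.multicup l r => l < r ∧ ¬ convexHull ℝ (G 0 '' realIcc l r) ⊆ Om G ε
  | _ => True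

/-- Geometric conditions on the parameters of an edge. -/
def EdgeAdmissible (G : ℝ → ℝ → ℝ × ℝ) (ε : ℝ) : FEdge → Prop
  | FEdge.cup c b s => c < b ∧ s c = c ∧ StrictAntiOn s (Icc c b) ∧ ContinuousOn s (Icc c b) ∧
      ContDiffOn ℝ 1 s (Ioc c b) ∧ ∀ t ∈ Icc c b, segment ℝ (G 0 (s t)) (G 0 t) ⊆ Om G ε
  | FEdge.tangents _ l r => l < r

/-- The vertex is the source of the edge, judged by their parameters. -/
def Emits : FVertex → FEdge → Prop
  | FVertex.longChord a b, FEdge.cup _ b' s => a = s b' ∧ b = b'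
  | FVertex.longChord _ b, FEdge.tangents Side.R l _ => l = (b : EReal)
  | FVertex.longChord a _, FEdge.tangents Side.L _ r => r = (a : EReal)
  | FVertex.multicup _ q, FEdge.tangents Side.R l _ => l = q
  | FVertex.multicup p _, FEdge.tangents Side.L _ r => r = p
  | FVertex.minusInf, FEdge.tangents Side.R l _ => l = ⊥
  | FVertex.plusInf, FEdge.tangents Side.L _ r => r = ⊤
  | _, _ => False

/-- The vertex is the target of the edge, judged by their parameters. -/
def Receives : FVertex → FEdge → Prop
  | FVertex.origin c, FEdge.cup c' _ _ => c = c'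
  | FVertex.angle u, FEdge.tangents Side.R _ r => r = (u : EReal)
  | FVertex.angle u, FEdge.tangents Side.L l _ => l = (u : EReal)
  | FVertex.plusInf, FEdge.tangents Side.R _ r => r = ⊤
  | FVertex.minusInf, FEdge.tangents Side.L l _ => l = ⊥
  | _, _ => False

def FEdge.IsCup : FEdge → Prop
  | FEdge.cup _ _ _ => True
  | FEdge.tangents _ _ _ => False

def FEdge.IsTangent (σ : Side) : FEdge → Prop
  | FEdge.cup _ _ _ => False
  | FEdge.tangents σ' _ _ => σ' = σ

/-! ### Foliation graphs -/

/-- Finite oriented graph whose vertices and edges are labelled by figures with their numerical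
parameters. -/
structure FoliationGraph where
  numV : ℕ
  numE : ℕ
  vertex : Fin numV → FVertex
  edge : Fin numE → FEdge
  src : Fin numE → Fin numV
  tgt : Fin numE → Fin numV

namespace FoliationGraph

/-- The graph with the orientation disregarded. -/
def underlying (Γ : FoliationGraph) : SimpleGraph (Fin Γ.numV) :=
  SimpleGraph.fromRel fun i j => ∃ e, Γ.src e = i ∧ Γ.tgt e = j

/-- The edges that a vertex of each type must have. -/
def VertexRule (Γ : FoliationGraph) (i : Fin Γ.numV) : FVertex → Prop
  | FVertex.angle _ =>
      (∃! e, Γ.tgt e = i ∧ (Γ.edge e).IsTangent Side.R) ∧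
      (∃! e, Γ.tgt e = i ∧ (Γ.edge e).IsTangent Side.L)
  | FVertex.longChord _ _ =>
      (∃! e, Γ.src e = i ∧ (Γ.edge e).IsCup) ∧
      (∃! e, Γ.src e = i ∧ (Γ.edge e).IsTangent Side.R) ∧
      (∃! e, Γ.src e = i ∧ (Γ.edge e).IsTangent Side.L)
  | FVertex.origin _ => ∃! e, Γ.tgt e = i
  | FVertex.multicup l r =>
      (r ≠ ⊤ → ∃! e, Γ.src e = i ∧ (Γ.edge e).IsTangent Side.R) ∧
      (l ≠ ⊥ → ∃! e, Γ.src e = i ∧ (Γ.edge e).IsTangent Side.L)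
  | FVertex.minusInf => ∃! e, Γ.src e = i ∨ Γ.tgt e = i
  | FVertex.plusInf => ∃! e, Γ.src e = i ∨ Γ.tgt e = i

/-- The set of figures of the graph: vertices and edges together. -/
def region (Γ : FoliationGraph) (G : ℝ → ℝ → ℝ × ℝ) (ε : ℝ) :
    Fin Γ.numV ⊕ Fin Γ.numE → Set (ℝ × ℝ)
  | Sum.inl i => vertexRegion G ε (Γ.vertex i)
  | Sum.inr e => edgeRegion G ε (Γ.edge e)

/-- `Γ` is the graph of a foliation of `Ω_ε`. -/
structure IsFoliation (Γ : FoliationGraph) (G : ℝ → ℝ → ℝ × ℝ) (f : ℝ → ℝ) (ε : ℝ) : Prop where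
  tree : Γ.underlying.IsTree
  no_multi_edges : Function.Injective fun e => s(Γ.src e, Γ.tgt e)
  vertex_admissible : ∀ i, VertexAdmissible G f ε (Γ.vertex i)
  edge_admissible : ∀ e, EdgeAdmissible G ε (Γ.edge e)
  emits : ∀ e, Emits (Γ.vertex (Γ.src e)) (Γ.edge e)
  receives : ∀ e, Receives (Γ.vertex (Γ.tgt e)) (Γ.edge e)
  vertex_rule : ∀ i, Γ.VertexRule i (Γ.vertex i)
  cover : (⋃ x, Γ.region G ε x) = Om G ε
  disjoint : ∀ x y, x ≠ y → Disjoint (interior (Γ.region G ε x)) (interior (Γ.region G ε y))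

/-- Simple graph: no oriented path of length greater than one (and no closed multicups, which are
not among the vertex types used here). -/
def IsSimple (Γ : FoliationGraph) : Prop := ∀ e e', Γ.tgt e ≠ Γ.src e'

end FoliationGraph

/-! ### Standard candidates -/

/-- The function `κ₂' / (κ₂ - κ)`. -/
def rate (G : ℝ → ℝ → ℝ × ℝ) (ε : ℝ) (σ : Side) (t : ℝ) : ℝ :=
  deriv (kap2 G) t / (kap2 G t - slope G ε σ t)

/-- The oriented integral `∫_a^b φ dh` of a `C¹` function `φ` against the measure `dh`, where `h` is
continuous and of locally bounded variation (integration by parts). -/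
def stieltjes (φ h : ℝ → ℝ) (a b : ℝ) : ℝ :=
  φ b * h b - φ a * h a - ∫ x in a..b, deriv φ x * h x

/-- `B` is the standard candidate on the tangent domain of type `σ` over `[l, r]`. If the tangents
come from infinity, then `β₂(t) = h(t) - ∫_{t₀}^t exp(-∫_τ^t κ₂'/(κ₂ - κ)) dh(τ)`, where `h` is the
function `tors` and `t₀` is this infinity; the integral is an improper one. -/
def StandardOnTangents (G : ℝ → ℝ → ℝ × ℝ) (f : ℝ → ℝ) (ε : ℝ) (B : ℝ × ℝ → ℝ)
    (σ : Side) (l r : EReal) : Prop :=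
  ∃ β₂ : ℝ → ℝ,
    (∀ t ∈ realIcc l r, ∀ x ∈ tanSeg G ε σ t,
      B x = f t + (x.1 - (G 0 t).1) *
        (kap3 G f t + (slope G ε σ t - kap2 G t) * β₂ t)) ∧
    (∀ t₀ ∈ realIcc l r, ∀ t ∈ realIcc l r,
      β₂ t = Real.exp (-∫ x in t₀..t, rate G ε σ x) *
        ((∫ τ in t₀..t, Real.exp (∫ x in t₀..τ, rate G ε σ x) *
            (deriv (kap3 G f) τ / (kap2 G τ - slope G ε σ τ))) + β₂ t₀)) ∧
    (match σ with
      | Side.R =>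
          (l = ⊥ → ∀ t ∈ realIcc l r, Tendsto
            (fun t₀ => stieltjes (fun τ => Real.exp (-∫ x in τ..t, rate G ε Side.R x))
              (tors G f) t₀ t) atBot (𝓝 (tors G f t - β₂ t))) ∧
          ∀ t ∈ realIoo l r, deriv β₂ t < 0
      | Side.L =>
          (r = ⊤ → ∀ t ∈ realIcc l r, Tendsto
            (fun t₀ => stieltjes (fun τ => Real.exp (-∫ x in τ..t, rate G ε Side.L x))
              (tors G f) t₀ t) atTop (𝓝 (tors G f t - β₂ t))) ∧
          ∀ t ∈ realIoo l r, 0 < deriv β₂ t)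

/-- `B` is the standard candidate on the cup formed by the chords `[g(s(t)), g(t)]`. -/
def StandardOnCup (G : ℝ → ℝ → ℝ × ℝ) (f : ℝ → ℝ) (B : ℝ × ℝ → ℝ)
    (c b : ℝ) (s : ℝ → ℝ) : Prop :=
  (∀ t ∈ Icc c b, ∀ α ∈ Icc (0 : ℝ) 1,
    B (α • G 0 t + (1 - α) • G 0 (s t)) = α * f t + (1 - α) * f (s t)) ∧
  (∀ t ∈ Icc c b, CupEquation G f (s t) t) ∧
  (∀ t ∈ Ioo c b, 0 < (t - s t) * det3 (gam1 G f t) (gam1 G f (s t)) (gam2 G f t))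

def StandardOnEdge (G : ℝ → ℝ → ℝ × ℝ) (f : ℝ → ℝ) (ε : ℝ) (B : ℝ × ℝ → ℝ) : FEdge → Prop
  | FEdge.cup c b s => StandardOnCup G f B c b s
  | FEdge.tangents σ l r => StandardOnTangents G f ε B σ l r

def StandardOnVertex (G : ℝ → ℝ → ℝ × ℝ) (f : ℝ → ℝ) (ε : ℝ) (B : ℝ × ℝ → ℝ) : FVertex → Prop
  /- affine, with `γ'(u)` parallel to the graph -/
  | FVertex.angle u => ∃ p q : ℝ,
      p * (deriv (G 0) u).1 + q * (deriv (G 0) u).2 = deriv f u ∧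
      ∀ x ∈ curvTriangle G ε u, B x = f u + p * (x.1 - (G 0 u).1) + q * (x.2 - (G 0 u).2)
  | FVertex.longChord a b => ∀ α ∈ Icc (0 : ℝ) 1,
      B (α • G 0 b + (1 - α) • G 0 a) = α * f b + (1 - α) * f a
  | FVertex.origin c => B (G 0 c) = f c
  | FVertex.multicup l r => ∃ p q₁ q₂ : ℝ,
      (∀ t ∈ realIcc l r, f t = p + q₁ * (G 0 t).1 + q₂ * (G 0 t).2) ∧
      ∀ x ∈ vertexRegion G ε (FVertex.multicup l r), B x = p + q₁ * x.1 + q₂ * x.2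
  | FVertex.minusInf => True
  | FVertex.plusInf => True

/-- `B` is the function constructed from `Γ`, `f` and `ε`: the standard candidate on each figure.
As the figures cover `Ω_ε` and a tangent domain shares a tangent with its source, this determines
`B` on `Ω_ε`. -/
def FoliationGraph.Generates (Γ : FoliationGraph) (G : ℝ → ℝ → ℝ × ℝ) (f : ℝ → ℝ) (ε : ℝ)
    (B : ℝ × ℝ → ℝ) : Prop :=
  (∀ i, StandardOnVertex G f ε B (Γ.vertex i)) ∧ (∀ e, StandardOnEdge G f ε B (Γ.edge e))

end

end BellmanFoliation

open BellmanFoliation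

/-!
A Bellman candidate that is `C¹` and affine or developable on each figure is the same thing as a
continuous field of planes `Φ` on the strip `Ω_ε`: the function is `B x = Φ x (x)`, and its
differential at `x` is the linear part of `Φ x`. If the plane at `x` lies above `B` at all points
visible from `x` (`Supports`), then `B` is locally concave (`Supports.locallyConcaveOn`) and `C¹` with
the expected differential (`Supports.contDiffOn`). For a continuous field this property is local along
segments, so it can be checked figure by figure (`supports_of_cover`). Two coordinates of a point, the
parameters `base` on the fixed boundary from which the right and the left tangent through it are
drawn, describe all figures of the foliation by inequalities.

All planes used contain the tangent of the boundary curve `(g₁, g₂, f)` at some `g t`, so that they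
have one free parameter, the vertical slope `β`. Along a family of tangents the planes fit together
exactly when `β` solves the relaxation equation `β' = ρ (θ - β)`, where `ρ` is positive for right
tangents and negative for left ones, and they are supporting when `θ ≤ β`
(`supports_tangents_R`, `supports_tangents_L`). Under a chord the two tangents of the boundary curve
must lie in one plane, which is the cup equation. From a maximum of `θ` there grows a family of
chords that solve it: the function `cupDefect` has exactly one zero for each right end
(`BoundaryData.exists_isCup`). The planes over these chords rotate in one direction, and so they are
supporting (`IsCup.planeEval_le`). On an interval of constancy of `θ` one plane contains the whole
arc, and this gives a multicup. The upper chord of a cup, or the ends of a multicup, provide initial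
values above `θ` for the tangent domains on both sides, and the solutions remain above `θ` as long as
`θ` falls away from the cup. A tangent domain that comes from infinity carries the solution which has
no homogeneous part there. It exists since the integrating factor tends to zero by the decay of the
tangents, and since the integral that defines it is bounded by the summability condition
(`IsRelaxation.exists_from_bot`).

As `ε` tends to zero the tangents become short and the rate `|ρ|` grows beyond any bound, uniformly on
compact sets (`AdmissibleFamily.eventually_large_rate`). Hence a cup around `c_i` closes up at a chord
tangent to the free boundary near `c_i`, and a solution that comes from `c_i` with a value bounded
independently of `ε` falls below `θ` immediately after it has passed the next minimum `v_k`
(`RootSystem.IsEssential.eventually_lt_right`, `RootSystem.IsEssential.eventually_lt_left`). The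
solutions from the two neighbors of `v_k` therefore take equal values at some `u_k` near `v_k` where
both are still above `θ` (`exists_angle`), which is the condition for an angle with the vertex
`g (u_k)`. For solutions from infinity the uniform bound holds because they increase with `ε`.

The central figures, the vertices `u_k` and the solutions form a `FoliationData`. If these satisfy
`FoliationData.Valid`, the planes on different figures agree on their intersection
(`FoliationData.Admissible.compat`), and the field of planes is continuous and supporting. The graph
has the shape of a path of central figures and angles, with an origin hanging from each long chord.
Essential roots exist because a system of turning points of `θ` with the least number of pieces has
no superfluous constant pieces (`exists_isEssential`).
-/

namespace BellmanFoliation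
noncomputable section

/-! ### Strictly convex curves and their tangent lines -/

/-- A `C³` curve that is the graph of a strictly convex function of the first coordinate. -/
structure IsConvexCurve (c : ℝ → ℝ × ℝ) : Prop where
  smooth : ContDiff ℝ 3 c
  pos : ∀ t, 0 < (deriv c t).1
  convex : ∀ t, 0 < (iteratedDeriv 2 c t).2 * (deriv c t).1
      - (deriv c t).2 * (iteratedDeriv 2 c t).1

/-- Slope of the curve `c` at the parameter `s`. -/
def curveSlope (c : ℝ → ℝ × ℝ) (s : ℝ) : ℝ := (deriv c s).2 / (deriv c s).1

/-- Signed vertical distance from the tangent line of `c` at `c s` to the point `x`. -/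
def gap (c : ℝ → ℝ × ℝ) (x : ℝ × ℝ) (s : ℝ) : ℝ :=
  x.2 - (c s).2 - curveSlope c s * (x.1 - (c s).1)

namespace IsConvexCurve

variable {c : ℝ → ℝ × ℝ} (hc : IsConvexCurve c)
include hc

lemma differentiable : Differentiable ℝ c := hc.smooth.differentiable (by norm_num)

lemma hasDerivAt (t : ℝ) : HasDerivAt c (deriv c t) t := (hc.differentiable t).hasDerivAt

lemma hasDerivAt_fst (t : ℝ) : HasDerivAt (fun s => (c s).1) (deriv c t).1 t :=
  (hc.hasDerivAt t).fst

lemma hasDerivAt_snd (t : ℝ) : HasDerivAt (fun s => (c s).2) (deriv c t).2 t :=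
  (hc.hasDerivAt t).snd

lemma contDiff_deriv : ContDiff ℝ 2 (deriv c) :=
  ((contDiff_succ_iff_deriv (n := 2)).1
    (by have := hc.smooth; rwa [show (3 : WithTop ℕ∞) = 2 + 1 by norm_num] at this)).2.2

lemma continuous : Continuous c := hc.smooth.continuous

lemma continuous_fst : Continuous fun s => (c s).1 := hc.continuous.fst

lemma continuous_snd : Continuous fun s => (c s).2 := hc.continuous.snd

lemma continuous_deriv_fst : Continuous fun s => (deriv c s).1 := hc.contDiff_deriv.continuous.fst

lemma strictMono_fst : StrictMono fun s => (c s).1 :=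
  strictMono_of_deriv_pos fun s => by rw [(hc.hasDerivAt_fst s).deriv]; exact hc.pos s

lemma fst_lt {s t : ℝ} : (c s).1 < (c t).1 ↔ s < t := hc.strictMono_fst.lt_iff_lt

lemma fst_le {s t : ℝ} : (c s).1 ≤ (c t).1 ↔ s ≤ t := hc.strictMono_fst.le_iff_le

lemma fst_inj {s t : ℝ} : (c s).1 = (c t).1 ↔ s = t := hc.strictMono_fst.injective.eq_iff

lemma contDiff_curveSlope : ContDiff ℝ 2 (curveSlope c) :=
  hc.contDiff_deriv.snd.div hc.contDiff_deriv.fst fun s => (hc.pos s).ne'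

lemma continuous_curveSlope : Continuous (curveSlope c) := hc.contDiff_curveSlope.continuous

lemma hasDerivAt_curveSlope (s : ℝ) :
    HasDerivAt (curveSlope c) (deriv (curveSlope c) s) s :=
  (hc.contDiff_curveSlope.differentiable (by norm_num) s).hasDerivAt

lemma continuous_deriv_curveSlope : Continuous (deriv (curveSlope c)) :=
  hc.contDiff_curveSlope.continuous_deriv (by norm_num)

lemma deriv_curveSlope (s : ℝ) : deriv (curveSlope c) s =
    ((iteratedDeriv 2 c s).2 * (deriv c s).1 - (deriv c s).2 * (iteratedDeriv 2 c s).1)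
      / (deriv c s).1 ^ 2 := by
  have h2 : HasDerivAt (deriv c) (iteratedDeriv 2 c s) s := by
    rw [iteratedDeriv_succ, iteratedDeriv_one]
    exact (hc.contDiff_deriv.differentiable (by norm_num) s).hasDerivAt
  have h3 : HasDerivAt (fun s => (deriv c s).1) (iteratedDeriv 2 c s).1 s := h2.fst
  have h4 : HasDerivAt (fun s => (deriv c s).2) (iteratedDeriv 2 c s).2 s := h2.snd
  exact (h4.div h3 (hc.pos s).ne').deriv

lemma deriv_curveSlope_pos (s : ℝ) : 0 < deriv (curveSlope c) s := by
  rw [hc.deriv_curveSlope]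
  exact div_pos (hc.convex s) (pow_pos (hc.pos s) 2)

lemma strictMono_curveSlope : StrictMono (curveSlope c) :=
  strictMono_of_deriv_pos hc.deriv_curveSlope_pos

lemma deriv_snd_eq (s : ℝ) : (deriv c s).2 = curveSlope c s * (deriv c s).1 := by
  rw [curveSlope, div_mul_cancel₀ _ (hc.pos s).ne']

lemma hasDerivAt_gap (x : ℝ × ℝ) (s : ℝ) :
    HasDerivAt (gap c x) (-(deriv (curveSlope c) s * (x.1 - (c s).1))) s := by
  have := (((hasDerivAt_const s x.2).sub (hc.hasDerivAt_snd s)).sub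
    ((hc.hasDerivAt_curveSlope s).mul
      ((hasDerivAt_const s x.1).sub (hc.hasDerivAt_fst s))))
  refine (this : HasDerivAt (gap c x) _ s).congr_deriv ?_
  rw [hc.deriv_snd_eq s]; simp only [Pi.sub_apply]; ring

lemma continuous_gap (x : ℝ × ℝ) : Continuous (gap c x) :=
  continuous_iff_continuousAt.2 fun s => (hc.hasDerivAt_gap x s).continuousAt

omit hc in
lemma continuous_gap_point (s : ℝ) : Continuous fun x => gap c x s := by
  unfold gap; fun_prop

lemma gap_strictAntiOn (x : ℝ × ℝ) {D : Set ℝ} (hD : Convex ℝ D)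
    (h : ∀ s ∈ interior D, (c s).1 < x.1) : StrictAntiOn (gap c x) D :=
  strictAntiOn_of_deriv_neg hD (hc.continuous_gap x).continuousOn fun s hs => by
    rw [(hc.hasDerivAt_gap x s).deriv, neg_lt_zero]
    exact mul_pos (hc.deriv_curveSlope_pos s) (sub_pos.2 (h s hs))

lemma gap_strictMonoOn (x : ℝ × ℝ) {D : Set ℝ} (hD : Convex ℝ D)
    (h : ∀ s ∈ interior D, x.1 < (c s).1) : StrictMonoOn (gap c x) D :=
  strictMonoOn_of_deriv_pos hD (hc.continuous_gap x).continuousOn fun s hs => by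
    rw [(hc.hasDerivAt_gap x s).deriv, neg_pos]
    exact mul_neg_of_pos_of_neg (hc.deriv_curveSlope_pos s) (sub_neg.2 (h s hs))

lemma gap_anti {x : ℝ × ℝ} {s₀ : ℝ} (h : (c s₀).1 ≤ x.1) : StrictAntiOn (gap c x) (Iic s₀) :=
  hc.gap_strictAntiOn x (convex_Iic _) fun s hs => by
    rw [interior_Iic] at hs; exact (hc.fst_lt.2 hs).trans_le h

lemma gap_mono {x : ℝ × ℝ} {s₀ : ℝ} (h : x.1 ≤ (c s₀).1) : StrictMonoOn (gap c x) (Ici s₀) :=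
  hc.gap_strictMonoOn x (convex_Ici _) fun s hs => by
    rw [interior_Ici] at hs; exact h.trans_lt (hc.fst_lt.2 hs)

omit hc in
lemma gap_self (s : ℝ) : gap c (c s) s = 0 := by simp [gap]

/-- A strictly convex curve lies strictly above its tangent lines. -/
lemma gap_pos {s t : ℝ} (h : s ≠ t) : 0 < gap c (c t) s := by
  rcases lt_or_gt_of_ne h with h | h
  · simpa [gap_self] using hc.gap_anti (x := c t) le_rfl (mem_Iic.2 h.le) self_mem_Iic h
  · simpa [gap_self] using hc.gap_mono (x := c t) le_rfl self_mem_Ici (mem_Ici.2 h.le) h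

lemma gap_nonneg (s t : ℝ) : 0 ≤ gap c (c t) s := by
  rcases eq_or_ne s t with rfl | h
  · rw [gap_self]
  · exact (hc.gap_pos h).le

omit hc in
lemma gap_eq_of_fst_eq {x : ℝ × ℝ} {s : ℝ} (h : (c s).1 = x.1) : gap c x s = x.2 - (c s).2 := by
  simp [gap, h]

omit hc in
lemma gap_add (x y : ℝ × ℝ) (s : ℝ) (a b : ℝ) (hab : a + b = 1) :
    gap c (a • x + b • y) s = a * gap c x s + b * gap c y s := by
  obtain rfl : b = 1 - a := by linarith
  simp only [gap, Prod.fst_add, Prod.snd_add, Prod.smul_fst, Prod.smul_snd, smul_eq_mul]; ring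

/-- A point of a segment with endpoints on or above the curve is on or above the curve. -/
lemma le_snd_of_mem_segment {x y z : ℝ × ℝ} {p q s : ℝ} (hp : (c p).1 = x.1) (hpx : (c p).2 ≤ x.2)
    (hq : (c q).1 = y.1) (hqy : (c q).2 ≤ y.2) (hz : z ∈ segment ℝ x y) (hs : (c s).1 = z.1) :
    (c s).2 ≤ z.2 := by
  obtain ⟨a, b, ha, hb, hab, rfl⟩ := hz
  have h1 : ∀ {w : ℝ × ℝ} {r : ℝ}, (c r).1 = w.1 → (c r).2 ≤ w.2 → 0 ≤ gap c w s := by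
    intro w r h h'
    have := hc.gap_nonneg s r
    simp only [gap, h] at this ⊢
    linarith
  have := gap_add (c := c) x y s a b hab
  rw [gap_eq_of_fst_eq hs] at this
  nlinarith [mul_nonneg ha (h1 hp hpx), mul_nonneg hb (h1 hq hqy)]

end IsConvexCurve

/-! ### The strip between the two boundaries and tangents to the free boundary -/

/-- Parameter of the tangency point of the tangent of the given type drawn from `x` to `h`. -/
def tanPar (h : ℝ → ℝ × ℝ) : Side → ℝ × ℝ → ℝ
  | Side.R, x => sInf {s | gap h x s = 0}
  | Side.L, x => sSup {s | gap h x s = 0}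

/-- Two nested convex curves with two tangents to the inner one from each point of the outer one,
each of which meets the outer curve once more. -/
structure IsTangentPair (g h : ℝ → ℝ × ℝ) : Prop where
  outer : IsConvexCurve g
  inner : IsConvexCurve h
  two : ∀ t, ∃ r l, r < l ∧ {s | gap h (g t) s = 0} = {r, l}
  exists_outer : ∀ s, ∃ t, (g t).1 = (h s).1
  second : ∀ σ t, ∃ t', t' ≠ t ∧ ∃ r : ℝ, g t' = g t + r • (h (tanPar h σ (g t)) - g t)

/-- The closed strip between the two curves. -/
def strip (g h : ℝ → ℝ × ℝ) : Set (ℝ × ℝ) :=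
  {x | ∃ t s, (g t).1 = x.1 ∧ (h s).1 = x.1 ∧ (g t).2 ≤ x.2 ∧ x.2 ≤ (h s).2}

namespace IsTangentPair

variable {g h : ℝ → ℝ × ℝ} (hp : IsTangentPair g h)
include hp

/-- The inner curve passes above every point of the outer curve: as the signed distance to a tangent
decreases and then increases in the tangency parameter, the two tangents through `g t` touch `h` on
the two sides of the vertical line through `g t`. -/
lemma exists_inner (t : ℝ) : ∃ s, (h s).1 = (g t).1 ∧ (g t).2 < (h s).2 := by
  obtain ⟨r, l, hrl, hset⟩ := hp.two t
  have hr : gap h (g t) r = 0 := by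
    have : r ∈ {s | gap h (g t) s = 0} := by rw [hset]; simp
    exact this
  have hl : gap h (g t) l = 0 := by
    have : l ∈ {s | gap h (g t) s = 0} := by rw [hset]; simp
    exact this
  have h1 : (h r).1 < (g t).1 := by
    by_contra hcon
    have := hp.inner.gap_mono (not_lt.1 hcon) self_mem_Ici (mem_Ici.2 hrl.le) hrl
    linarith
  have h2 : (g t).1 < (h l).1 := by
    by_contra hcon
    have := hp.inner.gap_anti (not_lt.1 hcon) (mem_Iic.2 hrl.le) self_mem_Iic hrl
    linarith
  obtain ⟨s, hs, hs'⟩ := intermediate_value_Icc hrl.le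
    hp.inner.continuous_fst.continuousOn (mem_Icc.2 ⟨h1.le, h2.le⟩)
  refine ⟨s, hs', ?_⟩
  have hrs : r < s := hp.inner.fst_lt.1 (by simpa [hs'] using h1)
  have := hp.inner.gap_anti (x := g t) hs'.le (mem_Iic.2 hrs.le) self_mem_Iic hrs
  rw [hr, IsConvexCurve.gap_eq_of_fst_eq hs'] at this
  linarith

lemma curve_mem_strip (t : ℝ) : g t ∈ strip g h := by
  obtain ⟨s, hs, hs'⟩ := hp.exists_inner t
  exact ⟨t, s, rfl, hs, le_rfl, hs'.le⟩

lemma lt_snd {t s : ℝ} (hts : (g t).1 = (h s).1) : (g t).2 < (h s).2 := by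
  obtain ⟨s', h1, h2⟩ := hp.exists_inner t
  rwa [hp.inner.fst_inj.1 (h1.trans hts)] at h2

lemma inner_mem_strip (s : ℝ) : h s ∈ strip g h := by
  obtain ⟨t, ht⟩ := hp.exists_outer s
  exact ⟨t, s, ht, rfl, (hp.lt_snd ht).le, le_rfl⟩

/-- The two tangency parameters of a point of the strip, and the parameter of the point of the
inner curve above it. -/
lemma tanPar_spec {x : ℝ × ℝ} (hx : x ∈ strip g h) : ∃ s₀, (h s₀).1 = x.1 ∧ x.2 ≤ (h s₀).2 ∧
    tanPar h Side.R x ≤ s₀ ∧ s₀ ≤ tanPar h Side.L x ∧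
    gap h x (tanPar h Side.R x) = 0 ∧ gap h x (tanPar h Side.L x) = 0 := by
  obtain ⟨t, s₀, ht, hs, htx, hxs⟩ := hx
  have anti := hp.inner.gap_anti (x := x) hs.le
  have mono := hp.inner.gap_mono (x := x) hs.ge
  have h0 : gap h x s₀ ≤ 0 := by rw [IsConvexCurve.gap_eq_of_fst_eq hs]; linarith
  obtain ⟨r, l, hrl, hset⟩ := hp.two t
  have hr : gap h (g t) r = 0 := by
    have : r ∈ {s | gap h (g t) s = 0} := by rw [hset]; simp
    exact this
  have hl : gap h (g t) l = 0 := by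
    have : l ∈ {s | gap h (g t) s = 0} := by rw [hset]; simp
    exact this
  have hrs : r < s₀ := by
    by_contra hcon
    have := hp.inner.gap_mono (x := g t) (s₀ := r) (by rw [ht, ← hs]; exact hp.inner.fst_le.2 (not_lt.1 hcon)) self_mem_Ici
      (mem_Ici.2 hrl.le) hrl
    linarith
  have hsl : s₀ < l := by
    by_contra hcon
    have := hp.inner.gap_anti (x := g t) (s₀ := l) (by rw [ht, ← hs]; exact hp.inner.fst_le.2 (not_lt.1 hcon))
      (mem_Iic.2 hrl.le) self_mem_Iic hrl
    linarith
  -- `x` is above `g t`, so its distance to the tangents is nonnegative at the two zeros for `g t`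
  have hup : ∀ s, gap h (g t) s ≤ gap h x s := fun s => by simp only [gap, ht]; linarith
  obtain ⟨a, ha, ha'⟩ := intermediate_value_Icc' hrs.le (hp.inner.continuous_gap x).continuousOn
    (mem_Icc.2 ⟨h0, by simpa [hr] using hup r⟩)
  obtain ⟨b, hb, hb'⟩ := intermediate_value_Icc hsl.le (hp.inner.continuous_gap x).continuousOn
    (mem_Icc.2 ⟨h0, by simpa [hl] using hup l⟩)
  have hzero : {s | gap h x s = 0} = {a, b} := by
    ext s
    simp only [mem_ofPred_eq, mem_insert_iff, mem_singleton_iff]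
    constructor
    · intro h
      rcases le_total s s₀ with h' | h'
      · exact Or.inl (anti.injOn h' ha.2 (by rw [h, ha']))
      · exact Or.inr (mono.injOn h' hb.1 (by rw [h, hb']))
    · rintro (rfl | rfl) <;> assumption
  have hab : a ≤ b := ha.2.trans hb.1
  have hR : tanPar h Side.R x = a := by rw [tanPar, hzero, csInf_pair, inf_eq_left.2 hab]
  have hL : tanPar h Side.L x = b := by rw [tanPar, hzero, csSup_pair, sup_eq_right.2 hab]
  exact ⟨s₀, hs, hxs, by rw [hR]; exact ha.2, by rw [hL]; exact hb.1, by rw [hR, ha'], by rw [hL, hb']⟩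

lemma gap_tanPar {x : ℝ × ℝ} (hx : x ∈ strip g h) (σ : Side) : gap h x (tanPar h σ x) = 0 := by
  obtain ⟨s₀, -, -, -, -, h1, h2⟩ := hp.tanPar_spec hx
  cases σ <;> assumption

lemma tanPar_le {x : ℝ × ℝ} (hx : x ∈ strip g h) : tanPar h Side.R x ≤ tanPar h Side.L x := by
  obtain ⟨s₀, -, -, h1, h2, -⟩ := hp.tanPar_spec hx
  exact h1.trans h2

lemma fst_tanPar_R_le {x : ℝ × ℝ} (hx : x ∈ strip g h) : (h (tanPar h Side.R x)).1 ≤ x.1 := by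
  obtain ⟨s₀, h0, -, h1, -⟩ := hp.tanPar_spec hx
  rw [← h0]; exact hp.inner.fst_le.2 h1

lemma le_fst_tanPar_L {x : ℝ × ℝ} (hx : x ∈ strip g h) : x.1 ≤ (h (tanPar h Side.L x)).1 := by
  obtain ⟨s₀, h0, -, -, h1, -⟩ := hp.tanPar_spec hx
  rw [← h0]; exact hp.inner.fst_le.2 h1

lemma gap_pos_of_lt {x : ℝ × ℝ} (hx : x ∈ strip g h) {s : ℝ} (hs : s < tanPar h Side.R x) :
    0 < gap h x s := by
  obtain ⟨s₀, h0, -, h1, -, h2, -⟩ := hp.tanPar_spec hx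
  rw [← h2]
  exact hp.inner.gap_anti h0.le (mem_Iic.2 (hs.le.trans h1)) (mem_Iic.2 h1) hs

lemma gap_pos_of_gt {x : ℝ × ℝ} (hx : x ∈ strip g h) {s : ℝ} (hs : tanPar h Side.L x < s) :
    0 < gap h x s := by
  obtain ⟨s₀, h0, -, -, h1, -, h2⟩ := hp.tanPar_spec hx
  rw [← h2]
  exact hp.inner.gap_mono h0.ge (mem_Ici.2 h1) (mem_Ici.2 (h1.trans hs.le)) hs

lemma gap_neg_of_mem {x : ℝ × ℝ} (hx : x ∈ strip g h) {s : ℝ} (h1 : tanPar h Side.R x < s)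
    (h2 : s < tanPar h Side.L x) : gap h x s < 0 := by
  obtain ⟨s₀, h0, -, h3, h4, h5, h6⟩ := hp.tanPar_spec hx
  rcases le_total s s₀ with h' | h'
  · rw [← h5]; exact hp.inner.gap_anti h0.le (mem_Iic.2 h3) (mem_Iic.2 h') h1
  · rw [← h6]; exact hp.inner.gap_mono h0.ge (mem_Ici.2 h') (mem_Ici.2 h4) h2

lemma gap_nonpos_of_mem {x : ℝ × ℝ} (hx : x ∈ strip g h) {s : ℝ} (h1 : tanPar h Side.R x ≤ s)
    (h2 : s ≤ tanPar h Side.L x) : gap h x s ≤ 0 := by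
  rcases h1.eq_or_lt with rfl | h1
  · rw [hp.gap_tanPar hx]
  rcases h2.eq_or_lt with rfl | h2
  · rw [hp.gap_tanPar hx]
  exact (hp.gap_neg_of_mem hx h1 h2).le

/-- Recognition of the right tangency parameter. -/
lemma tanPar_R_eq {x : ℝ × ℝ} (hx : x ∈ strip g h) {s : ℝ} (h0 : gap h x s = 0)
    (h1 : (h s).1 ≤ x.1) : tanPar h Side.R x = s := by
  obtain ⟨s₀, h2, -, h3, -, h4, -⟩ := hp.tanPar_spec hx
  exact (hp.inner.gap_anti h2.le).injOn (mem_Iic.2 h3)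
    (mem_Iic.2 (hp.inner.fst_le.1 (by rwa [h2]))) (by rw [h4, h0])

lemma tanPar_L_eq {x : ℝ × ℝ} (hx : x ∈ strip g h) {s : ℝ} (h0 : gap h x s = 0)
    (h1 : x.1 ≤ (h s).1) : tanPar h Side.L x = s := by
  obtain ⟨s₀, h2, -, -, h3, -, h4⟩ := hp.tanPar_spec hx
  exact (hp.inner.gap_mono h2.ge).injOn (mem_Ici.2 h3)
    (mem_Ici.2 (hp.inner.fst_le.1 (by rwa [h2]))) (by rw [h4, h0])

lemma tanPar_inner (σ : Side) (s : ℝ) : tanPar h σ (h s) = s := by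
  cases σ
  · exact hp.tanPar_R_eq (hp.inner_mem_strip s) (IsConvexCurve.gap_self s) le_rfl
  · exact hp.tanPar_L_eq (hp.inner_mem_strip s) (IsConvexCurve.gap_self s) le_rfl

lemma le_tanPar_R {x : ℝ × ℝ} (hx : x ∈ strip g h) {s : ℝ} (h0 : 0 ≤ gap h x s)
    (h1 : (h s).1 ≤ x.1) : s ≤ tanPar h Side.R x := by
  obtain ⟨s₀, h2, -, h3, -, h4, -⟩ := hp.tanPar_spec hx
  by_contra hcon
  have := hp.inner.gap_anti h2.le (mem_Iic.2 h3)
    (mem_Iic.2 (hp.inner.fst_le.1 (by rwa [h2]))) (not_le.1 hcon)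
  linarith

lemma tanPar_L_le {x : ℝ × ℝ} (hx : x ∈ strip g h) {s : ℝ} (h0 : 0 ≤ gap h x s)
    (h1 : x.1 ≤ (h s).1) : tanPar h Side.L x ≤ s := by
  obtain ⟨s₀, h2, -, -, h3, -, h4⟩ := hp.tanPar_spec hx
  by_contra hcon
  have := hp.inner.gap_mono h2.ge
    (mem_Ici.2 (hp.inner.fst_le.1 (by rwa [h2]))) (mem_Ici.2 h3) (not_le.1 hcon)
  linarith

lemma lt_tanPar_R_iff {x : ℝ × ℝ} (hx : x ∈ strip g h) {s : ℝ} :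
    s < tanPar h Side.R x ↔ (h s).1 < x.1 ∧ 0 < gap h x s := by
  constructor
  · intro hs
    exact ⟨(hp.inner.fst_lt.2 hs).trans_le (hp.fst_tanPar_R_le hx), hp.gap_pos_of_lt hx hs⟩
  · rintro ⟨h1, h2⟩
    refine lt_of_le_of_ne (hp.le_tanPar_R hx h2.le h1.le) ?_
    rintro rfl
    rw [hp.gap_tanPar hx] at h2; exact lt_irrefl _ h2

lemma tanPar_R_lt_iff {x : ℝ × ℝ} (hx : x ∈ strip g h) {s : ℝ} :
    tanPar h Side.R x < s ↔ x.1 < (h s).1 ∨ gap h x s < 0 := by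
  constructor
  · intro hs
    by_contra hcon
    rw [not_or, not_lt, not_lt] at hcon
    exact (hp.le_tanPar_R hx hcon.2 hcon.1).not_gt hs
  · rintro (h1 | h1)
    · exact hp.inner.fst_lt.1 ((hp.fst_tanPar_R_le hx).trans_lt h1)
    · by_contra hcon
      rcases (not_lt.1 hcon).eq_or_lt with rfl | h2
      · rw [hp.gap_tanPar hx] at h1; exact lt_irrefl _ h1
      · exact (hp.gap_pos_of_lt hx h2).not_gt h1

lemma tanPar_L_lt_iff {x : ℝ × ℝ} (hx : x ∈ strip g h) {s : ℝ} :
    tanPar h Side.L x < s ↔ x.1 < (h s).1 ∧ 0 < gap h x s := by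
  constructor
  · intro hs
    exact ⟨(hp.le_fst_tanPar_L hx).trans_lt (hp.inner.fst_lt.2 hs), hp.gap_pos_of_gt hx hs⟩
  · rintro ⟨h1, h2⟩
    refine lt_of_le_of_ne (hp.tanPar_L_le hx h2.le h1.le) ?_
    rintro rfl
    rw [hp.gap_tanPar hx] at h2; exact lt_irrefl _ h2

lemma lt_tanPar_L_iff {x : ℝ × ℝ} (hx : x ∈ strip g h) {s : ℝ} :
    s < tanPar h Side.L x ↔ (h s).1 < x.1 ∨ gap h x s < 0 := by
  constructor
  · intro hs
    by_contra hcon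
    rw [not_or, not_lt, not_lt] at hcon
    exact (hp.tanPar_L_le hx hcon.2 hcon.1).not_gt hs
  · rintro (h1 | h1)
    · exact hp.inner.fst_lt.1 (h1.trans_le (hp.le_fst_tanPar_L hx))
    · by_contra hcon
      rcases (not_lt.1 hcon).eq_or_lt with rfl | h2
      · rw [hp.gap_tanPar hx] at h1; exact lt_irrefl _ h1
      · exact (hp.gap_pos_of_gt hx h2).not_gt h1

/-- The inequalities between a tangency parameter of `x` and a given number are open conditions on
`x`, expressed by the sign of `gap`. -/
lemma continuousOn_tanPar (σ : Side) : ContinuousOn (tanPar h σ) (strip g h) := by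
  intro x hx
  refine tendsto_order.2 ⟨fun s hs => ?_, fun s hs => ?_⟩
  · cases σ
    · have h1 := (hp.lt_tanPar_R_iff hx).1 hs
      have h2 : ∀ᶠ y in 𝓝 x, (h s).1 < y.1 ∧ 0 < gap h y s :=
        (continuous_fst.continuousAt.eventually (lt_mem_nhds h1.1)).and
          ((IsConvexCurve.continuous_gap_point (c := h) s).continuousAt.eventually (lt_mem_nhds h1.2))
      filter_upwards [mem_nhdsWithin_of_mem_nhds h2, self_mem_nhdsWithin] with y hy hy'
      exact (hp.lt_tanPar_R_iff hy').2 hy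
    · have h1 := (hp.lt_tanPar_L_iff hx).1 hs
      have h2 : ∀ᶠ y in 𝓝 x, (h s).1 < y.1 ∨ gap h y s < 0 := by
        rcases h1 with h1 | h1
        · exact (continuous_fst.continuousAt.eventually (lt_mem_nhds h1)).mono fun _ h => Or.inl h
        · exact ((IsConvexCurve.continuous_gap_point (c := h) s).continuousAt.eventually
            (gt_mem_nhds h1)).mono fun _ h => Or.inr h
      filter_upwards [mem_nhdsWithin_of_mem_nhds h2, self_mem_nhdsWithin] with y hy hy'
      exact (hp.lt_tanPar_L_iff hy').2 hy
  · cases σ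
    · have h1 := (hp.tanPar_R_lt_iff hx).1 hs
      have h2 : ∀ᶠ y in 𝓝 x, y.1 < (h s).1 ∨ gap h y s < 0 := by
        rcases h1 with h1 | h1
        · exact (continuous_fst.continuousAt.eventually (gt_mem_nhds h1)).mono fun _ h => Or.inl h
        · exact ((IsConvexCurve.continuous_gap_point (c := h) s).continuousAt.eventually
            (gt_mem_nhds h1)).mono fun _ h => Or.inr h
      filter_upwards [mem_nhdsWithin_of_mem_nhds h2, self_mem_nhdsWithin] with y hy hy'
      exact (hp.tanPar_R_lt_iff hy').2 hy
    · have h1 := (hp.tanPar_L_lt_iff hx).1 hs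
      have h2 : ∀ᶠ y in 𝓝 x, y.1 < (h s).1 ∧ 0 < gap h y s :=
        (continuous_fst.continuousAt.eventually (gt_mem_nhds h1.1)).and
          ((IsConvexCurve.continuous_gap_point (c := h) s).continuousAt.eventually (lt_mem_nhds h1.2))
      filter_upwards [mem_nhdsWithin_of_mem_nhds h2, self_mem_nhdsWithin] with y hy hy'
      exact (hp.tanPar_L_lt_iff hy').2 hy

/-- If a segment stays in the strip, the right tangent through one endpoint touches the inner curve
before the left tangent through the other endpoint. -/
lemma tanPar_le_of_segment_subset {x y : ℝ × ℝ} (hxy : segment ℝ x y ⊆ strip g h) :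
    tanPar h Side.R x ≤ tanPar h Side.L y := by
  have hx := hxy (left_mem_segment ℝ x y)
  have hy := hxy (right_mem_segment ℝ x y)
  by_contra hcon
  obtain ⟨s, hs1, hs2⟩ := exists_between (not_le.1 hcon)
  have gx := hp.gap_pos_of_lt hx hs2
  have gy := hp.gap_pos_of_gt hy hs1
  have fx : (h s).1 < x.1 := (hp.inner.fst_lt.2 hs2).trans_le (hp.fst_tanPar_R_le hx)
  have fy : y.1 < (h s).1 := (hp.le_fst_tanPar_L hy).trans_lt (hp.inner.fst_lt.2 hs1)
  set a := ((h s).1 - y.1) / (x.1 - y.1) with ha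
  have hd : 0 < x.1 - y.1 := by linarith
  have ha0 : 0 < a := div_pos (by linarith) hd
  have ha1 : a < 1 := (div_lt_one hd).2 (by linarith)
  have hz := hxy ⟨a, 1 - a, ha0.le, by linarith, by ring, rfl⟩
  have hz1 : (h s).1 = (a • x + (1 - a) • y).1 := by
    simp only [Prod.fst_add, Prod.smul_fst, smul_eq_mul]
    have : a * (x.1 - y.1) = (h s).1 - y.1 := div_mul_cancel₀ _ hd.ne'
    linarith
  have hg := IsConvexCurve.gap_add (c := h) x y s a (1 - a) (by ring)
  rw [IsConvexCurve.gap_eq_of_fst_eq hz1] at hg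
  obtain ⟨t, s', -, h2, -, h4⟩ := hz
  rw [← hp.inner.fst_inj.1 (hz1.trans h2.symm)] at h4
  nlinarith [mul_pos ha0 gx, mul_pos (sub_pos.2 ha1) gy]

end IsTangentPair

end
end BellmanFoliation

namespace BellmanFoliation
noncomputable section

/-! ### Coordinates given by the two tangents through a point -/

/-- Parameter of the point of the outer curve from which the tangent of type `σ` through `x` is
drawn. -/
def base (g h : ℝ → ℝ × ℝ) (σ : Side) (x : ℝ × ℝ) : ℝ :=
  Function.invFun (fun t => tanPar h σ (g t)) (tanPar h σ x)

namespace IsTangentPair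

variable {g h : ℝ → ℝ × ℝ} (hp : IsTangentPair g h)
include hp

omit hp in
lemma exists_curve_mem (x : ℝ × ℝ) (hx : x ∈ strip g h) : ∃ t, (g t).1 = x.1 ∧ (g t).2 ≤ x.2 := by
  obtain ⟨t, _, h1, _, h2, _⟩ := hx; exact ⟨t, h1, h2⟩

lemma mem_strip_of_mem_segment {x y z : ℝ × ℝ} (hx : x ∈ strip g h) (hy : y ∈ strip g h)
    (hz : z ∈ segment ℝ x y) {s : ℝ} (hxs : gap h x s ≤ 0) (hys : gap h y s ≤ 0) :
    z ∈ strip g h := by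
  obtain ⟨p, -, hp1, -, hp2, -⟩ := hx
  obtain ⟨q, -, hq1, -, hq2, -⟩ := hy
  have hz1 : z.1 ∈ range fun t => (g t).1 := by
    have hc : (range fun t => (g t).1).OrdConnected :=
      (isPreconnected_range hp.outer.continuous_fst).ordConnected
    obtain ⟨a, b, ha, hb, hab, rfl⟩ := hz
    have hcv : Convex ℝ (range fun t => (g t).1) := hc.convex
    exact hcv ⟨p, hp1⟩ ⟨q, hq1⟩ ha hb hab
  obtain ⟨t, ht⟩ := hz1
  obtain ⟨s₀, hs, -⟩ := hp.exists_inner t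
  refine ⟨t, s₀, ht, hs.trans ht, hp.outer.le_snd_of_mem_segment hp1 hp2 hq1 hq2 hz ht, ?_⟩
  have hzs : gap h z s ≤ 0 := by
    obtain ⟨a, b, ha, hb, hab, rfl⟩ := hz
    rw [IsConvexCurve.gap_add _ _ _ _ _ hab]; nlinarith
  have h2 := hp.inner.gap_nonneg s s₀
  have h3 : (h s₀).1 = z.1 := hs.trans ht
  simp only [gap, h3] at h2 hzs
  linarith

lemma tangency_R_lt (t : ℝ) : (h (tanPar h Side.R (g t))).1 < (g t).1 := by
  refine lt_of_le_of_ne (hp.fst_tanPar_R_le (hp.curve_mem_strip t)) fun hcon => ?_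
  have := hp.gap_tanPar (hp.curve_mem_strip t) Side.R
  rw [IsConvexCurve.gap_eq_of_fst_eq hcon] at this
  have := hp.lt_snd hcon.symm
  linarith

lemma lt_tangency_L (t : ℝ) : (g t).1 < (h (tanPar h Side.L (g t))).1 := by
  refine lt_of_le_of_ne (hp.le_fst_tanPar_L (hp.curve_mem_strip t)) fun hcon => ?_
  have := hp.gap_tanPar (hp.curve_mem_strip t) Side.L
  rw [IsConvexCurve.gap_eq_of_fst_eq hcon.symm] at this
  have := hp.lt_snd hcon
  linarith

lemma tangency_lt (t : ℝ) : tanPar h Side.R (g t) < tanPar h Side.L (g t) :=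
  hp.inner.fst_lt.1 ((hp.tangency_R_lt t).trans (hp.lt_tangency_L t))

lemma gap_outer_inner_pos (s t : ℝ) : 0 < gap g (h s) t := by
  obtain ⟨t₀, h0⟩ := hp.exists_outer s
  have h1 := hp.outer.gap_nonneg t t₀
  have h2 := hp.lt_snd h0
  simp only [gap, h0] at h1 ⊢
  linarith

/-- The second point at which the tangent through `g t` meets the outer curve lies on the other side
of the tangency point. -/
lemma exists_opposite (σ : Side) (t : ℝ) : ∃ t', gap h (g t') (tanPar h σ (g t)) = 0 ∧
    ((g t').1 - (h (tanPar h σ (g t))).1) * ((g t).1 - (h (tanPar h σ (g t))).1) < 0 := by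
  obtain ⟨t', hne, r, hr⟩ := hp.second σ t
  set s := tanPar h σ (g t) with hs
  have hr' : g t' = (1 - r) • g t + r • h s := by rw [hr]; module
  have h1 := IsConvexCurve.gap_add (c := g) (g t) (h s) t (1 - r) r (by ring)
  have h2 := IsConvexCurve.gap_add (c := g) (g t) (h s) t' (1 - r) r (by ring)
  have h3 := IsConvexCurve.gap_add (c := h) (g t) (h s) s (1 - r) r (by ring)
  rw [← hr', IsConvexCurve.gap_self, mul_zero, zero_add] at h1
  rw [← hr', IsConvexCurve.gap_self] at h2
  rw [← hr', IsConvexCurve.gap_self, hp.gap_tanPar (hp.curve_mem_strip t)] at h3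
  have g1 := hp.outer.gap_pos hne.symm
  have g2 := hp.outer.gap_pos hne
  have g3 := hp.gap_outer_inner_pos s t
  have g4 := hp.gap_outer_inner_pos s t'
  -- `h s` lies strictly above the tangents of `g` at both points, hence strictly between the points
  have r0 : 0 < r := by
    by_contra hcon
    nlinarith
  have r1 : 1 < r := by
    by_contra hcon
    nlinarith
  refine ⟨t', by rw [h3]; ring, ?_⟩
  have hf : (g t').1 - (h s).1 = (1 - r) * ((g t).1 - (h s).1) := by
    rw [hr']; simp only [Prod.fst_add, Prod.smul_fst, smul_eq_mul]; ring
  rw [hf]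
  have : (g t).1 - (h s).1 ≠ 0 := by
    rw [hs]
    cases σ
    · exact (sub_pos.2 (hp.tangency_R_lt t)).ne'
    · exact (sub_neg.2 (hp.lt_tangency_L t)).ne
  nlinarith [sq_pos_of_ne_zero this]

lemma exists_opposite_R (t : ℝ) : ∃ t' < t, tanPar h Side.L (g t') = tanPar h Side.R (g t) := by
  obtain ⟨t', h1, h2⟩ := hp.exists_opposite Side.R t
  have h3 := hp.tangency_R_lt t
  have h4 : (g t').1 < (h (tanPar h Side.R (g t))).1 := by
    by_contra hcon
    nlinarith
  exact ⟨t', hp.outer.fst_lt.1 (h4.trans h3), hp.tanPar_L_eq (hp.curve_mem_strip t') h1 h4.le⟩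

lemma exists_opposite_L (t : ℝ) : ∃ t' > t, tanPar h Side.R (g t') = tanPar h Side.L (g t) := by
  obtain ⟨t', h1, h2⟩ := hp.exists_opposite Side.L t
  have h3 := hp.lt_tangency_L t
  have h4 : (h (tanPar h Side.L (g t))).1 < (g t').1 := by
    by_contra hcon
    nlinarith
  exact ⟨t', hp.outer.fst_lt.1 (h3.trans h4), hp.tanPar_R_eq (hp.curve_mem_strip t') h1 h4.le⟩

/-- If `g t₁` lies on the tangent at `h s`, then points of the outer curve beyond it are strictly
above this tangent. -/
lemma gap_pos_beyond {s t₁ t₂ : ℝ} (h0 : gap h (g t₁) s = 0)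
    (hlt : ((g t₁).1 - (h s).1) * ((g t₂).1 - (g t₁).1) > 0) : 0 < gap h (g t₂) s := by
  have hne : t₁ ≠ t₂ := by rintro rfl; simp at hlt
  by_contra hcon
  set A := (g t₁).1 - (h s).1
  set B := (g t₂).1 - (g t₁).1
  have hAB : A + B ≠ 0 := by
    intro h
    have : B = -A := by linarith
    rw [this] at hlt; nlinarith [sq_nonneg A]
  -- below `g t₁` there would be a convex combination of `h s` and `g t₂`, both of which lie above
  -- the tangent of `g` at `t₁`
  set a := B / (A + B) with ha
  have ha0 : 0 < a := by
    rw [ha, ← mul_div_mul_left B (A + B) (c := A) (by rintro h; rw [h] at hlt; simp at hlt)]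
    exact div_pos hlt (by nlinarith [sq_nonneg A])
  have ha1 : a < 1 := by
    have : 1 - a = A / (A + B) := by rw [ha]; field_simp; ring
    have h2 : 0 < A / (A + B) := by
      rw [← mul_div_mul_left A (A + B) (c := B) (by rintro h; rw [h] at hlt; simp at hlt)]
      exact div_pos (by linarith) (by nlinarith [sq_nonneg B])
    linarith
  have h1 := IsConvexCurve.gap_add (c := g) (h s) (g t₂) t₁ a (1 - a) (by ring)
  have h2 := IsConvexCurve.gap_add (c := h) (h s) (g t₂) s a (1 - a) (by ring)
  have g1 := hp.gap_outer_inner_pos s t₁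
  have g2 := hp.outer.gap_pos hne
  rw [IsConvexCurve.gap_self] at h2
  have hz1 : (g t₁).1 = (a • h s + (1 - a) • g t₂).1 := by
    simp only [Prod.fst_add, Prod.smul_fst, smul_eq_mul]
    have : a * (A + B) = B := div_mul_cancel₀ _ hAB
    simp only [A, B] at this; linarith
  rw [IsConvexCurve.gap_eq_of_fst_eq hz1] at h1
  have h3 : gap h (a • h s + (1 - a) • g t₂) s = gap h (g t₁) s +
      ((a • h s + (1 - a) • g t₂).2 - (g t₁).2) := by
    simp only [gap, hz1]; ring
  have := mul_pos ha0 g1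
  have := mul_pos (sub_pos.2 ha1) g2
  nlinarith

lemma strictMono_tangency (σ : Side) : StrictMono fun t => tanPar h σ (g t) := by
  intro t₁ t₂ h12
  have hg := hp.outer.fst_lt.2 h12
  cases σ
  · have h1 := hp.tangency_R_lt t₁
    refine (hp.lt_tanPar_R_iff (hp.curve_mem_strip t₂)).2 ⟨h1.trans hg, ?_⟩
    exact hp.gap_pos_beyond (hp.gap_tanPar (hp.curve_mem_strip t₁) Side.R)
      (mul_pos (sub_pos.2 h1) (sub_pos.2 hg))
  · have h1 := hp.lt_tangency_L t₂
    refine (hp.tanPar_L_lt_iff (hp.curve_mem_strip t₁)).2 ⟨hg.trans h1, ?_⟩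
    exact hp.gap_pos_beyond (hp.gap_tanPar (hp.curve_mem_strip t₂) Side.L)
      (mul_pos_of_neg_of_neg (sub_neg.2 h1) (sub_neg.2 hg))

lemma continuous_tangency (σ : Side) : Continuous fun t => tanPar h σ (g t) :=
  (hp.continuousOn_tanPar σ).comp_continuous hp.outer.continuous hp.curve_mem_strip

lemma surjective_tangency (σ : Side) : Function.Surjective fun t => tanPar h σ (g t) := by
  intro s
  obtain ⟨t, ht⟩ := hp.exists_outer s
  have h1 : tanPar h Side.R (g t) < s := hp.inner.fst_lt.1 (ht ▸ hp.tangency_R_lt t)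
  have h2 : s < tanPar h Side.L (g t) := hp.inner.fst_lt.1 (ht ▸ hp.lt_tangency_L t)
  have key : ∃ a b, tanPar h σ (g a) ≤ s ∧ s ≤ tanPar h σ (g b) := by
    cases σ
    · obtain ⟨t', -, h'⟩ := hp.exists_opposite_L t
      exact ⟨t, t', h1.le, h'.symm ▸ h2.le⟩
    · obtain ⟨t', -, h'⟩ := hp.exists_opposite_R t
      exact ⟨t', t, h'.symm ▸ h1.le, h2.le⟩
  obtain ⟨a, b, ha, hb⟩ := key
  obtain ⟨c, hc⟩ := mem_range_of_exists_le_of_exists_ge (hp.continuous_tangency σ) ⟨a, ha⟩ ⟨b, hb⟩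
  exact ⟨c, hc⟩

/-- The tangency parameter as an increasing bijection of the line. -/
def tangencyIso (σ : Side) : ℝ ≃o ℝ :=
  (hp.strictMono_tangency σ).orderIsoOfSurjective _ (hp.surjective_tangency σ)

lemma base_eq_symm (σ : Side) (x : ℝ × ℝ) :
    base g h σ x = (hp.tangencyIso σ).symm (tanPar h σ x) := by
  apply (hp.strictMono_tangency σ).injective
  have h1 := Function.rightInverse_invFun (hp.surjective_tangency σ) (tanPar h σ x)
  have h2 := (hp.tangencyIso σ).apply_symm_apply (tanPar h σ x)
  exact h1.trans h2.symm

lemma tangency_base (σ : Side) (x : ℝ × ℝ) : tanPar h σ (g (base g h σ x)) = tanPar h σ x :=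
  Function.rightInverse_invFun (hp.surjective_tangency σ) (tanPar h σ x)

lemma base_curve (σ : Side) (t : ℝ) : base g h σ (g t) = t :=
  (hp.strictMono_tangency σ).injective (hp.tangency_base σ (g t))

lemma lt_base_iff {σ : Side} {x : ℝ × ℝ} {t : ℝ} :
    t < base g h σ x ↔ tanPar h σ (g t) < tanPar h σ x := by
  rw [← hp.tangency_base σ x]; exact (hp.strictMono_tangency σ).lt_iff_lt.symm

lemma base_lt_iff {σ : Side} {x : ℝ × ℝ} {t : ℝ} :
    base g h σ x < t ↔ tanPar h σ x < tanPar h σ (g t) := by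
  rw [← hp.tangency_base σ x]; exact (hp.strictMono_tangency σ).lt_iff_lt.symm

lemma le_base_iff {σ : Side} {x : ℝ × ℝ} {t : ℝ} :
    t ≤ base g h σ x ↔ tanPar h σ (g t) ≤ tanPar h σ x := by
  rw [← not_lt, hp.base_lt_iff, not_lt]

lemma base_le_iff {σ : Side} {x : ℝ × ℝ} {t : ℝ} :
    base g h σ x ≤ t ↔ tanPar h σ x ≤ tanPar h σ (g t) := by
  rw [← not_lt, hp.lt_base_iff, not_lt]

lemma base_eq_iff {σ : Side} {x : ℝ × ℝ} {t : ℝ} :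
    base g h σ x = t ↔ tanPar h σ x = tanPar h σ (g t) := by
  rw [le_antisymm_iff, le_antisymm_iff, hp.base_le_iff, hp.le_base_iff]

lemma continuousOn_base (σ : Side) : ContinuousOn (base g h σ) (strip g h) := by
  have : base g h σ = fun x => (hp.tangencyIso σ).symm (tanPar h σ x) :=
    funext (hp.base_eq_symm σ)
  rw [this]
  exact (hp.tangencyIso σ).symm.continuous.comp_continuousOn (hp.continuousOn_tanPar σ)

lemma le_fst_base_R {x : ℝ × ℝ} (hx : x ∈ strip g h) : x.1 ≤ (g (base g h Side.R x)).1 := by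
  obtain ⟨t, ht, hle⟩ := exists_curve_mem x hx
  by_contra hcon
  set b := base g h Side.R x
  have h1 : b < t := hp.outer.fst_lt.1 (by rw [ht]; exact not_le.1 hcon)
  have h2 : 0 < gap h (g t) (tanPar h Side.R (g b)) :=
    hp.gap_pos_of_lt (hp.curve_mem_strip t) (hp.strictMono_tangency Side.R h1)
  have h3 := hp.gap_tanPar hx Side.R
  rw [← hp.tangency_base] at h3
  simp only [gap, ht] at h2 h3
  linarith

lemma fst_base_L_le {x : ℝ × ℝ} (hx : x ∈ strip g h) : (g (base g h Side.L x)).1 ≤ x.1 := by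
  obtain ⟨t, ht, hle⟩ := exists_curve_mem x hx
  by_contra hcon
  set b := base g h Side.L x
  have h1 : t < b := hp.outer.fst_lt.1 (by rw [ht]; exact not_le.1 hcon)
  have h2 : 0 < gap h (g t) (tanPar h Side.L (g b)) :=
    hp.gap_pos_of_gt (hp.curve_mem_strip t) (hp.strictMono_tangency Side.L h1)
  have h3 := hp.gap_tanPar hx Side.L
  rw [← hp.tangency_base] at h3
  simp only [gap, ht] at h2 h3
  linarith

lemma base_L_le_base_R {x : ℝ × ℝ} (hx : x ∈ strip g h) :
    base g h Side.L x ≤ base g h Side.R x :=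
  hp.outer.fst_le.1 ((hp.fst_base_L_le hx).trans (hp.le_fst_base_R hx))

omit hp in
/-- Three points on a line: the intermediate first coordinate gives a point of the segment. -/
lemma mem_segment_of_slope {x y z : ℝ × ℝ} {m : ℝ} (hy : y.2 - x.2 = m * (y.1 - x.1))
    (hz : z.2 - x.2 = m * (z.1 - x.1)) (hxz : x.1 ≤ z.1) (hzy : z.1 ≤ y.1) :
    z ∈ segment ℝ x y := by
  rcases eq_or_lt_of_le (hxz.trans hzy) with h | h
  · have h1 : z.1 = x.1 := by linarith
    have h2 : z.2 = x.2 := by rw [h1] at hz; linarith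
    rw [show z = x from Prod.ext h1 h2]; exact left_mem_segment ℝ x y
  · have hd : 0 < y.1 - x.1 := by linarith
    set b := (z.1 - x.1) / (y.1 - x.1) with hb
    have hbm : b * (y.1 - x.1) = z.1 - x.1 := div_mul_cancel₀ _ hd.ne'
    refine ⟨1 - b, b, sub_nonneg.2 ((div_le_one hd).2 (by linarith)),
      div_nonneg (by linarith) hd.le, by ring, ?_⟩
    ext
    · simp only [Prod.fst_add, Prod.smul_fst, smul_eq_mul]; linarith
    · simp only [Prod.snd_add, Prod.smul_snd, smul_eq_mul]
      have e3 : b * (y.2 - x.2) = z.2 - x.2 := by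
        rw [hy, hz, ← hbm]; ring
      linarith

omit hp in
lemma mem_segment_of_gap_eq_zero {c : ℝ → ℝ × ℝ} {x y z : ℝ × ℝ} {s : ℝ} (hx : gap c x s = 0)
    (hy : gap c y s = 0) (hz : gap c z s = 0) (hxz : x.1 ≤ z.1) (hzy : z.1 ≤ y.1) :
    z ∈ segment ℝ x y := by
  simp only [gap] at hx hy hz
  exact mem_segment_of_slope (m := curveSlope c s) (by linarith) (by linarith) hxz hzy

/-- The tangent segment of type `σ` drawn from `g t` is a level set of `base`. -/
lemma mem_tangentSegment_iff {σ : Side} {t : ℝ} {x : ℝ × ℝ} :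
    x ∈ segment ℝ (g t) (h (tanPar h σ (g t))) ↔ x ∈ strip g h ∧ base g h σ x = t := by
  have h0 := hp.gap_tanPar (hp.curve_mem_strip t) σ
  set s := tanPar h σ (g t) with hs
  constructor
  · intro hx
    have hxs : x ∈ strip g h := hp.mem_strip_of_mem_segment (hp.curve_mem_strip t)
      (hp.inner_mem_strip s) hx h0.le (IsConvexCurve.gap_self s).le
    refine ⟨hxs, hp.base_eq_iff.2 ?_⟩
    obtain ⟨a, b, ha, hb, hab, rfl⟩ := hx
    have hg : gap h (a • g t + b • h s) s = 0 := by
      rw [IsConvexCurve.gap_add _ _ _ _ _ hab, h0, IsConvexCurve.gap_self]; ring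
    obtain rfl : b = 1 - a := by linarith
    cases σ
    · refine hp.tanPar_R_eq hxs hg ?_
      have := hp.tangency_R_lt t
      simp only [Prod.fst_add, Prod.smul_fst, smul_eq_mul]
      nlinarith
    · refine hp.tanPar_L_eq hxs hg ?_
      have := hp.lt_tangency_L t
      simp only [Prod.fst_add, Prod.smul_fst, smul_eq_mul]
      nlinarith
  · rintro ⟨hx, hb⟩
    have hg := hp.gap_tanPar hx σ
    rw [hp.base_eq_iff.1 hb] at hg
    have hb' := hp.base_eq_iff.1 hb
    cases σ
    · rw [segment_symm]
      refine mem_segment_of_gap_eq_zero (IsConvexCurve.gap_self s) h0 hg ?_ ?_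
      · rw [hs, ← hb']; exact hp.fst_tanPar_R_le hx
      · rw [← hb]; exact hp.le_fst_base_R hx
    · refine mem_segment_of_gap_eq_zero h0 (IsConvexCurve.gap_self s) hg ?_ ?_
      · rw [← hb]; exact hp.fst_base_L_le hx
      · rw [hs, ← hb']; exact hp.le_fst_tanPar_L hx

/-- The curvilinear triangle with vertex `g u` in the coordinates `base`. -/
lemma mem_triangle_iff {u : ℝ} {x : ℝ × ℝ} :
    (∃ s ∈ Icc (tanPar h Side.R (g u)) (tanPar h Side.L (g u)), x ∈ segment ℝ (g u) (h s)) ↔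
      x ∈ strip g h ∧ base g h Side.L x ≤ u ∧ u ≤ base g h Side.R x := by
  have hu := hp.curve_mem_strip u
  have wR := hp.tangency_R_lt u
  have wL := hp.lt_tangency_L u
  have gR := hp.gap_tanPar hu Side.R
  have gL := hp.gap_tanPar hu Side.L
  constructor
  · rintro ⟨s, hs, hx⟩
    have hxs : x ∈ strip g h := hp.mem_strip_of_mem_segment hu (hp.inner_mem_strip s) hx
      (hp.gap_nonpos_of_mem hu hs.1 hs.2) (IsConvexCurve.gap_self s).le
    obtain ⟨a, b, ha, hb, hab, rfl⟩ := hx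
    refine ⟨hxs, hp.base_le_iff.2 (hp.tanPar_L_le hxs ?_ ?_),
      hp.le_base_iff.2 (hp.le_tanPar_R hxs ?_ ?_)⟩
    · rw [IsConvexCurve.gap_add _ _ _ _ _ hab, gL, mul_zero, zero_add]
      exact mul_nonneg hb (hp.inner.gap_nonneg _ _)
    · have := hp.inner.fst_le.2 hs.2
      obtain rfl : b = 1 - a := by linarith
      simp only [Prod.fst_add, Prod.smul_fst, smul_eq_mul]; nlinarith
    · rw [IsConvexCurve.gap_add _ _ _ _ _ hab, gR, mul_zero, zero_add]
      exact mul_nonneg hb (hp.inner.gap_nonneg _ _)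
    · have := hp.inner.fst_le.2 hs.1
      obtain rfl : b = 1 - a := by linarith
      simp only [Prod.fst_add, Prod.smul_fst, smul_eq_mul]; nlinarith
  · rintro ⟨hx, hL, hR⟩
    rw [hp.base_le_iff] at hL
    rw [hp.le_base_iff] at hR
    set r := tanPar h Side.R (g u) with hr
    set l := tanPar h Side.L (g u) with hl
    obtain ⟨s₀, h1, h2, h3, h4, -, -⟩ := hp.tanPar_spec hx
    rcases eq_or_ne x (g u) with rfl | hne
    · exact ⟨r, ⟨le_rfl, (hp.tangency_lt u).le⟩, left_mem_segment ℝ _ _⟩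
    have kx : 0 ≤ gap h x r := by
      rcases hR.eq_or_lt with h | h
      · rw [h, hp.gap_tanPar hx]
      · exact (hp.gap_pos_of_lt hx h).le
    have kx' : 0 ≤ gap h x l := by
      rcases hL.eq_or_lt with h | h
      · rw [← h, hp.gap_tanPar hx]
      · exact (hp.gap_pos_of_gt hx h).le
    -- the direction of `x - g u` is found among the directions of `h s - g u`
    let N : ℝ → ℝ := fun s => ((h s).1 - (g u).1) * (x.2 - (g u).2)
      - ((h s).2 - (g u).2) * (x.1 - (g u).1)
    have hN : Continuous N := by
      have := hp.inner.continuous_fst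
      have := hp.inner.continuous_snd
      fun_prop
    have hNr : N r ≤ 0 := by
      have : N r = ((h r).1 - (g u).1) * gap h x r := by
        simp only [N, gap] at gR ⊢
        have e : (g u).2 = (h r).2 + curveSlope h r * ((g u).1 - (h r).1) := by linarith
        rw [e]; ring
      rw [this]; nlinarith
    have hNl : 0 ≤ N l := by
      have : N l = ((h l).1 - (g u).1) * gap h x l := by
        simp only [N, gap] at gL ⊢
        have e : (g u).2 = (h l).2 + curveSlope h l * ((g u).1 - (h l).1) := by linarith
        rw [e]; ring
      rw [this]; nlinarith
    obtain ⟨s, hs, hs0⟩ := intermediate_value_Icc (hp.tangency_lt u).le hN.continuousOn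
      (mem_Icc.2 ⟨hNr, hNl⟩)
    refine ⟨s, hs, ?_⟩
    simp only [N] at hs0
    -- `x = g u + m (h s - g u)`
    obtain ⟨m, hm1, hm2⟩ : ∃ m : ℝ, x.1 - (g u).1 = m * ((h s).1 - (g u).1) ∧
        x.2 - (g u).2 = m * ((h s).2 - (g u).2) := by
      by_cases hz : (h s).1 - (g u).1 = 0
      · have hv : (g u).2 < (h s).2 := hp.lt_snd (by linarith)
        refine ⟨(x.2 - (g u).2) / ((h s).2 - (g u).2), ?_, ?_⟩
        · rw [hz, zero_mul, zero_sub, neg_eq_zero] at hs0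
          rw [hz, mul_zero]
          exact (mul_eq_zero.1 hs0).resolve_left (by linarith)
        · rw [div_mul_cancel₀]; linarith
      · refine ⟨(x.1 - (g u).1) / ((h s).1 - (g u).1), ?_, ?_⟩
        · rw [div_mul_cancel₀ _ hz]
        · field_simp; linarith
    have hxm : x = (1 - m) • g u + m • h s := by
      ext
      · simp only [Prod.fst_add, Prod.smul_fst, smul_eq_mul]; linarith
      · simp only [Prod.snd_add, Prod.smul_snd, smul_eq_mul]; linarith
    have gxr : gap h x r = m * gap h (h s) r := by
      rw [hxm, IsConvexCurve.gap_add _ _ _ _ _ (by ring), gR]; ring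
    have gxl : gap h x l = m * gap h (h s) l := by
      rw [hxm, IsConvexCurve.gap_add _ _ _ _ _ (by ring), gL]; ring
    have hm0 : 0 ≤ m := by
      have hrl := hp.tangency_lt u
      by_contra hcon
      rcases eq_or_ne s r with hsr | hsr
      · have := hp.inner.gap_pos (s := l) (t := s) (by rw [hsr]; exact hrl.ne')
        nlinarith
      · have := hp.inner.gap_pos (s := r) (t := s) hsr.symm
        nlinarith
    have hm1' : m ≤ 1 := by
      by_contra hcon
      rw [not_le] at hcon
      rcases eq_or_ne s s₀ with rfl | hss
      · have hz : (h s).1 - (g u).1 = 0 := by rw [← h1] at hm1; nlinarith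
        have hv : (g u).2 < (h s).2 := hp.lt_snd (by linarith)
        nlinarith
      · have e1 : gap h (g u) s₀ ≤ 0 := hp.gap_nonpos_of_mem hu (hR.trans h3) (h4.trans hL)
        have e2 : gap h x s₀ ≤ 0 := by rw [IsConvexCurve.gap_eq_of_fst_eq h1]; linarith
        have e3 := hp.inner.gap_pos (s := s₀) (t := s) hss.symm
        have e4 : gap h x s₀ = (1 - m) * gap h (g u) s₀ + m * gap h (h s) s₀ := by
          rw [hxm, IsConvexCurve.gap_add _ _ _ _ _ (by ring)]
        nlinarith
    exact ⟨1 - m, m, by linarith, hm0, by ring, hxm.symm⟩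

end IsTangentPair

/-! ### Pairs of curves of an admissible family -/

namespace AdmissibleFamily

variable {εmax : EReal} {G : ℝ → ℝ → ℝ × ℝ} (hG : AdmissibleFamily εmax G)
include hG

lemma isConvexCurve {ε : ℝ} (hε : ε ∈ paramSet εmax) : IsConvexCurve (G ε) :=
  ⟨hG.smooth ε hε, hG.deriv_fst_pos ε hε, hG.convexity ε hε⟩

lemma zero_mem : (0 : ℝ) ∈ paramSet εmax := ⟨le_rfl, by exact_mod_cast hG.εmax_pos⟩

lemma tangency_iff {ε : ℝ} (hε : ε ∈ paramSet εmax) (t s : ℝ) :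
    Tangency G ε t s ↔ gap (G ε) (G 0 t) s = 0 := by
  have h := (hG.deriv_fst_pos ε hε s).ne'
  rw [Tangency, gap, curveSlope]
  constructor
  · intro h0; field_simp; linarith
  · intro h0; field_simp at h0; linarith

lemma tpar_eq {ε : ℝ} (hε : ε ∈ paramSet εmax) (σ : Side) (t : ℝ) :
    tpar G ε σ t = tanPar (G ε) σ (G 0 t) := by
  have : {s | Tangency G ε t s} = {s | gap (G ε) (G 0 t) s = 0} :=
    Set.ext fun s => hG.tangency_iff hε t s
  cases σ <;> simp only [tpar, tanPar, this]

lemma tpt_eq {ε : ℝ} (hε : ε ∈ paramSet εmax) (σ : Side) (t : ℝ) :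
    tpt G ε σ t = G ε (tanPar (G ε) σ (G 0 t)) := by rw [tpt, hG.tpar_eq hε]

lemma isTangentPair {ε : ℝ} (hε : ε ∈ paramSet εmax) (h0 : 0 < ε) :
    IsTangentPair (G 0) (G ε) where
  outer := hG.isConvexCurve hG.zero_mem
  inner := hG.isConvexCurve hε
  two t := by
    obtain ⟨r, l, h1, h2⟩ := hG.two_tangents ε hε h0 t
    refine ⟨r, l, h1, ?_⟩
    rw [← h2]
    exact Set.ext fun s => (hG.tangency_iff hε t s).symm
  exists_outer s := by
    obtain ⟨t, ht, -⟩ := hG.nested 0 hG.zero_mem ε hε h0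
      (show ((G ε s).1, (G ε s).2 + 1) ∈ Xi G ε from ⟨s, rfl, by simp⟩)
    exact ⟨t, ht.symm⟩
  second σ t := by
    obtain ⟨t', h1, r, h2⟩ := hG.second_point ε hε h0 σ t
    exact ⟨t', h1, r, by rw [h2, hG.tpt_eq hε]⟩

variable {ε : ℝ} (hε : ε ∈ paramSet εmax) (h0 : 0 < ε)
include hε h0

lemma mem_tanSeg_iff {σ : Side} {t : ℝ} {x : ℝ × ℝ} :
    x ∈ tanSeg G ε σ t ↔ x ∈ strip (G 0) (G ε) ∧ base (G 0) (G ε) σ x = t := by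
  rw [tanSeg, hG.tpt_eq hε, (hG.isTangentPair hε h0).mem_tangentSegment_iff]

lemma mem_curvTriangle_iff {u : ℝ} {x : ℝ × ℝ} :
    x ∈ curvTriangle G ε u ↔ x ∈ strip (G 0) (G ε) ∧ base (G 0) (G ε) Side.L x ≤ u ∧
      u ≤ base (G 0) (G ε) Side.R x := by
  rw [← (hG.isTangentPair hε h0).mem_triangle_iff, curvTriangle, hG.tpar_eq hε, hG.tpar_eq hε]
  simp only [mem_iUnion, exists_prop]

lemma Om_eq_strip : Om G ε = strip (G 0) (G ε) := by
  ext x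
  simp only [Om, mem_iUnion, hG.mem_curvTriangle_iff hε h0]
  exact ⟨fun ⟨_, h⟩ => h.1, fun h => ⟨base (G 0) (G ε) Side.L x, h, le_rfl,
    (hG.isTangentPair hε h0).base_L_le_base_R h⟩⟩

end AdmissibleFamily

end
end BellmanFoliation

namespace BellmanFoliation
noncomputable section

/-! ### Gluing locally supporting planes -/

/-- Value at `x` of the affine function with coefficients `P`. -/
def planeEval (P : ℝ × ℝ × ℝ) (x : ℝ × ℝ) : ℝ := P.1 + P.2.1 * x.1 + P.2.2 * x.2

/-- Linear part of the affine function with coefficients `P`. -/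
def planeGrad (P : ℝ × ℝ × ℝ) : (ℝ × ℝ) →L[ℝ] ℝ :=
  P.2.1 • ContinuousLinearMap.fst ℝ ℝ ℝ + P.2.2 • ContinuousLinearMap.snd ℝ ℝ ℝ

lemma planeGrad_apply (P : ℝ × ℝ × ℝ) (v : ℝ × ℝ) :
    planeGrad P v = P.2.1 * v.1 + P.2.2 * v.2 := by simp [planeGrad]

lemma continuous_planeGrad : Continuous planeGrad := by unfold planeGrad; fun_prop

lemma planeEval_sub (P : ℝ × ℝ × ℝ) (x y : ℝ × ℝ) :
    planeEval P y = planeEval P x + planeGrad P (y - x) := by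
  rw [planeGrad_apply]; simp only [planeEval, Prod.fst_sub, Prod.snd_sub]; ring

/-- The planes of the field `Φ` lie above the function `x ↦ Φ x (x)` at the points that are visible
in `S`. -/
def Supports (S : Set (ℝ × ℝ)) (Φ : ℝ × ℝ → ℝ × ℝ × ℝ) (ω : Set (ℝ × ℝ)) : Prop :=
  ∀ x ∈ ω, ∀ y ∈ ω, segment ℝ x y ⊆ S → planeEval (Φ y) y ≤ planeEval (Φ x) y

/-- A continuous field of planes which is supporting on each piece of a finite closed cover is
supporting everywhere: along a segment, the slope of the plane is continuous and cannot increase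
in the vicinity of any point. -/
theorem supports_of_cover {S : Set (ℝ × ℝ)} {Φ : ℝ × ℝ → ℝ × ℝ × ℝ} (hΦ : ContinuousOn Φ S)
    {ι : Type*} [Finite ι] {ω : ι → Set (ℝ × ℝ)} (hcov : S ⊆ ⋃ i, ω i)
    (hcl : ∀ i, ∀ x ∈ S, x ∈ closure (ω i) → x ∈ ω i) (hsupp : ∀ i, Supports S Φ (ω i)) :
    Supports S Φ S := by
  intro x hx y hy hxy
  let c : ℝ → ℝ × ℝ := fun τ => x + τ • (y - x)
  have hc : Continuous c := by fun_prop
  have hcS : ∀ τ ∈ Icc (0 : ℝ) 1, c τ ∈ S := by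
    intro τ hτ
    apply hxy
    rw [segment_eq_image']
    exact ⟨τ, hτ, rfl⟩
  have hseg : ∀ τ ∈ Icc (0 : ℝ) 1, ∀ τ' ∈ Icc (0 : ℝ) 1, segment ℝ (c τ) (c τ') ⊆ S := by
    intro τ hτ τ' hτ'
    refine Subset.trans ((convex_segment x y).segment_subset ?_ ?_) hxy
    · rw [segment_eq_image']; exact ⟨τ, hτ, rfl⟩
    · rw [segment_eq_image']; exact ⟨τ', hτ', rfl⟩
  let m : ℝ → ℝ := fun τ => planeGrad (Φ (c τ)) (y - x)
  let b : ℝ → ℝ := fun τ => planeEval (Φ (c τ)) (c τ)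
  have hΦc : ContinuousOn (fun τ => Φ (c τ)) (Icc 0 1) := hΦ.comp hc.continuousOn hcS
  have hm : ContinuousOn m (Icc 0 1) := by
    have : ContinuousOn (fun τ => planeGrad (Φ (c τ))) (Icc 0 1) :=
      continuous_planeGrad.comp_continuousOn hΦc
    exact this.clm_apply continuousOn_const
  have hb : ContinuousOn b (Icc 0 1) := by
    simp only [b, planeEval]
    have h1 : ContinuousOn (fun τ => (Φ (c τ)).1) (Icc 0 1) := continuous_fst.comp_continuousOn hΦc
    have h2 : ContinuousOn (fun τ => (Φ (c τ)).2.1) (Icc 0 1) :=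
      (continuous_fst.comp continuous_snd).comp_continuousOn hΦc
    have h3 : ContinuousOn (fun τ => (Φ (c τ)).2.2) (Icc 0 1) :=
      (continuous_snd.comp continuous_snd).comp_continuousOn hΦc
    exact (h1.add (h2.mul hc.fst.continuousOn)).add (h3.mul hc.snd.continuousOn)
  have hstep : ∀ (τ τ' : ℝ), planeEval (Φ (c τ)) (c τ') = b τ + m τ * (τ' - τ) := by
    intro τ τ'
    rw [planeEval_sub _ (c τ)]
    have : c τ' - c τ = (τ' - τ) • (y - x) := by simp only [c]; module
    rw [this, map_smul, smul_eq_mul, mul_comm]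
  -- near each point of the segment, the plane at that point lies above the function, and vice versa
  have hloc : ∀ τ ∈ Icc (0 : ℝ) 1, ∀ᶠ τ' in 𝓝 τ, τ' ∈ Icc (0 : ℝ) 1 →
      b τ' ≤ b τ + m τ * (τ' - τ) ∧ b τ ≤ b τ' + m τ' * (τ - τ') := by
    intro τ hτ
    have h1 : ∀ i, ∀ᶠ τ' in 𝓝 τ, c τ ∉ ω i → c τ' ∉ ω i := by
      intro i
      by_cases hi : c τ ∈ ω i
      · exact Eventually.of_forall fun _ h => absurd hi h
      · have : c τ ∈ (closure (ω i))ᶜ := fun h => hi (hcl i _ (hcS τ hτ) h)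
        filter_upwards [hc.continuousAt.eventually (isClosed_closure.isOpen_compl.mem_nhds this)]
          with τ' h' _ h''
        exact h' (subset_closure h'')
    filter_upwards [eventually_all.2 h1] with τ' h' hτ'
    obtain ⟨i, hi⟩ := mem_iUnion.1 (hcov (hcS τ' hτ'))
    have hi' : c τ ∈ ω i := by by_contra h; exact h' i h hi
    have e1 := hsupp i (c τ) hi' (c τ') hi (hseg τ hτ τ' hτ')
    have e2 := hsupp i (c τ') hi (c τ) hi' (hseg τ' hτ' τ hτ)
    rw [hstep τ τ'] at e1; rw [hstep τ' τ] at e2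
    exact ⟨e1, e2⟩
  -- the one-sided form of the derivative estimates for `m` and `b` that follows from `hloc`
  have hslope : ∀ {F G' : ℝ → ℝ} {τ r : ℝ}, τ ∈ Ico (0 : ℝ) 1 → G' τ < r →
      (∀ τ', τ < τ' → b τ' ≤ b τ + m τ * (τ' - τ) ∧ b τ ≤ b τ' + m τ' * (τ - τ') →
        F τ' - F τ ≤ G' τ * (τ' - τ)) → ∃ᶠ z in 𝓝[>] τ, _root_.slope F τ z < r := by
    intro F G' τ r hτ hr hF
    refine Eventually.frequently ?_
    have h2 : ∀ᶠ z in 𝓝[>] τ, z < 1 := mem_nhdsWithin_of_mem_nhds (Iio_mem_nhds hτ.2)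
    filter_upwards [mem_nhdsWithin_of_mem_nhds (hloc τ ⟨hτ.1, hτ.2.le⟩), h2,
      self_mem_nhdsWithin] with z hz hz1 hz2
    have hz2' : τ < z := hz2
    rw [slope_def_field, div_lt_iff₀ (sub_pos.2 hz2')]
    refine (hF z hz2 (hz ⟨hτ.1.trans hz2'.le, hz1.le⟩)).trans_lt ?_
    exact mul_lt_mul_of_pos_right hr (sub_pos.2 hz2')
  have hanti : ∀ τ ∈ Icc (0 : ℝ) 1, m τ ≤ m 0 := by
    refine image_le_of_liminf_slope_right_le_deriv_boundary (B := fun _ => m 0) (B' := fun _ => 0)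
      hm le_rfl continuousOn_const (fun τ _ => hasDerivWithinAt_const _ _ _) fun τ hτ r hr => ?_
    refine hslope (F := m) (G' := fun _ => 0) hτ hr fun τ' h1 h2 => ?_
    nlinarith
  -- as `m ≤ m 0`, the values on the segment stay below the line of slope `m 0`
  have hfin := image_le_of_liminf_slope_right_le_deriv_boundary (f := b)
    (B := fun τ => b 0 + m 0 * τ) (B' := fun _ => m 0) hb (by simp)
    (by fun_prop)
    (fun τ _ => by
      simpa using (((hasDerivAt_id τ).const_mul (m 0)).const_add (b 0)).hasDerivWithinAt)
    (fun τ hτ r hr => hslope (F := b) (G' := fun _ => m 0) hτ hr fun τ' h1 h2 => by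
      nlinarith [hanti τ ⟨hτ.1, hτ.2.le⟩]) (right_mem_Icc.2 zero_le_one)
  have h1 : c 1 = y := by simp [c]
  have h0 : c 0 = x := by simp [c]
  have e := hstep 0 1
  rw [h0, h1] at e
  rw [e]
  have : b 1 = planeEval (Φ y) y := by simp only [b, h1]
  rw [← this]
  simpa using hfin

/-- A function with supporting planes is locally concave. -/
theorem Supports.locallyConcaveOn {S : Set (ℝ × ℝ)} {Φ : ℝ × ℝ → ℝ × ℝ × ℝ}
    (h : Supports S Φ S) : LocallyConcaveOn S fun x => planeEval (Φ x) x := by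
  intro K hK hKc
  refine ⟨hKc, fun x hx y hy a b ha hb hab => ?_⟩
  have hz : a • x + b • y ∈ K := hKc hx hy ha hb hab
  have h1 := h _ (hK hz) x (hK hx) ((hKc.segment_subset hz hx).trans hK)
  have h2 := h _ (hK hz) y (hK hy) ((hKc.segment_subset hz hy).trans hK)
  change a • planeEval (Φ x) x + b • planeEval (Φ y) y ≤
    planeEval (Φ (a • x + b • y)) (a • x + b • y)
  generalize Φ (a • x + b • y) = P at h1 h2 ⊢
  have : planeEval P (a • x + b • y) = a * planeEval P x + b * planeEval P y := by
    obtain rfl : b = 1 - a := by linarith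
    simp only [planeEval, Prod.fst_add, Prod.snd_add, Prod.smul_fst, Prod.smul_snd, smul_eq_mul]
    ring
  simp only [smul_eq_mul]
  rw [this]
  nlinarith

/-- Nearby points of the strip are joined by two segments of comparable length. -/
lemma IsTangentPair.eventually_linked {g h : ℝ → ℝ × ℝ} (hp : IsTangentPair g h) {x : ℝ × ℝ}
    (hx : x ∈ strip g h) : ∃ C : ℝ, 0 ≤ C ∧ ∀ᶠ y in 𝓝[strip g h] x, ∃ z,
      segment ℝ x z ⊆ strip g h ∧ segment ℝ z y ⊆ strip g h ∧
      ‖z - x‖ ≤ C * ‖y - x‖ ∧ ‖y - z‖ ≤ C * ‖y - x‖ := by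
  obtain ⟨s, hs, hxs, -⟩ := hp.tanPar_spec hx
  have direct : ∀ y ∈ strip g h, gap h y s ≤ 0 → segment ℝ x y ⊆ strip g h := by
    intro y hy hgy z hz
    refine hp.mem_strip_of_mem_segment hx hy hz (s := s) ?_ hgy
    rw [IsConvexCurve.gap_eq_of_fst_eq hs]; linarith
  -- below the inner curve, all nearby points are visible from `x`; at a point of the inner curve,
  -- a point above the tangent is reached by moving along the tangent and then vertically
  rcases hxs.lt_or_eq with hlt | heq
  · refine ⟨1, zero_le_one, ?_⟩
    have h1 : gap h x s < 0 := by rw [IsConvexCurve.gap_eq_of_fst_eq hs]; linarith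
    have h2 : ∀ᶠ y in 𝓝 x, gap h y s < 0 :=
      (IsConvexCurve.continuous_gap_point s).continuousAt.eventually (gt_mem_nhds h1)
    filter_upwards [mem_nhdsWithin_of_mem_nhds h2, self_mem_nhdsWithin] with y hy hyS
    refine ⟨y, direct y hyS hy.le, ?_, by simp, by simp⟩
    rw [segment_same]; exact singleton_subset_iff.2 hyS
  · have hxeq : x = h s := Prod.ext hs.symm heq
    set k := curveSlope h s with hk
    refine ⟨2 + |k|, by positivity, ?_⟩
    have bR := hp.tangency_base Side.R (h s)
    have bL := hp.tangency_base Side.L (h s)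
    rw [hp.tanPar_inner] at bR bL
    set tR := base g h Side.R (h s)
    set tL := base g h Side.L (h s)
    have h1 : (h s).1 < (g tR).1 := by rw [← bR]; exact hp.tangency_R_lt tR
    have h2 : (g tL).1 < (h s).1 := by
      conv_rhs => rw [← bL]
      exact hp.lt_tangency_L tL
    have h3 : ∀ᶠ y : ℝ × ℝ in 𝓝 x, (g tL).1 < y.1 ∧ y.1 < (g tR).1 := by
      rw [hxeq]
      exact (continuous_fst.continuousAt.eventually (lt_mem_nhds h2)).and
        (continuous_fst.continuousAt.eventually (gt_mem_nhds h1))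
    filter_upwards [mem_nhdsWithin_of_mem_nhds h3, self_mem_nhdsWithin] with y hy hyS
    have hyx1 : |y.1 - x.1| ≤ ‖y - x‖ := norm_fst_le (y - x)
    have hyx2 : |y.2 - x.2| ≤ ‖y - x‖ := norm_snd_le (y - x)
    by_cases hg : gap h y s ≤ 0
    · refine ⟨y, direct y hyS hg, ?_, ?_, ?_⟩
      · rw [segment_same]; exact singleton_subset_iff.2 hyS
      · nlinarith [abs_nonneg k, norm_nonneg (y - x)]
      · simp only [sub_self, norm_zero]; positivity
    · rw [not_le] at hg
      set z : ℝ × ℝ := (y.1, x.2 + k * (y.1 - x.1)) with hz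
      have gz : gap h z s = 0 := by simp only [gap, hz, ← hxeq]; ring
      have g0R : gap h (g tR) s = 0 := by
        have := hp.gap_tanPar (hp.curve_mem_strip tR) Side.R; rwa [bR] at this
      have g0L : gap h (g tL) s = 0 := by
        have := hp.gap_tanPar (hp.curve_mem_strip tL) Side.L; rwa [bL] at this
      have hzS : z ∈ strip g h := hp.mem_strip_of_mem_segment (hp.curve_mem_strip tL)
        (hp.curve_mem_strip tR) (mem_segment_of_gap_eq_zero g0L g0R gz hy.1.le hy.2.le) g0L.le g0R.le
      refine ⟨z, direct z hzS gz.le, ?_, ?_, ?_⟩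
      · have hzy : z.2 ≤ y.2 := by
          simp only [gap, ← hxeq] at hg; simp only [hz]; linarith
        obtain ⟨t, -, ht, -, htz, -⟩ := hzS
        obtain ⟨-, s', -, hs', -, hys'⟩ := hyS
        rintro w ⟨a, b, ha, hb, hab, rfl⟩
        obtain rfl : b = 1 - a := by linarith
        have e1 : (a • z + (1 - a) • y).1 = y.1 := by
          simp only [Prod.fst_add, Prod.smul_fst, smul_eq_mul, hz]; ring
        have e2 : (a • z + (1 - a) • y).2 = a * z.2 + (1 - a) * y.2 := by
          simp only [Prod.snd_add, Prod.smul_snd, smul_eq_mul]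
        exact ⟨t, s', by rw [e1, ht], by rw [e1, hs'], by rw [e2]; nlinarith, by rw [e2]; nlinarith⟩
      · have : ‖z - x‖ ≤ (1 + |k|) * ‖y - x‖ := by
          rw [Prod.norm_def, max_le_iff]
          simp only [hz, Prod.fst_sub, Prod.snd_sub, Real.norm_eq_abs, add_sub_cancel_left, abs_mul]
          constructor <;> nlinarith [abs_nonneg k, norm_nonneg (y - x)]
        nlinarith [norm_nonneg (y - x)]
      · rw [Prod.norm_def, max_le_iff]
        simp only [hz, Prod.fst_sub, Prod.snd_sub, Real.norm_eq_abs, sub_self, abs_zero]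
        refine ⟨by positivity, ?_⟩
        have e : y.2 - (x.2 + k * (y.1 - x.1)) = (y.2 - x.2) - k * (y.1 - x.1) := by ring
        rw [e]
        refine (abs_sub _ _).trans ?_
        rw [abs_mul]
        nlinarith [abs_nonneg k, norm_nonneg (y - x)]

/-- A function with a continuous field of supporting planes in the strip is differentiable, and its
differential is given by these planes: for `x`, `y` visible from each other, the increment lies
between the values of the two linear parts. -/
theorem Supports.hasFDerivWithinAt {g h : ℝ → ℝ × ℝ} (hp : IsTangentPair g h)
    {Φ : ℝ × ℝ → ℝ × ℝ × ℝ} (hΦ : ContinuousOn Φ (strip g h))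
    (hs : Supports (strip g h) Φ (strip g h)) {x : ℝ × ℝ} (hx : x ∈ strip g h) :
    HasFDerivWithinAt (fun x => planeEval (Φ x) x) (planeGrad (Φ x)) (strip g h) x := by
  rw [hasFDerivWithinAt_iff_isLittleO, Asymptotics.isLittleO_iff]
  intro e he
  obtain ⟨C, hC0, hC⟩ := hp.eventually_linked hx
  set S := strip g h
  obtain ⟨η, hη, hη'⟩ : ∃ η > 0, 2 * η * C ≤ e :=
    ⟨e / (2 * (C + 1)), by positivity, by
      rw [show 2 * (e / (2 * (C + 1))) * C = e * (C / (C + 1)) by field_simp]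
      exact mul_le_of_le_one_right he.le ((div_le_one (by linarith)).2 (by linarith))⟩
  have hcont : ContinuousWithinAt (fun y => planeGrad (Φ y)) S x :=
    continuous_planeGrad.continuousAt.comp_continuousWithinAt (hΦ x hx)
  obtain ⟨δ, hδ, hδ'⟩ := Metric.continuousWithinAt_iff.1 hcont η hη
  have hest : ∀ p q : ℝ × ℝ, segment ℝ p q ⊆ S → ‖p - x‖ < δ → ‖q - x‖ < δ →
      |planeEval (Φ q) q - planeEval (Φ p) p - planeGrad (Φ x) (q - p)| ≤ η * ‖q - p‖ := by
    intro p q hpq hpx hqx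
    have hp' := hpq (left_mem_segment ℝ p q)
    have hq' := hpq (right_mem_segment ℝ p q)
    have e1 := hs p hp' q hq' hpq
    have e2 := hs q hq' p hp' (by rwa [segment_symm])
    rw [planeEval_sub (Φ p) p q] at e1
    rw [planeEval_sub (Φ q) q p, show p - q = -(q - p) by abel, map_neg] at e2
    have k1 : ∀ w ∈ S, ‖w - x‖ < δ →
        |planeGrad (Φ w) (q - p) - planeGrad (Φ x) (q - p)| ≤ η * ‖q - p‖ := by
      intro w hw hwx
      have h1 := hδ' hw (by rwa [dist_eq_norm])
      rw [dist_eq_norm] at h1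
      rw [← _root_.sub_apply, ← Real.norm_eq_abs]
      exact (ContinuousLinearMap.le_opNorm _ _).trans
        (mul_le_mul_of_nonneg_right h1.le (norm_nonneg _))
    have k2 := abs_le.1 (k1 p hp' hpx)
    have k3 := abs_le.1 (k1 q hq' hqx)
    rw [abs_le]
    constructor <;> linarith
  have hnear : ∀ᶠ y in 𝓝[S] x, (C + 1) * ‖y - x‖ < δ := by
    have : Tendsto (fun y : ℝ × ℝ => (C + 1) * ‖y - x‖) (𝓝 x) (𝓝 ((C + 1) * ‖x - x‖)) := by
      apply Continuous.tendsto; fun_prop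
    rw [sub_self, norm_zero, mul_zero] at this
    exact mem_nhdsWithin_of_mem_nhds (this.eventually (gt_mem_nhds hδ))
  filter_upwards [hC, hnear] with y ⟨z, h1, h2, h3, h4⟩ hy
  have ny := norm_nonneg (y - x)
  have a1 := hest x z h1 (by simpa using hδ) (by nlinarith)
  have a2 := hest z y h2 (by nlinarith) (by nlinarith)
  rw [Real.norm_eq_abs]
  have e3 : planeGrad (Φ x) (y - x) = planeGrad (Φ x) (y - z) + planeGrad (Φ x) (z - x) := by
    rw [← map_add]; congr 1; abel
  rw [e3, abs_le]
  have a1' := abs_le.1 a1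
  have a2' := abs_le.1 a2
  constructor <;> nlinarith

theorem Supports.contDiffOn {g h : ℝ → ℝ × ℝ} (hp : IsTangentPair g h)
    {Φ : ℝ × ℝ → ℝ × ℝ × ℝ} (hΦ : ContinuousOn Φ (strip g h))
    (hs : Supports (strip g h) Φ (strip g h)) :
    ContDiffOn ℝ 1 (fun x => planeEval (Φ x) x) (strip g h) := by
  rw [show (1 : WithTop ℕ∞) = 0 + 1 by norm_num,
    contDiffOn_succ_iff_hasFDerivWithinAt (by simp)]
  intro x hx
  refine ⟨strip g h, by rw [insert_eq_of_mem hx]; exact self_mem_nhdsWithin, by simp,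
    fun y => planeGrad (Φ y), fun y hy => hs.hasFDerivWithinAt hp hΦ hy, ?_⟩
  exact contDiffOn_zero.2 (continuous_planeGrad.comp_continuousOn hΦ)

end
end BellmanFoliation

namespace BellmanFoliation
noncomputable section

/-! ### Differentiation along the tangents -/

/-- Derivative of a continuous function given implicitly. -/
lemma hasDerivAt_of_implicit {F : ℝ × ℝ → ℝ} {φ : ℝ → ℝ} {t a b : ℝ}
    (hF : HasFDerivAt F (a • ContinuousLinearMap.fst ℝ ℝ ℝ + b • ContinuousLinearMap.snd ℝ ℝ ℝ)
      (t, φ t)) (hφ : ContinuousAt φ t) (h0 : ∀ᶠ t' in 𝓝 t, F (t', φ t') = F (t, φ t))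
    (hb : b ≠ 0) : HasDerivAt φ (-a / b) t := by
  have hb' : 0 < |b| := abs_pos.2 hb
  have key : ∀ e > 0, ∀ᶠ t' in 𝓝 t,
      |a * (t' - t) + b * (φ t' - φ t)| ≤ e * (|t' - t| + |φ t' - φ t|) := by
    intro e he
    have h1 := (Asymptotics.isLittleO_iff.1 (hasFDerivAt_iff_isLittleO.1 hF)) he
    have hpair : Tendsto (fun t' => (t', φ t')) (𝓝 t) (𝓝 (t, φ t)) :=
      (continuousAt_id.prodMk hφ)
    filter_upwards [hpair.eventually h1, h0] with t' h2 h3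
    rw [h3, sub_self, zero_sub, norm_neg] at h2
    simp only [_root_.add_apply, _root_.smul_apply,
      ContinuousLinearMap.coe_fst', ContinuousLinearMap.coe_snd', Prod.fst_sub, Prod.snd_sub,
      smul_eq_mul, Real.norm_eq_abs] at h2
    refine h2.trans (mul_le_mul_of_nonneg_left ?_ he.le)
    rw [Prod.norm_def]
    exact max_le (le_add_of_nonneg_right (abs_nonneg _)) (le_add_of_nonneg_left (abs_nonneg _))
  -- the estimate with `e = |b| / 2` gives a Lipschitz bound at `t`, which makes the error `o(t' - t)`
  set K := 2 * |a| / |b| + 1 with hK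
  have hKp : 0 < K := by positivity
  have hlip : ∀ᶠ t' in 𝓝 t, |φ t' - φ t| ≤ K * |t' - t| := by
    filter_upwards [key (|b| / 2) (by positivity)] with t' h
    have h1 : |b| * |φ t' - φ t| ≤ |a * (t' - t) + b * (φ t' - φ t)| + |a| * |t' - t| := by
      rw [← abs_mul, ← abs_mul]
      have := abs_sub (a * (t' - t) + b * (φ t' - φ t)) (a * (t' - t))
      rwa [add_sub_cancel_left] at this
    have h2 : K * |b| = 2 * |a| + |b| := by rw [hK]; field_simp
    have h3 : |b| * |φ t' - φ t| ≤ |b| * (K * |t' - t|) := by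
      have : |b| * (K * |t' - t|) = (2 * |a| + |b|) * |t' - t| := by rw [← h2]; ring
      rw [this]; linarith
    exact le_of_mul_le_mul_left h3 hb'
  rw [hasDerivAt_iff_isLittleO, Asymptotics.isLittleO_iff]
  intro e he
  filter_upwards [hlip, key (e * |b| / (1 + K)) (by positivity)] with t' h1 h2
  rw [Real.norm_eq_abs, Real.norm_eq_abs, smul_eq_mul]
  have h3 : φ t' - φ t - (t' - t) * (-a / b) = (a * (t' - t) + b * (φ t' - φ t)) / b := by
    field_simp; ring
  rw [h3, abs_div, div_le_iff₀ hb']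
  refine h2.trans ?_
  have h4 : e * |b| / (1 + K) * (|t' - t| + |φ t' - φ t|) ≤
      e * |b| / (1 + K) * ((1 + K) * |t' - t|) :=
    mul_le_mul_of_nonneg_left (by linarith) (by positivity)
  refine h4.trans (le_of_eq ?_)
  field_simp

namespace IsTangentPair

variable {g h : ℝ → ℝ × ℝ} (hp : IsTangentPair g h)
include hp

lemma tangency_fst_ne (σ : Side) (t : ℝ) : (g t).1 - (h (tanPar h σ (g t))).1 ≠ 0 := by
  cases σ
  · exact (sub_pos.2 (hp.tangency_R_lt t)).ne'
  · exact (sub_neg.2 (hp.lt_tangency_L t)).ne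

lemma tangency_snd (σ : Side) (t : ℝ) : (g t).2 - (h (tanPar h σ (g t))).2 =
    curveSlope h (tanPar h σ (g t)) * ((g t).1 - (h (tanPar h σ (g t))).1) := by
  have := hp.gap_tanPar (hp.curve_mem_strip t) σ
  rw [gap] at this; linarith

lemma slope_mul_pos (σ : Side) (t : ℝ) :
    0 < (curveSlope g t - curveSlope h (tanPar h σ (g t))) *
      ((g t).1 - (h (tanPar h σ (g t))).1) := by
  have h1 := hp.gap_outer_inner_pos (tanPar h σ (g t)) t
  have h2 := hp.tangency_snd σ t
  rw [gap] at h1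
  nlinarith

lemma slope_R_lt (t : ℝ) : curveSlope h (tanPar h Side.R (g t)) < curveSlope g t := by
  have h1 := hp.slope_mul_pos Side.R t
  have h2 := hp.tangency_R_lt t
  by_contra hcon
  nlinarith

lemma lt_slope_L (t : ℝ) : curveSlope g t < curveSlope h (tanPar h Side.L (g t)) := by
  have h1 := hp.slope_mul_pos Side.L t
  have h2 := hp.lt_tangency_L t
  by_contra hcon
  nlinarith

lemma slope_ne (σ : Side) (t : ℝ) : curveSlope g t - curveSlope h (tanPar h σ (g t)) ≠ 0 :=
  fun h0 => (hp.slope_mul_pos σ t).ne' (by rw [h0, zero_mul])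

lemma hasFDerivAt_gap (t s : ℝ) : HasFDerivAt (fun p : ℝ × ℝ => gap h (g p.1) p.2)
    (((deriv g t).1 * (curveSlope g t - curveSlope h s)) • ContinuousLinearMap.fst ℝ ℝ ℝ +
      (-(deriv (curveSlope h) s * ((g t).1 - (h s).1))) • ContinuousLinearMap.snd ℝ ℝ ℝ)
    (t, s) := by
  have f1 : HasFDerivAt (fun p : ℝ × ℝ => p.1) (ContinuousLinearMap.fst ℝ ℝ ℝ) (t, s) :=
    hasFDerivAt_fst
  have f2 : HasFDerivAt (fun p : ℝ × ℝ => p.2) (ContinuousLinearMap.snd ℝ ℝ ℝ) (t, s) :=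
    hasFDerivAt_snd
  have a1 := (hp.outer.hasDerivAt_fst t).comp_hasFDerivAt_of_eq (t, s) f1 rfl
  have a2 := (hp.outer.hasDerivAt_snd t).comp_hasFDerivAt_of_eq (t, s) f1 rfl
  have b1 := (hp.inner.hasDerivAt_fst s).comp_hasFDerivAt_of_eq (t, s) f2 rfl
  have b2 := (hp.inner.hasDerivAt_snd s).comp_hasFDerivAt_of_eq (t, s) f2 rfl
  have b3 := (hp.inner.hasDerivAt_curveSlope s).comp_hasFDerivAt_of_eq (t, s) f2 rfl
  refine ((a2.sub b2).sub (b3.mul (a1.sub b1))).congr_fderiv ?_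
  have e1 := hp.outer.deriv_snd_eq t
  have e2 := hp.inner.deriv_snd_eq s
  ext <;> simp [e1, e2] <;> ring

lemma hasDerivAt_tangency (σ : Side) (t : ℝ) : HasDerivAt (fun t => tanPar h σ (g t))
    ((deriv g t).1 * (curveSlope g t - curveSlope h (tanPar h σ (g t))) /
      (deriv (curveSlope h) (tanPar h σ (g t)) * ((g t).1 - (h (tanPar h σ (g t))).1))) t := by
  have hne : -(deriv (curveSlope h) (tanPar h σ (g t)) * ((g t).1 - (h (tanPar h σ (g t))).1)) ≠ 0 :=
    neg_ne_zero.2 (mul_ne_zero (hp.inner.deriv_curveSlope_pos _).ne' (hp.tangency_fst_ne σ t))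
  refine (hasDerivAt_of_implicit (hp.hasFDerivAt_gap t (tanPar h σ (g t)))
    (hp.continuous_tangency σ).continuousAt (Eventually.of_forall fun t' => ?_) hne).congr_deriv ?_
  · simp only [hp.gap_tanPar (hp.curve_mem_strip _)]
  · rw [neg_div_neg_eq]

lemma continuous_tangency_slope (σ : Side) :
    Continuous fun t => curveSlope h (tanPar h σ (g t)) :=
  hp.inner.continuous_curveSlope.comp (hp.continuous_tangency σ)

lemma continuous_tangency_fst (σ : Side) :
    Continuous fun t => (h (tanPar h σ (g t))).1 :=
  hp.inner.continuous_fst.comp (hp.continuous_tangency σ)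

/-- The slope of the tangent drawn from `g t` increases with `t`. -/
lemma hasDerivAt_tangency_slope (σ : Side) (t : ℝ) :
    HasDerivAt (fun t => curveSlope h (tanPar h σ (g t)))
      ((deriv g t).1 * (curveSlope g t - curveSlope h (tanPar h σ (g t))) /
        ((g t).1 - (h (tanPar h σ (g t))).1)) t := by
  refine ((hp.inner.hasDerivAt_curveSlope _).comp t (hp.hasDerivAt_tangency σ t)).congr_deriv ?_
  have h1 := (hp.inner.deriv_curveSlope_pos (tanPar h σ (g t))).ne'
  have h2 := hp.tangency_fst_ne σ t
  field_simp

lemma hasDerivAt_tangency_fst (σ : Side) (t : ℝ) :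
    HasDerivAt (fun t => (h (tanPar h σ (g t))).1)
      ((deriv h (tanPar h σ (g t))).1 *
        ((deriv g t).1 * (curveSlope g t - curveSlope h (tanPar h σ (g t))) /
      (deriv (curveSlope h) (tanPar h σ (g t)) * ((g t).1 - (h (tanPar h σ (g t))).1)))) t :=
  (hp.inner.hasDerivAt_fst _).comp t (hp.hasDerivAt_tangency σ t)

lemma gap_eq_of_tangency (σ : Side) (t : ℝ) (y : ℝ × ℝ) : gap h y (tanPar h σ (g t)) =
    y.2 - (g t).2 - curveSlope h (tanPar h σ (g t)) * (y.1 - (g t).1) := by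
  have := hp.tangency_snd σ t
  rw [gap]; linarith

end IsTangentPair

/-! ### The equation along the tangents -/

/-- Solutions of `β' = ρ (θ - β)`. -/
def IsRelaxation (ρ θ β : ℝ → ℝ) : Prop := ∀ t, HasDerivAt β (ρ t * (θ t - β t)) t

lemma kap2_eq (G : ℝ → ℝ → ℝ × ℝ) : kap2 G = curveSlope (G 0) := rfl

/-- Coefficients of the affine function with the value `f t` and the derivative `f' t` along the
fixed boundary at `g t`, the coefficient of the second coordinate being `b`. -/
def planeAt (G : ℝ → ℝ → ℝ × ℝ) (f : ℝ → ℝ) (t b : ℝ) : ℝ × ℝ × ℝ :=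
  (f t - (kap3 G f t - b * kap2 G t) * (G 0 t).1 - b * (G 0 t).2, kap3 G f t - b * kap2 G t, b)

lemma planeEval_planeAt (G : ℝ → ℝ → ℝ × ℝ) (f : ℝ → ℝ) (t b : ℝ) (x : ℝ × ℝ) :
    planeEval (planeAt G f t b) x =
      f t + (kap3 G f t - b * kap2 G t) * (x.1 - (G 0 t).1) + b * (x.2 - (G 0 t).2) := by
  simp only [planeEval, planeAt]; ring

lemma planeEval_planeAt_self (G : ℝ → ℝ → ℝ × ℝ) (f : ℝ → ℝ) (t b : ℝ) :
    planeEval (planeAt G f t b) (G 0 t) = f t := by rw [planeEval_planeAt]; ring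

/-- The regularity of the boundary function and of the fixed boundary used below. -/
structure BoundaryData (G : ℝ → ℝ → ℝ × ℝ) (f : ℝ → ℝ) : Prop where
  curve : IsConvexCurve (G 0)
  smooth : ContDiff ℝ 2 f

namespace BoundaryData

variable {G : ℝ → ℝ → ℝ × ℝ} {f : ℝ → ℝ} (hf : BoundaryData G f)
include hf

lemma hasDerivAt (t : ℝ) : HasDerivAt f (deriv f t) t :=
  (hf.smooth.differentiable (by norm_num) t).hasDerivAt

lemma contDiff_deriv : ContDiff ℝ 1 (deriv f) :=
  ((contDiff_succ_iff_deriv (n := 1)).1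
    (by have := hf.smooth; rwa [show (2 : WithTop ℕ∞) = 1 + 1 by norm_num] at this)).2.2

lemma continuous_deriv : Continuous (deriv f) := hf.contDiff_deriv.continuous

lemma contDiff_kap3 : ContDiff ℝ 1 (kap3 G f) :=
  hf.contDiff_deriv.div (hf.curve.contDiff_deriv.fst.of_le (by norm_num)) fun t => (hf.curve.pos t).ne'

lemma hasDerivAt_kap3' (t : ℝ) : HasDerivAt (kap3 G f) (deriv (kap3 G f) t) t :=
  (hf.contDiff_kap3.differentiable (by norm_num) t).hasDerivAt

lemma hasDerivAt_kap2 (t : ℝ) : HasDerivAt (kap2 G) (deriv (kap2 G) t) t :=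
  hf.curve.hasDerivAt_curveSlope t

lemma deriv_kap2_pos (t : ℝ) : 0 < deriv (kap2 G) t := hf.curve.deriv_curveSlope_pos t

lemma continuous_deriv_kap2 : Continuous (deriv (kap2 G)) := hf.curve.continuous_deriv_curveSlope

lemma continuous_kap2 : Continuous (kap2 G) := hf.curve.continuous_curveSlope

lemma continuous_kap3 : Continuous (kap3 G f) := hf.contDiff_kap3.continuous

lemma strictMono_kap2 : StrictMono (kap2 G) := hf.curve.strictMono_curveSlope

lemma continuous_tors : Continuous (tors G f) :=
  (hf.contDiff_kap3.continuous_deriv (by norm_num)).div hf.continuous_deriv_kap2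
    fun t => (hf.deriv_kap2_pos t).ne'

lemma deriv_kap3 (t : ℝ) : deriv (kap3 G f) t = tors G f t * deriv (kap2 G) t := by
  rw [tors, div_mul_cancel₀ _ (hf.deriv_kap2_pos t).ne']

lemma hasDerivAt_kap3 (t : ℝ) : HasDerivAt (kap3 G f) (tors G f t * deriv (kap2 G) t) t := by
  rw [← hf.deriv_kap3]; exact hf.hasDerivAt_kap3' t

lemma deriv_eq (t : ℝ) : deriv f t = kap3 G f t * (deriv (G 0) t).1 := by
  rw [kap3, div_mul_cancel₀ _ (hf.curve.pos t).ne']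

lemma deriv_snd (t : ℝ) : (deriv (G 0) t).2 = kap2 G t * (deriv (G 0) t).1 :=
  hf.curve.deriv_snd_eq t

/-- Derivative of the value of a moving plane at a fixed point. -/
lemma hasDerivAt_planeEval {β : ℝ → ℝ} {t β' : ℝ} (hβ : HasDerivAt β β' t) (x : ℝ × ℝ) :
    HasDerivAt (fun t => planeEval (planeAt G f t (β t)) x)
      (β' * (x.2 - (G 0 t).2) + (deriv (kap2 G) t * (tors G f t - β t) - β' * kap2 G t) *
        (x.1 - (G 0 t).1)) t := by
  have hk : HasDerivAt (fun t => kap3 G f t - β t * kap2 G t)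
      (tors G f t * deriv (kap2 G) t - (β' * kap2 G t + β t * deriv (kap2 G) t)) t :=
    (hf.hasDerivAt_kap3 t).sub (hβ.mul (hf.hasDerivAt_kap2 t))
  have h1 : HasDerivAt (fun t => x.1 - (G 0 t).1) (-(deriv (G 0) t).1) t :=
    (hf.curve.hasDerivAt_fst t).const_sub x.1
  have h2 : HasDerivAt (fun t => x.2 - (G 0 t).2) (-(deriv (G 0) t).2) t :=
    (hf.curve.hasDerivAt_snd t).const_sub x.2
  have := ((hf.hasDerivAt t).add (hk.mul h1)).add (hβ.mul h2)
  refine (this.congr_deriv ?_).congr_of_eventuallyEq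
    (Eventually.of_forall fun t => planeEval_planeAt G f t (β t) x)
  rw [hf.deriv_eq, hf.deriv_snd]; ring

lemma continuousOn_planeAt {β : ℝ → ℝ} {D : Set ℝ} (hβ : ContinuousOn β D) :
    ContinuousOn (fun t => planeAt G f t (β t)) D := by
  have h1 := hf.continuous_kap2.continuousOn (s := D)
  have h2 := hf.continuous_kap3.continuousOn (s := D)
  have h3 := hf.smooth.continuous.continuousOn (s := D)
  have h4 := hf.curve.continuous_fst.continuousOn (s := D)
  have h5 := hf.curve.continuous_snd.continuousOn (s := D)
  have h6 := h2.sub (hβ.mul h1)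
  exact ((h3.sub (h6.mul h4)).sub (hβ.mul h5)).prodMk (h6.prodMk hβ)

end BoundaryData

namespace AdmissibleFamily

variable {εmax : EReal} {G : ℝ → ℝ → ℝ × ℝ} (hG : AdmissibleFamily εmax G)
include hG

variable {ε : ℝ} (hε : ε ∈ paramSet εmax) (h0 : 0 < ε)
include hε h0

lemma slope_eq (σ : Side) (t : ℝ) :
    slope G ε σ t = curveSlope (G ε) (tanPar (G ε) σ (G 0 t)) := by
  have hp := hG.isTangentPair hε h0
  have h1 := hp.tangency_snd σ t
  have h2 := hp.tangency_fst_ne σ t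
  rw [slope, hG.tpt_eq hε, div_eq_iff (by rw [← neg_sub]; exact neg_ne_zero.2 h2)]
  linarith

lemma continuous_slope (σ : Side) : Continuous (slope G ε σ) := by
  rw [funext (hG.slope_eq hε h0 σ)]
  exact (hG.isTangentPair hε h0).continuous_tangency_slope σ

lemma kap2_sub_slope_ne (σ : Side) (t : ℝ) : kap2 G t - slope G ε σ t ≠ 0 := by
  rw [hG.slope_eq hε h0]; exact (hG.isTangentPair hε h0).slope_ne σ t

lemma slope_R_lt (t : ℝ) : slope G ε Side.R t < kap2 G t := by
  rw [hG.slope_eq hε h0]; exact (hG.isTangentPair hε h0).slope_R_lt t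

lemma lt_slope_L (t : ℝ) : kap2 G t < slope G ε Side.L t := by
  rw [hG.slope_eq hε h0]; exact (hG.isTangentPair hε h0).lt_slope_L t

lemma continuous_rate (σ : Side) : Continuous (rate G ε σ) := by
  have hc := hG.isConvexCurve hG.zero_mem
  exact hc.continuous_deriv_curveSlope.div
    (hc.continuous_curveSlope.sub (hG.continuous_slope hε h0 σ)) (hG.kap2_sub_slope_ne hε h0 σ)

lemma rate_R_pos (t : ℝ) : 0 < rate G ε Side.R t :=
  div_pos ((hG.isConvexCurve hG.zero_mem).deriv_curveSlope_pos t)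
    (sub_pos.2 (hG.slope_R_lt hε h0 t))

lemma rate_L_neg (t : ℝ) : rate G ε Side.L t < 0 :=
  div_neg_of_pos_of_neg ((hG.isConvexCurve hG.zero_mem).deriv_curveSlope_pos t)
    (sub_neg.2 (hG.lt_slope_L hε h0 t))

lemma rate_mul (σ : Side) (t : ℝ) :
    rate G ε σ t * (kap2 G t - slope G ε σ t) = deriv (kap2 G) t :=
  div_mul_cancel₀ _ (hG.kap2_sub_slope_ne hε h0 σ t)

/-- Along the tangents, the planes of a solution rotate around the tangent lines. -/
lemma hasDerivAt_planeEval_tangent {f : ℝ → ℝ} (hf : BoundaryData G f) {σ : Side} {β : ℝ → ℝ}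
    (hβ : IsRelaxation (rate G ε σ) (tors G f) β) (x : ℝ × ℝ) (t : ℝ) :
    HasDerivAt (fun t => planeEval (planeAt G f t (β t)) x)
      (rate G ε σ t * (tors G f t - β t) * gap (G ε) x (tanPar (G ε) σ (G 0 t))) t := by
  refine (hf.hasDerivAt_planeEval (hβ t) x).congr_deriv ?_
  rw [(hG.isTangentPair hε h0).gap_eq_of_tangency, ← hG.slope_eq hε h0, ← hG.rate_mul hε h0 σ]
  ring

/-- For fixed `y`, the value at `y` of the plane with parameter `t` decreases for `t` before the base
of `y` and increases afterwards, as long as the tangent from `g t` does not pass below `y`;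
visibility of `y` from `x` guarantees this between the bases of `x` and `y`. -/
lemma supports_tangents_R {f : ℝ → ℝ} (hf : BoundaryData G f) {β : ℝ → ℝ}
    (hβ : IsRelaxation (rate G ε Side.R) (tors G f) β) {D : Set ℝ} (hD : D.OrdConnected)
    (hle : ∀ t ∈ D, tors G f t ≤ β t) :
    Supports (strip (G 0) (G ε)) (fun x => planeAt G f (base (G 0) (G ε) Side.R x)
      (β (base (G 0) (G ε) Side.R x))) {x ∈ strip (G 0) (G ε) | base (G 0) (G ε) Side.R x ∈ D} := by
  have hp := hG.isTangentPair hε h0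
  rintro x ⟨hx, hxD⟩ y ⟨hy, hyD⟩ hxy
  have hd := hG.hasDerivAt_planeEval_tangent hε h0 hf hβ y
  have hc : Continuous fun t => planeEval (planeAt G f t (β t)) y :=
    continuous_iff_continuousAt.2 fun t => (hd t).continuousAt
  have hsign : ∀ t ∈ D, rate G ε Side.R t * (tors G f t - β t) ≤ 0 := fun t ht =>
    mul_nonpos_of_nonneg_of_nonpos (hG.rate_R_pos hε h0 t).le (sub_nonpos.2 (hle t ht))
  set a := base (G 0) (G ε) Side.R x with ha
  set b := base (G 0) (G ε) Side.R y with hb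
  rcases le_total a b with hab | hab
  · refine antitoneOn_of_deriv_nonpos (convex_Icc a b) hc.continuousOn
      (fun t _ => (hd t).differentiableAt.differentiableWithinAt) (fun t ht => ?_)
      (left_mem_Icc.2 hab) (right_mem_Icc.2 hab) hab
    rw [interior_Icc] at ht
    rw [(hd t).deriv]
    refine mul_nonpos_of_nonpos_of_nonneg (hsign t (hD.out hxD hyD ⟨ht.1.le, ht.2.le⟩)) ?_
    exact (hp.gap_pos_of_lt hy (hp.lt_base_iff.1 ht.2)).le
  · refine monotoneOn_of_deriv_nonneg (convex_Icc b a) hc.continuousOn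
      (fun t _ => (hd t).differentiableAt.differentiableWithinAt) (fun t ht => ?_)
      (left_mem_Icc.2 hab) (right_mem_Icc.2 hab) hab
    rw [interior_Icc] at ht
    rw [(hd t).deriv]
    refine mul_nonneg_of_nonpos_of_nonpos (hsign t (hD.out hyD hxD ⟨ht.1.le, ht.2.le⟩)) ?_
    exact hp.gap_nonpos_of_mem hy (hp.base_lt_iff.1 ht.1).le
      ((hp.lt_base_iff.1 ht.2).le.trans (hp.tanPar_le_of_segment_subset hxy))

lemma supports_tangents_L {f : ℝ → ℝ} (hf : BoundaryData G f) {β : ℝ → ℝ}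
    (hβ : IsRelaxation (rate G ε Side.L) (tors G f) β) {D : Set ℝ} (hD : D.OrdConnected)
    (hle : ∀ t ∈ D, tors G f t ≤ β t) :
    Supports (strip (G 0) (G ε)) (fun x => planeAt G f (base (G 0) (G ε) Side.L x)
      (β (base (G 0) (G ε) Side.L x))) {x ∈ strip (G 0) (G ε) | base (G 0) (G ε) Side.L x ∈ D} := by
  have hp := hG.isTangentPair hε h0
  rintro x ⟨hx, hxD⟩ y ⟨hy, hyD⟩ hxy
  have hd := hG.hasDerivAt_planeEval_tangent hε h0 hf hβ y
  have hc : Continuous fun t => planeEval (planeAt G f t (β t)) y :=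
    continuous_iff_continuousAt.2 fun t => (hd t).continuousAt
  have hsign : ∀ t ∈ D, 0 ≤ rate G ε Side.L t * (tors G f t - β t) := fun t ht =>
    mul_nonneg_of_nonpos_of_nonpos (hG.rate_L_neg hε h0 t).le (sub_nonpos.2 (hle t ht))
  set a := base (G 0) (G ε) Side.L x with ha
  set b := base (G 0) (G ε) Side.L y with hb
  rcases le_total a b with hab | hab
  · refine antitoneOn_of_deriv_nonpos (convex_Icc a b) hc.continuousOn
      (fun t _ => (hd t).differentiableAt.differentiableWithinAt) (fun t ht => ?_)
      (left_mem_Icc.2 hab) (right_mem_Icc.2 hab) hab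
    rw [interior_Icc] at ht
    rw [(hd t).deriv]
    refine mul_nonpos_of_nonneg_of_nonpos (hsign t (hD.out hxD hyD ⟨ht.1.le, ht.2.le⟩)) ?_
    exact hp.gap_nonpos_of_mem hy ((hp.tanPar_le_of_segment_subset
      (by rwa [segment_symm] at hxy)).trans (hp.base_lt_iff.1 ht.1).le) (hp.lt_base_iff.1 ht.2).le
  · refine monotoneOn_of_deriv_nonneg (convex_Icc b a) hc.continuousOn
      (fun t _ => (hd t).differentiableAt.differentiableWithinAt) (fun t ht => ?_)
      (left_mem_Icc.2 hab) (right_mem_Icc.2 hab) hab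
    rw [interior_Icc] at ht
    rw [(hd t).deriv]
    refine mul_nonneg (hsign t (hD.out hyD hxD ⟨ht.1.le, ht.2.le⟩)) ?_
    exact (hp.gap_pos_of_gt hy (hp.base_lt_iff.1 ht.1)).le

end AdmissibleFamily

end
end BellmanFoliation

namespace BellmanFoliation
noncomputable section

/-! ### Relaxation equations -/

lemma hasDerivAt_exp_integral {ρ : ℝ → ℝ} (hρ : Continuous ρ) (s t : ℝ) :
    HasDerivAt (fun t => Real.exp (∫ x in s..t, ρ x)) (ρ t * Real.exp (∫ x in s..t, ρ x)) t := by
  have := (hρ.integral_hasStrictDerivAt s t).hasDerivAt.exp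
  rwa [mul_comm] at this

namespace IsRelaxation

variable {ρ θ β : ℝ → ℝ}

lemma continuous (h : IsRelaxation ρ θ β) : Continuous β :=
  continuous_iff_continuousAt.2 fun t => (h t).continuousAt

/-- With the integrating factor, the distance from a solution to a constant is controlled by the
position of `θ` with respect to this constant. -/
lemma hasDerivAt_exp_mul (h : IsRelaxation ρ θ β) (hρ : Continuous ρ) (s c t : ℝ) :
    HasDerivAt (fun t => Real.exp (∫ x in s..t, ρ x) * (β t - c))
      (ρ t * Real.exp (∫ x in s..t, ρ x) * (θ t - c)) t := by
  refine ((hasDerivAt_exp_integral hρ s t).mul ((h t).sub_const c)).congr_deriv ?_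
  ring

lemma le_exp_mul (h : IsRelaxation ρ θ β) (hρ : Continuous ρ) {s t c : ℝ} (hst : s ≤ t)
    (hρ0 : ∀ x, 0 < ρ x) (hθ : ∀ x ∈ Icc s t, c ≤ θ x) :
    β s - c ≤ Real.exp (∫ x in s..t, ρ x) * (β t - c) := by
  have hd := h.hasDerivAt_exp_mul hρ s c
  have := monotoneOn_of_deriv_nonneg (convex_Icc s t)
    (fun x _ => (hd x).continuousAt.continuousWithinAt)
    (fun x _ => (hd x).differentiableAt.differentiableWithinAt) (fun x hx => by
      rw [(hd x).deriv]
      exact mul_nonneg (mul_nonneg (hρ0 x).le (Real.exp_pos _).le)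
        (sub_nonneg.2 (hθ x (interior_subset hx)))) (left_mem_Icc.2 hst) (right_mem_Icc.2 hst) hst
  simpa using this

lemma exp_mul_le (h : IsRelaxation ρ θ β) (hρ : Continuous ρ) {s t c : ℝ} (hst : s ≤ t)
    (hρ0 : ∀ x, 0 < ρ x) (hθ : ∀ x ∈ Icc s t, θ x ≤ c) :
    Real.exp (∫ x in s..t, ρ x) * (β t - c) ≤ β s - c := by
  have hd := h.hasDerivAt_exp_mul hρ s c
  have := antitoneOn_of_deriv_nonpos (convex_Icc s t)
    (fun x _ => (hd x).continuousAt.continuousWithinAt)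
    (fun x _ => (hd x).differentiableAt.differentiableWithinAt) (fun x hx => by
      rw [(hd x).deriv]
      exact mul_nonpos_of_nonneg_of_nonpos (mul_nonneg (hρ0 x).le (Real.exp_pos _).le)
        (sub_nonpos.2 (hθ x (interior_subset hx)))) (left_mem_Icc.2 hst) (right_mem_Icc.2 hst) hst
  simpa using this

lemma reflect (h : IsRelaxation ρ θ β) :
    IsRelaxation (fun t => -ρ (-t)) (fun t => θ (-t)) (fun t => β (-t)) := by
  intro t
  refine ((h (-t)).comp t (hasDerivAt_neg t)).congr_deriv ?_
  ring

/-- Explicit form of a solution. -/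
lemma eq_integral (h : IsRelaxation ρ θ β) (hρ : Continuous ρ) (hθ : Continuous θ) (s t : ℝ) :
    β t = Real.exp (-∫ x in s..t, ρ x) *
      ((∫ τ in s..t, Real.exp (∫ x in s..τ, ρ x) * (ρ τ * θ τ)) + β s) := by
  have hd := h.hasDerivAt_exp_mul hρ s 0
  have he : Continuous fun t => Real.exp (∫ x in s..t, ρ x) :=
    continuous_iff_continuousAt.2 fun t => (hasDerivAt_exp_integral hρ s t).continuousAt
  have := intervalIntegral.integral_eq_sub_of_hasDerivAt (a := s) (b := t) (fun x _ => hd x)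
    (Continuous.intervalIntegrable (by fun_prop) _ _)
  simp only [sub_zero, intervalIntegral.integral_same, Real.exp_zero, one_mul] at this
  have h2 : (∫ τ in s..t, Real.exp (∫ x in s..τ, ρ x) * (ρ τ * θ τ)) =
      ∫ τ in s..t, ρ τ * Real.exp (∫ x in s..τ, ρ x) * θ τ := by
    congr 1; ext τ; ring
  rw [h2, this, Real.exp_neg]
  field_simp
  ring

lemma exists_solution (hρ : Continuous ρ) (hθ : Continuous θ) (s b : ℝ) :
    ∃ β, IsRelaxation ρ θ β ∧ β s = b := by
  have he : Continuous fun t => Real.exp (∫ x in s..t, ρ x) :=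
    continuous_iff_continuousAt.2 fun t => (hasDerivAt_exp_integral hρ s t).continuousAt
  refine ⟨fun t => ((∫ τ in s..t, ρ τ * Real.exp (∫ x in s..τ, ρ x) * θ τ) + b) /
    Real.exp (∫ x in s..t, ρ x), fun t => ?_, by simp⟩
  have h1 : HasDerivAt (fun t => (∫ τ in s..t, ρ τ * Real.exp (∫ x in s..τ, ρ x) * θ τ) + b)
      (ρ t * Real.exp (∫ x in s..t, ρ x) * θ t) t :=
    ((Continuous.integral_hasStrictDerivAt (by fun_prop) s t).hasDerivAt).add_const b
  refine (h1.div (hasDerivAt_exp_integral hρ s t) (Real.exp_pos _).ne').congr_deriv ?_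
  have := (Real.exp_pos (∫ x in s..t, ρ x)).ne'
  field_simp

/-- Solutions differ by a multiple of the solution of the homogeneous equation. -/
lemma add_exp (h : IsRelaxation ρ θ β) (hρ : Continuous ρ) (v L : ℝ) :
    IsRelaxation ρ θ fun t => β t + L * Real.exp (-∫ x in v..t, ρ x) := by
  intro t
  have h1 : HasDerivAt (fun t => Real.exp (-∫ x in v..t, ρ x))
      (Real.exp (-∫ x in v..t, ρ x) * -ρ t) t :=
    (hρ.integral_hasStrictDerivAt v t).hasDerivAt.neg.exp
  refine ((h t).add (h1.const_mul L)).congr_deriv ?_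
  ring

/-- The integral of the weight against `dθ` in terms of a solution. -/
lemma stieltjes_eq (h : IsRelaxation ρ θ β) (hρ : Continuous ρ) (hθ : Continuous θ) (s t : ℝ) :
    stieltjes (fun τ => Real.exp (-∫ x in τ..t, ρ x)) θ s t =
      θ t - β t + Real.exp (-∫ x in s..t, ρ x) * (β s - θ s) := by
  have hsymm : ∀ τ, Real.exp (-∫ x in τ..t, ρ x) = Real.exp (∫ x in t..τ, ρ x) := fun τ => by
    rw [intervalIntegral.integral_symm τ t]
  have hd := h.hasDerivAt_exp_mul hρ t 0
  have he : Continuous fun τ => Real.exp (∫ x in t..τ, ρ x) :=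
    continuous_iff_continuousAt.2 fun τ => (hasDerivAt_exp_integral hρ t τ).continuousAt
  have hI := intervalIntegral.integral_eq_sub_of_hasDerivAt (a := s) (b := t) (fun x _ => hd x)
    (Continuous.intervalIntegrable (by fun_prop) _ _)
  have hder : deriv (fun τ => Real.exp (∫ x in t..τ, ρ x)) =
      fun τ => ρ τ * Real.exp (∫ x in t..τ, ρ x) :=
    funext fun τ => (hasDerivAt_exp_integral hρ t τ).deriv
  simp only [hsymm, stieltjes, hder]
  simp only [sub_zero] at hI
  rw [hI]
  simp only [intervalIntegral.integral_same, Real.exp_zero, one_mul]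
  ring

/-- A solution that starts above a growing `θ` is below `θ` later if the rate is large. -/
lemma lt_of_large_rate (h : IsRelaxation ρ θ β) (hρ : Continuous ρ) {v x q M N : ℝ} (hvx : v ≤ x)
    (hxq : x ≤ q) (hρ0 : ∀ x, 0 < ρ x) (hθ : MonotoneOn θ (Icc v q)) (hlt : θ x < θ q)
    (hM : β v ≤ M) (hN : M - θ x < (θ q - θ x) * (1 + N * (x - v))) (hρN : ∀ t ∈ Icc v x, N ≤ ρ t) :
    β q < θ q := by
  have h1 := h.exp_mul_le hρ hvx hρ0 (c := θ x)
    fun t ht => hθ ⟨ht.1, ht.2.trans hxq⟩ ⟨hvx, hxq⟩ ht.2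
  have h2 := h.exp_mul_le hρ hxq hρ0 (c := θ q)
    fun t ht => hθ ⟨hvx.trans ht.1, ht.2⟩ (right_mem_Icc.2 (hvx.trans hxq)) ht.2
  have hI : N * (x - v) ≤ ∫ t in v..x, ρ t := by
    have := intervalIntegral.integral_mono_on (μ := volume) hvx (f := fun _ => N)
      intervalIntegrable_const (hρ.intervalIntegrable _ _) hρN
    rwa [intervalIntegral.integral_const, smul_eq_mul, mul_comm] at this
  have he : 1 + N * (x - v) ≤ Real.exp (∫ t in v..x, ρ t) := by
    have := Real.add_one_le_exp (∫ t in v..x, ρ t); linarith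
  -- already at `x` the solution is below `θ q`, where it stays since `θ ≤ θ q` up to `q`
  have h3 : β x < θ q := by
    by_contra hcon
    rw [not_lt] at hcon
    have h4 : (θ q - θ x) * (1 + N * (x - v)) ≤
        Real.exp (∫ t in v..x, ρ t) * (β x - θ x) := by
      have hpos := Real.exp_pos (∫ t in v..x, ρ t)
      calc (θ q - θ x) * (1 + N * (x - v)) ≤ (θ q - θ x) * Real.exp (∫ t in v..x, ρ t) :=
            mul_le_mul_of_nonneg_left he (by linarith)
        _ ≤ Real.exp (∫ t in v..x, ρ t) * (β x - θ x) := by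
            rw [mul_comm]; exact mul_le_mul_of_nonneg_left (by linarith) hpos.le
    linarith
  by_contra hcon
  rw [not_lt] at hcon
  have := mul_nonneg (Real.exp_pos (∫ t in x..q, ρ t)).le (sub_nonneg.2 hcon)
  linarith

/-- Comparison of the solutions coming from `-∞` for two rates. -/
lemma le_of_rate_le {ρ' β' : ℝ → ℝ} (h : IsRelaxation ρ θ β) (h' : IsRelaxation ρ' θ β')
    (hρ : Continuous ρ) (hle : ∀ t, ρ' t ≤ ρ t) {v : ℝ} (hβ' : ∀ t ≤ v, θ t ≤ β' t)
    (hlim : Tendsto (fun t => Real.exp (-∫ x in t..v, ρ x) * (β t - θ t)) atBot (𝓝 0)) :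
    β v ≤ β' v := by
  have hsymm : ∀ τ, Real.exp (-∫ x in τ..v, ρ x) = Real.exp (∫ x in v..τ, ρ x) := fun τ => by
    rw [intervalIntegral.integral_symm τ v]
  simp only [hsymm] at hlim
  have hd : ∀ t, HasDerivAt (fun t => Real.exp (∫ x in v..t, ρ x) * (β t - β' t))
      (Real.exp (∫ x in v..t, ρ x) * ((ρ t - ρ' t) * (θ t - β' t))) t := fun t => by
    refine ((hasDerivAt_exp_integral hρ v t).mul ((h t).sub (h' t))).congr_deriv ?_
    simp only [Pi.sub_apply]; ring
  have hanti : AntitoneOn (fun t => Real.exp (∫ x in v..t, ρ x) * (β t - β' t)) (Iic v) :=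
    antitoneOn_of_deriv_nonpos (convex_Iic v)
    (fun x _ => (hd x).continuousAt.continuousWithinAt)
    (fun x _ => (hd x).differentiableAt.differentiableWithinAt) (fun x hx => by
      rw [(hd x).deriv]
      exact mul_nonpos_of_nonneg_of_nonpos (Real.exp_pos _).le
        (mul_nonpos_of_nonneg_of_nonpos (sub_nonneg.2 (hle x))
          (sub_nonpos.2 (hβ' x (mem_Iic.1 (interior_subset hx))))))
  have hfin : β v - β' v ≤ 0 := by
    refine ge_of_tendsto hlim ((eventually_le_atBot v).mono fun t ht => ?_)
    have h1 := hanti ht self_mem_Iic ht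
    simp only [intervalIntegral.integral_same, Real.exp_zero, one_mul] at h1
    refine h1.trans (mul_le_mul_of_nonneg_left ?_ (Real.exp_pos _).le)
    linarith [hβ' t ht]
  linarith

/-- Existence of the solution that comes from `-∞`, where `θ` is nonincreasing. `P` is an integrating
factor. If `θ` is unbounded near `-∞`, the bound needed for convergence comes from the identity
`ρ P θ = κ' Λ` and from the integrability of `κ Λ'`. -/
lemma exists_from_bot {P Λ w κ : ℝ → ℝ} {v : ℝ} (hρ : Continuous ρ) (hρ0 : ∀ x, 0 < ρ x)
    (hθ : Continuous θ) (hanti : AntitoneOn θ (Iic v)) (hne : ∀ t ≤ v, ∃ s < t, θ t < θ s)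
    (hP : ∀ t, HasDerivAt P (ρ t * P t) t) (hP0 : ∀ t, 0 < P t) (hPlim : Tendsto P atBot (𝓝 0))
    (hΛ : ∀ t, HasDerivAt Λ (w t) t) (hw : ∀ t, 0 < w t) (hwc : Continuous w)
    (hΛlim : Tendsto Λ atBot (𝓝 0))
    {k : ℝ → ℝ} (hκ : ∀ t, HasDerivAt κ (k t) t) (hk : ∀ t, 0 ≤ θ t → 0 ≤ k t)
    (hPk : ∀ t, ρ t * P t * θ t = k t * Λ t)
    (hint : ∃ K, ∀ b ≤ v, (∀ t ≤ b, κ t ≤ 0) → ∀ a ≤ b, ∫ t in a..b, -κ t * w t ≤ K) :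
    ∃ β, IsRelaxation ρ θ β ∧ (∀ t ≤ v, θ t < β t) ∧
      ∀ t, Tendsto (fun s => Real.exp (-∫ x in s..t, ρ x) * (β s - θ s)) atBot (𝓝 0) := by
  obtain ⟨y, hy, hyv⟩ := exists_solution hρ hθ v 0
  have hPpos : ∀ s t : ℝ, s ≤ t → P s ≤ P t := fun s t hst =>
    monotone_of_deriv_nonneg (fun t => (hP t).differentiableAt) (fun t => by
      rw [(hP t).deriv]; exact (mul_pos (hρ0 t) (hP0 t)).le) hst
  have hΛmono : StrictMono Λ := strictMono_of_deriv_pos fun t => by rw [(hΛ t).deriv]; exact hw t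
  have hΛ0 : ∀ t, 0 < Λ t := fun t =>
    (le_of_tendsto hΛlim ((eventually_le_atBot (t - 1)).mono fun s hs =>
      hΛmono.monotone hs) : 0 ≤ Λ (t - 1)).trans_lt (hΛmono (by linarith))
  -- `P` and the exponential of the integral are proportional
  have hPe : ∀ s t, P t = Real.exp (∫ x in s..t, ρ x) * P s := by
    intro s t
    have hd : ∀ t, HasDerivAt (fun t => P t / Real.exp (∫ x in s..t, ρ x)) 0 t := fun t => by
      refine ((hP t).div (hasDerivAt_exp_integral hρ s t) (Real.exp_pos _).ne').congr_deriv ?_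
      rw [div_eq_zero_iff]; left; ring
    have := is_const_of_deriv_eq_zero (fun t => (hd t).differentiableAt)
      (fun t => (hd t).deriv) t s
    simp only [intervalIntegral.integral_same, Real.exp_zero, div_one] at this
    rw [← this]; field_simp
  let D : ℝ → ℝ := fun t => P t * (y t - θ t)
  have hDstep : ∀ s t, s ≤ t → t ≤ v → D s + P s * (θ s - θ t) ≤ D t := by
    intro s t hst htv
    have h1 := hy.le_exp_mul hρ hst hρ0 (c := θ t)
      fun x hx => hanti (hx.2.trans htv) htv hx.2
    have h2 := mul_le_mul_of_nonneg_left h1 (hP0 s).le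
    have h3 : P s * (Real.exp (∫ x in s..t, ρ x) * (y t - θ t)) = D t := by
      simp only [D]; rw [hPe s t]; ring
    rw [h3] at h2
    simp only [D] at h2 ⊢
    linarith
  have hDmono : ∀ s t, s ≤ t → t ≤ v → D s ≤ D t := fun s t hst htv => by
    have := hDstep s t hst htv
    have h2 := hanti (hst.trans htv) htv hst
    nlinarith [hP0 s]
  -- boundedness of `D` near `-∞`
  have hbdd : ∃ m, ∀ t ≤ v, m ≤ D t := by
    by_cases hθb : ∃ Θ, ∀ t ≤ v, θ t ≤ Θ
    · obtain ⟨Θ, hΘ⟩ := hθb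
      refine ⟨-(P v * Θ), fun t ht => ?_⟩
      have h1 := hy.exp_mul_le hρ ht hρ0 (c := Θ) fun x hx => hΘ x hx.2
      have h2 := mul_le_mul_of_nonneg_left h1 (hP0 t).le
      rw [hyv, hPe t v] at *
      have := mul_le_mul_of_nonneg_left (hΘ t ht) (hP0 t).le
      simp only [D]
      linarith
    · push Not at hθb
      obtain ⟨v', hv', hθv'⟩ := hθb 0
      have hθ0 : ∀ t ≤ v', 0 ≤ θ t := fun t ht => hθv'.le.trans (hanti (ht.trans hv') hv' ht)
      have hκm : ∀ s t, s ≤ t → t ≤ v' → κ s ≤ κ t := fun s t hst ht =>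
        monotoneOn_of_deriv_nonneg (convex_Iic v')
          (fun x _ => (hκ x).continuousAt.continuousWithinAt)
          (fun x _ => (hκ x).differentiableAt.differentiableWithinAt) (fun x hx => by
            rw [(hκ x).deriv]; exact hk x (hθ0 x (mem_Iic.1 (interior_subset hx)))) (hst.trans ht) ht hst
      have hκc : Continuous κ := continuous_iff_continuousAt.2 fun t => (hκ t).continuousAt
      have hPy : ∀ t, HasDerivAt (fun t => P t * y t) (k t * Λ t) t := fun t => by
        refine ((hP t).mul (hy t)).congr_deriv ?_
        rw [← hPk]; ring
      have hκΛ : ∀ c t, HasDerivAt (fun t => P t * y t - (κ t + c) * Λ t) (-(κ t + c) * w t) t :=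
        fun c t => by
          refine ((hPy t).sub (((hκ t).add_const c).mul (hΛ t))).congr_deriv ?_
          ring
      -- boundedness of `P y` near `-∞`
      have hA : ∃ m, ∀ t ≤ v', m ≤ P t * y t := by
        by_cases hκ0 : ∃ v'' ≤ v', κ v'' ≤ 0
        · obtain ⟨v'', hv'', hκv⟩ := hκ0
          have hκneg : ∀ t ≤ v'', κ t ≤ 0 := fun t ht => (hκm t v'' ht hv'').trans hκv
          obtain ⟨K, hK⟩ := hint
          have hκΛb : ∀ t ≤ v'', -κ t * Λ t ≤ K := by
            intro t ht
            have h1 : ∀ᶠ s in atBot, -κ t * (Λ t - Λ s) ≤ K := by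
              filter_upwards [eventually_le_atBot t] with s hs
              have e1 := intervalIntegral.integral_eq_sub_of_hasDerivAt (a := s) (b := t)
                (fun x _ => hΛ x) (hwc.intervalIntegrable _ _)
              rw [← e1, ← intervalIntegral.integral_const_mul]
              refine le_trans ?_ (hK t ((ht.trans hv'').trans hv') (fun x hx => hκneg x (hx.trans ht)) s hs)
              refine intervalIntegral.integral_mono_on hs
                (Continuous.intervalIntegrable (by fun_prop) _ _)
                (Continuous.intervalIntegrable (by fun_prop) _ _) fun x hx => ?_
              have := hκm x t hx.2 (ht.trans hv'')
              exact mul_le_mul_of_nonneg_right (by linarith) (hw x).le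
            have h2 : Tendsto (fun s => -κ t * (Λ t - Λ s)) atBot (𝓝 (-κ t * (Λ t - 0))) :=
              (tendsto_const_nhds.sub hΛlim).const_mul _
            rw [sub_zero] at h2
            exact le_of_tendsto h2 h1
          have h3 : ∀ t ≤ v'', P v'' * y v'' - κ v'' * Λ v'' - 2 * K ≤ P t * y t := by
            intro t ht
            have hd := hκΛ 0
            simp only [add_zero] at hd
            have e1 := intervalIntegral.integral_eq_sub_of_hasDerivAt (a := t) (b := v'')
              (fun x _ => hd x) (Continuous.intervalIntegrable (by fun_prop) _ _)
            have e2 := hK v'' (hv''.trans hv') hκneg t ht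
            have e3 := hκΛb t ht
            rw [e1] at e2
            linarith
          refine ⟨min (P v'' * y v'' - κ v'' * Λ v'' - 2 * K) (P v'' * y v''), fun t ht => ?_⟩
          rcases le_total t v'' with h | h
          · exact (min_le_left _ _).trans (h3 t h)
          · refine (min_le_right _ _).trans ?_
            refine monotoneOn_of_deriv_nonneg (convex_Iic v')
              (fun x _ => (hPy x).continuousAt.continuousWithinAt)
              (fun x _ => (hPy x).differentiableAt.differentiableWithinAt) (fun x hx => ?_)
              hv'' ht h
            rw [(hPy x).deriv]
            exact mul_nonneg (hk x (hθ0 x (mem_Iic.1 (interior_subset hx)))) (hΛ0 x).le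
        · push Not at hκ0
          refine ⟨P v' * y v' - κ v' * Λ v', fun t ht => ?_⟩
          have hd := hκΛ 0
          simp only [add_zero] at hd
          have := antitoneOn_of_deriv_nonpos (convex_Iic v')
              (fun x _ => (hd x).continuousAt.continuousWithinAt)
              (fun x _ => (hd x).differentiableAt.differentiableWithinAt) (fun x hx => by
                rw [(hd x).deriv]
                have := (hκ0 x (mem_Iic.1 (interior_subset hx))).le
                have := (hw x).le
                nlinarith) ht self_mem_Iic ht
          have h2 := mul_nonneg (hκ0 t ht).le (hΛ0 t).le
          simp only at this
          linarith
      obtain ⟨m, hm⟩ := hA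
      -- otherwise `P θ ≥ 1` near `-∞`, and the logarithm of `P` is bounded by `P y`
      by_contra hcon
      push Not at hcon
      obtain ⟨t₁, ht₁, hDt₁⟩ := hcon (m - 1)
      obtain ⟨t₁, ht₁', hDt₁⟩ : ∃ t₁ ≤ v', D t₁ < m - 1 :=
        ⟨min t₁ v', min_le_right _ _, (hDmono _ _ (min_le_left _ _) ht₁).trans_lt hDt₁⟩
      have hbig : ∀ t ≤ t₁, 1 ≤ P t * θ t := fun t ht => by
        have e1 := hDmono t t₁ ht (ht₁'.trans hv')
        have e2 := hm t (ht.trans ht₁')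
        simp only [D] at e1 hDt₁
        linarith
      have hlog : ∀ t, HasDerivAt (fun t => P t * y t - Real.log (P t))
          (k t * Λ t - ρ t) t := fun t => by
        refine ((hPy t).sub ((hP t).log (hP0 t).ne')).congr_deriv ?_
        rw [mul_div_assoc, div_self (hP0 t).ne', mul_one]
      have hmono : ∀ t ≤ t₁, P t * y t - Real.log (P t) ≤ P t₁ * y t₁ - Real.log (P t₁) :=
        fun t ht => monotoneOn_of_deriv_nonneg (convex_Iic t₁)
              (fun x _ => (hlog x).continuousAt.continuousWithinAt)
              (fun x _ => (hlog x).differentiableAt.differentiableWithinAt) (fun x hx => by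
                rw [(hlog x).deriv, ← hPk]
                have := hbig x (mem_Iic.1 (interior_subset hx))
                have := hρ0 x
                nlinarith) ht self_mem_Iic ht
      have hloglim : Tendsto (fun t => Real.log (P t)) atBot atBot :=
        Real.tendsto_log_nhdsGT_zero.comp (tendsto_nhdsWithin_iff.2
          ⟨hPlim, Eventually.of_forall hP0⟩)
      obtain ⟨t, ht, ht'⟩ := ((hloglim.eventually_lt_atBot
        (m - (P t₁ * y t₁ - Real.log (P t₁)))).and (eventually_le_atBot t₁)).exists
      have e1 := hmono t ht'
      have e2 := hm t (ht'.trans ht₁')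
      linarith
  -- the limit of `D` at `-∞`
  obtain ⟨m, hm⟩ := hbdd
  let D' : ℝ → ℝ := fun t => D (min t v)
  have hD'mono : Monotone D' := fun s t hst =>
    hDmono _ _ (min_le_min_right v hst) (min_le_right _ _)
  have hD'lim := tendsto_atBot_ciInf hD'mono ⟨m, by rintro _ ⟨t, rfl⟩; exact hm _ (min_le_right _ _)⟩
  set L := ⨅ t, D' t with hL
  have hDL : Tendsto D atBot (𝓝 L) := hD'lim.congr'
    ((eventually_le_atBot v).mono fun t ht => by simp only [D', min_eq_left ht])
  have hLle : ∀ t ≤ v, L ≤ D t := fun t ht =>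
    le_of_tendsto hDL ((eventually_le_atBot t).mono fun s hs => hDmono s t hs ht)
  have hmul : ∀ t, P t * Real.exp (-∫ x in v..t, ρ x) = P v := fun t => by
    rw [hPe v t, Real.exp_neg]; field_simp
  refine ⟨fun t => y t + -L / P v * Real.exp (-∫ x in v..t, ρ x), hy.add_exp hρ v _, ?_, ?_⟩
  · intro t ht
    obtain ⟨s, hst, hs⟩ := hne t ht
    have h1 := hDstep s t hst.le ht
    have h2 := hLle s (hst.le.trans ht)
    have h3 := mul_pos (hP0 s) (sub_pos.2 hs)
    have h4 : 0 < P t * (y t + -L / P v * Real.exp (-∫ x in v..t, ρ x) - θ t) := by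
      have : P t * (y t + -L / P v * Real.exp (-∫ x in v..t, ρ x) - θ t) = D t - L := by
        simp only [D]
        have e := hmul t
        have e' := (hP0 v).ne'
        have : P t * (-L / P v * Real.exp (-∫ x in v..t, ρ x)) = -L := by
          rw [show P t * (-L / P v * Real.exp (-∫ x in v..t, ρ x)) =
            -L / P v * (P t * Real.exp (-∫ x in v..t, ρ x)) by ring, e]
          field_simp
        linarith
      rw [this]; linarith
    have := (mul_pos_iff_of_pos_left (hP0 t)).1 h4
    linarith
  · intro t
    have h1 : Tendsto (fun s => (D s - L) / P t) atBot (𝓝 ((L - L) / P t)) :=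
      (hDL.sub_const L).div_const _
    rw [sub_self, zero_div] at h1
    refine h1.congr fun s => ?_
    have e1 : Real.exp (-∫ x in s..t, ρ x) = P s / P t := by
      rw [hPe s t, Real.exp_neg]; have := (hP0 s).ne'; field_simp
    have e := hmul s
    have e' := (hP0 v).ne'
    rw [e1]
    have : P s * (-L / P v * Real.exp (-∫ x in v..s, ρ x)) = -L := by
      rw [show P s * (-L / P v * Real.exp (-∫ x in v..s, ρ x)) =
        -L / P v * (P s * Real.exp (-∫ x in v..s, ρ x)) by ring, e]
      field_simp
    rw [div_mul_eq_mul_div]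
    congr 1
    simp only [D]
    linarith

end IsRelaxation

end
end BellmanFoliation

namespace BellmanFoliation
noncomputable section

/-! ### Tangents coming from infinity -/

namespace AdmissibleFamily

variable {εmax : EReal} {G : ℝ → ℝ → ℝ × ℝ} (hG : AdmissibleFamily εmax G)
include hG

section FixedParameter

variable {ε : ℝ} (hε : ε ∈ paramSet εmax) (h0 : 0 < ε)
include hε h0

lemma lam_mul (σ : Side) (t : ℝ) :
    HasDerivAt (fun t => (tpt G ε σ t).1) (lam G ε σ t * ((G 0 t).1 - (tpt G ε σ t).1)) t := by
  have hp := hG.isTangentPair hε h0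
  have hd : HasDerivAt (tpt G ε σ) (deriv (tpt G ε σ) t) t := by
    rw [funext (hG.tpt_eq hε σ)]
    exact ((hp.inner.differentiable _).comp t
      (hp.hasDerivAt_tangency σ t).differentiableAt).hasDerivAt
  have hne : (G 0 t).1 - (tpt G ε σ t).1 ≠ 0 := by
    rw [hG.tpt_eq hε]; exact hp.tangency_fst_ne σ t
  rw [lam, div_mul_cancel₀ _ hne]
  exact hd.fst

lemma continuous_lam (σ : Side) : Continuous (lam G ε σ) := by
  have hp := hG.isTangentPair hε h0
  have hc : Continuous fun t => tanPar (G ε) σ (G 0 t) := hp.continuous_tangency σ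
  have h1 : lam G ε σ = fun t => (deriv (G ε) (tanPar (G ε) σ (G 0 t))).1 *
      ((deriv (G 0) t).1 * (curveSlope (G 0) t - curveSlope (G ε) (tanPar (G ε) σ (G 0 t))) /
      (deriv (curveSlope (G ε)) (tanPar (G ε) σ (G 0 t)) *
        ((G 0 t).1 - (G ε (tanPar (G ε) σ (G 0 t))).1))) /
      ((G 0 t).1 - (G ε (tanPar (G ε) σ (G 0 t))).1) := by
    ext t
    have h2 := hG.lam_mul hε h0 σ t
    simp only [hG.tpt_eq hε] at h2
    rw [eq_div_iff (hp.tangency_fst_ne σ t)]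
    exact h2.unique (hp.hasDerivAt_tangency_fst σ t)
  rw [h1]
  have hd : Continuous fun t => (G 0 t).1 - (G ε (tanPar (G ε) σ (G 0 t))).1 :=
    hp.outer.continuous_fst.sub (hp.continuous_tangency_fst σ)
  refine Continuous.div ((hp.inner.continuous_deriv_fst.comp hc).mul (Continuous.div
    (hp.outer.continuous_deriv_fst.mul (hp.outer.continuous_curveSlope.sub
      (hp.continuous_tangency_slope σ)))
    ((hp.inner.continuous_deriv_curveSlope.comp hc).mul hd) fun t => ?_)) hd
    (hp.tangency_fst_ne σ)
  exact mul_ne_zero (hp.inner.deriv_curveSlope_pos _).ne' (hp.tangency_fst_ne σ t)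

/-- Exponential of the integral of `lam`. -/
lemma hasDerivAt_tangentLength (σ : Side) (v t : ℝ) :
    HasDerivAt (fun t => ((G 0 t).1 - (tpt G ε σ t).1) * Real.exp (∫ x in v..t, lam G ε σ x))
      ((deriv (G 0) t).1 * Real.exp (∫ x in v..t, lam G ε σ x)) t := by
  refine ((((hG.isConvexCurve hG.zero_mem).hasDerivAt_fst t).sub (hG.lam_mul hε h0 σ t)).mul
    (hasDerivAt_exp_integral (hG.continuous_lam hε h0 σ) v t)).congr_deriv ?_
  simp only [Pi.sub_apply]
  ring

/-- An integrating factor of the relaxation equation in terms of `lam`. -/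
lemma hasDerivAt_integratingFactor (σ : Side) (v t : ℝ) :
    HasDerivAt (fun t => (kap2 G t - slope G ε σ t) *
      (((G 0 t).1 - (tpt G ε σ t).1) * Real.exp (∫ x in v..t, lam G ε σ x)))
      (rate G ε σ t * ((kap2 G t - slope G ε σ t) *
      (((G 0 t).1 - (tpt G ε σ t).1) * Real.exp (∫ x in v..t, lam G ε σ x)))) t := by
  have hp := hG.isTangentPair hε h0
  have hs := hp.hasDerivAt_tangency_slope σ t
  rw [← funext (hG.slope_eq hε h0 σ)] at hs
  have hk : HasDerivAt (kap2 G) (deriv (curveSlope (G 0)) t) t := hp.outer.hasDerivAt_curveSlope t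
  refine ((hk.sub hs).mul (hG.hasDerivAt_tangentLength hε h0 σ v t)).congr_deriv ?_
  have h1 := hG.rate_mul hε h0 σ t
  have h2 := hp.tangency_fst_ne σ t
  rw [kap2_eq] at h1 ⊢
  rw [← mul_assoc (rate G ε σ t), h1]
  simp only [Pi.sub_apply, hG.tpt_eq hε, hG.slope_eq hε h0]
  field_simp
  ring

lemma tangentLength_mul_pos (σ : Side) (t : ℝ) :
    0 < (kap2 G t - slope G ε σ t) * ((G 0 t).1 - (tpt G ε σ t).1) := by
  rw [hG.slope_eq hε h0, hG.tpt_eq hε]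
  exact (hG.isTangentPair hε h0).slope_mul_pos σ t

omit hG hε h0 in
lemma norm_tangentLength_le (σ : Side) (v t : ℝ) :
    ‖((G 0 t).1 - (tpt G ε σ t).1) * Real.exp (∫ x in v..t, lam G ε σ x)‖ ≤
      (1 + ‖tpt G ε σ t - G 0 t‖) * Real.exp (∫ x in v..t, lam G ε σ x) := by
  rw [norm_mul, Real.norm_of_nonneg (Real.exp_pos _).le]
  refine mul_le_mul_of_nonneg_right ?_ (Real.exp_pos _).le
  have := norm_fst_le (tpt G ε σ t - G 0 t)
  rw [Prod.fst_sub, ← norm_neg, neg_sub] at this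
  linarith

lemma norm_integratingFactor_le (σ : Side) (v t : ℝ)
    (h : 0 ≤ (kap2 G v - kap2 G t) * ((G 0 t).1 - (tpt G ε σ t).1)) :
    ‖(kap2 G t - slope G ε σ t) *
      (((G 0 t).1 - (tpt G ε σ t).1) * Real.exp (∫ x in v..t, lam G ε σ x))‖ ≤
      (|kap2 G v| + 1) * ((1 + ‖tpt G ε σ t - G 0 t‖) * Real.exp (∫ x in v..t, lam G ε σ x)) := by
  have hE := Real.exp_pos (∫ x in v..t, lam G ε σ x)
  rw [← mul_assoc, ← mul_assoc, Real.norm_of_nonneg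
    (mul_pos (hG.tangentLength_mul_pos hε h0 σ t) hE).le]
  refine mul_le_mul_of_nonneg_right ?_ hE.le
  have h1 := norm_fst_le (tpt G ε σ t - G 0 t)
  have h2 := norm_snd_le (tpt G ε σ t - G 0 t)
  rw [Prod.fst_sub, Real.norm_eq_abs, abs_sub_comm] at h1
  rw [Prod.snd_sub, Real.norm_eq_abs, abs_sub_comm] at h2
  have h3 : slope G ε σ t * ((G 0 t).1 - (tpt G ε σ t).1) = (G 0 t).2 - (tpt G ε σ t).2 := by
    rw [hG.slope_eq hε h0, hG.tpt_eq hε, (hG.isTangentPair hε h0).tangency_snd]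
  have h4 : kap2 G v * ((G 0 t).1 - (tpt G ε σ t).1) ≤ |kap2 G v| * ‖tpt G ε σ t - G 0 t‖ := by
    refine (le_abs_self _).trans ?_
    rw [abs_mul]
    exact mul_le_mul_of_nonneg_left h1 (abs_nonneg _)
  have h5 := neg_abs_le ((G 0 t).2 - (tpt G ε σ t).2)
  nlinarith [abs_nonneg (kap2 G v)]

lemma continuous_exp_lam (σ : Side) (v : ℝ) :
    Continuous fun t => Real.exp (∫ x in v..t, lam G ε σ x) :=
  continuous_iff_continuousAt.2 fun t =>
    (hasDerivAt_exp_integral (hG.continuous_lam hε h0 σ) v t).continuousAt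

omit hG hε h0 in
lemma integral_le_of_lintegral {φ : ℝ → ℝ} (hφ : Continuous φ) {S : Set ℝ}
    (hS : ∫⁻ t in S, ENNReal.ofReal (φ t) < ⊤) {a b : ℝ} (hab : a ≤ b) (hsub : Icc a b ⊆ S)
    (hpos : ∀ t ∈ Icc a b, 0 ≤ φ t) :
    ∫ t in a..b, φ t ≤ (∫⁻ t in S, ENNReal.ofReal (φ t)).toReal := by
  rw [intervalIntegral.integral_of_le hab, integral_eq_lintegral_of_nonneg_ae
    ((ae_restrict_mem measurableSet_Ioc).mono fun t ht => hpos t ⟨ht.1.le, ht.2⟩)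
    hφ.aestronglyMeasurable]
  exact ENNReal.toReal_mono hS.ne (lintegral_mono_set (Ioc_subset_Icc_self.trans hsub))

/-- The integrating factor is `(κ₂ - κ) Λ`, where `Λ` is the horizontal length of the tangent times
the exponential of `∫ λ`. Both tend to zero by the decay condition of the family, and the
summability condition bounds the integral of `κ₃ Λ'`, because `κ₃ g₁' = f'`. -/
lemma exists_relaxation_from_bot {f : ℝ → ℝ} (hf : BoundaryData G f)
    (hsum : SummabilityCondition εmax G f) {v : ℝ} (hanti : AntitoneOn (tors G f) (Iic v))
    (hne : ∀ t ≤ v, ∃ s < t, tors G f t < tors G f s) :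
    ∃ β, IsRelaxation (rate G ε Side.R) (tors G f) β ∧ (∀ t ≤ v, tors G f t < β t) ∧
      ∀ t, Tendsto (fun s => Real.exp (-∫ x in s..t, rate G ε Side.R x) * (β s - tors G f s))
        atBot (𝓝 0) := by
  have hp := hG.isTangentPair hε h0
  have hsymm : ∀ t, Real.exp (-∫ x in t..v, lam G ε Side.R x) =
      Real.exp (∫ x in v..t, lam G ε Side.R x) := fun t => by
    rw [intervalIntegral.integral_symm t v]
  have hdecay := hG.decay_right ε hε h0 v
  simp only [hsymm] at hdecay
  have hpos : ∀ t, 0 < (G 0 t).1 - (tpt G ε Side.R t).1 := fun t => by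
    rw [hG.tpt_eq hε]; exact sub_pos.2 (hp.tangency_R_lt t)
  refine IsRelaxation.exists_from_bot (hG.continuous_rate hε h0 _) (hG.rate_R_pos hε h0)
    hf.continuous_tors hanti hne (hG.hasDerivAt_integratingFactor hε h0 Side.R v)
    (fun t => ?_) (squeeze_zero_norm' (a := fun t => (|kap2 G v| + 1) *
      ((1 + ‖tpt G ε Side.R t - G 0 t‖) * Real.exp (∫ x in v..t, lam G ε Side.R x))) ?_ ?_)
    (hG.hasDerivAt_tangentLength hε h0 Side.R v)
    (fun t => mul_pos (hf.curve.pos t) (Real.exp_pos _))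
    (hf.curve.continuous_deriv_fst.mul (hG.continuous_exp_lam hε h0 _ v))
    (squeeze_zero_norm (norm_tangentLength_le Side.R v) hdecay)
    hf.hasDerivAt_kap3 (fun t ht => mul_nonneg ht (hf.deriv_kap2_pos t).le) (fun t => ?_) ?_
  · rw [← mul_assoc]; exact mul_pos (hG.tangentLength_mul_pos hε h0 _ t) (Real.exp_pos _)
  · filter_upwards [eventually_le_atBot v] with t ht
    exact hG.norm_integratingFactor_le hε h0 _ v t
      (mul_nonneg (sub_nonneg.2 (hf.strictMono_kap2.monotone ht)) (hpos t).le)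
  · simpa using hdecay.const_mul (|kap2 G v| + 1)
  · rw [← mul_assoc, hG.rate_mul hε h0]; ring
  · have hs := (hsum ε hε h0 v).1
    simp only [hsymm] at hs
    refine ⟨_, fun b hb hκ a hab => le_trans (le_of_eq ?_) (integral_le_of_lintegral
      (φ := fun t => -(deriv f t * Real.exp (∫ x in v..t, lam G ε Side.R x))) ?_ hs hab
      (fun t ht => ht.2.trans hb) fun t ht => ?_)⟩
    · congr 1; ext t; rw [hf.deriv_eq]; ring
    · exact (hf.continuous_deriv.mul (hG.continuous_exp_lam hε h0 _ v)).neg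
    · rw [neg_nonneg, hf.deriv_eq]
      exact mul_nonpos_of_nonpos_of_nonneg (mul_nonpos_of_nonpos_of_nonneg (hκ t ht.2)
        (hf.curve.pos t).le) (Real.exp_pos _).le

/-- The reflection `t ↦ -t` exchanges the left and the right tangents. -/
lemma exists_relaxation_from_top {f : ℝ → ℝ} (hf : BoundaryData G f)
    (hsum : SummabilityCondition εmax G f) {v : ℝ} (hmono : MonotoneOn (tors G f) (Ici v))
    (hne : ∀ t ≥ v, ∃ s > t, tors G f t < tors G f s) :
    ∃ β, IsRelaxation (rate G ε Side.L) (tors G f) β ∧ (∀ t ≥ v, tors G f t < β t) ∧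
      ∀ t, Tendsto (fun s => Real.exp (-∫ x in s..t, rate G ε Side.L x) * (β s - tors G f s))
        atTop (𝓝 0) := by
  have hp := hG.isTangentPair hε h0
  have hdecay := hG.decay_left ε hε h0 v
  have hneg : ∀ t, (G 0 t).1 - (tpt G ε Side.L t).1 < 0 := fun t => by
    rw [hG.tpt_eq hε]; exact sub_neg.2 (hp.lt_tangency_L t)
  have refl : ∀ {F F' : ℝ → ℝ}, (∀ t, HasDerivAt F (F' t) t) →
      ∀ t, HasDerivAt (fun t => F (-t)) (-F' (-t)) t := fun h t => by
    refine ((h (-t)).comp t (hasDerivAt_neg t)).congr_deriv ?_; ring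
  obtain ⟨β, h1, h2, h3⟩ := IsRelaxation.exists_from_bot
    (ρ := fun t => -rate G ε Side.L (-t)) (θ := fun t => tors G f (-t)) (v := -v)
    (w := fun t => (deriv (G 0) (-t)).1 * Real.exp (∫ x in v..(-t), lam G ε Side.L x))
    (P := fun t => (kap2 G (-t) - slope G ε Side.L (-t)) *
      (((G 0 (-t)).1 - (tpt G ε Side.L (-t)).1) * Real.exp (∫ x in v..(-t), lam G ε Side.L x)))
    (Λ := fun t => -(((G 0 (-t)).1 - (tpt G ε Side.L (-t)).1) *
      Real.exp (∫ x in v..(-t), lam G ε Side.L x)))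
    (κ := fun t => -kap3 G f (-t)) (k := fun t => tors G f (-t) * deriv (kap2 G) (-t))
    ((hG.continuous_rate hε h0 _).comp continuous_neg).neg
    (fun t => neg_pos.2 (hG.rate_L_neg hε h0 _))
    (hf.continuous_tors.comp continuous_neg)
    (fun s hs t ht hst => hmono (mem_Ici.2 (by linarith [mem_Iic.1 ht]))
      (mem_Ici.2 (by linarith [mem_Iic.1 hs])) (by linarith))
    (fun t ht => by
      obtain ⟨s, hs, hs'⟩ := hne (-t) (by linarith)
      exact ⟨-s, by linarith, by simpa using hs'⟩)
    (fun t => ((refl (hG.hasDerivAt_integratingFactor hε h0 Side.L v)) t).congr_deriv (by ring))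
    (fun t => by
      rw [← mul_assoc]; exact mul_pos (hG.tangentLength_mul_pos hε h0 _ _) (Real.exp_pos _))
    (squeeze_zero_norm' (a := fun t => (|kap2 G v| + 1) *
      ((1 + ‖tpt G ε Side.L (-t) - G 0 (-t)‖) * Real.exp (∫ x in v..(-t), lam G ε Side.L x)))
      (by
        filter_upwards [eventually_le_atBot (-v)] with t ht
        exact hG.norm_integratingFactor_le hε h0 _ v (-t)
          (mul_nonneg_of_nonpos_of_nonpos
            (sub_nonpos.2 (hf.strictMono_kap2.monotone (by linarith))) (hneg _).le))
      (by simpa using (hdecay.comp tendsto_neg_atBot_atTop).const_mul (|kap2 G v| + 1)))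
    (fun t => ((refl (hG.hasDerivAt_tangentLength hε h0 Side.L v)) t).neg.congr_deriv (by ring))
    (fun t => mul_pos (hf.curve.pos _) (Real.exp_pos _))
    ((hf.curve.continuous_deriv_fst.mul (hG.continuous_exp_lam hε h0 _ v)).comp continuous_neg)
    (squeeze_zero_norm (fun t => by
      rw [norm_neg]; exact norm_tangentLength_le Side.L v (-t))
      (hdecay.comp tendsto_neg_atBot_atTop))
    (fun t => (refl hf.hasDerivAt_kap3 t).neg.congr_deriv (by ring))
    (fun t ht => mul_nonneg ht (hf.deriv_kap2_pos _).le)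
    (fun t => by
      have := hG.rate_mul hε h0 Side.L (-t)
      rw [← this]; ring)
    (by
      have hs := (hsum ε hε h0 v).2
      refine ⟨(∫⁻ τ in Ici v, ENNReal.ofReal
        (deriv f τ * Real.exp (∫ s in v..τ, lam G ε Side.L s))).toReal,
        fun b hb hκ a hab => le_trans (le_of_eq ?_) (integral_le_of_lintegral
        (φ := fun t => deriv f t * Real.exp (∫ x in v..t, lam G ε Side.L x)) (a := -b) (b := -a)
        (hf.continuous_deriv.mul (hG.continuous_exp_lam hε h0 _ v)) hs (by linarith)
        (fun t ht => by have := ht.1; exact mem_Ici.2 (by linarith)) fun t ht => ?_)⟩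
      · rw [← intervalIntegral.integral_comp_neg]
        congr 1; ext t; rw [hf.deriv_eq]; ring
      · rw [hf.deriv_eq]
        have := hκ (-t) (by linarith [ht.1])
        rw [neg_neg] at this
        exact mul_nonneg (mul_nonneg (by linarith) (hf.curve.pos t).le) (Real.exp_pos _).le)
  refine ⟨fun t => β (-t), ?_, fun t ht => ?_, fun t => ?_⟩
  · have := h1.reflect
    simpa only [neg_neg] using this
  · have := h2 (-t) (by linarith)
    simpa only [neg_neg] using this
  · have := (h3 (-t)).comp tendsto_neg_atTop_atBot
    refine this.congr fun s => ?_
    simp only [Function.comp, neg_neg]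
    congr 3
    rw [intervalIntegral.integral_neg, intervalIntegral.integral_comp_neg (fun x => rate G ε Side.L x),
      neg_neg, neg_neg, intervalIntegral.integral_symm, neg_neg]

omit h0 in
/-- Points of the curves with larger parameters lie above the tangents. -/
lemma gap_nonneg_of_lt {ε' : ℝ} (hε' : ε' ∈ paramSet εmax) (hlt : ε < ε') (s s' : ℝ) :
    0 ≤ gap (G ε) (G ε' s') s := by
  refine le_of_forall_pos_le_add fun δ hδ => ?_
  obtain ⟨r, h1, h2⟩ := hG.nested ε hε ε' hε' hlt
    (show ((G ε' s').1, (G ε' s').2 + δ) ∈ Xi G ε' from ⟨s', rfl, by simpa using hδ⟩)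
  have h3 := (hG.isConvexCurve hε).gap_nonneg s r
  simp only at h1 h2
  simp only [gap, ← h1] at h3 ⊢
  linarith

lemma slope_monotone_param {ε' : ℝ} (hε' : ε' ∈ paramSet εmax) (hlt : ε < ε') (σ : Side) (t : ℝ) :
    0 ≤ (slope G ε' σ t - slope G ε σ t) * ((tpt G ε' σ t).1 - (G 0 t).1) := by
  have h0' := h0.trans hlt
  have h1 := hG.gap_nonneg_of_lt hε hε' hlt (tanPar (G ε) σ (G 0 t)) (tanPar (G ε') σ (G 0 t))
  rw [(hG.isTangentPair hε h0).gap_eq_of_tangency, ← hG.slope_eq hε h0] at h1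
  have h2 := (hG.isTangentPair hε' h0').tangency_snd σ t
  rw [← hG.slope_eq hε' h0'] at h2
  rw [hG.tpt_eq hε']
  linarith

lemma rate_R_le {ε' : ℝ} (hε' : ε' ∈ paramSet εmax) (hlt : ε < ε') (t : ℝ) :
    rate G ε' Side.R t ≤ rate G ε Side.R t := by
  have h1 := hG.slope_monotone_param hε h0 hε' hlt Side.R t
  have h2 := hG.slope_R_lt hε h0 t
  have h3 : (tpt G ε' Side.R t).1 - (G 0 t).1 < 0 := by
    rw [hG.tpt_eq hε']; exact sub_neg.2 ((hG.isTangentPair hε' (h0.trans hlt)).tangency_R_lt t)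
  have h4 : slope G ε' Side.R t ≤ slope G ε Side.R t := by
    by_contra hcon
    nlinarith
  exact div_le_div_of_nonneg_left
    ((hG.isConvexCurve hG.zero_mem).deriv_curveSlope_pos t).le (by linarith) (by linarith)

lemma rate_L_ge {ε' : ℝ} (hε' : ε' ∈ paramSet εmax) (hlt : ε < ε') (t : ℝ) :
    rate G ε Side.L t ≤ rate G ε' Side.L t := by
  have h1 := hG.slope_monotone_param hε h0 hε' hlt Side.L t
  have h2 := hG.lt_slope_L hε h0 t
  have h3 : 0 < (tpt G ε' Side.L t).1 - (G 0 t).1 := by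
    rw [hG.tpt_eq hε']; exact sub_pos.2 ((hG.isTangentPair hε' (h0.trans hlt)).lt_tangency_L t)
  have h4 : slope G ε Side.L t ≤ slope G ε' Side.L t := by
    by_contra hcon
    nlinarith
  have h5 := div_le_div_of_nonneg_left
    ((hG.isConvexCurve hG.zero_mem).deriv_curveSlope_pos t).le (sub_pos.2 h2)
    (sub_le_sub_right h4 (kap2 G t))
  have e : ∀ e : ℝ, rate G e Side.L t = -(deriv (kap2 G) t / (slope G e Side.L t - kap2 G t)) :=
    fun e => by rw [rate, ← div_neg, neg_sub]
  rw [e, e]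
  exact neg_le_neg h5

end FixedParameter

/-! ### Short tangents for small values of the parameter -/

lemma eventually_mem : ∀ᶠ ε : ℝ in 𝓝[>] 0, ε ∈ paramSet εmax ∧ 0 < ε := by
  have h1 : ∃ a : ℝ, 0 < a ∧ (a : EReal) ≤ εmax := by
    obtain ⟨a, ha, ha'⟩ := EReal.lt_iff_exists_real_btwn.1 hG.εmax_pos
    exact ⟨a, by exact_mod_cast ha, ha'.le⟩
  obtain ⟨a, ha, ha'⟩ := h1
  filter_upwards [Ioo_mem_nhdsGT ha] with ε hε
  exact ⟨⟨hε.1.le, (EReal.coe_lt_coe_iff.2 hε.2).trans_le ha'⟩, hε.1⟩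

/-- For small values of the parameter the tangents from the fixed boundary are nearly tangent to it,
uniformly on compact sets. -/
lemma eventually_slope_near (σ : Side) {a b η : ℝ} (hη : 0 < η) :
    ∀ᶠ ε : ℝ in 𝓝[>] 0, ∀ t ∈ Icc a b, |slope G ε σ t - kap2 G t| < η := by
  have hc := hG.isConvexCurve hG.zero_mem
  -- a small shift towards the tangency point
  obtain ⟨δ, hδ0, hδ⟩ : ∃ δ : ℝ, (match σ with | Side.R => δ < 0 | Side.L => 0 < δ) ∧
      ∀ t ∈ Icc a b, |kap2 G (t + δ) - kap2 G t| < η := by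
    have hu : UniformContinuousOn (kap2 G) (Icc (a - 1) (b + 1)) :=
      isCompact_Icc.uniformContinuousOn_of_continuous hc.continuous_curveSlope.continuousOn
    obtain ⟨d, hd, hd'⟩ := Metric.uniformContinuousOn_iff.1 hu η hη
    have hm : 0 < min (d / 2) 1 := by positivity
    have hm1 : min (d / 2) 1 < d := (min_le_left _ _).trans_lt (by linarith)
    have hm2 : min (d / 2) 1 ≤ 1 := min_le_right _ _
    cases σ
    · refine ⟨-min (d / 2) 1, by simpa using hm, fun t ht => ?_⟩
      refine hd' _ ⟨?_, ?_⟩ _ ⟨?_, ?_⟩ ?_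
      any_goals linarith [ht.1, ht.2]
      rw [Real.dist_eq, add_sub_cancel_left, abs_neg, abs_of_pos hm]; exact hm1
    · refine ⟨min (d / 2) 1, hm, fun t ht => ?_⟩
      refine hd' _ ⟨?_, ?_⟩ _ ⟨?_, ?_⟩ ?_
      any_goals linarith [ht.1, ht.2]
      rw [Real.dist_eq, add_sub_cancel_left, abs_of_pos hm]; exact hm1
  set sg : ℝ := (match σ with | Side.R => -1 | Side.L => 1) with hsg
  have hδs : 0 < sg * δ := by cases σ <;> simp only [hsg] at hδ0 ⊢ <;> linarith
  -- the point `G ε (t + δ)` is below the line of slope `kap2 t ± η` through `G 0 t`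
  have hcont : ∀ t ∈ Icc a b, ∀ᶠ p : ℝ × ℝ in 𝓝 (0, t), p.1 ∈ paramSet εmax →
      0 < sg * ((G p.1 (p.2 + δ)).1 - (G 0 p.2).1) ∧
      (G p.1 (p.2 + δ)).2 - (G 0 p.2).2 -
        (kap2 G p.2 + sg * η) * ((G p.1 (p.2 + δ)).1 - (G 0 p.2).1) < 0 := by
    intro t ht
    have hk := hG.continuous_deriv 0 (by norm_num)
    simp only [iteratedDeriv_zero] at hk
    have hsh : ContinuousOn (fun p : ℝ × ℝ => G p.1 (p.2 + δ)) (paramSet εmax ×ˢ univ) :=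
      hk.comp (f := fun p : ℝ × ℝ => (p.1, p.2 + δ)) (by fun_prop) fun p hp => ⟨hp.1, mem_univ _⟩
    have hmem : ((0 : ℝ), t) ∈ paramSet εmax ×ˢ (univ : Set ℝ) := ⟨hG.zero_mem, mem_univ _⟩
    have hg : Continuous fun p : ℝ × ℝ => G 0 p.2 := hc.continuous.comp continuous_snd
    have hk2 : Continuous fun p : ℝ × ℝ => kap2 G p.2 :=
      hc.continuous_curveSlope.comp continuous_snd
    have c1 : ContinuousOn (fun p : ℝ × ℝ => (G p.1 (p.2 + δ)).1 - (G 0 p.2).1)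
        (paramSet εmax ×ˢ univ) :=
      (continuous_fst.comp_continuousOn hsh).sub hg.fst.continuousOn
    have c2 : ContinuousOn (fun p : ℝ × ℝ => (G p.1 (p.2 + δ)).2 - (G 0 p.2).2 -
        (kap2 G p.2 + sg * η) * ((G p.1 (p.2 + δ)).1 - (G 0 p.2).1)) (paramSet εmax ×ˢ univ) :=
      ((continuous_snd.comp_continuousOn hsh).sub hg.snd.continuousOn).sub
        ((hk2.add continuous_const).continuousOn.mul c1)
    have v1 : 0 < sg * ((G 0 (t + δ)).1 - (G 0 t).1) := by
      cases σ
      · have := hc.fst_lt.2 (show t + δ < t by linarith)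
        simp only [hsg]; linarith
      · have := hc.fst_lt.2 (show t < t + δ by linarith)
        simp only [hsg]; linarith
    have v2 : (G 0 (t + δ)).2 - (G 0 t).2 -
        (kap2 G t + sg * η) * ((G 0 (t + δ)).1 - (G 0 t).1) < 0 := by
      have h1 := hc.gap_nonneg (t + δ) t
      have h2 := abs_lt.1 (hδ t ht)
      rw [gap, ← kap2_eq] at h1
      have h3 : sg * sg = 1 := by cases σ <;> simp [hsg]
      have h4 : 0 < η - sg * (kap2 G (t + δ) - kap2 G t) := by
        cases σ <;> simp only [hsg] <;> linarith
      have h5 := mul_pos h4 v1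
      have h6 : (η - sg * (kap2 G (t + δ) - kap2 G t)) * (sg * ((G 0 (t + δ)).1 - (G 0 t).1)) =
        (sg * η) * ((G 0 (t + δ)).1 - (G 0 t).1) - (sg * sg) *
          ((kap2 G (t + δ) - kap2 G t) * ((G 0 (t + δ)).1 - (G 0 t).1)) := by ring
      rw [h6, h3] at h5
      linarith
    have e1 := ((c1.const_smul sg) _ hmem).eventually (lt_mem_nhds (a := (0 : ℝ)) v1)
    have e2 := (c2 _ hmem).eventually (eventually_lt_nhds (b := (0 : ℝ)) v2)
    rw [eventually_nhdsWithin_iff] at e1 e2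
    filter_upwards [e1, e2] with p hp1 hp2 hp
    exact ⟨by simpa using hp1 ⟨hp, mem_univ _⟩, hp2 ⟨hp, mem_univ _⟩⟩
  have hunif := (isCompact_Icc (a := a) (b := b)).eventually_forall_of_forall_eventually
    (P := fun ε t => ε ∈ paramSet εmax →
      0 < sg * ((G ε (t + δ)).1 - (G 0 t).1) ∧ (G ε (t + δ)).2 - (G 0 t).2 -
        (kap2 G t + sg * η) * ((G ε (t + δ)).1 - (G 0 t).1) < 0) hcont
  filter_upwards [mem_nhdsWithin_of_mem_nhds hunif, hG.eventually_mem] with ε hu ⟨hε, h0⟩ t ht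
  obtain ⟨u1, u2⟩ := hu t ht hε
  have hp := hG.isTangentPair hε h0
  have h1 := hp.inner.gap_nonneg (tanPar (G ε) σ (G 0 t)) (t + δ)
  rw [hp.gap_eq_of_tangency, ← hG.slope_eq hε h0] at h1
  have h2 : 0 < (kap2 G t + sg * η - slope G ε σ t) * ((G ε (t + δ)).1 - (G 0 t).1) := by linarith
  rw [abs_lt]
  cases σ
  · have h3 := hG.slope_R_lt hε h0 t
    simp only [hsg] at u1 h2
    constructor
    · by_contra hcon
      nlinarith
    · linarith
  · have h3 := hG.lt_slope_L hε h0 t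
    simp only [hsg] at u1 h2
    constructor
    · linarith
    · by_contra hcon
      nlinarith

lemma eventually_large_rate (σ : Side) (a b N : ℝ) :
    ∀ᶠ ε : ℝ in 𝓝[>] 0, ∀ t ∈ Icc a b, N ≤ |rate G ε σ t| := by
  have hc := hG.isConvexCurve hG.zero_mem
  rcases lt_or_ge b a with hab | hab
  · exact Eventually.of_forall fun ε t ht => absurd (ht.1.trans ht.2) hab.not_ge
  obtain ⟨t₀, -, hm⟩ := isCompact_Icc.exists_isMinOn (nonempty_Icc.2 hab)
    hc.continuous_deriv_curveSlope.continuousOn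
  have hm0 := hc.deriv_curveSlope_pos t₀
  filter_upwards [hG.eventually_slope_near σ (a := a) (b := b)
    (show 0 < deriv (curveSlope (G 0)) t₀ / (|N| + 1) by positivity), hG.eventually_mem]
    with ε h1 ⟨hε, h0⟩ t ht
  have h2 := h1 t ht
  have h3 : deriv (curveSlope (G 0)) t₀ ≤ deriv (curveSlope (G 0)) t := hm ht
  have h4 := abs_pos.2 (hG.kap2_sub_slope_ne hε h0 σ t)
  rw [abs_sub_comm, lt_div_iff₀ (by positivity)] at h2
  rw [rate, abs_div, le_div_iff₀ h4, kap2_eq, abs_of_pos (hc.deriv_curveSlope_pos t)]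
  rw [kap2_eq] at h2 h4
  nlinarith [le_abs_self N, abs_nonneg N]

/-- The chord over `[a, b]` leaves the strip for small values of the parameter. -/
lemma eventually_tangency_lt {a b : ℝ} (hab : a < b) : ∀ᶠ ε : ℝ in 𝓝[>] 0,
    tanPar (G ε) Side.L (G 0 a) < tanPar (G ε) Side.R (G 0 b) := by
  have hc := hG.isConvexCurve hG.zero_mem
  have hk : kap2 G a < kap2 G b := hc.strictMono_curveSlope hab
  filter_upwards [hG.eventually_slope_near Side.L (a := a) (b := a)
    (show 0 < (kap2 G b - kap2 G a) / 2 by linarith),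
    hG.eventually_slope_near Side.R (a := b) (b := b)
    (show 0 < (kap2 G b - kap2 G a) / 2 by linarith), hG.eventually_mem] with ε h1 h2 ⟨hε, h0⟩
  have h3 := abs_lt.1 (h1 a ⟨le_rfl, le_rfl⟩)
  have h4 := abs_lt.1 (h2 b ⟨le_rfl, le_rfl⟩)
  rw [hG.slope_eq hε h0] at h3 h4
  exact (hG.isConvexCurve hε).strictMono_curveSlope.lt_iff_lt.1 (by linarith)

end AdmissibleFamily

end
end BellmanFoliation

namespace BellmanFoliation
noncomputable section

/-! ### Cups -/

/-- A function with positive derivative wherever it is nonpositive stays negative to the left of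
a nonpositive value. -/
lemma neg_of_deriv_pos_of_nonpos {φ φ' : ℝ → ℝ} {p q : ℝ} (hpq : p < q)
    (hd : ∀ x ∈ Icc p q, HasDerivAt φ (φ' x) x) (hpos : ∀ x ∈ Ioc p q, φ x ≤ 0 → 0 < φ' x)
    (hq : φ q ≤ 0) : φ p < 0 := by
  have hmin : ∀ m ∈ Ioc p q, φ m ≤ 0 → ∃ x ∈ Icc p q, φ x < φ m := by
    intro m hm h0
    have h1 := (hasDerivAt_iff_tendsto_slope.1 (hd m ⟨hm.1.le, hm.2⟩)).eventually
      (lt_mem_nhds (hpos m hm h0))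
    have h2 : ∀ᶠ x in 𝓝[<] m, 0 < _root_.slope φ m x :=
      h1.filter_mono (nhdsWithin_mono _ fun x hx => ne_of_lt hx)
    obtain ⟨x, hx, hxm⟩ := (h2.and (Ioo_mem_nhdsLT hm.1)).exists
    refine ⟨x, ⟨hxm.1.le, hxm.2.le.trans hm.2⟩, ?_⟩
    rw [slope_def_field] at hx
    by_contra hcon
    exact absurd hx (not_lt.2 (div_nonpos_of_nonneg_of_nonpos (by linarith) (by linarith [hxm.2])))
  obtain ⟨m, hm, hmm⟩ := isCompact_Icc.exists_isMinOn (nonempty_Icc.2 hpq.le)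
    (fun x hx => (hd x hx).continuousAt.continuousWithinAt : ContinuousOn φ (Icc p q))
  have hle : ∀ x ∈ Icc p q, φ m ≤ φ x := fun x hx => hmm hx
  have hmq := hle q (right_mem_Icc.2 hpq.le)
  have hmp : m = p := by
    by_contra hne
    obtain ⟨x, hx, hlt⟩ := hmin m ⟨lt_of_le_of_ne hm.1 (Ne.symm hne), hm.2⟩ (hmq.trans hq)
    exact absurd (hle x hx) hlt.not_ge
  obtain ⟨x, hx, hlt⟩ := hmin q ⟨hpq, le_rfl⟩ hq
  have := hle x hx
  rw [hmp] at this
  linarith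

/-- The mirror image of `neg_of_deriv_pos_of_nonpos`. -/
lemma pos_of_deriv_pos_of_nonneg {φ φ' : ℝ → ℝ} {p q : ℝ} (hpq : p < q)
    (hd : ∀ x ∈ Icc p q, HasDerivAt φ (φ' x) x) (hpos : ∀ x ∈ Ico p q, 0 ≤ φ x → 0 < φ' x)
    (hp : 0 ≤ φ p) : 0 < φ q := by
  have := neg_of_deriv_pos_of_nonpos (φ := fun x => -φ (-x)) (φ' := fun x => φ' (-x))
    (neg_lt_neg hpq)
    (fun x hx => (((hd (-x) ⟨by linarith [hx.2], by linarith [hx.1]⟩).comp x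
      (hasDerivAt_neg x)).neg).congr_deriv (by ring))
    (fun x hx h => hpos (-x) ⟨by linarith [hx.2], by linarith [hx.1]⟩ (by linarith))
    (by simpa using hp)
  simpa using this

/-- If `F'` is a positive multiple of `φ`, which vanishes at both ends and grows up to some point and
decreases afterwards, then `F` is nondecreasing; it can be constant only if `θ` is. -/
lemma pos_of_unimodal {F φ θ w v : ℝ → ℝ} {a b r : ℝ} (hab : a < b)
    (hF : ∀ t, HasDerivAt F (w t * φ t) t) (hφ : ∀ t, HasDerivAt φ (v t * (θ t - r)) t)
    (hw : ∀ t, 0 < w t) (hv : ∀ t, 0 < v t) (hθ : Continuous θ) (ha : φ a = 0) (hb : φ b = 0)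
    (h0 : F a = 0)
    (h : ∀ t ∈ Icc a b, (∀ x ∈ Icc a t, r ≤ θ x) ∨ (∀ x ∈ Icc t b, θ x ≤ r))
    (hne : ¬ ConstOn θ (Icc a b)) : 0 < F b := by
  have hφc : Continuous φ := continuous_iff_continuousAt.2 fun t => (hφ t).continuousAt
  have hFc : Continuous F := continuous_iff_continuousAt.2 fun t => (hF t).continuousAt
  have hφ0 : ∀ t ∈ Icc a b, 0 ≤ φ t := by
    intro t ht
    rcases h t ht with h1 | h1
    · rw [← ha]
      refine monotoneOn_of_deriv_nonneg (convex_Icc a t) hφc.continuousOn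
        (fun x _ => (hφ x).differentiableAt.differentiableWithinAt) (fun x hx => ?_)
        (left_mem_Icc.2 ht.1) (right_mem_Icc.2 ht.1) ht.1
      rw [(hφ x).deriv]
      exact mul_nonneg (hv x).le (sub_nonneg.2 (h1 x (interior_subset hx)))
    · rw [← hb]
      refine antitoneOn_of_deriv_nonpos (convex_Icc t b) hφc.continuousOn
        (fun x _ => (hφ x).differentiableAt.differentiableWithinAt) (fun x hx => ?_)
        (left_mem_Icc.2 ht.2) (right_mem_Icc.2 ht.2) ht.2
      rw [(hφ x).deriv]
      exact mul_nonpos_of_nonneg_of_nonpos (hv x).le (sub_nonpos.2 (h1 x (interior_subset hx)))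
  have hmono : MonotoneOn F (Icc a b) := by
    refine monotoneOn_of_deriv_nonneg (convex_Icc a b) hFc.continuousOn
      (fun x _ => (hF x).differentiableAt.differentiableWithinAt) (fun x hx => ?_)
    rw [(hF x).deriv]
    exact mul_nonneg (hw x).le (hφ0 x (interior_subset hx))
  have ha' := left_mem_Icc.2 hab.le
  have hb' := right_mem_Icc.2 hab.le
  refine lt_of_le_of_ne (h0 ▸ hmono ha' hb' hab.le) fun hFb => hne ?_
  have hF0 : ∀ t ∈ Icc a b, F t = 0 := fun t ht => le_antisymm
    (hFb ▸ hmono ht hb' ht.2) (h0 ▸ hmono ha' ht ht.1)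
  have hzero : ∀ {u u' : ℝ → ℝ}, (∀ t, HasDerivAt u (u' t) t) → (∀ t ∈ Ioo a b, u t = 0) →
      ∀ t ∈ Ioo a b, u' t = 0 := by
    intro u u' hu h t ht
    refine (hu t).unique ((hasDerivAt_const t (0 : ℝ)).congr_of_eventuallyEq ?_)
    filter_upwards [Ioo_mem_nhds ht.1 ht.2] with x hx using h x hx
  have h1 : ∀ t ∈ Ioo a b, φ t = 0 := fun t ht =>
    (mul_eq_zero.1 (hzero hF (fun t ht => hF0 t ⟨ht.1.le, ht.2.le⟩) t ht)).resolve_left (hw t).ne'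
  have h2 : ∀ t ∈ Ioo a b, θ t = r := fun t ht =>
    sub_eq_zero.1 ((mul_eq_zero.1 (hzero hφ h1 t ht)).resolve_left (hv t).ne')
  have h3 : ∀ t ∈ Icc a b, θ t = r := by
    rw [← closure_Ioo hab.ne]
    exact fun t ht => (isClosed_eq hθ continuous_const).closure_subset_iff.2 h2 ht
  exact fun s hs t ht => by rw [h3 s hs, h3 t ht]

open Classical in
/-- Slope of `κ₃` against `κ₂` over `[a, b]`, extended to the diagonal by continuity. -/
def chordRatio (G : ℝ → ℝ → ℝ × ℝ) (f : ℝ → ℝ) (a b : ℝ) : ℝ :=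
  if a = b then tors G f a else (kap3 G f b - kap3 G f a) / (kap2 G b - kap2 G a)

open Classical in
/-- Slope of the chord `[g a, g b]`, extended to the diagonal by continuity. -/
def chordSlope (G : ℝ → ℝ → ℝ × ℝ) (a b : ℝ) : ℝ :=
  if a = b then kap2 G a else ((G 0 b).2 - (G 0 a).2) / ((G 0 b).1 - (G 0 a).1)

/-- The amount by which the plane tangent to the curve `(g, f)` at `a`, and having parallel to it
the tangent at `b`, misses the point of the curve with parameter `b`. It vanishes exactly
for the solutions of the cup equation. -/
def cupDefect (G : ℝ → ℝ → ℝ × ℝ) (f : ℝ → ℝ) (a b : ℝ) : ℝ :=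
  f b - f a - kap3 G f a * ((G 0 b).1 - (G 0 a).1) -
    (kap3 G f b - kap3 G f a) / (kap2 G b - kap2 G a) *
      ((G 0 b).2 - (G 0 a).2 - kap2 G a * ((G 0 b).1 - (G 0 a).1))

namespace BoundaryData

variable {G : ℝ → ℝ → ℝ × ℝ} {f : ℝ → ℝ} (hf : BoundaryData G f)

lemma chordRatio_self (a : ℝ) : chordRatio G f a a = tors G f a := by simp [chordRatio]

lemma chordSlope_self (a : ℝ) : chordSlope G a a = kap2 G a := by simp [chordSlope]

lemma chordRatio_of_ne {a b : ℝ} (hab : a ≠ b) :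
    chordRatio G f a b = (kap3 G f b - kap3 G f a) / (kap2 G b - kap2 G a) := by
  simp [chordRatio, hab]

lemma chordSlope_of_ne {a b : ℝ} (hab : a ≠ b) :
    chordSlope G a b = ((G 0 b).2 - (G 0 a).2) / ((G 0 b).1 - (G 0 a).1) := by
  simp [chordSlope, hab]

include hf

lemma kap2_sub_ne {a b : ℝ} (hab : a ≠ b) : kap2 G b - kap2 G a ≠ 0 :=
  sub_ne_zero.2 (hf.strictMono_kap2.injective.ne hab.symm)

lemma fst_sub_ne {a b : ℝ} (hab : a ≠ b) : (G 0 b).1 - (G 0 a).1 ≠ 0 :=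
  sub_ne_zero.2 (hf.curve.strictMono_fst.injective.ne hab.symm)

lemma chordRatio_mul (a b : ℝ) :
    chordRatio G f a b * (kap2 G b - kap2 G a) = kap3 G f b - kap3 G f a := by
  rcases eq_or_ne a b with rfl | hab
  · simp
  · rw [chordRatio_of_ne hab, div_mul_cancel₀ _ (hf.kap2_sub_ne hab)]

lemma chordSlope_mul (a b : ℝ) :
    chordSlope G a b * ((G 0 b).1 - (G 0 a).1) = (G 0 b).2 - (G 0 a).2 := by
  rcases eq_or_ne a b with rfl | hab
  · simp
  · rw [chordSlope_of_ne hab, div_mul_cancel₀ _ (hf.fst_sub_ne hab)]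

lemma exists_tors_eq_chordRatio {a b : ℝ} (hab : a ≤ b) :
    ∃ ξ ∈ Icc a b, tors G f ξ = chordRatio G f a b := by
  rcases hab.eq_or_lt with rfl | hlt
  · exact ⟨a, by simp, (chordRatio_self a).symm⟩
  obtain ⟨ξ, hξ, h⟩ := exists_hasDerivAt_eq_zero hlt
    (f := fun t => kap3 G f t - kap3 G f a - chordRatio G f a b * (kap2 G t - kap2 G a))
    (f' := fun t => tors G f t * deriv (kap2 G) t - chordRatio G f a b * deriv (kap2 G) t)
    (((hf.continuous_kap3.sub continuous_const).sub
      (continuous_const.mul (hf.continuous_kap2.sub continuous_const))).continuousOn)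
    (by rw [hf.chordRatio_mul]; ring)
    (fun t _ => ((hf.hasDerivAt_kap3 t).sub_const _).sub
      (((hf.hasDerivAt_kap2 t).sub_const _).const_mul _))
  refine ⟨ξ, ⟨hξ.1.le, hξ.2.le⟩, ?_⟩
  rw [← sub_mul] at h
  exact sub_eq_zero.1 ((mul_eq_zero.1 h).resolve_right (hf.deriv_kap2_pos ξ).ne')

lemma exists_kap2_eq_chordSlope {a b : ℝ} (hab : a ≤ b) :
    ∃ ξ ∈ Icc a b, kap2 G ξ = chordSlope G a b := by
  rcases hab.eq_or_lt with rfl | hlt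
  · exact ⟨a, by simp, (chordSlope_self a).symm⟩
  obtain ⟨ξ, hξ, h⟩ := exists_hasDerivAt_eq_zero hlt
    (f := fun t => (G 0 t).2 - (G 0 a).2 - chordSlope G a b * ((G 0 t).1 - (G 0 a).1))
    (f' := fun t => (deriv (G 0) t).2 - chordSlope G a b * (deriv (G 0) t).1)
    (((hf.curve.continuous_snd.sub continuous_const).sub
      (continuous_const.mul (hf.curve.continuous_fst.sub continuous_const))).continuousOn)
    (by rw [hf.chordSlope_mul]; ring)
    (fun t _ => ((hf.curve.hasDerivAt_snd t).sub_const _).sub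
      (((hf.curve.hasDerivAt_fst t).sub_const _).const_mul _))
  refine ⟨ξ, ⟨hξ.1.le, hξ.2.le⟩, ?_⟩
  rw [hf.deriv_snd, ← sub_mul] at h
  exact sub_eq_zero.1 ((mul_eq_zero.1 h).resolve_right (hf.curve.pos ξ).ne')

lemma gap_left_pos {a b : ℝ} (hab : a ≠ b) :
    0 < (G 0 b).2 - (G 0 a).2 - kap2 G a * ((G 0 b).1 - (G 0 a).1) := by
  have := hf.curve.gap_pos hab
  rwa [gap, ← kap2_eq] at this

lemma gap_right_pos {a b : ℝ} (hab : a ≠ b) :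
    0 < kap2 G b * ((G 0 b).1 - (G 0 a).1) - ((G 0 b).2 - (G 0 a).2) := by
  have := hf.curve.gap_pos hab.symm
  rw [gap, ← kap2_eq] at this
  linarith

lemma hasDerivAt_bend (a r t : ℝ) : HasDerivAt
    (fun t => kap3 G f t - kap3 G f a - r * (kap2 G t - kap2 G a))
    (deriv (kap2 G) t * (tors G f t - r)) t :=
  (((hf.hasDerivAt_kap3 t).sub_const _).sub
    (((hf.hasDerivAt_kap2 t).sub_const _).const_mul _)).congr_deriv (by ring)

lemma hasDerivAt_excess (a r t : ℝ) : HasDerivAt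
    (fun t => f t - f a - kap3 G f a * ((G 0 t).1 - (G 0 a).1) -
      r * ((G 0 t).2 - (G 0 a).2 - kap2 G a * ((G 0 t).1 - (G 0 a).1)))
    ((deriv (G 0) t).1 * (kap3 G f t - kap3 G f a - r * (kap2 G t - kap2 G a))) t := by
  have h1 := (hf.curve.hasDerivAt_fst t).sub_const (G 0 a).1
  have h2 := (hf.curve.hasDerivAt_snd t).sub_const (G 0 a).2
  refine ((((hf.hasDerivAt t).sub_const _).sub (h1.const_mul _)).sub
    ((h2.sub (h1.const_mul _)).const_mul r)).congr_deriv ?_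
  rw [hf.deriv_eq, hf.deriv_snd]; ring

lemma cupDefect_pos {a b : ℝ} (hab : a < b)
    (h : ∀ t ∈ Icc a b, (∀ x ∈ Icc a t, chordRatio G f a b ≤ tors G f x) ∨
      (∀ x ∈ Icc t b, tors G f x ≤ chordRatio G f a b))
    (hne : ¬ ConstOn (tors G f) (Icc a b)) : 0 < cupDefect G f a b := by
  have := pos_of_unimodal hab (hf.hasDerivAt_excess a (chordRatio G f a b))
    (hf.hasDerivAt_bend a (chordRatio G f a b)) hf.curve.pos hf.deriv_kap2_pos hf.continuous_tors
    (by simp) (by rw [hf.chordRatio_mul]; ring) (by simp) h hne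
  rwa [chordRatio_of_ne hab.ne] at this

lemma cupDefect_neg {a b : ℝ} (hab : a < b)
    (h : ∀ t ∈ Icc a b, (∀ x ∈ Icc a t, tors G f x ≤ chordRatio G f a b) ∨
      (∀ x ∈ Icc t b, chordRatio G f a b ≤ tors G f x))
    (hne : ¬ ConstOn (tors G f) (Icc a b)) : cupDefect G f a b < 0 := by
  have := pos_of_unimodal (θ := fun t => -tors G f t) (r := -chordRatio G f a b) hab
    (fun t => ((hf.hasDerivAt_excess a (chordRatio G f a b) t).neg).congr_deriv
      (mul_neg _ _).symm)
    (fun t => ((hf.hasDerivAt_bend a (chordRatio G f a b) t).neg).congr_deriv (by ring))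
    hf.curve.pos hf.deriv_kap2_pos hf.continuous_tors.neg
    (by simp) (by rw [hf.chordRatio_mul]; ring) (by simp)
    (fun t ht => (h t ht).imp (fun h x hx => neg_le_neg (h x hx)) fun h x hx => neg_le_neg (h x hx))
    (fun hc => hne fun s hs t ht => neg_injective (hc s hs t ht))
  rw [cupDefect, ← chordRatio_of_ne hab.ne]
  exact neg_pos.1 this

/-- Partial derivatives of `cupDefect`; the first variable of the pair is the right endpoint. -/
lemma hasFDerivAt_cupDefect {a b : ℝ} (hab : a ≠ b) :
    HasFDerivAt (fun p : ℝ × ℝ => cupDefect G f p.2 p.1)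
      ((deriv (kap2 G) b * (chordRatio G f a b - tors G f b) *
          ((G 0 b).2 - (G 0 a).2 - kap2 G a * ((G 0 b).1 - (G 0 a).1)) / (kap2 G b - kap2 G a)) •
        ContinuousLinearMap.fst ℝ ℝ ℝ +
      (deriv (kap2 G) a * (chordRatio G f a b - tors G f a) *
          (kap2 G b * ((G 0 b).1 - (G 0 a).1) - ((G 0 b).2 - (G 0 a).2)) / (kap2 G b - kap2 G a)) •
        ContinuousLinearMap.snd ℝ ℝ ℝ) (b, a) := by
  have f1 : HasFDerivAt (fun p : ℝ × ℝ => p.1) (ContinuousLinearMap.fst ℝ ℝ ℝ) (b, a) :=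
    hasFDerivAt_fst
  have f2 : HasFDerivAt (fun p : ℝ × ℝ => p.2) (ContinuousLinearMap.snd ℝ ℝ ℝ) (b, a) :=
    hasFDerivAt_snd
  have pb1 := (hf.curve.hasDerivAt_fst b).comp_hasFDerivAt_of_eq (b, a) f1 rfl
  have pb2 := (hf.curve.hasDerivAt_snd b).comp_hasFDerivAt_of_eq (b, a) f1 rfl
  have pb3 := (hf.hasDerivAt b).comp_hasFDerivAt_of_eq (b, a) f1 rfl
  have kb2 := (hf.hasDerivAt_kap2 b).comp_hasFDerivAt_of_eq (b, a) f1 rfl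
  have kb3 := (hf.hasDerivAt_kap3 b).comp_hasFDerivAt_of_eq (b, a) f1 rfl
  have pa1 := (hf.curve.hasDerivAt_fst a).comp_hasFDerivAt_of_eq (b, a) f2 rfl
  have pa2 := (hf.curve.hasDerivAt_snd a).comp_hasFDerivAt_of_eq (b, a) f2 rfl
  have pa3 := (hf.hasDerivAt a).comp_hasFDerivAt_of_eq (b, a) f2 rfl
  have ka2 := (hf.hasDerivAt_kap2 a).comp_hasFDerivAt_of_eq (b, a) f2 rfl
  have ka3 := (hf.hasDerivAt_kap3 a).comp_hasFDerivAt_of_eq (b, a) f2 rfl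
  have hK := hf.kap2_sub_ne hab
  have hinv := (hasDerivAt_inv hK).comp_hasFDerivAt_of_eq (b, a) (kb2.sub ka2) rfl
  have := ((pb3.sub pa3).sub (ka3.mul (pb1.sub pa1))).sub
    (((kb3.sub ka3).mul hinv).mul ((pb2.sub pa2).sub (ka2.mul (pb1.sub pa1))))
  refine (this.congr_fderiv ?_).congr_of_eventuallyEq
    (Eventually.of_forall fun p => ?_)
  · rw [chordRatio_of_ne hab]
    ext
    · simp [hf.deriv_eq, hf.deriv_snd]
      field_simp
      ring
    · simp [hf.deriv_eq, hf.deriv_snd]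
      field_simp
      ring
  · simp only [cupDefect, div_eq_mul_inv]; rfl

end BoundaryData

end
end BellmanFoliation

namespace BellmanFoliation
noncomputable section

/-! ### Growth of a cup from its origin -/

/-- The pairs `(s t, t)`, `c ≤ t ≤ b`, form a cup with the origin `c`: they solve the cup equation,
and both differentials have the right sign. -/
structure IsCup (G : ℝ → ℝ → ℝ × ℝ) (f : ℝ → ℝ) (c b : ℝ) (s : ℝ → ℝ) : Prop where
  lt : c < b
  map_origin : s c = c
  strictAnti : StrictAntiOn s (Icc c b)
  continuousOn : ContinuousOn s (Icc c b)
  defect : ∀ t ∈ Ioc c b, cupDefect G f (s t) t = 0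
  tors_left : ∀ t ∈ Ioc c b, tors G f (s t) < chordRatio G f (s t) t
  tors_right : ∀ t ∈ Ioc c b, tors G f t < chordRatio G f (s t) t

namespace BoundaryData

variable {G : ℝ → ℝ → ℝ × ℝ} {f : ℝ → ℝ} (hf : BoundaryData G f)
include hf

lemma hasDerivAt_cupDefect_left {a b : ℝ} (hab : a ≠ b) :
    HasDerivAt (fun a => cupDefect G f a b)
      (deriv (kap2 G) a * (chordRatio G f a b - tors G f a) *
          (kap2 G b * ((G 0 b).1 - (G 0 a).1) - ((G 0 b).2 - (G 0 a).2)) /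
          (kap2 G b - kap2 G a)) a := by
  have := (hf.hasFDerivAt_cupDefect hab).comp_hasDerivAt a
    ((hasDerivAt_const a b).prodMk (hasDerivAt_id a))
  exact this.congr_deriv (by simp)

lemma hasDerivAt_cupDefect_right {a b : ℝ} (hab : a ≠ b) :
    HasDerivAt (fun b => cupDefect G f a b)
      (deriv (kap2 G) b * (chordRatio G f a b - tors G f b) *
          ((G 0 b).2 - (G 0 a).2 - kap2 G a * ((G 0 b).1 - (G 0 a).1)) /
          (kap2 G b - kap2 G a)) b := by
  have := (hf.hasFDerivAt_cupDefect hab).comp_hasDerivAt b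
    ((hasDerivAt_id b).prodMk (hasDerivAt_const b a))
  exact this.congr_deriv (by simp)

/-- A maximum of the torsion function, strict in a weak sense, is the origin of a cup. For a right end
`b` close to `c` the defect of `(a, b)` is negative at `a = a₀` and positive at `a = c`, and it
vanishes at exactly one point `s b` in between. -/
lemma exists_isCup {a₀ c b₀ : ℝ} (ha₀ : a₀ < c) (hb₀ : c < b₀)
    (hmono : MonotoneOn (tors G f) (Icc a₀ c)) (hanti : AntitoneOn (tors G f) (Icc c b₀))
    (hl : ∀ t < c, ¬ ConstOn (tors G f) (Icc t c)) (hr : ∀ t > c, ¬ ConstOn (tors G f) (Icc c t)) :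
    ∃ b s, b ≤ b₀ ∧ IsCup G f c b s ∧ ∀ t ∈ Icc c b, a₀ ≤ s t := by
  have hsub : ∀ {I J : Set ℝ}, I ⊆ J → ¬ ConstOn (tors G f) I → ¬ ConstOn (tors G f) J :=
    fun h h1 h2 => h1 fun s hs t ht => h2 s (h hs) t (h ht)
  have hne : ∀ a ∈ Icc a₀ c, ∀ b ∈ Icc c b₀, a < b → ¬ ConstOn (tors G f) (Icc a b) := by
    intro a ha b hb hab
    rcases ha.2.eq_or_lt with rfl | h
    · exact hr b hab
    · exact hsub (Icc_subset_Icc_right hb.1) (hl a h)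
  -- the signs of the differentials at a zero of the defect: otherwise the mean `chordRatio` would be
  -- on the same side of `θ` as in a one-sided sub-interval, and the defect would have a strict sign
  have hleft : ∀ a ∈ Icc a₀ c, ∀ b ∈ Icc c b₀, a < b → cupDefect G f a b ≤ 0 →
      tors G f a < chordRatio G f a b := by
    intro a ha b hb hab h
    by_contra! hcon
    refine h.not_gt (hf.cupDefect_pos hab (fun t ht => ?_) (hne a ha b hb hab))
    rcases le_total t c with htc | htc
    · exact Or.inl fun x hx => hcon.trans (hmono ha ⟨ha.1.trans hx.1, hx.2.trans htc⟩ hx.1)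
    · rcases le_total (chordRatio G f a b) (tors G f t) with h1 | h1
      · refine Or.inl fun x hx => ?_
        rcases le_total x c with hxc | hxc
        · exact hcon.trans (hmono ha ⟨ha.1.trans hx.1, hxc⟩ hx.1)
        · exact h1.trans (hanti ⟨hxc, hx.2.trans (ht.2.trans hb.2)⟩ ⟨htc, ht.2.trans hb.2⟩ hx.2)
      · exact Or.inr fun x hx => (hanti ⟨htc, ht.2.trans hb.2⟩
          ⟨htc.trans hx.1, hx.2.trans hb.2⟩ hx.1).trans h1
  have hright : ∀ a ∈ Icc a₀ c, ∀ b ∈ Icc c b₀, a < b → 0 ≤ cupDefect G f a b →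
      tors G f b < chordRatio G f a b := by
    intro a ha b hb hab h
    by_contra! hcon
    refine h.not_gt (hf.cupDefect_neg hab (fun t ht => ?_) (hne a ha b hb hab))
    rcases le_total c t with htc | htc
    · exact Or.inr fun x hx => hcon.trans (hanti ⟨htc.trans hx.1, hx.2.trans hb.2⟩ hb hx.2)
    · rcases le_total (chordRatio G f a b) (tors G f t) with h1 | h1
      · refine Or.inr fun x hx => ?_
        rcases le_total c x with hxc | hxc
        · exact hcon.trans (hanti ⟨hxc, hx.2.trans hb.2⟩ hb hx.2)
        · exact h1.trans (hmono ⟨ha.1.trans ht.1, htc⟩ ⟨(ha.1.trans ht.1).trans hx.1, hxc⟩ hx.1)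
      · exact Or.inl fun x hx => (hmono ⟨ha.1.trans hx.1, hx.2.trans htc⟩
          ⟨ha.1.trans ht.1, htc⟩ hx.2).trans h1
  -- hence the defect changes its sign at most once in each variable
  have hnegL : ∀ b ∈ Icc c b₀, ∀ p ∈ Icc a₀ c, ∀ q ∈ Icc a₀ c, p < q → q < b →
      cupDefect G f q b ≤ 0 → cupDefect G f p b < 0 := by
    intro b hb p hp q hq hpq hqb h
    refine neg_of_deriv_pos_of_nonpos (φ := fun a => cupDefect G f a b) hpq
      (fun x hx => hf.hasDerivAt_cupDefect_left (hx.2.trans_lt hqb).ne) (fun x hx h0 => ?_) h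
    have hxb : x < b := hx.2.trans_lt hqb
    have h1 := hleft x ⟨hp.1.trans hx.1.le, hx.2.trans hq.2⟩ b hb hxb h0
    exact div_pos (mul_pos (mul_pos (hf.deriv_kap2_pos x) (sub_pos.2 h1))
      (hf.gap_right_pos hxb.ne)) (sub_pos.2 (hf.strictMono_kap2 hxb))
  have hposR : ∀ a ∈ Icc a₀ c, ∀ p ∈ Icc c b₀, ∀ q ∈ Icc c b₀, a < p → p < q →
      0 ≤ cupDefect G f a p → 0 < cupDefect G f a q := by
    intro a ha p hp q hq hap hpq h
    refine pos_of_deriv_pos_of_nonneg (φ := fun b => cupDefect G f a b) hpq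
      (fun x hx => hf.hasDerivAt_cupDefect_right (hap.trans_le hx.1).ne) (fun x hx h0 => ?_) h
    have hax : a < x := hap.trans_le hx.1
    have h1 := hright a ha x ⟨hp.1.trans hx.1, hx.2.le.trans hq.2⟩ hax h0
    exact div_pos (mul_pos (mul_pos (hf.deriv_kap2_pos x) (sub_pos.2 h1))
      (hf.gap_left_pos hax.ne)) (sub_pos.2 (hf.strictMono_kap2 hax))
  have hc_left : c ∈ Icc a₀ c := ⟨ha₀.le, le_rfl⟩
  have hc_right : c ∈ Icc c b₀ := ⟨le_rfl, hb₀.le⟩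
  have ha₀_mem : a₀ ∈ Icc a₀ c := ⟨le_rfl, ha₀.le⟩
  have hpos_c : ∀ b ∈ Icc c b₀, c < b → 0 < cupDefect G f c b := by
    intro b hb hcb
    by_contra! hcon
    -- otherwise the torsion function would be less than its mean over an interval of decrease
    obtain ⟨ξ, hξ, hr⟩ := hf.exists_tors_eq_chordRatio hcb.le
    have := hleft c hc_left b hb hcb hcon
    rw [← hr] at this
    exact this.not_ge (hanti hc_right ⟨hξ.1, hξ.2.trans hb.2⟩ hξ.1)
  have hneg_c : ∀ a ∈ Icc a₀ c, a < c → cupDefect G f a c < 0 := by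
    intro a ha hac
    by_contra! hcon
    obtain ⟨ξ, hξ, hr⟩ := hf.exists_tors_eq_chordRatio hac.le
    have := hright a ha c hc_right hac hcon
    rw [← hr] at this
    exact this.not_ge (hmono ⟨ha.1.trans hξ.1, hξ.2⟩ hc_left hξ.2)
  have hcontR : ∀ {a b : ℝ}, a ≠ b → ContinuousAt (fun b => cupDefect G f a b) b :=
    fun h => (hf.hasDerivAt_cupDefect_right h).continuousAt
  -- the range of the right endpoints
  obtain ⟨b₁, hb₁, hneg⟩ : ∃ b₁ ∈ Ioc c b₀, ∀ b ∈ Icc c b₁, cupDefect G f a₀ b < 0 := by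
    have h1 := (hcontR ha₀.ne).eventually (gt_mem_nhds (hneg_c a₀ ha₀_mem ha₀))
    obtain ⟨δ, hδ, h2⟩ := Metric.eventually_nhds_iff.1 h1
    refine ⟨min b₀ (c + δ / 2), ⟨lt_min hb₀ (by linarith), min_le_left _ _⟩, fun b hb => h2 ?_⟩
    have := hb.2.trans (min_le_right _ _)
    rw [Real.dist_eq, abs_lt]
    constructor <;> linarith [hb.1]
  have hmem : ∀ {b}, b ∈ Icc c b₁ → b ∈ Icc c b₀ := fun h => ⟨h.1, h.2.trans hb₁.2⟩
  have hex : ∀ b, ∃ a, b ∈ Ioc c b₁ → a ∈ Ioo a₀ c ∧ cupDefect G f a b = 0 := by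
    intro b
    by_cases hb : b ∈ Ioc c b₁
    · have hb' := hmem ⟨hb.1.le, hb.2⟩
      have hcont : ContinuousOn (fun a => cupDefect G f a b) (Icc a₀ c) := fun a ha =>
        (hf.hasDerivAt_cupDefect_left (ha.2.trans_lt hb.1).ne).continuousAt.continuousWithinAt
      obtain ⟨a, ha, h⟩ := intermediate_value_Ioo ha₀.le hcont
        ⟨hneg b ⟨hb.1.le, hb.2⟩, hpos_c b hb' hb.1⟩
      exact ⟨a, fun _ => ⟨ha, h⟩⟩
    · exact ⟨c, fun h => absurd h hb⟩
  choose s₀ hs₀ using hex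
  classical
  set s : ℝ → ℝ := fun b => if b = c then c else s₀ b with hs
  have hsc : s c = c := by simp [hs]
  have hsb : ∀ b ∈ Ioc c b₁, s b ∈ Ioo a₀ c ∧ cupDefect G f (s b) b = 0 := fun b hb => by
    simp only [hs, if_neg hb.1.ne']; exact hs₀ b hb
  have hs_le : ∀ b ∈ Icc c b₁, s b ∈ Icc a₀ c := fun b hb => by
    rcases hb.1.eq_or_lt with rfl | h
    · rw [hsc]; exact hc_left
    · exact Ioo_subset_Icc_self (hsb b ⟨h, hb.2⟩).1
  have hcmp1 : ∀ b ∈ Icc c b₁, ∀ a ∈ Icc a₀ c, a < b → cupDefect G f a b < 0 → a < s b := by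
    intro b hb a ha hab h
    rcases hb.1.eq_or_lt with rfl | hcb
    · rwa [hsc]
    by_contra! hcon
    have h1 := hsb b ⟨hcb, hb.2⟩
    rcases hcon.eq_or_lt with heq | hlt
    · rw [← heq, h1.2] at h; exact lt_irrefl _ h
    · exact (hnegL b (hmem hb) _ (hs_le b hb) a ha hlt hab h.le).ne h1.2
  have hcmp2 : ∀ b ∈ Ioc c b₁, ∀ a ∈ Icc a₀ c, 0 < cupDefect G f a b → s b < a := by
    intro b hb a ha h
    by_contra! hcon
    have h1 := hsb b hb
    rcases hcon.eq_or_lt with heq | hlt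
    · rw [heq, h1.2] at h; exact lt_irrefl _ h
    · exact (hnegL b (hmem ⟨hb.1.le, hb.2⟩) a ha _ ⟨h1.1.1.le, h1.1.2.le⟩ hlt (h1.1.2.trans hb.1)
        h1.2.le).not_gt h
  have hanti_s : StrictAntiOn s (Icc c b₁) := by
    intro b hb b' hb' hbb
    have hcb' : c < b' := hb.1.trans_lt hbb
    rcases hb.1.eq_or_lt with rfl | hcb
    · rw [hsc]; exact (hsb b' ⟨hcb', hb'.2⟩).1.2
    have h1 := hsb b ⟨hcb, hb.2⟩
    exact hcmp2 b' ⟨hcb', hb'.2⟩ _ (hs_le b hb) (hposR _ (hs_le b hb) b (hmem hb) b' (hmem hb')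
      (h1.1.2.trans hcb) hbb h1.2.ge)
  refine ⟨b₁, s, hb₁.2, ⟨hb₁.1, hsc, hanti_s, fun b hb => ?_, fun t ht => (hsb t ht).2,
    fun t ht => ?_, fun t ht => ?_⟩, fun t ht => (hs_le t ht).1⟩
  -- continuity follows from the comparison of `s b` with numbers at which the defect has a sign
  · refine tendsto_order.2 ⟨fun a ha => ?_, fun a ha => ?_⟩
    · rcases lt_or_ge a a₀ with h | h
      · filter_upwards [self_mem_nhdsWithin] with b' hb' using h.trans_le (hs_le b' hb').1
      have ha' : a ∈ Icc a₀ c := ⟨h, ha.le.trans (hs_le b hb).2⟩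
      have hab : a < b := ha.trans_le ((hs_le b hb).2.trans hb.1)
      have hd : cupDefect G f a b < 0 := by
        rcases hb.1.eq_or_lt with rfl | hcb
        · exact hneg_c a ha' hab
        · have h1 := hsb b ⟨hcb, hb.2⟩
          exact hnegL b (hmem hb) a ha' _ (hs_le b hb) ha (h1.1.2.trans hcb) h1.2.le
      filter_upwards [self_mem_nhdsWithin, mem_nhdsWithin_of_mem_nhds (lt_mem_nhds hab),
        mem_nhdsWithin_of_mem_nhds ((hcontR hab.ne).eventually (gt_mem_nhds hd))] with b' h1 h2 h3
      exact hcmp1 b' h1 a ha' h2 h3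
    · rcases lt_or_ge c a with h | h
      · filter_upwards [self_mem_nhdsWithin] with b' hb' using (hs_le b' hb').2.trans_lt h
      have hcb : c < b := by
        rcases hb.1.eq_or_lt with rfl | hcb
        · rw [hsc] at ha; exact absurd ha h.not_gt
        · exact hcb
      have ha' : a ∈ Icc a₀ c := ⟨(hs_le b hb).1.trans ha.le, h⟩
      have hd : 0 < cupDefect G f a b := by
        by_contra! hcon
        exact (hnegL b (hmem hb) _ (hs_le b hb) a ha' ha (h.trans_lt hcb) hcon).ne
          (hsb b ⟨hcb, hb.2⟩).2
      filter_upwards [self_mem_nhdsWithin, mem_nhdsWithin_of_mem_nhds (lt_mem_nhds hcb),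
        mem_nhdsWithin_of_mem_nhds ((hcontR (h.trans_lt hcb).ne).eventually (lt_mem_nhds hd))]
        with b' h1 h2 h3
      exact hcmp2 b' ⟨h2, h1.2⟩ a ha' h3
  · have h1 := hsb t ht
    exact hleft _ (Ioo_subset_Icc_self h1.1) t (hmem ⟨ht.1.le, ht.2⟩) (h1.1.2.trans ht.1) h1.2.le
  · have h1 := hsb t ht
    exact hright _ (Ioo_subset_Icc_self h1.1) t (hmem ⟨ht.1.le, ht.2⟩) (h1.1.2.trans ht.1) h1.2.ge

end BoundaryData

end
end BellmanFoliation

namespace BellmanFoliation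
noncomputable section

/-! ### Chords of a cup and planes over them -/

lemma continuousOn_of_mean {ψ q s : ℝ → ℝ} {c b : ℝ} (hψ : ContinuousAt ψ c)
    (hs : ContinuousWithinAt s (Icc c b) c) (hsc : s c = c) (hq : ContinuousOn q (Ioc c b))
    (hmean : ∀ t ∈ Icc c b, ∃ ξ ∈ Icc (s t) t, ψ ξ = q t) : ContinuousOn q (Icc c b) := by
  intro t ht
  rcases ht.1.eq_or_lt with rfl | hct
  · have hex : ∀ t, ∃ ξ, t ∈ Icc c b → ξ ∈ Icc (s t) t ∧ ψ ξ = q t := fun t => by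
      by_cases ht : t ∈ Icc c b
      · obtain ⟨ξ, h1, h2⟩ := hmean t ht; exact ⟨ξ, fun _ => ⟨h1, h2⟩⟩
      · exact ⟨0, fun h => absurd h ht⟩
    choose ξ hξ using hex
    have hlim : Tendsto ξ (𝓝[Icc c b] c) (𝓝 c) := by
      refine tendsto_of_tendsto_of_tendsto_of_le_of_le' (by simpa only [hsc] using hs.tendsto)
        (tendsto_id.mono_left nhdsWithin_le_nhds) ?_ ?_ <;>
        filter_upwards [self_mem_nhdsWithin] with t ht
      exacts [(hξ t ht).1.1, (hξ t ht).1.2]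
    have h0 := hξ c ht
    rw [hsc, Icc_self, mem_singleton_iff] at h0
    rw [ContinuousWithinAt, ← h0.2, h0.1]
    refine (hψ.tendsto.comp hlim).congr' ?_
    filter_upwards [self_mem_nhdsWithin] with t ht using (hξ t ht).2
  · refine (hq t ⟨hct, ht.2⟩).mono_of_mem_nhdsWithin ?_
    filter_upwards [self_mem_nhdsWithin, mem_nhdsWithin_of_mem_nhds (Ioi_mem_nhds hct)]
      with x h1 h2 using ⟨h2, h1.2⟩

/-- Signed vertical distance from the line through `g a` and `g b` to the point `x`. -/
def chordGap (G : ℝ → ℝ → ℝ × ℝ) (a b : ℝ) (x : ℝ × ℝ) : ℝ :=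
  x.2 - (G 0 b).2 - chordSlope G a b * (x.1 - (G 0 b).1)

lemma continuous_chordGap (G : ℝ → ℝ → ℝ × ℝ) (a b : ℝ) : Continuous (chordGap G a b) := by
  unfold chordGap; fun_prop

lemma chordGap_add (G : ℝ → ℝ → ℝ × ℝ) (a b : ℝ) (x y : ℝ × ℝ) (α β : ℝ) (h : α + β = 1) :
    chordGap G a b (α • x + β • y) = α * chordGap G a b x + β * chordGap G a b y := by
  obtain rfl : β = 1 - α := by linarith
  simp only [chordGap, Prod.fst_add, Prod.snd_add, Prod.smul_fst, Prod.smul_snd, smul_eq_mul]; ring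

namespace BoundaryData

variable {G : ℝ → ℝ → ℝ × ℝ} {f : ℝ → ℝ} (hf : BoundaryData G f)
include hf

omit hf in
lemma chordRatio_comm (a b : ℝ) : chordRatio G f a b = chordRatio G f b a := by
  rcases eq_or_ne a b with rfl | h
  · rfl
  · rw [chordRatio_of_ne h, chordRatio_of_ne h.symm, ← neg_div_neg_eq, neg_sub, neg_sub]

omit hf in
lemma chordGap_right (a b : ℝ) : chordGap G a b (G 0 b) = 0 := by simp [chordGap]

lemma chordGap_left (a b : ℝ) : chordGap G a b (G 0 a) = 0 := by
  have := hf.chordSlope_mul a b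
  rw [chordGap]; linarith

lemma exists_chordGap_strictMonoOn {a b : ℝ} (hab : a ≤ b) : ∃ ξ ∈ Icc a b,
    StrictAntiOn (fun p => chordGap G a b (G 0 p)) (Iic ξ) ∧
    StrictMonoOn (fun p => chordGap G a b (G 0 p)) (Ici ξ) := by
  obtain ⟨ξ, hξ, hm⟩ := hf.exists_kap2_eq_chordSlope hab
  have hd : ∀ p, HasDerivAt (fun p => chordGap G a b (G 0 p))
      ((deriv (G 0) p).1 * (kap2 G p - chordSlope G a b)) p := fun p => by
    refine (((hf.curve.hasDerivAt_snd p).sub_const _).sub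
      (((hf.curve.hasDerivAt_fst p).sub_const _).const_mul _)).congr_deriv ?_
    rw [hf.deriv_snd]; ring
  have hc : Continuous fun p => chordGap G a b (G 0 p) :=
    continuous_iff_continuousAt.2 fun p => (hd p).continuousAt
  refine ⟨ξ, hξ, strictAntiOn_of_deriv_neg (convex_Iic ξ) hc.continuousOn fun x hx => ?_,
    strictMonoOn_of_deriv_pos (convex_Ici ξ) hc.continuousOn fun x hx => ?_⟩
  · rw [(hd x).deriv, ← hm]
    rw [interior_Iic] at hx
    exact mul_neg_of_pos_of_neg (hf.curve.pos x) (sub_neg.2 (hf.strictMono_kap2 hx))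
  · rw [(hd x).deriv, ← hm]
    rw [interior_Ici] at hx
    exact mul_pos (hf.curve.pos x) (sub_pos.2 (hf.strictMono_kap2 hx))

lemma chordGap_curve_pos {a b p : ℝ} (hab : a ≤ b) (hp : p < a ∨ b < p) :
    0 < chordGap G a b (G 0 p) := by
  obtain ⟨ξ, hξ, h1, h2⟩ := hf.exists_chordGap_strictMonoOn hab
  rcases hp with hp | hp
  · exact (hf.chordGap_left a b).symm.trans_lt (h1 (mem_Iic.2 (hp.le.trans hξ.1)) hξ.1 hp)
  · exact (chordGap_right a b).symm.trans_lt (h2 hξ.2 (mem_Ici.2 (hξ.2.trans hp.le)) hp)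

lemma chordGap_curve_neg {a b p : ℝ} (hp : a < p ∧ p < b) : chordGap G a b (G 0 p) < 0 := by
  obtain ⟨ξ, hξ, h1, h2⟩ := hf.exists_chordGap_strictMonoOn (hp.1.trans hp.2).le
  rcases le_total p ξ with h | h
  · exact (h1 hξ.1 h hp.1).trans_eq (hf.chordGap_left a b)
  · exact (h2 h hξ.2 hp.2).trans_eq (chordGap_right a b)

lemma iteratedDeriv_two_eq (t : ℝ) : iteratedDeriv 2 f t =
    deriv (kap3 G f) t * (deriv (G 0) t).1 + kap3 G f t * (iteratedDeriv 2 (G 0) t).1 := by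
  have h2 : HasDerivAt (deriv (G 0)) (iteratedDeriv 2 (G 0) t) t := by
    rw [iteratedDeriv_succ, iteratedDeriv_one]
    exact (hf.curve.contDiff_deriv.differentiable (by norm_num) t).hasDerivAt
  have h1 := (hf.hasDerivAt_kap3' t).mul h2.fst
  have h3 : deriv f = kap3 G f * fun s => (deriv (G 0) s).1 := funext fun t => hf.deriv_eq t
  rw [iteratedDeriv_succ, iteratedDeriv_one, h3]
  exact h1.deriv

lemma iteratedDeriv_two_snd (t : ℝ) : (iteratedDeriv 2 (G 0) t).2 =
    deriv (kap2 G) t * (deriv (G 0) t).1 + kap2 G t * (iteratedDeriv 2 (G 0) t).1 := by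
  have h2 : HasDerivAt (deriv (G 0)) (iteratedDeriv 2 (G 0) t) t := by
    rw [iteratedDeriv_succ, iteratedDeriv_one]
    exact (hf.curve.contDiff_deriv.differentiable (by norm_num) t).hasDerivAt
  have h1 := (hf.hasDerivAt_kap2 t).mul h2.fst
  have h3 : (fun s => (deriv (G 0) s).2) = kap2 G * fun s => (deriv (G 0) s).1 :=
    funext fun t => hf.deriv_snd t
  have h4 : HasDerivAt (fun s => (deriv (G 0) s).2) (iteratedDeriv 2 (G 0) t).2 t := h2.snd
  rw [h3] at h4
  exact h4.unique h1

lemma det3_gam2 (x y : ℝ) : det3 (gam1 G f x) (gam1 G f y) (gam2 G f x) =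
    (deriv (G 0) x).1 ^ 2 * (deriv (G 0) y).1 * deriv (kap2 G) x * (kap2 G y - kap2 G x) *
      (tors G f x - chordRatio G f x y) := by
  have h := hf.chordRatio_mul x y
  simp only [det3, Matrix.det_fin_three, gam1, gam2, Matrix.of_apply, Matrix.cons_val_zero,
    Matrix.cons_val_one, Matrix.cons_val]
  rw [hf.iteratedDeriv_two_eq, hf.iteratedDeriv_two_snd, hf.deriv_eq x, hf.deriv_eq y,
    hf.deriv_snd x, hf.deriv_snd y, hf.deriv_kap3]
  linear_combination ((deriv (G 0) x).1 ^ 2 * (deriv (G 0) y).1 * deriv (kap2 G) x) * h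

lemma cupEquation_iff {a b : ℝ} (hab : a ≠ b) : CupEquation G f a b ↔ cupDefect G f a b = 0 := by
  have h := hf.kap2_sub_ne hab
  have e : det3 (gam1 G f b) (gam1 G f a) (gam G f a - gam G f b) =
      (deriv (G 0) b).1 * (deriv (G 0) a).1 * (kap2 G b - kap2 G a) * cupDefect G f a b := by
    simp only [det3, Matrix.det_fin_three, gam1, gam, Matrix.of_apply, Matrix.cons_val_zero,
      Matrix.cons_val_one, Matrix.cons_val, Pi.sub_apply]
    rw [hf.deriv_eq a, hf.deriv_eq b, hf.deriv_snd a, hf.deriv_snd b, cupDefect]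
    field_simp
    ring
  rw [CupEquation, e, mul_eq_zero, or_iff_right]
  exact mul_ne_zero (mul_ne_zero (hf.curve.pos b).ne' (hf.curve.pos a).ne') h

lemma differential_ne_zero {x y : ℝ} (hxy : x ≠ y) (h : tors G f x ≠ chordRatio G f x y) :
    differential G f x y ≠ 0 := by
  have hk := hf.kap2_sub_ne hxy
  have hx := (hf.curve.pos x).ne'
  have hy := (hf.curve.pos y).ne'
  rw [differential, hf.det3_gam2]
  refine div_ne_zero (mul_ne_zero (mul_ne_zero (mul_ne_zero (mul_ne_zero (pow_ne_zero _ hx) hy)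
    (hf.deriv_kap2_pos x).ne') hk) (sub_ne_zero.2 h)) ?_
  rw [hf.deriv_snd x, hf.deriv_snd y,
    show (deriv (G 0) x).1 * (kap2 G y * (deriv (G 0) y).1) -
      kap2 G x * (deriv (G 0) x).1 * (deriv (G 0) y).1 =
      (deriv (G 0) x).1 * (deriv (G 0) y).1 * (kap2 G y - kap2 G x) by ring]
  exact mul_ne_zero (mul_ne_zero hx hy) hk

end BoundaryData

end
end BellmanFoliation

namespace BellmanFoliation
noncomputable section

/-! ### Coordinates on a cup and rotation of its planes -/

namespace IsCup

variable {G : ℝ → ℝ → ℝ × ℝ} {f : ℝ → ℝ} {c b : ℝ} {s : ℝ → ℝ} (hs : IsCup G f c b s)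
include hs

lemma restrict {b' : ℝ} (h1 : c < b') (h2 : b' ≤ b) : IsCup G f c b' s where
  lt := h1
  map_origin := hs.map_origin
  strictAnti := hs.strictAnti.mono (Icc_subset_Icc_right h2)
  continuousOn := hs.continuousOn.mono (Icc_subset_Icc_right h2)
  defect t ht := hs.defect t ⟨ht.1, ht.2.trans h2⟩
  tors_left t ht := hs.tors_left t ⟨ht.1, ht.2.trans h2⟩
  tors_right t ht := hs.tors_right t ⟨ht.1, ht.2.trans h2⟩

lemma left_mem : c ∈ Icc c b := left_mem_Icc.2 hs.lt.le

lemma right_mem : b ∈ Icc c b := right_mem_Icc.2 hs.lt.le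

lemma map_le {t : ℝ} (ht : t ∈ Icc c b) : s t ≤ c := by
  conv_rhs => rw [← hs.map_origin]
  exact hs.strictAnti.antitoneOn hs.left_mem ht ht.1

lemma map_lt {t : ℝ} (ht : t ∈ Ioc c b) : s t < c := by
  conv_rhs => rw [← hs.map_origin]
  exact hs.strictAnti hs.left_mem ⟨ht.1.le, ht.2⟩ ht.1

lemma map_le_self {t : ℝ} (ht : t ∈ Icc c b) : s t ≤ t := (hs.map_le ht).trans ht.1

lemma map_lt_self {t : ℝ} (ht : t ∈ Ioc c b) : s t < t := (hs.map_lt ht).trans ht.1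

lemma chordGap_pos {t τ : ℝ} (hf : BoundaryData G f) (ht : t ∈ Icc c b) (hτ : τ ∈ Icc c b)
    (h : t < τ) {y : ℝ × ℝ} (hy : y ∈ segment ℝ (G 0 (s τ)) (G 0 τ)) :
    0 < chordGap G (s t) t y := by
  obtain ⟨α, β, hα, hβ, hαβ, rfl⟩ := hy
  rw [chordGap_add _ _ _ _ _ _ _ hαβ]
  have h1 := hf.chordGap_curve_pos (hs.map_le_self ht) (Or.inl (hs.strictAnti ht hτ h))
  have h2 := hf.chordGap_curve_pos (hs.map_le_self ht) (Or.inr h)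
  rcases hα.eq_or_lt with rfl | hα'
  · rw [zero_add] at hαβ; rw [hαβ]; linarith
  · exact add_pos_of_pos_of_nonneg (mul_pos hα' h1) (mul_nonneg hβ h2.le)

lemma chordGap_neg {t τ : ℝ} (hf : BoundaryData G f) (ht : t ∈ Icc c b) (hτ : τ ∈ Icc c b)
    (h : τ < t) {y : ℝ × ℝ} (hy : y ∈ segment ℝ (G 0 (s τ)) (G 0 τ)) :
    chordGap G (s t) t y < 0 := by
  obtain ⟨α, β, hα, hβ, hαβ, rfl⟩ := hy
  rw [chordGap_add _ _ _ _ _ _ _ hαβ]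
  have h1 : chordGap G (s t) t (G 0 (s τ)) < 0 := hf.chordGap_curve_neg ⟨hs.strictAnti hτ ht h,
    (hs.map_le_self hτ).trans_lt h⟩
  have h2 : chordGap G (s t) t (G 0 τ) < 0 := hf.chordGap_curve_neg
    ⟨(hs.strictAnti hτ ht h).trans_le (hs.map_le_self hτ), h⟩
  rcases hα.eq_or_lt with rfl | hα'
  · rw [zero_add] at hαβ; rw [hαβ]; linarith
  · exact add_neg_of_neg_of_nonpos (mul_neg_of_pos_of_neg hα' h1)
      (mul_nonpos_of_nonneg_of_nonpos hβ h2.le)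

omit hs in
lemma chordGap_eq_zero (hf : BoundaryData G f) {t : ℝ} {y : ℝ × ℝ}
    (hy : y ∈ segment ℝ (G 0 (s t)) (G 0 t)) : chordGap G (s t) t y = 0 := by
  obtain ⟨α, β, -, -, hαβ, rfl⟩ := hy
  rw [chordGap_add _ _ _ _ _ _ _ hαβ, hf.chordGap_left, BoundaryData.chordGap_right]; ring

lemma hasDerivAt (hf : BoundaryData G f) {t : ℝ} (ht : t ∈ Ioo c b) : HasDerivAt s
    (-(deriv (kap2 G) t * (chordRatio G f (s t) t - tors G f t) *
        ((G 0 t).2 - (G 0 (s t)).2 - kap2 G (s t) * ((G 0 t).1 - (G 0 (s t)).1))) /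
      (deriv (kap2 G) (s t) * (chordRatio G f (s t) t - tors G f (s t)) *
        (kap2 G t * ((G 0 t).1 - (G 0 (s t)).1) - ((G 0 t).2 - (G 0 (s t)).2)))) t := by
  have ht' : t ∈ Ioc c b := ⟨ht.1, ht.2.le⟩
  have hne := (hs.map_lt_self ht').ne
  have hK := hf.kap2_sub_ne hne
  have hB := (mul_pos (mul_pos (hf.deriv_kap2_pos (s t)) (sub_pos.2 (hs.tors_left t ht')))
    (hf.gap_right_pos hne)).ne'
  have h1 := hasDerivAt_of_implicit (hf.hasFDerivAt_cupDefect hne)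
    (hs.continuousOn.continuousAt (Icc_mem_nhds ht.1 ht.2)) ?_ (div_ne_zero hB hK)
  · refine h1.congr_deriv ?_
    rw [neg_div, neg_div, div_div_div_cancel_right₀ hK]
  · filter_upwards [Ioo_mem_nhds ht.1 ht.2] with t' ht''
    rw [hs.defect t' ⟨ht''.1, ht''.2.le⟩, hs.defect t ht']

/-- The pairs of a cup depend on the parameter smoothly outside the origin. -/
lemma contDiffOn (hf : BoundaryData G f) {b' : ℝ} (hb' : b' < b) : ContDiffOn ℝ 1 s (Ioc c b') := by
  have hsc : ContinuousOn s (Ioo c b) := hs.continuousOn.mono Ioo_subset_Icc_self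
  have hne : ∀ t ∈ Ioo c b, s t ≠ t := fun t ht => (hs.map_lt_self ⟨ht.1, ht.2.le⟩).ne
  have k2 := hf.continuous_kap2
  have k3 := hf.continuous_kap3
  have g1 := hf.curve.continuous_fst
  have g2 := hf.curve.continuous_snd
  have hr : ContinuousOn (fun t => chordRatio G f (s t) t) (Ioo c b) := by
    refine ContinuousOn.congr (f := fun t => (kap3 G f t - kap3 G f (s t)) /
      (kap2 G t - kap2 G (s t))) ?_ fun t ht => BoundaryData.chordRatio_of_ne (hne t ht)
    exact (k3.continuousOn.sub (k3.comp_continuousOn hsc)).div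
      (k2.continuousOn.sub (k2.comp_continuousOn hsc)) fun t ht => hf.kap2_sub_ne (hne t ht)
  have hd1 : ContinuousOn (fun t => (G 0 t).1 - (G 0 (s t)).1) (Ioo c b) :=
    g1.continuousOn.sub (g1.comp_continuousOn hsc)
  have hd2 : ContinuousOn (fun t => (G 0 t).2 - (G 0 (s t)).2) (Ioo c b) :=
    g2.continuousOn.sub (g2.comp_continuousOn hsc)
  have hk' := hf.continuous_deriv_kap2
  have hθ := hf.continuous_tors
  refine ContDiffOn.mono (s := Ioo c b) ?_ fun t ht => ⟨ht.1, ht.2.trans_lt hb'⟩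
  rw [show (1 : WithTop ℕ∞) = 0 + 1 from rfl, contDiffOn_succ_iff_deriv_of_isOpen isOpen_Ioo]
  refine ⟨fun t ht => (hs.hasDerivAt hf ht).differentiableAt.differentiableWithinAt, by simp,
    contDiffOn_zero.2 ?_⟩
  refine ContinuousOn.congr ?_ fun t ht => (hs.hasDerivAt hf ht).deriv
  refine ContinuousOn.div (((hk'.continuousOn.mul (hr.sub hθ.continuousOn)).mul
    (hd2.sub ((k2.comp_continuousOn hsc).mul hd1))).neg)
    (((hk'.comp_continuousOn hsc).mul (hr.sub (hθ.comp_continuousOn hsc))).mul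
    ((k2.continuousOn.mul hd1).sub hd2)) fun t ht => ?_
  exact (mul_pos (mul_pos (hf.deriv_kap2_pos (s t)) (sub_pos.2 (hs.tors_left t ⟨ht.1, ht.2.le⟩)))
    (hf.gap_right_pos (hne t ht))).ne'

lemma continuousOn_chordRatio (hf : BoundaryData G f) :
    ContinuousOn (fun t => chordRatio G f (s t) t) (Icc c b) := by
  have hsc : ContinuousOn s (Ioc c b) := hs.continuousOn.mono Ioc_subset_Icc_self
  have k2 := hf.continuous_kap2
  have k3 := hf.continuous_kap3
  have hne : ∀ t ∈ Ioc c b, s t ≠ t := fun t ht => (hs.map_lt_self ht).ne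
  refine continuousOn_of_mean hf.continuous_tors.continuousAt (hs.continuousOn c hs.left_mem)
    hs.map_origin (ContinuousOn.congr (f := fun t => (kap3 G f t - kap3 G f (s t)) /
      (kap2 G t - kap2 G (s t))) ?_ fun t ht => BoundaryData.chordRatio_of_ne (hne t ht))
    fun t ht => hf.exists_tors_eq_chordRatio (hs.map_le_self ht)
  exact (k3.continuousOn.sub (k3.comp_continuousOn hsc)).div
    (k2.continuousOn.sub (k2.comp_continuousOn hsc)) fun t ht => hf.kap2_sub_ne (hne t ht)

lemma continuousOn_chordSlope (hf : BoundaryData G f) :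
    ContinuousOn (fun t => chordSlope G (s t) t) (Icc c b) := by
  have hsc : ContinuousOn s (Ioc c b) := hs.continuousOn.mono Ioc_subset_Icc_self
  have g1 := hf.curve.continuous_fst
  have g2 := hf.curve.continuous_snd
  have hne : ∀ t ∈ Ioc c b, s t ≠ t := fun t ht => (hs.map_lt_self ht).ne
  refine continuousOn_of_mean hf.continuous_kap2.continuousAt (hs.continuousOn c hs.left_mem)
    hs.map_origin (ContinuousOn.congr (f := fun t => ((G 0 t).2 - (G 0 (s t)).2) /
      ((G 0 t).1 - (G 0 (s t)).1)) ?_ fun t ht => BoundaryData.chordSlope_of_ne (hne t ht))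
    fun t ht => hf.exists_kap2_eq_chordSlope (hs.map_le_self ht)
  exact (g2.continuousOn.sub (g2.comp_continuousOn hsc)).div
    (g1.continuousOn.sub (g1.comp_continuousOn hsc)) fun t ht => hf.fst_sub_ne (hne t ht)

/-- The plane over the chord rotates around it as the chord moves. -/
lemma hasDerivAt_planeEval (hf : BoundaryData G f) {t : ℝ} (ht : t ∈ Ioo c b) :
    ∃ r' ≤ 0, ∀ x, HasDerivAt (fun t => planeEval (planeAt G f t (chordRatio G f (s t) t)) x)
      (r' * chordGap G (s t) t x) t := by
  have ht' : t ∈ Ioc c b := ⟨ht.1, ht.2.le⟩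
  have hne := (hs.map_lt_self ht').ne
  have hK := hf.kap2_sub_ne hne
  have hX := hf.gap_left_pos hne
  have hY := hf.gap_right_pos hne
  have hA := sub_pos.2 (hs.tors_left t ht')
  have hB := sub_pos.2 (hs.tors_right t ht')
  have hk := hf.deriv_kap2_pos t
  have hks := (hf.deriv_kap2_pos (s t)).ne'
  have hD : (G 0 t).1 - (G 0 (s t)).1 ≠ 0 := hf.fst_sub_ne hne
  have hD' : 0 < (G 0 t).1 - (G 0 (s t)).1 := sub_pos.2 (hf.curve.fst_lt.2 (hs.map_lt_self ht'))
  have hsd := hs.hasDerivAt hf ht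
  have hr : HasDerivAt (fun t => chordRatio G f (s t) t)
      (-(deriv (kap2 G) t * (chordRatio G f (s t) t - tors G f t) *
        ((G 0 t).1 - (G 0 (s t)).1) /
        (kap2 G t * ((G 0 t).1 - (G 0 (s t)).1) - ((G 0 t).2 - (G 0 (s t)).2)))) t := by
    have e1 := (hf.hasDerivAt_kap3 t).sub ((hf.hasDerivAt_kap3 (s t)).comp t hsd)
    have e2 := (hf.hasDerivAt_kap2 t).sub ((hf.hasDerivAt_kap2 (s t)).comp t hsd)
    have e3 := e1.div e2 hK
    have e4 : HasDerivAt (fun t => chordRatio G f (s t) t) _ t :=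
      e3.congr_of_eventuallyEq (by
        filter_upwards [Ioo_mem_nhds ht.1 ht.2] with t' ht''
        exact BoundaryData.chordRatio_of_ne (hs.map_lt_self ⟨ht''.1, ht''.2.le⟩).ne)
    refine e4.congr_deriv ?_
    have h3 := hf.chordRatio_mul (s t) t
    simp only [Pi.sub_apply, Function.comp]
    rw [← h3]
    set r := chordRatio G f (s t) t
    set X := (G 0 t).2 - (G 0 (s t)).2 - kap2 G (s t) * ((G 0 t).1 - (G 0 (s t)).1) with hXd
    set Y := kap2 G t * ((G 0 t).1 - (G 0 (s t)).1) - ((G 0 t).2 - (G 0 (s t)).2) with hYd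
    have hXY : (kap2 G t - kap2 G (s t)) * ((G 0 t).1 - (G 0 (s t)).1) = X + Y := by
      rw [hXd, hYd]; ring
    have hY' := hY.ne'
    have hA' := hA.ne'
    field_simp
    linear_combination (deriv (kap2 G) t * (r - tors G f t)) * hXY
  refine ⟨-(deriv (kap2 G) t * (chordRatio G f (s t) t - tors G f t) *
    ((G 0 t).1 - (G 0 (s t)).1) /
    (kap2 G t * ((G 0 t).1 - (G 0 (s t)).1) - ((G 0 t).2 - (G 0 (s t)).2))), ?_,
    fun x => (hf.hasDerivAt_planeEval hr x).congr_deriv ?_⟩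
  · exact neg_nonpos.2 (div_nonneg (mul_nonneg (mul_nonneg hk.le hB.le) hD'.le) hY.le)
  · have hm := hf.chordSlope_mul (s t) t
    have hq : ∀ A D Y : ℝ, A * D / Y = A * (D / Y) := fun A D Y => mul_div_assoc A D Y
    have hqY := div_mul_cancel₀ ((G 0 t).1 - (G 0 (s t)).1) hY.ne'
    rw [chordGap, hq]
    set q := ((G 0 t).1 - (G 0 (s t)).1) /
      (kap2 G t * ((G 0 t).1 - (G 0 (s t)).1) - ((G 0 t).2 - (G 0 (s t)).2))
    have key : q * chordSlope G (s t) t = q * kap2 G t - 1 := by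
      refine mul_right_cancel₀ hD ?_
      linear_combination q * hm - hqY
    linear_combination (-deriv (kap2 G) t * (chordRatio G f (s t) t - tors G f t) *
      (x.1 - (G 0 t).1)) * key

/-- The points of the fixed boundary or above it and on the upper chord or below it form the cup. -/
lemma mem_iUnion_iff (hf : BoundaryData G f) {x : ℝ × ℝ} :
    (∃ t ∈ Icc c b, x ∈ segment ℝ (G 0 (s t)) (G 0 t)) ↔
      (∃ p, (G 0 p).1 = x.1 ∧ (G 0 p).2 ≤ x.2) ∧ chordGap G (s b) b x ≤ 0 := by
  constructor
  · rintro ⟨t, ht, hx⟩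
    constructor
    · have hx' := hx
      obtain ⟨α, β, hα, hβ, hαβ, rfl⟩ := hx
      have hcv : Convex ℝ (range fun t => (G 0 t).1) :=
        (isPreconnected_range hf.curve.continuous_fst).ordConnected.convex
      obtain ⟨p, hp⟩ := hcv ⟨s t, rfl⟩ ⟨t, rfl⟩ hα hβ hαβ
      exact ⟨p, hp, hf.curve.le_snd_of_mem_segment rfl le_rfl rfl le_rfl hx' hp⟩
    · rcases ht.2.eq_or_lt with rfl | h
      · exact (chordGap_eq_zero hf hx).le
      · exact (hs.chordGap_neg hf hs.right_mem ht h hx).le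
  · rintro ⟨⟨p, hp1, hp2⟩, hx⟩
    have hge : ∀ t, chordGap G (s t) t (G 0 p) ≤ chordGap G (s t) t x := fun t => by
      simp only [chordGap, hp1]; linarith
    have hpb : s b ≤ p ∧ p ≤ b := by
      by_contra hcon
      have hcon' : p < s b ∨ b < p := by
        by_contra hh; push Not at hh; exact hcon hh
      exact ((hf.chordGap_curve_pos (hs.map_le_self hs.right_mem) hcon').trans_le (hge b)).not_ge hx
    -- the chord with one endpoint below `x`
    obtain ⟨t₀, ht₀, h0, hpt⟩ : ∃ t₀ ∈ Icc c b, 0 ≤ chordGap G (s t₀) t₀ x ∧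
        ∀ t ∈ Icc t₀ b, s t ≤ p ∧ p ≤ t := by
      rcases le_total c p with hcp | hcp
      · refine ⟨p, ⟨hcp, hpb.2⟩, (BoundaryData.chordGap_right _ _).symm.trans_le (hge p),
          fun t ht => ⟨(hs.map_le ⟨hcp.trans ht.1, ht.2⟩).trans hcp, ht.1⟩⟩
      · obtain ⟨t₀, ht₀, rfl⟩ := intermediate_value_Icc' hs.lt.le hs.continuousOn
          (show p ∈ Icc (s b) (s c) from ⟨hpb.1, by rwa [hs.map_origin]⟩)
        refine ⟨t₀, ht₀, (hf.chordGap_left _ _).symm.trans_le (hge t₀), fun t ht =>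
          ⟨hs.strictAnti.antitoneOn ht₀ ⟨ht₀.1.trans ht.1, ht.2⟩ ht.1,
            hcp.trans (ht₀.1.trans ht.1)⟩⟩
    have hcont : ContinuousOn (fun t => chordGap G (s t) t x) (Icc t₀ b) :=
      ((continuousOn_const.sub hf.curve.continuous_snd.continuousOn).sub
        ((hs.continuousOn_chordSlope hf).mul
          (continuousOn_const.sub hf.curve.continuous_fst.continuousOn))).mono
        (Icc_subset_Icc_left ht₀.1)
    obtain ⟨τ, hτ, hτ0⟩ := intermediate_value_Icc' ht₀.2 hcont ⟨hx, h0⟩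
    have hm := hpt τ hτ
    refine ⟨τ, ⟨ht₀.1.trans hτ.1, hτ.2⟩, IsTangentPair.mem_segment_of_slope
      (m := chordSlope G (s τ) τ) (hf.chordSlope_mul _ _).symm ?_ ?_ ?_⟩
    · have h1 := hf.chordGap_left (s τ) τ
      simp only [chordGap] at hτ0 h1
      linarith
    · rw [← hp1]; exact hf.curve.fst_le.2 hm.1
    · rw [← hp1]; exact hf.curve.fst_le.2 hm.2

end IsCup

/-- Parameter of the right endpoint of the chord of the cup that passes through `x`. -/
def chordParam (G : ℝ → ℝ → ℝ × ℝ) (c b : ℝ) (s : ℝ → ℝ) (x : ℝ × ℝ) : ℝ :=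
  Classical.epsilon fun t => t ∈ Icc c b ∧ x ∈ segment ℝ (G 0 (s t)) (G 0 t)

namespace IsCup

variable {G : ℝ → ℝ → ℝ × ℝ} {f : ℝ → ℝ} {c b : ℝ} {s : ℝ → ℝ} (hs : IsCup G f c b s)

omit hs in
lemma chordParam_spec {x : ℝ × ℝ} (hx : ∃ t ∈ Icc c b, x ∈ segment ℝ (G 0 (s t)) (G 0 t)) :
    chordParam G c b s x ∈ Icc c b ∧
      x ∈ segment ℝ (G 0 (s (chordParam G c b s x))) (G 0 (chordParam G c b s x)) :=
  Classical.epsilon_spec (p := fun t => t ∈ Icc c b ∧ x ∈ segment ℝ (G 0 (s t)) (G 0 t)) hx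

include hs

lemma chordParam_eq (hf : BoundaryData G f) {x : ℝ × ℝ} {t : ℝ} (ht : t ∈ Icc c b)
    (hx : x ∈ segment ℝ (G 0 (s t)) (G 0 t)) : chordParam G c b s x = t := by
  obtain ⟨h1, h2⟩ := chordParam_spec ⟨t, ht, hx⟩
  rcases lt_trichotomy (chordParam G c b s x) t with h | h | h
  · exact absurd (chordGap_eq_zero hf h2) (hs.chordGap_pos hf h1 ht h hx).ne'
  · exact h
  · exact absurd (chordGap_eq_zero hf h2) (hs.chordGap_neg hf h1 ht h hx).ne

lemma chordParam_lt_iff (hf : BoundaryData G f) {x : ℝ × ℝ}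
    (hx : ∃ t ∈ Icc c b, x ∈ segment ℝ (G 0 (s t)) (G 0 t)) {t : ℝ} (ht : t ∈ Icc c b) :
    chordParam G c b s x < t ↔ chordGap G (s t) t x < 0 := by
  obtain ⟨h1, h2⟩ := chordParam_spec hx
  refine ⟨fun h => hs.chordGap_neg hf ht h1 h h2, fun h => ?_⟩
  by_contra! hcon
  rcases hcon.eq_or_lt with heq | hlt
  · rw [← heq] at h2; exact h.ne (chordGap_eq_zero hf h2)
  · exact (hs.chordGap_pos hf ht h1 hlt h2).not_gt h

lemma lt_chordParam_iff (hf : BoundaryData G f) {x : ℝ × ℝ}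
    (hx : ∃ t ∈ Icc c b, x ∈ segment ℝ (G 0 (s t)) (G 0 t)) {t : ℝ} (ht : t ∈ Icc c b) :
    t < chordParam G c b s x ↔ 0 < chordGap G (s t) t x := by
  obtain ⟨h1, h2⟩ := chordParam_spec hx
  refine ⟨fun h => hs.chordGap_pos hf ht h1 h h2, fun h => ?_⟩
  by_contra! hcon
  rcases hcon.eq_or_lt with heq | hlt
  · rw [heq] at h2; exact h.ne' (chordGap_eq_zero hf h2)
  · exact (hs.chordGap_neg hf ht h1 hlt h2).not_gt h

lemma continuousOn_chordParam (hf : BoundaryData G f) : ContinuousOn (chordParam G c b s)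
    {x | ∃ t ∈ Icc c b, x ∈ segment ℝ (G 0 (s t)) (G 0 t)} := by
  intro x hx
  have h1 := (chordParam_spec hx).1
  refine tendsto_order.2 ⟨fun a ha => ?_, fun a ha => ?_⟩
  · rcases lt_or_ge a c with h | h
    · filter_upwards [self_mem_nhdsWithin] with y hy using h.trans_le (chordParam_spec hy).1.1
    · have ha' : a ∈ Icc c b := ⟨h, ha.le.trans h1.2⟩
      filter_upwards [self_mem_nhdsWithin, mem_nhdsWithin_of_mem_nhds
        ((continuous_chordGap G (s a) a).continuousAt.eventually
          (lt_mem_nhds ((hs.lt_chordParam_iff hf hx ha').1 ha)))] with y hy h2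
      exact (hs.lt_chordParam_iff hf hy ha').2 h2
  · rcases lt_or_ge b a with h | h
    · filter_upwards [self_mem_nhdsWithin] with y hy using (chordParam_spec hy).1.2.trans_lt h
    · have ha' : a ∈ Icc c b := ⟨h1.1.trans ha.le, h⟩
      filter_upwards [self_mem_nhdsWithin, mem_nhdsWithin_of_mem_nhds
        ((continuous_chordGap G (s a) a).continuousAt.eventually
          (gt_mem_nhds ((hs.chordParam_lt_iff hf hx ha').1 ha)))] with y hy h2
      exact (hs.chordParam_lt_iff hf hy ha').2 h2

/-- The plane over the chord through `y` is the lowest at `y` among the planes over the chords. -/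
lemma planeEval_le (hf : BoundaryData G f) {t τ : ℝ} (ht : t ∈ Icc c b) (hτ : τ ∈ Icc c b)
    {y : ℝ × ℝ} (hy : y ∈ segment ℝ (G 0 (s τ)) (G 0 τ)) :
    planeEval (planeAt G f τ (chordRatio G f (s τ) τ)) y ≤
      planeEval (planeAt G f t (chordRatio G f (s t) t)) y := by
  have hc : ContinuousOn (fun t => planeEval (planeAt G f t (chordRatio G f (s t) t)) y)
      (Icc c b) := by
    have := hf.continuousOn_planeAt (hs.continuousOn_chordRatio hf)
    exact (this.fst.add (this.snd.fst.mul continuousOn_const)).add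
      (this.snd.snd.mul continuousOn_const)
  rcases le_total t τ with h | h
  · have hsub : Icc t τ ⊆ Icc c b := Icc_subset_Icc ht.1 hτ.2
    refine antitoneOn_of_deriv_nonpos (convex_Icc t τ) (hc.mono hsub)
      (fun x hx => ?_) (fun x hx => ?_) (left_mem_Icc.2 h) (right_mem_Icc.2 h) h <;>
      rw [interior_Icc] at hx <;>
      obtain ⟨r', hr', hd⟩ := hs.hasDerivAt_planeEval hf
        (show x ∈ Ioo c b from ⟨ht.1.trans_lt hx.1, hx.2.trans_le hτ.2⟩)
    · exact (hd y).differentiableAt.differentiableWithinAt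
    · rw [(hd y).deriv]
      exact mul_nonpos_of_nonpos_of_nonneg hr'
        (hs.chordGap_pos hf (hsub ⟨hx.1.le, hx.2.le⟩) hτ hx.2 hy).le
  · have hsub : Icc τ t ⊆ Icc c b := Icc_subset_Icc hτ.1 ht.2
    refine monotoneOn_of_deriv_nonneg (convex_Icc τ t) (hc.mono hsub)
      (fun x hx => ?_) (fun x hx => ?_) (left_mem_Icc.2 h) (right_mem_Icc.2 h) h <;>
      rw [interior_Icc] at hx <;>
      obtain ⟨r', hr', hd⟩ := hs.hasDerivAt_planeEval hf
        (show x ∈ Ioo c b from ⟨hτ.1.trans_lt hx.1, hx.2.trans_le ht.2⟩)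
    · exact (hd y).differentiableAt.differentiableWithinAt
    · rw [(hd y).deriv]
      exact mul_nonneg_of_nonpos_of_nonpos hr'
        (hs.chordGap_neg hf (hsub ⟨hx.1.le, hx.2.le⟩) hτ hx.1 hy).le

lemma supports (hf : BoundaryData G f) (S : Set (ℝ × ℝ)) :
    Supports S (fun x => planeAt G f (chordParam G c b s x)
      (chordRatio G f (s (chordParam G c b s x)) (chordParam G c b s x)))
      {x | ∃ t ∈ Icc c b, x ∈ segment ℝ (G 0 (s t)) (G 0 t)} := fun _ hx _ hy _ =>
  hs.planeEval_le hf (chordParam_spec hx).1 (chordParam_spec hy).1 (chordParam_spec hy).2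

/-- The plane over a chord contains the chord of the curve `(g, f)`. -/
lemma planeEval_chord (hf : BoundaryData G f) {t : ℝ} (ht : t ∈ Icc c b) :
    planeEval (planeAt G f t (chordRatio G f (s t) t)) (G 0 (s t)) = f (s t) := by
  rcases ht.1.eq_or_lt with rfl | h
  · rw [hs.map_origin, planeEval_planeAt_self]
  have ht' : t ∈ Ioc c b := ⟨h, ht.2⟩
  have h1 := hs.defect t ht'
  have h2 := hf.chordRatio_mul (s t) t
  rw [cupDefect, ← BoundaryData.chordRatio_of_ne (hs.map_lt_self ht').ne] at h1
  rw [planeEval_planeAt]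
  linear_combination h1 + ((G 0 t).1 - (G 0 (s t)).1) * h2

lemma cupEquation (hf : BoundaryData G f) {t : ℝ} (ht : t ∈ Icc c b) :
    CupEquation G f (s t) t := by
  rcases ht.1.eq_or_lt with rfl | h
  · rw [hs.map_origin]
    simp [CupEquation, det3, Matrix.det_fin_three, Matrix.of_apply]
  · exact (hf.cupEquation_iff (hs.map_lt_self ⟨h, ht.2⟩).ne).2 (hs.defect t ⟨h, ht.2⟩)

lemma det3_pos (hf : BoundaryData G f) {t : ℝ} (ht : t ∈ Ioc c b) :
    0 < (t - s t) * det3 (gam1 G f t) (gam1 G f (s t)) (gam2 G f t) := by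
  have h1 := hs.map_lt_self ht
  have h2 := hs.tors_right t ht
  rw [hf.det3_gam2, ← BoundaryData.chordRatio_comm (s t) t]
  refine mul_pos (sub_pos.2 h1) (mul_pos_of_neg_of_neg (mul_neg_of_pos_of_neg ?_
    (sub_neg.2 (hf.strictMono_kap2 h1))) (sub_neg.2 h2))
  exact mul_pos (mul_pos (pow_pos (hf.curve.pos t) 2) (hf.curve.pos _)) (hf.deriv_kap2_pos t)

lemma differential_ne_zero (hf : BoundaryData G f) :
    differential G f (s b) b ≠ 0 ∧ differential G f b (s b) ≠ 0 := by
  have hb : b ∈ Ioc c b := right_mem_Ioc.2 hs.lt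
  refine ⟨hf.differential_ne_zero (hs.map_lt_self hb).ne (hs.tors_left b hb).ne,
    hf.differential_ne_zero (hs.map_lt_self hb).ne' ?_⟩
  rw [← BoundaryData.chordRatio_comm (s b) b]
  exact (hs.tors_right b hb).ne

end IsCup

end
end BellmanFoliation

namespace BellmanFoliation
noncomputable section

/-! ### Foliations with prescribed angles -/

/-- Central figure of the part of the foliation between two neighboring angles: a full cup, a
multicup, or one of the infinities. -/
inductive Core
  | cup (c b : ℝ) (s : ℝ → ℝ)
  | multicup (l r : EReal)
  | minusInf
  | plusInf

namespace Core

/-- Left end of the arc of the fixed boundary under a central figure. -/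
def left : Core → EReal
  | cup _ b s => (s b : ℝ)
  | multicup l _ => l
  | minusInf => ⊥
  | plusInf => ⊤

/-- Right end of the arc of the fixed boundary under a central figure. -/
def right : Core → EReal
  | cup _ b _ => b
  | multicup _ r => r
  | minusInf => ⊥
  | plusInf => ⊤

/-- A real point between two extended real numbers. -/
def point (l r : EReal) : ℝ := Classical.epsilon fun t => t ∈ realIcc l r

/-- Slope in the vertical direction of the plane over the border of a central figure. -/
def val (G : ℝ → ℝ → ℝ × ℝ) (f : ℝ → ℝ) : Core → ℝ
  | cup _ b s => chordRatio G f (s b) b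
  | multicup l r => tors G f (point l r)
  | minusInf => 0
  | plusInf => 0

/-- The plane at a point of a central figure. -/
def plane (G : ℝ → ℝ → ℝ × ℝ) (f : ℝ → ℝ) : Core → ℝ × ℝ → ℝ × ℝ × ℝ
  | cup c b s, x => planeAt G f (chordParam G c b s x)
      (chordRatio G f (s (chordParam G c b s x)) (chordParam G c b s x))
  | multicup l r, _ => planeAt G f (point l r) (tors G f (point l r))
  | minusInf, _ => 0
  | plusInf, _ => 0

/-- A full cup is bounded from above by a chord tangent to the free boundary; the arc of a
multicup is too long to be covered by chords inside the domain. -/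
def Valid (G : ℝ → ℝ → ℝ × ℝ) (f : ℝ → ℝ) (ε : ℝ) : Core → Prop
  | cup c b s => (∃ b' > b, IsCup G f c b' s) ∧ c < b ∧
      tanPar (G ε) Side.L (G 0 (s b)) = tanPar (G ε) Side.R (G 0 b)
  | multicup l r => l < r ∧ ConstOn (tors G f) (realIcc l r) ∧ ∃ t₁ ∈ realIcc l r,
      ∃ t₂ ∈ realIcc l r, t₁ < t₂ ∧ tanPar (G ε) Side.L (G 0 t₁) < tanPar (G ε) Side.R (G 0 t₂)
  | minusInf => True
  | plusInf => True

lemma point_mem {l r : EReal} (h : l < r) : point l r ∈ realIcc l r := by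
  obtain ⟨t, h1, h2⟩ := EReal.lt_iff_exists_real_btwn.1 h
  exact Classical.epsilon_spec (p := fun t => t ∈ realIcc l r) ⟨t, h1.le, h2.le⟩

end Core

variable {n : ℕ}

/-- Left neighbor of the `i`-th central figure: an angle or `-∞`. -/
def leftSink (u : Fin n → ℝ) : Fin (n + 1) → EReal := Fin.cons ⊥ fun k => (u k : EReal)

/-- Right neighbor of the `i`-th central figure: an angle or `+∞`. -/
def rightSink (u : Fin n → ℝ) : Fin (n + 1) → EReal :=
  Fin.snoc (α := fun _ => EReal) (fun k => (u k : EReal)) ⊤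

@[simp] lemma leftSink_zero (u : Fin n → ℝ) : leftSink u 0 = ⊥ := rfl

@[simp] lemma leftSink_succ (u : Fin n → ℝ) (k : Fin n) : leftSink u k.succ = u k := rfl

@[simp] lemma rightSink_last (u : Fin n → ℝ) : rightSink u (Fin.last n) = ⊤ := by simp [rightSink]

@[simp] lemma rightSink_castSucc (u : Fin n → ℝ) (k : Fin n) : rightSink u k.castSucc = u k := by
  simp [rightSink]

/-- The data that determine a foliation: central figures, vertices of the angles, and
solutions of the equations along the tangents drawn to the right and to the left of
each central figure. -/
structure FoliationData (n : ℕ) where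
  core : Fin (n + 1) → Core
  u : Fin n → ℝ
  βR : Fin (n + 1) → ℝ → ℝ
  βL : Fin (n + 1) → ℝ → ℝ

/-- Figures of the foliation. -/
inductive Piece (n : ℕ)
  | angle (k : Fin n)
  | right (i : Fin (n + 1))
  | left (i : Fin (n + 1))
  | core (i : Fin (n + 1))

instance : Finite (Piece n) :=
  Finite.of_surjective (α := Fin n ⊕ Fin (n + 1) ⊕ Fin (n + 1) ⊕ Fin (n + 1))
    (fun x => match x with
      | .inl k => .angle k
      | .inr (.inl i) => .right i
      | .inr (.inr (.inl i)) => .left i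
      | .inr (.inr (.inr i)) => .core i)
    (fun x => match x with
      | .angle k => ⟨.inl k, rfl⟩
      | .right i => ⟨.inr (.inl i), rfl⟩
      | .left i => ⟨.inr (.inr (.inl i)), rfl⟩
      | .core i => ⟨.inr (.inr (.inr i)), rfl⟩)

namespace FoliationData

variable (D : FoliationData n) (G : ℝ → ℝ → ℝ × ℝ) (f : ℝ → ℝ) (ε : ℝ)

/-- Conditions under which the data give a foliation and a smooth locally concave function. -/
structure Valid : Prop where
  core_valid : ∀ i, (D.core i).Valid G f ε
  le_left : ∀ i, leftSink D.u i ≤ (D.core i).left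
  lt_left : ∀ i, (D.core i).left ≠ ⊥ → leftSink D.u i < (D.core i).left
  right_le : ∀ i, (D.core i).right ≤ rightSink D.u i
  right_lt : ∀ i, (D.core i).right ≠ ⊤ → (D.core i).right < rightSink D.u i
  solR : ∀ i, (D.core i).right ≠ ⊤ → IsRelaxation (rate G ε Side.R) (tors G f) (D.βR i)
  solL : ∀ i, (D.core i).left ≠ ⊥ → IsRelaxation (rate G ε Side.L) (tors G f) (D.βL i)
  initR : ∀ i, ∀ b : ℝ, (D.core i).right = b → D.βR i b = (D.core i).val G f
  initL : ∀ i, ∀ a : ℝ, (D.core i).left = a → D.βL i a = (D.core i).val G f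
  leR : ∀ i, ∀ t ∈ realIcc (D.core i).right (rightSink D.u i), tors G f t ≤ D.βR i t
  leL : ∀ i, ∀ t ∈ realIcc (leftSink D.u i) (D.core i).left, tors G f t ≤ D.βL i t
  ltR : ∀ i, ∀ t ∈ realIoo (D.core i).right (rightSink D.u i), tors G f t < D.βR i t
  ltL : ∀ i, ∀ t ∈ realIoo (leftSink D.u i) (D.core i).left, tors G f t < D.βL i t
  decayR : ∀ i, (D.core i).right = ⊥ → ∀ t, Tendsto
    (fun s => Real.exp (-∫ x in s..t, rate G ε Side.R x) * (D.βR i s - tors G f s)) atBot (𝓝 0)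
  decayL : ∀ i, (D.core i).left = ⊤ → ∀ t, Tendsto
    (fun s => Real.exp (-∫ x in s..t, rate G ε Side.L x) * (D.βL i s - tors G f s)) atTop (𝓝 0)
  matching : ∀ k : Fin n, D.βR k.castSucc (D.u k) = D.βL k.succ (D.u k)

/-- Regions of the figures in terms of the two tangents through a point. -/
def region : Piece n → Set (ℝ × ℝ)
  | .angle k => {x | x ∈ strip (G 0) (G ε) ∧ base (G 0) (G ε) Side.L x ≤ D.u k ∧
      D.u k ≤ base (G 0) (G ε) Side.R x}
  | .right i => {x | x ∈ strip (G 0) (G ε) ∧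
      base (G 0) (G ε) Side.R x ∈ realIcc (D.core i).right (rightSink D.u i)}
  | .left i => {x | x ∈ strip (G 0) (G ε) ∧
      base (G 0) (G ε) Side.L x ∈ realIcc (leftSink D.u i) (D.core i).left}
  | .core i => {x | x ∈ strip (G 0) (G ε) ∧ (D.core i).left ≤ base (G 0) (G ε) Side.L x ∧
      base (G 0) (G ε) Side.R x ≤ (D.core i).right}

/-- The planes on a figure. -/
def planeOn : Piece n → ℝ × ℝ → ℝ × ℝ × ℝ
  | .angle k, _ => planeAt G f (D.u k) (D.βR k.castSucc (D.u k))
  | .right i, x => planeAt G f (base (G 0) (G ε) Side.R x) (D.βR i (base (G 0) (G ε) Side.R x))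
  | .left i, x => planeAt G f (base (G 0) (G ε) Side.L x) (D.βL i (base (G 0) (G ε) Side.L x))
  | .core i, x => (D.core i).plane G f x

/-- Some figure that contains a point. -/
def pieceOf (x : ℝ × ℝ) : Piece n :=
  @Classical.epsilon _ ⟨.right 0⟩ fun j => x ∈ D.region G ε j

/-- The field of planes given by the data. -/
def field (x : ℝ × ℝ) : ℝ × ℝ × ℝ := D.planeOn G f ε (D.pieceOf G ε x) x

/-- The function given by the data. -/
def candidate (x : ℝ × ℝ) : ℝ := planeEval (D.field G f ε x) x

variable {D G f ε}

lemma region_subset (j : Piece n) : D.region G ε j ⊆ strip (G 0) (G ε) := by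
  cases j <;> exact fun x hx => hx.1

end FoliationData

lemma realIcc_ordConnected (l r : EReal) : (realIcc l r).OrdConnected :=
  ⟨fun _ hx _ hy _ hz => ⟨hx.1.trans (EReal.coe_le_coe_iff.2 hz.1),
    (EReal.coe_le_coe_iff.2 hz.2).trans hy.2⟩⟩

lemma isClosed_realIcc (l r : EReal) : IsClosed (realIcc l r) :=
  (isClosed_le continuous_const continuous_coe_real_ereal).inter
    (isClosed_le continuous_coe_real_ereal continuous_const)

lemma isOpen_realIoo (l r : EReal) : IsOpen (realIoo l r) :=
  (isOpen_lt continuous_const continuous_coe_real_ereal).inter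
    (isOpen_lt continuous_coe_real_ereal continuous_const)

lemma continuousOn_of_cover {X Y : Type*} [TopologicalSpace X] [TopologicalSpace Y] {S : Set X}
    {φ : X → Y} {ι : Type*} [Finite ι] {ω : ι → Set X} (hcov : S ⊆ ⋃ i, ω i)
    (hcl : ∀ i, ∀ x ∈ S, x ∈ closure (ω i) → x ∈ ω i) (h : ∀ i, ContinuousOn φ (ω i)) :
    ContinuousOn φ S := by
  intro x hx
  refine ContinuousWithinAt.mono ?_ hcov
  rw [ContinuousWithinAt, nhdsWithin_iUnion, tendsto_iSup]
  intro i
  by_cases hi : x ∈ closure (ω i)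
  · exact h i x (hcl i x hx hi)
  · rw [notMem_closure_iff_nhdsWithin_eq_bot.1 hi]; exact tendsto_bot

/-- A relatively closed part of `S` cut out by a closed condition on a function. -/
lemma mem_of_mem_closure_preimage {X Y : Type*} [TopologicalSpace X] [TopologicalSpace Y]
    {S : Set X} {φ : X → Y} (hφ : ContinuousOn φ S) {C : Set Y} (hC : IsClosed C) {x : X}
    (hx : x ∈ S) (h : x ∈ closure {y | y ∈ S ∧ φ y ∈ C}) : φ x ∈ C := by
  rw [← hC.closure_eq]
  refine ContinuousWithinAt.mem_closure (f := φ) (s := {y | y ∈ S ∧ φ y ∈ C})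
    ((hφ x hx).mono fun y hy => hy.1) h fun y hy => hy.2

end
end BellmanFoliation

namespace BellmanFoliation
noncomputable section

/-! ### Mutual position of the figures -/

variable {n : ℕ}

namespace FoliationData

/-- Valid data over an admissible family of curves. -/
structure Admissible (D : FoliationData n) (εmax : EReal) (G : ℝ → ℝ → ℝ × ℝ) (f : ℝ → ℝ) (ε : ℝ) :
    Prop where
  family : AdmissibleFamily εmax G
  mem : ε ∈ paramSet εmax
  pos : 0 < ε
  boundary : BoundaryData G f
  valid : D.Valid G f ε

namespace Admissible

variable {D : FoliationData n} {εmax : EReal} {G : ℝ → ℝ → ℝ × ℝ} {f : ℝ → ℝ} {ε : ℝ}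
  (H : D.Admissible εmax G f ε)
include H

lemma pair : IsTangentPair (G 0) (G ε) := H.family.isTangentPair H.mem H.pos

lemma cup_spec {i : Fin (n + 1)} {c b : ℝ} {s : ℝ → ℝ} (hi : D.core i = .cup c b s) :
    IsCup G f c b s ∧ tanPar (G ε) Side.L (G 0 (s b)) = tanPar (G ε) Side.R (G 0 b) := by
  have h := H.valid.core_valid i
  rw [hi] at h
  obtain ⟨⟨b', hb', h1⟩, h2, h3⟩ := h
  exact ⟨h1.restrict h2 hb'.le, h3⟩

lemma left_le_right (i : Fin (n + 1)) : (D.core i).left ≤ (D.core i).right := by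
  cases hi : D.core i with
  | cup c b s =>
    have h := (H.cup_spec hi).1
    exact EReal.coe_le_coe_iff.2 (h.map_le_self h.right_mem)
  | multicup l r =>
    have h := H.valid.core_valid i
    rw [hi] at h
    exact h.1.le
  | minusInf => exact le_rfl
  | plusInf => exact le_rfl

/-- The central figures separate the tangents of the two types. -/
lemma tangency_le {i : Fin (n + 1)} {a b : ℝ} (ha : (D.core i).left = a)
    (hb : (D.core i).right = b) :
    tanPar (G ε) Side.L (G 0 a) ≤ tanPar (G ε) Side.R (G 0 b) := by
  cases hi : D.core i with
  | cup c b' s =>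
    have h := (H.cup_spec hi).2
    rw [hi] at ha hb
    rw [← EReal.coe_eq_coe_iff.1 ha, ← EReal.coe_eq_coe_iff.1 hb, h]
  | multicup l r =>
    have h := H.valid.core_valid i
    rw [hi] at h ha hb
    obtain ⟨-, -, t₁, ht₁, t₂, ht₂, -, h2⟩ := h
    simp only [Core.left, Core.right] at ha hb
    rw [ha, hb] at ht₁ ht₂
    exact (((H.pair.strictMono_tangency Side.L).monotone (EReal.coe_le_coe_iff.1 ht₁.1)).trans
      h2.le).trans ((H.pair.strictMono_tangency Side.R).monotone (EReal.coe_le_coe_iff.1 ht₂.2))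
  | minusInf => rw [hi] at ha; exact absurd ha (by simp [Core.left])
  | plusInf => rw [hi] at ha; exact absurd ha (by simp [Core.left])

lemma tangency_le_tangency {x : ℝ × ℝ} (hx : x ∈ strip (G 0) (G ε)) :
    tanPar (G ε) Side.R (G 0 (base (G 0) (G ε) Side.R x)) ≤
      tanPar (G ε) Side.L (G 0 (base (G 0) (G ε) Side.L x)) := by
  rw [H.pair.tangency_base, H.pair.tangency_base]; exact H.pair.tanPar_le hx

lemma left_le_of_mem_right {i : Fin (n + 1)} {x : ℝ × ℝ} (hx : x ∈ D.region G ε (.right i)) :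
    (D.core i).left ≤ base (G 0) (G ε) Side.L x := by
  obtain ⟨hxS, hx1, -⟩ := hx
  have hne : (D.core i).right ≠ ⊤ := fun h => by
    rw [h] at hx1; exact absurd hx1 (not_le.2 (EReal.coe_lt_top _))
  induction ha : (D.core i).left with
  | bot => exact bot_le
  | top => exact absurd (top_le_iff.1 (ha ▸ H.left_le_right i)) hne
  | coe a =>
    induction hb : (D.core i).right with
    | bot =>
      have := H.left_le_right i
      rw [ha, hb] at this
      exact absurd this (not_le.2 (EReal.bot_lt_coe a))
    | top => exact absurd hb hne
    | coe b =>
      rw [hb] at hx1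
      refine EReal.coe_le_coe_iff.2 ((H.pair.strictMono_tangency Side.L).le_iff_le.1 ?_)
      exact (H.tangency_le ha hb).trans (((H.pair.strictMono_tangency Side.R).monotone
        (EReal.coe_le_coe_iff.1 hx1)).trans (H.tangency_le_tangency hxS))

lemma le_right_of_mem_left {i : Fin (n + 1)} {x : ℝ × ℝ} (hx : x ∈ D.region G ε (.left i)) :
    base (G 0) (G ε) Side.R x ≤ (D.core i).right := by
  obtain ⟨hxS, -, hx1⟩ := hx
  have hne : (D.core i).left ≠ ⊥ := fun h => by
    rw [h] at hx1; exact absurd hx1 (not_le.2 (EReal.bot_lt_coe _))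
  induction hb : (D.core i).right with
  | top => exact le_top
  | bot => exact absurd (le_bot_iff.1 (hb ▸ H.left_le_right i)) hne
  | coe b =>
    induction ha : (D.core i).left with
    | top =>
      have := H.left_le_right i
      rw [ha, hb] at this
      exact absurd this (not_le.2 (EReal.coe_lt_top b))
    | bot => exact absurd ha hne
    | coe a =>
      rw [ha] at hx1
      refine EReal.coe_le_coe_iff.2 ((H.pair.strictMono_tangency Side.R).le_iff_le.1 ?_)
      exact (H.tangency_le_tangency hxS).trans (((H.pair.strictMono_tangency Side.L).monotone
        (EReal.coe_le_coe_iff.1 hx1)).trans (H.tangency_le ha hb))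

lemma base_le {x : ℝ × ℝ} (hx : x ∈ strip (G 0) (G ε)) :
    (base (G 0) (G ε) Side.L x : EReal) ≤ base (G 0) (G ε) Side.R x :=
  EReal.coe_le_coe_iff.2 (H.pair.base_L_le_base_R hx)

lemma u_lt_core (k : Fin n) : (D.u k : EReal) < (D.core k.succ).left := by
  have := H.valid.lt_left k.succ fun h => by
    have := H.valid.le_left k.succ
    rw [h, leftSink_succ] at this
    exact absurd this (not_le.2 (EReal.bot_lt_coe _))
  rwa [leftSink_succ] at this

lemma core_lt_u (k : Fin n) : (D.core k.castSucc).right < (D.u k : EReal) := by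
  have := H.valid.right_lt k.castSucc fun h => by
    have := H.valid.right_le k.castSucc
    rw [h, rightSink_castSucc] at this
    exact absurd this (not_le.2 (EReal.coe_lt_top _))
  rwa [rightSink_castSucc] at this

lemma sink_lt_sink (i : Fin (n + 1)) : leftSink D.u i < rightSink D.u i := by
  rcases eq_or_ne (D.core i).left ⊥ with h | h
  · rcases eq_or_ne (D.core i).right ⊤ with h' | h'
    · refine lt_of_le_of_ne ((H.valid.le_left i).trans ((H.left_le_right i).trans
        (H.valid.right_le i))) fun heq => ?_
      have h1 := H.valid.le_left i
      have h2 := H.valid.right_le i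
      rw [h, le_bot_iff] at h1
      rw [h', top_le_iff, ← heq, h1] at h2
      exact absurd h2 (by simp)
    · exact (H.valid.le_left i).trans_lt ((H.left_le_right i).trans_lt (H.valid.right_lt i h'))
  · exact (H.valid.lt_left i h).trans_le ((H.left_le_right i).trans (H.valid.right_le i))

lemma strictMono_u : StrictMono D.u := by
  cases n with
  | zero => exact fun i => i.elim0
  | succ m =>
    refine Fin.strictMono_iff_lt_succ.2 fun k => ?_
    have := H.sink_lt_sink k.succ.castSucc
    have h1 : leftSink D.u k.succ.castSucc = D.u k.castSucc := by
      rw [← Fin.succ_castSucc, leftSink_succ]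
    rw [h1, rightSink_castSucc] at this
    exact EReal.coe_lt_coe_iff.1 this

omit H in
lemma exists_of_lt {i j : Fin (n + 1)} (hij : i < j) :
    ∃ k l : Fin n, i = k.castSucc ∧ j = l.succ ∧ k ≤ l := by
  induction i using Fin.lastCases with
  | last => exact absurd hij (Fin.le_last j).not_gt
  | cast k =>
    induction j using Fin.cases with
    | zero => exact absurd hij (Fin.zero_le _).not_gt
    | succ l => exact ⟨k, l, rfl, rfl, Fin.castSucc_lt_succ_iff.1 hij⟩

/-- All figures between two neighboring angles lie between their two vertices. -/
lemma slab {i : Fin (n + 1)} {x : ℝ × ℝ} (hx : x ∈ D.region G ε (.right i) ∨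
    x ∈ D.region G ε (.left i) ∨ x ∈ D.region G ε (.core i)) :
    leftSink D.u i ≤ base (G 0) (G ε) Side.L x ∧ base (G 0) (G ε) Side.R x ≤ rightSink D.u i := by
  rcases hx with hx | hx | hx
  · exact ⟨(H.valid.le_left i).trans (H.left_le_of_mem_right hx), hx.2.2⟩
  · exact ⟨hx.2.1, (H.le_right_of_mem_left hx).trans (H.valid.right_le i)⟩
  · exact ⟨(H.valid.le_left i).trans hx.2.1, hx.2.2.trans (H.valid.right_le i)⟩

lemma exists_piece {x : ℝ × ℝ} (hx : x ∈ strip (G 0) (G ε)) : ∃ j, x ∈ D.region G ε j := by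
  have hle := H.pair.base_L_le_base_R hx
  by_cases hang : ∃ k, base (G 0) (G ε) Side.L x ≤ D.u k ∧ D.u k ≤ base (G 0) (G ε) Side.R x
  · obtain ⟨k, hk⟩ := hang; exact ⟨.angle k, hx, hk⟩
  push Not at hang
  -- the central figure between the angles surrounding `x`
  obtain ⟨i, h1, h2⟩ : ∃ i, leftSink D.u i ≤ base (G 0) (G ε) Side.L x ∧
      base (G 0) (G ε) Side.R x ≤ rightSink D.u i := by
    by_contra! hcon
    have : ∀ i, leftSink D.u i ≤ base (G 0) (G ε) Side.L x := by
      intro i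
      induction i using Fin.induction with
      | zero => exact bot_le
      | succ k ih =>
        have h3 := hcon _ ih
        rw [rightSink_castSucc, EReal.coe_lt_coe_iff] at h3
        rw [leftSink_succ, EReal.coe_le_coe_iff]
        by_contra! h4
        exact absurd h3.le (not_le.2 (hang k h4.le))
    have h5 := hcon _ (this (Fin.last n))
    rw [rightSink_last] at h5
    exact absurd h5 not_top_lt
  rcases le_total (D.core i).right (base (G 0) (G ε) Side.R x) with h3 | h3
  · exact ⟨.right i, hx, h3, h2⟩
  rcases le_total ((base (G 0) (G ε) Side.L x : ℝ) : EReal) (D.core i).left with h4 | h4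
  · exact ⟨.left i, hx, h1, h4⟩
  · exact ⟨.core i, hx, h4, h3⟩

lemma pieceOf_mem {x : ℝ × ℝ} (hx : x ∈ strip (G 0) (G ε)) :
    x ∈ D.region G ε (D.pieceOf G ε x) :=
  @Classical.epsilon_spec _ (fun j => x ∈ D.region G ε j) (H.exists_piece hx)

lemma iUnion_region : ⋃ j, D.region G ε j = strip (G 0) (G ε) := by
  ext x
  rw [mem_iUnion]
  exact ⟨fun ⟨j, hj⟩ => D.region_subset j hj, fun hx => H.exists_piece hx⟩

lemma mem_of_mem_closure (j : Piece n) {x : ℝ × ℝ} (hx : x ∈ strip (G 0) (G ε))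
    (h : x ∈ closure (D.region G ε j)) : x ∈ D.region G ε j := by
  have hR := H.pair.continuousOn_base Side.R
  have hL := H.pair.continuousOn_base Side.L
  have hRL : ContinuousOn (fun x => (base (G 0) (G ε) Side.L x, base (G 0) (G ε) Side.R x))
      (strip (G 0) (G ε)) := hL.prodMk hR
  cases j with
  | angle k => exact ⟨hx, mem_of_mem_closure_preimage hRL
      (C := {p | p.1 ≤ D.u k ∧ D.u k ≤ p.2}) ((isClosed_le continuous_fst continuous_const).inter
        (isClosed_le continuous_const continuous_snd)) hx h⟩
  | right i => exact ⟨hx, mem_of_mem_closure_preimage hR (isClosed_realIcc _ _) hx h⟩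
  | left i => exact ⟨hx, mem_of_mem_closure_preimage hL (isClosed_realIcc _ _) hx h⟩
  | core i => exact ⟨hx, mem_of_mem_closure_preimage hRL
      (C := {p | (D.core i).left ≤ (p.1 : EReal) ∧ (p.2 : EReal) ≤ (D.core i).right})
      ((isClosed_le continuous_const (continuous_coe_real_ereal.comp continuous_fst)).inter
        (isClosed_le (continuous_coe_real_ereal.comp continuous_snd) continuous_const)) hx h⟩

/-- The plane with constant slope in the vertical direction does not depend on the point of an
interval of constancy of the torsion function. -/
lemma planeAt_eq_of_constOn {I : Set ℝ} (hI : I.OrdConnected) (hc : ConstOn (tors G f) I) {s t : ℝ}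
    (hs : s ∈ I) (ht : t ∈ I) : planeAt G f s (tors G f s) = planeAt G f t (tors G f t) := by
  have hf := H.boundary
  set r := tors G f s with hr
  have hrt : tors G f t = r := hc t ht s hs
  rw [hrt]
  have hconst : ∀ x, planeEval (planeAt G f s r) x = planeEval (planeAt G f t r) x := by
    intro x
    have hd : ∀ τ, HasDerivAt (fun τ => planeEval (planeAt G f τ r) x)
        (deriv (kap2 G) τ * (tors G f τ - r) * (x.1 - (G 0 τ).1)) τ := fun τ =>
      (hf.hasDerivAt_planeEval (hasDerivAt_const τ r) x).congr_deriv (by ring)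
    have key : ∀ a b, a ≤ b → a ∈ I → b ∈ I →
        planeEval (planeAt G f a r) x = planeEval (planeAt G f b r) x := by
      intro a b hab ha hb
      refine (constant_of_has_deriv_right_zero (f := fun τ => planeEval (planeAt G f τ r) x)
        (a := a) (b := b) (fun τ _ => (hd τ).continuousAt.continuousWithinAt) (fun τ hτ => ?_) b
        (right_mem_Icc.2 hab)).symm
      have := (hd τ).hasDerivWithinAt (s := Ici τ)
      rwa [hc τ (hI.out ha hb ⟨hτ.1, hτ.2.le⟩) s hs, ← hr, sub_self, mul_zero, zero_mul] at this
    rcases le_total s t with h | h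
    · exact key s t h hs ht
    · exact (key t s h ht hs).symm
  have h1 := hconst (0, 0)
  have h2 := hconst (1, 0)
  have h3 := hconst (0, 1)
  simp only [planeEval] at h1 h2 h3
  refine Prod.ext ?_ (Prod.ext ?_ ?_) <;> linarith

/-- On the border of a full cup or a multicup its plane is tangent to the curve `(g, f)`. -/
lemma plane_border {i : Fin (n + 1)} {x : ℝ × ℝ} (hx : x ∈ D.region G ε (.core i)) {t : ℝ}
    (ht : ((D.core i).right = t ∧ base (G 0) (G ε) Side.R x = t) ∨
      ((D.core i).left = t ∧ base (G 0) (G ε) Side.L x = t)) :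
    (D.core i).plane G f x = planeAt G f t ((D.core i).val G f) := by
  have hf := H.boundary
  have hp := H.pair
  cases hi : D.core i with
  | cup c b s =>
    obtain ⟨hs, hw⟩ := H.cup_spec hi
    rw [hi] at ht
    simp only [Core.left, Core.right, EReal.coe_eq_coe_iff] at ht
    have hbs := hp.gap_tanPar (hp.curve_mem_strip (s b)) Side.L
    have hbb := hp.gap_tanPar (hp.curve_mem_strip b) Side.R
    have w1 := hp.tangency_R_lt b
    have w2 := hp.lt_tangency_L (s b)
    rw [← hw] at hbb w1
    have hg := hp.gap_tanPar hx.1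
    have hseg : x ∈ segment ℝ (G 0 (s b)) (G 0 b) := by
      rcases ht with ⟨rfl, h⟩ | ⟨rfl, h⟩
      · have h1 := hg Side.R
        rw [← hp.tangency_base, h, ← hw] at h1
        refine IsTangentPair.mem_segment_of_gap_eq_zero hbs hbb h1 ?_ ?_
        · have := hp.fst_tanPar_R_le hx.1
          rw [← hp.tangency_base, h, ← hw] at this
          exact w2.le.trans this
        · have := hp.le_fst_base_R hx.1; rwa [h] at this
      · have h1 := hg Side.L
        rw [← hp.tangency_base, h] at h1
        refine IsTangentPair.mem_segment_of_gap_eq_zero hbs hbb h1 ?_ ?_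
        · have := hp.fst_base_L_le hx.1; rwa [h] at this
        · have := hp.le_fst_tanPar_L hx.1
          rw [← hp.tangency_base, h] at this
          exact this.trans w1.le
    have hpar := hs.chordParam_eq hf hs.right_mem hseg
    simp only [Core.plane, Core.val, hpar]
    rcases ht with ⟨rfl, -⟩ | ⟨rfl, -⟩
    · rfl
    · -- the two tangent planes at the endpoints of a chord coincide
      have h1 := hs.planeEval_chord hf hs.right_mem
      have h2 := hf.chordRatio_mul (s b) b
      rw [planeEval_planeAt] at h1
      refine Prod.ext ?_ (Prod.ext ?_ rfl)
      · simp only [planeAt]; linear_combination h1 + (G 0 (s b)).1 * h2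
      · simp only [planeAt]; linear_combination -h2
  | multicup l r =>
    have h := H.valid.core_valid i
    rw [hi] at h ht
    obtain ⟨hlr, hc, -⟩ := h
    have htm : t ∈ realIcc l r := by
      simp only [Core.left, Core.right] at ht
      rcases ht with ⟨rfl, -⟩ | ⟨rfl, -⟩
      · exact ⟨hlr.le, le_rfl⟩
      · exact ⟨le_rfl, hlr.le⟩
    have hpt := Core.point_mem hlr
    simp only [Core.plane, Core.val]
    rw [hc _ hpt t htm, ← H.planeAt_eq_of_constOn (realIcc_ordConnected l r) hc hpt htm,
      hc _ hpt t htm]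
  | minusInf => rw [hi] at ht; simp [Core.left, Core.right] at ht
  | plusInf => rw [hi] at ht; simp [Core.left, Core.right] at ht

end Admissible

end FoliationData

end
end BellmanFoliation

namespace BellmanFoliation
noncomputable section

/-! ### Compatibility of the planes on different figures -/

variable {n : ℕ}

namespace FoliationData

/-- Two figures overlap at most along a tangent, and their planes agree there. -/
def Compat (D : FoliationData n) (G : ℝ → ℝ → ℝ × ℝ) (f : ℝ → ℝ) (ε : ℝ) (p q : Piece n) : Prop :=
  (∃ σ t, ∀ x, x ∈ D.region G ε p → x ∈ D.region G ε q → base (G 0) (G ε) σ x = t) ∧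
  ∀ x, x ∈ D.region G ε p → x ∈ D.region G ε q → D.planeOn G f ε p x = D.planeOn G f ε q x

lemma Compat.symm {D : FoliationData n} {G : ℝ → ℝ → ℝ × ℝ} {f : ℝ → ℝ} {ε : ℝ} {p q : Piece n}
    (h : D.Compat G f ε p q) : D.Compat G f ε q p :=
  ⟨h.1.imp fun _ h => h.imp fun _ h x hp hq => h x hq hp, fun x hp hq => (h.2 x hq hp).symm⟩

lemma compat_of_forall_notMem {D : FoliationData n} {G : ℝ → ℝ → ℝ × ℝ} {f : ℝ → ℝ} {ε : ℝ}
    {p q : Piece n} (h : ∀ x, x ∈ D.region G ε p → x ∉ D.region G ε q) : D.Compat G f ε p q :=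
  ⟨⟨Side.R, 0, fun x hp hq => absurd hq (h x hp)⟩, fun x hp hq => absurd hq (h x hp)⟩

namespace Admissible

variable {D : FoliationData n} {εmax : EReal} {G : ℝ → ℝ → ℝ × ℝ} {f : ℝ → ℝ} {ε : ℝ}
  (H : D.Admissible εmax G f ε)
include H

lemma compat_right_core (i : Fin (n + 1)) : D.Compat G f ε (.right i) (.core i) := by
  have key : ∀ x, x ∈ D.region G ε (.right i) → x ∈ D.region G ε (.core i) →
      (D.core i).right = base (G 0) (G ε) Side.R x := fun x hp hq => le_antisymm hp.2.1 hq.2.2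
  refine ⟨⟨Side.R, (D.core i).right.toReal, fun x hp hq => by rw [key x hp hq]; rfl⟩,
    fun x hp hq => ?_⟩
  have h := key x hp hq
  change planeAt G f _ _ = (D.core i).plane G f x
  rw [H.plane_border hq (Or.inl ⟨h, rfl⟩), H.valid.initR i _ h]

lemma compat_left_core (i : Fin (n + 1)) : D.Compat G f ε (.left i) (.core i) := by
  have key : ∀ x, x ∈ D.region G ε (.left i) → x ∈ D.region G ε (.core i) →
      (D.core i).left = base (G 0) (G ε) Side.L x := fun x hp hq => le_antisymm hq.2.1 hp.2.2
  refine ⟨⟨Side.L, (D.core i).left.toReal, fun x hp hq => by rw [key x hp hq]; rfl⟩,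
    fun x hp hq => ?_⟩
  have h := key x hp hq
  change planeAt G f _ _ = (D.core i).plane G f x
  rw [H.plane_border hq (Or.inr ⟨h, rfl⟩), H.valid.initL i _ h]

lemma compat_right_left (i : Fin (n + 1)) : D.Compat G f ε (.right i) (.left i) := by
  have key : ∀ x, x ∈ D.region G ε (.right i) → x ∈ D.region G ε (.left i) →
      x ∈ D.region G ε (.core i) := fun x hp hq =>
    ⟨hp.1, H.left_le_of_mem_right hp, H.le_right_of_mem_left hq⟩
  obtain ⟨⟨σ, t, h1⟩, h2⟩ := H.compat_right_core i
  exact ⟨⟨σ, t, fun x hp hq => h1 x hp (key x hp hq)⟩, fun x hp hq =>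
    (h2 x hp (key x hp hq)).trans ((H.compat_left_core i).2 x hq (key x hp hq)).symm⟩

lemma compat_angle_right (k : Fin n) (i : Fin (n + 1)) :
    D.Compat G f ε (.angle k) (.right i) := by
  have key : ∀ x, x ∈ D.region G ε (.angle k) → x ∈ D.region G ε (.right i) →
      i = k.castSucc ∧ base (G 0) (G ε) Side.R x = D.u k := by
    intro x ⟨hx, h1, h2⟩ hq
    have h3 := H.left_le_of_mem_right hq
    have h4 := hq.2.2
    rcases lt_trichotomy i k.castSucc with h | h | h
    · obtain ⟨l, rfl⟩ := Fin.exists_castSucc_eq.2 (h.trans (Fin.castSucc_lt_last k)).ne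
      rw [rightSink_castSucc, EReal.coe_le_coe_iff] at h4
      exact absurd (H.strictMono_u (Fin.castSucc_lt_castSucc_iff.1 h)) (h2.trans h4).not_gt
    · subst h
      rw [rightSink_castSucc, EReal.coe_le_coe_iff] at h4
      exact ⟨rfl, le_antisymm h4 h2⟩
    · obtain ⟨k', l, hk, rfl, hkl⟩ := exists_of_lt h
      obtain rfl := Fin.castSucc_inj.1 hk
      have h5 := EReal.coe_lt_coe_iff.1 ((H.u_lt_core l).trans_le h3)
      exact absurd (H.strictMono_u.monotone hkl) (h5.trans_le h1).not_ge
  refine ⟨⟨Side.R, D.u k, fun x hp hq => (key x hp hq).2⟩, fun x hp hq => ?_⟩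
  obtain ⟨rfl, h⟩ := key x hp hq
  simp only [planeOn, h]

lemma compat_angle_left (k : Fin n) (i : Fin (n + 1)) :
    D.Compat G f ε (.angle k) (.left i) := by
  have key : ∀ x, x ∈ D.region G ε (.angle k) → x ∈ D.region G ε (.left i) →
      i = k.succ ∧ base (G 0) (G ε) Side.L x = D.u k := by
    intro x ⟨hx, h1, h2⟩ hq
    have h3 := H.le_right_of_mem_left hq
    have h4 := hq.2.1
    rcases le_or_gt i k.castSucc with h | h
    · obtain ⟨l, rfl⟩ := Fin.exists_castSucc_eq.2 (h.trans_lt (Fin.castSucc_lt_last k)).ne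
      have h5 := EReal.coe_lt_coe_iff.1 (h3.trans_lt (H.core_lt_u l))
      exact absurd (H.strictMono_u.monotone (Fin.castSucc_le_castSucc_iff.1 h))
        (h2.trans_lt h5).not_ge
    · obtain ⟨k', l, hk, rfl, hkl⟩ := exists_of_lt h
      obtain rfl := Fin.castSucc_inj.1 hk
      rw [leftSink_succ, EReal.coe_le_coe_iff] at h4
      rcases hkl.eq_or_lt with rfl | hlt
      · exact ⟨rfl, le_antisymm h1 h4⟩
      · exact absurd (H.strictMono_u hlt) (h4.trans h1).not_gt
  refine ⟨⟨Side.L, D.u k, fun x hp hq => (key x hp hq).2⟩, fun x hp hq => ?_⟩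
  obtain ⟨rfl, h⟩ := key x hp hq
  simp only [planeOn, h, H.valid.matching]

lemma compat_angle_core (k : Fin n) (i : Fin (n + 1)) :
    D.Compat G f ε (.angle k) (.core i) := by
  refine compat_of_forall_notMem fun x ⟨hx, h1, h2⟩ ⟨_, h3, h4⟩ => ?_
  rcases le_or_gt i k.castSucc with h | h
  · obtain ⟨l, rfl⟩ := Fin.exists_castSucc_eq.2 (h.trans_lt (Fin.castSucc_lt_last k)).ne
    have h5 := EReal.coe_lt_coe_iff.1 (h4.trans_lt (H.core_lt_u l))
    exact absurd (H.strictMono_u.monotone (Fin.castSucc_le_castSucc_iff.1 h))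
      (h2.trans_lt h5).not_ge
  · obtain ⟨k', l, hk, rfl, hkl⟩ := exists_of_lt h
    obtain rfl := Fin.castSucc_inj.1 hk
    have h5 := EReal.coe_lt_coe_iff.1 ((H.u_lt_core l).trans_le h3)
    exact absurd (H.strictMono_u.monotone hkl) (h5.trans_le h1).not_ge

lemma compat_angle_angle {k l : Fin n} (hkl : k < l) : D.Compat G f ε (.angle k) (.angle l) := by
  refine compat_of_forall_notMem fun x ⟨hx, h1, _⟩ ⟨_, _, h2⟩ => ?_
  have hlt : k.succ < Fin.last n := by
    rw [Fin.lt_def, Fin.val_succ, Fin.val_last]; have := l.2; rw [Fin.lt_def] at hkl; omega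
  obtain ⟨m, hm⟩ := Fin.exists_castSucc_eq.2 hlt.ne
  have hml : m ≤ l := by
    rw [← Fin.castSucc_lt_succ_iff, hm]; exact Fin.succ_lt_succ_iff.2 hkl
  have h3 := H.u_lt_core k
  have h4 := H.core_lt_u m
  rw [hm] at h4
  have h5 := H.left_le_right k.succ
  have hor : ∃ a b : ℝ, (D.core k.succ).left = a ∧ (D.core k.succ).right = b := by
    refine ⟨_, _, (EReal.coe_toReal ?_ ?_).symm, (EReal.coe_toReal ?_ ?_).symm⟩
    · exact ((h5.trans_lt h4).trans (EReal.coe_lt_top _)).ne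
    · exact ((EReal.bot_lt_coe _).trans h3).ne'
    · exact (h4.trans (EReal.coe_lt_top _)).ne
    · exact ((EReal.bot_lt_coe _).trans (h3.trans_le h5)).ne'
  obtain ⟨a, b, ha, hb⟩ := hor
  rw [ha, EReal.coe_lt_coe_iff] at h3
  rw [hb, EReal.coe_lt_coe_iff] at h4
  have e1 := H.pair.strictMono_tangency Side.L (h1.trans_lt h3)
  have e2 := H.pair.strictMono_tangency Side.R
    (h4.trans_le ((H.strictMono_u.monotone hml).trans h2))
  exact absurd ((e1.trans_le (H.tangency_le ha hb)).trans e2) (H.tangency_le_tangency hx).not_gt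

/-- Figures that belong to different central figures can meet only at the vertex of an angle, along
the two tangents that bound it; the two planes agree there by the choice of the vertex. -/
lemma compat_of_lt {i j : Fin (n + 1)} (hij : i < j) {p q : Piece n}
    (hp : p = .right i ∨ p = .left i ∨ p = .core i)
    (hq : q = .right j ∨ q = .left j ∨ q = .core j) : D.Compat G f ε p q := by
  obtain ⟨k, l, rfl, rfl, hkl⟩ := exists_of_lt hij
  have key : ∀ x, x ∈ D.region G ε p → x ∈ D.region G ε q → k = l ∧ p = .right k.castSucc ∧
      q = .left l.succ ∧ base (G 0) (G ε) Side.R x = D.u k ∧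
      base (G 0) (G ε) Side.L x = D.u k := by
    intro x hx hx'
    have h0 := H.pair.base_L_le_base_R (D.region_subset p hx)
    have h1 := (H.slab (i := k.castSucc) (x := x)
      (by rcases hp with rfl | rfl | rfl <;> simp [hx])).2
    have h2 := (H.slab (i := l.succ) (x := x) (by rcases hq with rfl | rfl | rfl <;> simp [hx'])).1
    rw [rightSink_castSucc, EReal.coe_le_coe_iff] at h1
    rw [leftSink_succ, EReal.coe_le_coe_iff] at h2
    have h3 := H.strictMono_u.monotone hkl
    have h4 : D.u k = D.u l := le_antisymm h3 (h2.trans (h0.trans h1))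
    have h5 : base (G 0) (G ε) Side.R x = D.u k := le_antisymm h1 (by rw [h4]; exact h2.trans h0)
    have h6 : base (G 0) (G ε) Side.L x = D.u k := le_antisymm (h0.trans h1) (by rwa [h4])
    have h7 : ¬ base (G 0) (G ε) Side.R x ≤ (D.core k.castSucc).right := by
      rw [h5, not_le]; exact H.core_lt_u k
    have h8 : ¬ (D.core l.succ).left ≤ base (G 0) (G ε) Side.L x := by
      rw [h6, h4, not_le]; exact H.u_lt_core l
    refine ⟨H.strictMono_u.injective h4, ?_, ?_, h5, h6⟩
    · rcases hp with rfl | rfl | rfl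
      · rfl
      · exact absurd (H.le_right_of_mem_left hx) h7
      · exact absurd hx.2.2 h7
    · rcases hq with rfl | rfl | rfl
      · exact absurd (H.left_le_of_mem_right hx') h8
      · rfl
      · exact absurd hx'.2.1 h8
  refine ⟨⟨Side.R, D.u k, fun x hx hx' => (key x hx hx').2.2.2.1⟩, fun x hx hx' => ?_⟩
  obtain ⟨rfl, rfl, rfl, h1, h2⟩ := key x hx hx'
  simp only [planeOn, h1, h2, H.valid.matching]

/-- Two different figures have at most a part of one line in common, on which their planes agree. -/
lemma compat {p q : Piece n} (hpq : p ≠ q) : D.Compat G f ε p q := by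
  have hne : ∀ {i j : Fin (n + 1)}, i ≠ j → ∀ {p q : Piece n},
      (p = .right i ∨ p = .left i ∨ p = .core i) →
      (q = .right j ∨ q = .left j ∨ q = .core j) → D.Compat G f ε p q := fun h _ _ hp hq => by
    rcases lt_or_gt_of_ne h with h | h
    · exact H.compat_of_lt h hp hq
    · exact (H.compat_of_lt h hq hp).symm
  cases p with
  | angle k =>
    cases q with
    | angle l =>
      rcases lt_or_gt_of_ne (fun h : k = l => hpq (by rw [h])) with h | h
      · exact H.compat_angle_angle h
      · exact (H.compat_angle_angle h).symm
    | right j => exact H.compat_angle_right k j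
    | left j => exact H.compat_angle_left k j
    | core j => exact H.compat_angle_core k j
  | right i =>
    cases q with
    | angle l => exact (H.compat_angle_right l i).symm
    | right j => exact hne (fun h : i = j => hpq (by rw [h])) (by simp) (by simp)
    | left j =>
      rcases eq_or_ne i j with rfl | h
      · exact H.compat_right_left i
      · exact hne h (by simp) (by simp)
    | core j =>
      rcases eq_or_ne i j with rfl | h
      · exact H.compat_right_core i
      · exact hne h (by simp) (by simp)
  | left i =>
    cases q with
    | angle l => exact (H.compat_angle_left l i).symm
    | right j =>
      rcases eq_or_ne i j with rfl | h
      · exact (H.compat_right_left i).symm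
      · exact hne h (by simp) (by simp)
    | left j => exact hne (fun h : i = j => hpq (by rw [h])) (by simp) (by simp)
    | core j =>
      rcases eq_or_ne i j with rfl | h
      · exact H.compat_left_core i
      · exact hne h (by simp) (by simp)
  | core i =>
    cases q with
    | angle l => exact (H.compat_angle_core l i).symm
    | right j =>
      rcases eq_or_ne i j with rfl | h
      · exact (H.compat_right_core i).symm
      · exact hne h (by simp) (by simp)
    | left j =>
      rcases eq_or_ne i j with rfl | h
      · exact (H.compat_left_core i).symm
      · exact hne h (by simp) (by simp)
    | core j => exact hne (fun h : i = j => hpq (by rw [h])) (by simp) (by simp)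

lemma field_eq {j : Piece n} {x : ℝ × ℝ} (hx : x ∈ D.region G ε j) :
    D.field G f ε x = D.planeOn G f ε j x := by
  have h := H.pieceOf_mem (D.region_subset j hx)
  rw [field]
  rcases eq_or_ne (D.pieceOf G ε x) j with e | e
  · rw [e]
  · exact (H.compat e).2 x h hx

lemma candidate_eq {j : Piece n} {x : ℝ × ℝ} (hx : x ∈ D.region G ε j) :
    D.candidate G f ε x = planeEval (D.planeOn G f ε j x) x := by
  rw [candidate, H.field_eq hx]

/-- Points under a tangent line that connects two points of the fixed boundary. -/
lemma hull_eq {a b : ℝ} (hab : a < b)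
    (hw : tanPar (G ε) Side.L (G 0 a) = tanPar (G ε) Side.R (G 0 b)) :
    {x : ℝ × ℝ | (∃ p, (G 0 p).1 = x.1 ∧ (G 0 p).2 ≤ x.2) ∧ chordGap G a b x ≤ 0} =
      {x | x ∈ strip (G 0) (G ε) ∧ a ≤ base (G 0) (G ε) Side.L x ∧
        base (G 0) (G ε) Side.R x ≤ b} := by
  have hp := H.pair
  have hf := H.boundary
  have hgap : ∀ y, chordGap G a b y = gap (G ε) y (tanPar (G ε) Side.R (G 0 b)) := by
    intro y
    have h1 := hp.gap_tanPar (hp.curve_mem_strip a) Side.L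
    rw [hw, hp.gap_eq_of_tangency] at h1
    have h2 := hf.chordSlope_mul a b
    have h3 := hf.fst_sub_ne hab.ne
    have h4 : chordSlope G a b = curveSlope (G ε) (tanPar (G ε) Side.R (G 0 b)) := by
      refine mul_right_cancel₀ h3 ?_
      rw [h2]; linarith
    rw [hp.gap_eq_of_tangency, chordGap, h4]
  ext x
  simp only [hgap, mem_ofPred_eq]
  constructor
  · rintro ⟨⟨p, h1, h2⟩, h3⟩
    obtain ⟨q, hq, -⟩ := hp.exists_inner p
    have hx : x ∈ strip (G 0) (G ε) := by
      refine ⟨p, q, h1, hq.trans h1, h2, ?_⟩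
      have h4 := hp.inner.gap_nonneg (tanPar (G ε) Side.R (G 0 b)) q
      simp only [gap, hq.trans h1] at h3 h4
      linarith
    refine ⟨hx, ?_, ?_⟩
    · by_contra! hcon
      have h5 := hp.gap_pos_of_gt hx (hp.base_lt_iff.1 hcon)
      rw [hw] at h5
      exact h5.not_ge h3
    · by_contra! hcon
      exact (hp.gap_pos_of_lt hx (hp.lt_base_iff.1 hcon)).not_ge h3
  · rintro ⟨hx, h1, h2⟩
    refine ⟨IsTangentPair.exists_curve_mem x hx, hp.gap_nonpos_of_mem hx (hp.base_le_iff.1 h2) ?_⟩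
    rw [← hw]; exact hp.le_base_iff.1 h1

/-- A full cup in terms of its chords. -/
lemma mem_core_cup_iff {i : Fin (n + 1)} {c b : ℝ} {s : ℝ → ℝ} (hi : D.core i = .cup c b s)
    {x : ℝ × ℝ} : x ∈ D.region G ε (.core i) ↔ ∃ t ∈ Icc c b, x ∈ segment ℝ (G 0 (s t)) (G 0 t) := by
  obtain ⟨hs, hw⟩ := H.cup_spec hi
  have h := Set.ext_iff.1 (H.hull_eq (hs.map_lt_self (right_mem_Ioc.2 hs.lt)) hw) x
  rw [hs.mem_iUnion_iff H.boundary]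
  simpa only [region, hi, Core.left, Core.right, EReal.coe_le_coe_iff, mem_ofPred_eq] using h.symm

omit H in
lemma core_infinite_empty {i : Fin (n + 1)} (hi : D.core i = .minusInf ∨ D.core i = .plusInf)
    (x : ℝ × ℝ) : x ∉ D.region G ε (.core i) := by
  rintro ⟨-, h1, h2⟩
  rcases hi with hi | hi <;> rw [hi] at h1 h2
  · exact absurd h2 (not_le.2 (EReal.bot_lt_coe _))
  · exact absurd h1 (not_le.2 (EReal.coe_lt_top _))

lemma continuousOn_planeOn (j : Piece n) : ContinuousOn (D.planeOn G f ε j) (D.region G ε j) := by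
  have hf := H.boundary
  have hsub := D.region_subset (G := G) (ε := ε) j
  cases j with
  | angle k => exact continuousOn_const
  | right i =>
    rcases eq_or_ne (D.core i).right ⊤ with h | h
    · refine continuousOn_of_forall_continuousAt fun x hx => absurd hx.2.1 ?_
      rw [h]; exact not_le.2 (EReal.coe_lt_top _)
    · exact (hf.continuousOn_planeAt (D := univ)
        (H.valid.solR i h).continuous.continuousOn).comp ((H.pair.continuousOn_base Side.R).mono hsub)
        fun _ _ => mem_univ _
  | left i =>
    rcases eq_or_ne (D.core i).left ⊥ with h | h
    · refine continuousOn_of_forall_continuousAt fun x hx => absurd hx.2.2 ?_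
      rw [h]; exact not_le.2 (EReal.bot_lt_coe _)
    · exact (hf.continuousOn_planeAt (D := univ)
        (H.valid.solL i h).continuous.continuousOn).comp ((H.pair.continuousOn_base Side.L).mono hsub)
        fun _ _ => mem_univ _
  | core i =>
    cases hi : D.core i with
    | cup c b s =>
      obtain ⟨hs, -⟩ := H.cup_spec hi
      have h1 := (hs.continuousOn_chordParam hf).mono fun x hx => (H.mem_core_cup_iff hi).1 hx
      have h2 := hf.continuousOn_planeAt (hs.continuousOn_chordRatio hf)
      have h3 : D.planeOn G f ε (.core i) = fun x => planeAt G f (chordParam G c b s x)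
          (chordRatio G f (s (chordParam G c b s x)) (chordParam G c b s x)) := by
        ext1 x; simp only [planeOn, hi, Core.plane]
      rw [h3]
      exact h2.comp h1 fun x hx => (IsCup.chordParam_spec ((H.mem_core_cup_iff hi).1 hx)).1
    | multicup l r =>
      have h3 : D.planeOn G f ε (.core i) = fun _ =>
          planeAt G f (Core.point l r) (tors G f (Core.point l r)) := by
        ext1 x; simp only [planeOn, hi, Core.plane]
      rw [h3]; exact continuousOn_const
    | minusInf => exact fun _ hx => absurd hx (core_infinite_empty (Or.inl hi) _)
    | plusInf => exact fun _ hx => absurd hx (core_infinite_empty (Or.inr hi) _)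

omit H in
lemma supports_const {S ω : Set (ℝ × ℝ)} {Φ : ℝ × ℝ → ℝ × ℝ × ℝ} {P : ℝ × ℝ × ℝ}
    (h : ∀ x ∈ ω, Φ x = P) : Supports S Φ ω := fun x hx y hy _ => by rw [h x hx, h y hy]

lemma supports_planeOn (j : Piece n) :
    Supports (strip (G 0) (G ε)) (D.planeOn G f ε j) (D.region G ε j) := by
  have hf := H.boundary
  cases j with
  | angle k => exact supports_const fun _ _ => rfl
  | right i =>
    rcases eq_or_ne (D.core i).right ⊤ with h | h
    · refine fun x hx => absurd hx.2.1 ?_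
      rw [h]; exact not_le.2 (EReal.coe_lt_top _)
    · exact H.family.supports_tangents_R H.mem H.pos hf (H.valid.solR i h)
        (realIcc_ordConnected _ _) (H.valid.leR i)
  | left i =>
    rcases eq_or_ne (D.core i).left ⊥ with h | h
    · refine fun x hx => absurd hx.2.2 ?_
      rw [h]; exact not_le.2 (EReal.bot_lt_coe _)
    · exact H.family.supports_tangents_L H.mem H.pos hf (H.valid.solL i h)
        (realIcc_ordConnected _ _) (H.valid.leL i)
  | core i =>
    cases hi : D.core i with
    | cup c b s =>
      obtain ⟨hs, -⟩ := H.cup_spec hi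
      intro x hx y hy hxy
      simp only [planeOn, hi, Core.plane]
      exact hs.supports hf _ x ((H.mem_core_cup_iff hi).1 hx) y ((H.mem_core_cup_iff hi).1 hy) hxy
    | multicup l r => exact supports_const fun x _ => by simp only [planeOn, hi, Core.plane]; rfl
    | minusInf => exact fun _ hx => absurd hx (core_infinite_empty (Or.inl hi) _)
    | plusInf => exact fun _ hx => absurd hx (core_infinite_empty (Or.inr hi) _)

lemma continuousOn_field : ContinuousOn (D.field G f ε) (strip (G 0) (G ε)) :=
  continuousOn_of_cover H.iUnion_region.ge (fun j _ hx h => H.mem_of_mem_closure j hx h)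
    fun j => (H.continuousOn_planeOn j).congr fun _ hx => H.field_eq hx

lemma supports_field : Supports (strip (G 0) (G ε)) (D.field G f ε) (strip (G 0) (G ε)) :=
  supports_of_cover H.continuousOn_field H.iUnion_region.ge
    (fun j x hx h => H.mem_of_mem_closure j hx h) fun j x hx y hy hxy => by
      rw [H.field_eq hx, H.field_eq hy]; exact H.supports_planeOn j x hx y hy hxy

lemma contDiffOn_candidate : ContDiffOn ℝ 1 (D.candidate G f ε) (Om G ε) := by
  rw [H.family.Om_eq_strip H.mem H.pos]
  exact H.supports_field.contDiffOn H.pair H.continuousOn_field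

lemma candidate_curve (t : ℝ) : D.candidate G f ε (G 0 t) = f t := by
  have hf := H.boundary
  obtain ⟨j, hj⟩ := H.exists_piece (H.pair.curve_mem_strip t)
  rw [H.candidate_eq hj]
  have hbase := fun σ => H.pair.base_curve σ t
  cases j with
  | angle k =>
    have h1 := hj.2
    rw [hbase, hbase] at h1
    rw [show t = D.u k from le_antisymm h1.1 h1.2]
    exact planeEval_planeAt_self _ _ _ _
  | right i => simp only [planeOn, hbase]; exact planeEval_planeAt_self _ _ _ _
  | left i => simp only [planeOn, hbase]; exact planeEval_planeAt_self _ _ _ _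
  | core i =>
    cases hi : D.core i with
    | cup c b s =>
      obtain ⟨hs, -⟩ := H.cup_spec hi
      obtain ⟨τ, hτ, hx⟩ := (H.mem_core_cup_iff hi).1 hj
      simp only [planeOn, hi, Core.plane]
      rw [hs.chordParam_eq hf hτ hx]
      have h1 := IsCup.chordGap_eq_zero hf hx
      by_cases h2 : t < s τ ∨ τ < t
      · exact absurd h1 (hf.chordGap_curve_pos (hs.map_le_self hτ) h2).ne'
      push Not at h2
      rcases h2.1.eq_or_lt with h3 | h3
      · rw [← h3]; exact hs.planeEval_chord hf hτ
      · rcases h2.2.eq_or_lt with h4 | h4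
        · rw [h4]; exact planeEval_planeAt_self _ _ _ _
        · exact absurd h1 (hf.chordGap_curve_neg ⟨h3, h4⟩).ne
    | multicup l r =>
      have h := H.valid.core_valid i
      rw [hi] at h
      have h1 := hj.2
      rw [hbase, hbase, hi] at h1
      simp only [planeOn, hi, Core.plane]
      rw [H.planeAt_eq_of_constOn (realIcc_ordConnected l r) h.2.1 (Core.point_mem h.1) h1]
      exact planeEval_planeAt_self _ _ _ _
    | minusInf => exact absurd hj (core_infinite_empty (Or.inl hi) _)
    | plusInf => exact absurd hj (core_infinite_empty (Or.inr hi) _)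

end Admissible

end FoliationData

end
end BellmanFoliation

namespace BellmanFoliation
noncomputable section

/-! ### Plane domains -/

lemma isPlaneDomain_of_param {X : Type*} [TopologicalSpace X] {φ : X → ℝ × ℝ} (hφ : Continuous φ)
    {A B : Set X} (hA : IsConnected A) (hB : B ⊆ closure A) {ω : Set (ℝ × ℝ)}
    (ho : IsOpen (φ '' A)) (hAω : φ '' A ⊆ ω) (hω : ω ⊆ φ '' B) : IsPlaneDomain ω :=
  ⟨φ '' A, ho, hA.image φ hφ.continuousOn, hAω,
    hω.trans ((image_mono hB).trans (image_closure_subset_closure_image hφ))⟩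

lemma isPlaneDomain_of_convex {ω : Set (ℝ × ℝ)} (h : Convex ℝ ω) (hne : (interior ω).Nonempty) :
    IsPlaneDomain ω :=
  ⟨interior ω, isOpen_interior, ⟨hne, h.interior.isPreconnected⟩, interior_subset, by
    rw [h.closure_interior_eq_closure_of_nonempty_interior hne]; exact subset_closure⟩

lemma realIcc_subset_closure {l r : EReal} (h : l < r) : realIcc l r ⊆ closure (realIoo l r) := by
  intro t ht
  rcases ht.1.eq_or_lt with h1 | h1
  · obtain ⟨r', h2, h3⟩ := EReal.lt_iff_exists_real_btwn.1 (h1 ▸ h)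
    have h2' := EReal.coe_lt_coe_iff.1 h2
    have hsub : Ioo t r' ⊆ realIoo l r := fun x hx =>
      ⟨h1 ▸ EReal.coe_lt_coe_iff.2 hx.1, (EReal.coe_lt_coe_iff.2 hx.2).trans h3⟩
    refine closure_mono hsub ?_
    rw [closure_Ioo h2'.ne]; exact left_mem_Icc.2 h2'.le
  rcases ht.2.eq_or_lt with h4 | h4
  · obtain ⟨l', h2, h3⟩ := EReal.lt_iff_exists_real_btwn.1 (h4 ▸ h)
    have h3' := EReal.coe_lt_coe_iff.1 h3
    have hsub : Ioo l' t ⊆ realIoo l r := fun x hx =>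
      ⟨h2.trans (EReal.coe_lt_coe_iff.2 hx.1), h4 ▸ EReal.coe_lt_coe_iff.2 hx.2⟩
    refine closure_mono hsub ?_
    rw [closure_Ioo h3'.ne]; exact right_mem_Icc.2 h3'.le
  · exact subset_closure ⟨h1, h4⟩

lemma isConnected_realIoo {l r : EReal} (h : l < r) : IsConnected (realIoo l r) := by
  obtain ⟨t, h1, h2⟩ := EReal.lt_iff_exists_real_btwn.1 h
  refine ⟨⟨t, h1, h2⟩, OrdConnected.isPreconnected ⟨fun _ hx _ hy _ hz =>
    ⟨hx.1.trans_le (EReal.coe_le_coe_iff.2 hz.1), (EReal.coe_le_coe_iff.2 hz.2).trans_lt hy.2⟩⟩⟩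

lemma interior_eq_empty_of_graph {S : Set (ℝ × ℝ)} {φ : ℝ → ℝ} (h : ∀ x ∈ S, x.2 = φ x.1) :
    interior S = ∅ := by
  rw [eq_empty_iff_forall_notMem]
  intro x hx
  have h1 : ∀ᶠ y : ℝ in 𝓝 x.2, (x.1, y) ∈ S := by
    have h2 : Tendsto (fun y : ℝ => (x.1, y)) (𝓝 x.2) (𝓝 x) :=
      (Continuous.prodMk_right x.1).tendsto x.2
    exact h2.eventually (mem_interior_iff_mem_nhds.1 hx)
  obtain ⟨y, hy, hne⟩ := ((h1.filter_mono nhdsWithin_le_nhds).and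
    (self_mem_nhdsWithin (s := {x.2}ᶜ))).exists
  exact hne ((h _ hy).trans (h x (interior_subset hx)).symm)

namespace IsConvexCurve

variable {c : ℝ → ℝ × ℝ} (hc : IsConvexCurve c)
include hc

lemma isOpenMap_fst : IsOpenMap fun t => (c t).1 :=
  isOpenMap_of_hasStrictDerivAt (f' := fun t => (deriv c t).1) (fun t => by
    have h : ContDiff ℝ 1 fun t => (c t).1 := (contDiff_fst.comp hc.smooth).of_le (by norm_num)
    have := (h.contDiffAt (x := t)).hasStrictDerivAt one_ne_zero
    rwa [(hc.hasDerivAt_fst t).deriv] at this) fun t => (hc.pos t).ne'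

lemma isOpen_graph {P : ℝ → ℝ → Prop} (hP : IsOpen {p : ℝ × ℝ | P (c p.1).2 p.2}) :
    IsOpen {x : ℝ × ℝ | ∃ t, (c t).1 = x.1 ∧ P (c t).2 x.2} := by
  have h := (hc.isOpenMap_fst.prodMap IsOpenMap.id) _ hP
  convert h using 1
  ext x
  constructor
  · rintro ⟨t, h1, h2⟩; exact ⟨(t, x.2), h2, Prod.ext h1 rfl⟩
  · rintro ⟨p, h1, rfl⟩; exact ⟨p.1, rfl, h1⟩

lemma isOpen_epigraph : IsOpen {x : ℝ × ℝ | ∃ t, (c t).1 = x.1 ∧ (c t).2 < x.2} :=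
  hc.isOpen_graph (P := fun a b => a < b)
    (isOpen_lt (hc.continuous_snd.comp _root_.continuous_fst) _root_.continuous_snd)

lemma isOpen_hypograph : IsOpen {x : ℝ × ℝ | ∃ t, (c t).1 = x.1 ∧ x.2 < (c t).2} :=
  hc.isOpen_graph (P := fun a b => b < a)
    (isOpen_lt _root_.continuous_snd (hc.continuous_snd.comp _root_.continuous_fst))

end IsConvexCurve

namespace IsTangentPair

variable {g h : ℝ → ℝ × ℝ} (hp : IsTangentPair g h)
include hp

/-- The domain between two curves without the curves themselves is open. -/
lemma isOpen_strip_diff : IsOpen (strip g h \ (range g ∪ range h)) := by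
  have heq : strip g h \ (range g ∪ range h) =
      {x : ℝ × ℝ | ∃ t, (g t).1 = x.1 ∧ (g t).2 < x.2} ∩
        {x : ℝ × ℝ | ∃ t, (h t).1 = x.1 ∧ x.2 < (h t).2} := by
    ext x
    constructor
    · rintro ⟨⟨t, s, h1, h2, h3, h4⟩, hx⟩
      refine ⟨⟨t, h1, h3.lt_of_ne fun h5 => hx (Or.inl ⟨t, Prod.ext h1 h5⟩)⟩,
        ⟨s, h2, h4.lt_of_ne fun h5 => hx (Or.inr ⟨s, Prod.ext h2 h5.symm⟩)⟩⟩
    · rintro ⟨⟨t, h1, h3⟩, ⟨s, h2, h4⟩⟩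
      refine ⟨⟨t, s, h1, h2, h3.le, h4.le⟩, ?_⟩
      rintro (⟨t', rfl⟩ | ⟨s', rfl⟩)
      · rw [hp.outer.fst_inj] at h1; subst h1; exact lt_irrefl _ h3
      · rw [hp.inner.fst_inj] at h2; subst h2; exact lt_irrefl _ h4
  rw [heq]
  exact hp.outer.isOpen_epigraph.inter hp.inner.isOpen_hypograph

/-- A tangent domain is parametrized by the parameter on the fixed boundary and the position on the
tangent; the open rectangle fills an open set, the part of the domain off the two curves. -/
lemma isPlaneDomain_tangents (σ : Side) {I J : Set ℝ} (hI : IsConnected I) (hIo : IsOpen I)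
    (hIJ : I ⊆ J) (hJ : J ⊆ closure I) :
    IsPlaneDomain {x | x ∈ strip g h ∧ base g h σ x ∈ J} := by
  have hmem : ∀ {t : ℝ} {x : ℝ × ℝ}, x ∈ segment ℝ (g t) (h (tanPar h σ (g t))) ↔
      x ∈ strip g h ∧ base g h σ x = t := hp.mem_tangentSegment_iff
  set φ : ℝ × ℝ → ℝ × ℝ := fun p => g p.1 + p.2 • (h (tanPar h σ (g p.1)) - g p.1) with hφ
  have hcont : Continuous φ := by
    have h1 := hp.outer.continuous
    have h2 := hp.inner.continuous.comp (hp.continuous_tangency σ)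
    exact (h1.comp continuous_fst).add (continuous_snd.smul
      ((h2.comp continuous_fst).sub (h1.comp continuous_fst)))
  have hU : φ '' (I ×ˢ Ioo 0 1) =
      (strip g h \ (range g ∪ range h)) ∩ {x | x ∈ strip g h ∧ base g h σ x ∈ I} := by
    ext x
    constructor
    · rintro ⟨⟨t, α⟩, ⟨ht, h0, h1⟩, rfl⟩
      have hseg : φ (t, α) ∈ segment ℝ (g t) (h (tanPar h σ (g t))) := by
        rw [segment_eq_image']; exact ⟨α, ⟨h0.le, h1.le⟩, rfl⟩
      obtain ⟨h2, h3⟩ := hmem.1 hseg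
      have hne : (h (tanPar h σ (g t))).1 - (g t).1 ≠ 0 := by
        have := hp.tangency_fst_ne σ t
        exact fun h => this (by linarith)
      have h4 : (φ (t, α)).1 - (g t).1 = α * ((h (tanPar h σ (g t))).1 - (g t).1) := by
        simp [hφ]
      refine ⟨⟨h2, ?_⟩, h2, by rwa [h3]⟩
      rintro (⟨t', ht'⟩ | ⟨s, hs⟩)
      · rw [← ht', hp.base_curve] at h3
        rw [← ht', h3, sub_self] at h4
        exact mul_ne_zero h0.ne' hne h4.symm
      · rw [hp.base_eq_iff, ← hs, hp.tanPar_inner] at h3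
        rw [← hs, h3] at h4
        exact h1.ne (mul_right_cancel₀ hne (by rw [one_mul, ← h4]))
    · rintro ⟨⟨-, h1⟩, h2, h3⟩
      have hseg := hmem.2 ⟨h2, rfl⟩
      rw [segment_eq_image'] at hseg
      obtain ⟨α, ⟨h4, h5⟩, h6⟩ := hseg
      refine ⟨(base g h σ x, α), ⟨h3, h4.lt_of_ne ?_, h5.lt_of_ne ?_⟩, h6⟩
      · rintro rfl; exact h1 (Or.inl ⟨base g h σ x, by simpa using h6⟩)
      · rintro rfl; exact h1 (Or.inr ⟨tanPar h σ (g (base g h σ x)), by simpa using h6⟩)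
  refine isPlaneDomain_of_param hcont (A := I ×ˢ Ioo 0 1) (B := J ×ˢ Icc 0 1)
    (hI.prod (isConnected_Ioo one_pos)) ?_ ?_ ?_ ?_
  · rw [closure_prod_eq, closure_Ioo zero_ne_one]; exact prod_mono hJ le_rfl
  · rw [hU]
    have := (hp.continuousOn_base σ).mono (sdiff_subset (t := range g ∪ range h))
    convert this.isOpen_inter_preimage hp.isOpen_strip_diff hIo using 1
    ext x
    exact ⟨fun hx => ⟨hx.1, hx.2.2⟩, fun hx => ⟨hx.1, hx.1.1, hx.2⟩⟩
  · rw [hU]; exact fun x hx => ⟨hx.2.1, hIJ hx.2.2⟩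
  · rintro x ⟨h1, h2⟩
    have hseg := hmem.2 ⟨h1, rfl⟩
    rw [segment_eq_image'] at hseg
    obtain ⟨α, h4, h6⟩ := hseg
    exact ⟨(base g h σ x, α), ⟨h2, h4⟩, h6⟩

/-- An angle is parametrized by the segments from its vertex to the free boundary. -/
lemma isPlaneDomain_triangle (u : ℝ) :
    IsPlaneDomain {x | x ∈ strip g h ∧ base g h Side.L x ≤ u ∧ u ≤ base g h Side.R x} := by
  have hmem : ∀ {x : ℝ × ℝ}, (∃ s ∈ Icc (tanPar h Side.R (g u)) (tanPar h Side.L (g u)),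
      x ∈ segment ℝ (g u) (h s)) ↔ x ∈ strip g h ∧ base g h Side.L x ≤ u ∧ u ≤ base g h Side.R x :=
    hp.mem_triangle_iff
  have hlt := hp.tangency_lt u
  have hgu := hp.curve_mem_strip u
  set φ : ℝ × ℝ → ℝ × ℝ := fun p => g u + p.2 • (h p.1 - g u) with hφ
  have hcont : Continuous φ := by
    have h2 := hp.inner.continuous
    fun_prop
  have hU : φ '' (Ioo (tanPar h Side.R (g u)) (tanPar h Side.L (g u)) ×ˢ Ioo 0 1) =
      (strip g h \ (range g ∪ range h)) ∩
        {x | (base g h Side.L x, base g h Side.R x) ∈ Iio u ×ˢ Ioi u} := by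
    ext x
    constructor
    · rintro ⟨⟨s, α⟩, ⟨hs, h0, h1⟩, rfl⟩
      have hseg : φ (s, α) ∈ segment ℝ (g u) (h s) := by
        rw [segment_eq_image']; exact ⟨α, ⟨h0.le, h1.le⟩, rfl⟩
      obtain ⟨h2, h3, h4⟩ := hmem.1 ⟨s, ⟨hs.1.le, hs.2.le⟩, hseg⟩
      have hgap : ∀ s', gap h (φ (s, α)) s' = (1 - α) * gap h (g u) s' + α * gap h (h s) s' := by
        intro s'
        rw [← IsConvexCurve.gap_add _ _ _ _ _ (by ring)]
        congr 1
        simp only [hφ]; module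
      have h5 : base g h Side.L (φ (s, α)) ≠ u := by
        intro heq
        rw [hp.base_eq_iff] at heq
        have h6 := hgap (tanPar h Side.L (g u))
        rw [hp.gap_tanPar hgu, ← heq, hp.gap_tanPar h2, heq, mul_zero, zero_add] at h6
        exact (mul_pos h0 (hp.inner.gap_pos hs.2.ne')).ne h6
      have h5' : base g h Side.R (φ (s, α)) ≠ u := by
        intro heq
        rw [hp.base_eq_iff] at heq
        have h6 := hgap (tanPar h Side.R (g u))
        rw [hp.gap_tanPar hgu, ← heq, hp.gap_tanPar h2, heq, mul_zero, zero_add] at h6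
        exact (mul_pos h0 (hp.inner.gap_pos hs.1.ne)).ne h6
      refine ⟨⟨h2, ?_⟩, h3.lt_of_ne h5, h4.lt_of_ne h5'.symm⟩
      rintro (⟨t', ht'⟩ | ⟨s', hs'⟩)
      · rw [← ht', hp.base_curve] at h3 h4 h5
        exact h5 (le_antisymm h3 h4)
      · have h6 := hgap s'
        rw [← hs', IsConvexCurve.gap_self] at h6
        have e1 : base g h Side.L (h s') < u := by rw [hs']; exact h3.lt_of_ne h5
        have e2 : u < base g h Side.R (h s') := by rw [hs']; exact h4.lt_of_ne h5'.symm
        rw [hp.base_lt_iff, hp.tanPar_inner] at e1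
        rw [hp.lt_base_iff, hp.tanPar_inner] at e2
        have e3 := hp.gap_neg_of_mem hgu e2 e1
        -- the point lies on the inner curve and inside the segment that ends on this curve
        have e4 := hp.le_fst_tanPar_L h2
        have e5 : s' = s := by
          by_contra hne
          have k1 := hp.inner.gap_pos (s := s) (t := s') (Ne.symm hne)
          have k2 := hgap s
          rw [← hs', IsConvexCurve.gap_self] at k2
          have k3 := hp.gap_neg_of_mem hgu hs.1 hs.2
          nlinarith
        rw [e5, IsConvexCurve.gap_self] at h6
        rw [e5] at e3
        nlinarith
    · rintro ⟨⟨h2, h1⟩, h3, h4⟩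
      obtain ⟨s, hs, hseg⟩ := hmem.2 ⟨h2, le_of_lt h3, le_of_lt h4⟩
      have hs1 : s ≠ tanPar h Side.R (g u) := by
        rintro rfl
        exact (ne_of_gt h4) (hp.mem_tangentSegment_iff.1 hseg).2
      have hs2 : s ≠ tanPar h Side.L (g u) := by
        rintro rfl
        exact (ne_of_lt h3) (hp.mem_tangentSegment_iff.1 hseg).2
      rw [segment_eq_image'] at hseg
      obtain ⟨α, ⟨h4, h5⟩, h6⟩ := hseg
      refine ⟨(s, α), ⟨⟨hs.1.lt_of_ne hs1.symm, hs.2.lt_of_ne hs2⟩, h4.lt_of_ne ?_,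
        h5.lt_of_ne ?_⟩, h6⟩
      · rintro rfl; exact h1 (Or.inl ⟨u, by simpa using h6⟩)
      · rintro rfl; exact h1 (Or.inr ⟨s, by simpa using h6⟩)
  refine isPlaneDomain_of_param hcont
    (B := Icc (tanPar h Side.R (g u)) (tanPar h Side.L (g u)) ×ˢ Icc 0 1)
    ((isConnected_Ioo hlt).prod (isConnected_Ioo one_pos)) ?_ ?_ ?_ ?_
  · rw [closure_prod_eq, closure_Ioo zero_ne_one, closure_Ioo hlt.ne]
  · rw [hU]
    have := ((hp.continuousOn_base Side.L).prodMk (hp.continuousOn_base Side.R)).mono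
      (sdiff_subset (t := range g ∪ range h))
    exact this.isOpen_inter_preimage hp.isOpen_strip_diff (isOpen_Iio.prod isOpen_Ioi)
  · rw [hU]; exact fun x hx => ⟨hx.1.1, le_of_lt hx.2.1, le_of_lt hx.2.2⟩
  · rintro x hx
    obtain ⟨s, hs, hseg⟩ := hmem.2 hx
    rw [segment_eq_image'] at hseg
    obtain ⟨α, h4, h6⟩ := hseg
    exact ⟨(s, α), ⟨hs, h4⟩, h6⟩

end IsTangentPair

/-- The convex hull of an arc of a convex curve. -/
lemma BoundaryData.isPlaneDomain_hull {G : ℝ → ℝ → ℝ × ℝ} {f : ℝ → ℝ} (hf : BoundaryData G f)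
    {a b : ℝ} (hab : a < b) : IsPlaneDomain
      {x : ℝ × ℝ | (∃ p, (G 0 p).1 = x.1 ∧ (G 0 p).2 ≤ x.2) ∧ chordGap G a b x ≤ 0} := by
  refine isPlaneDomain_of_convex ?_ ?_
  · rintro x ⟨⟨p, hp, hpx⟩, hx⟩ y ⟨⟨q, hq, hqy⟩, hy⟩ α β hα hβ hαβ
    have hmem : α • x + β • y ∈ segment ℝ x y := ⟨α, β, hα, hβ, hαβ, rfl⟩
    refine ⟨?_, ?_⟩
    · have h1 : (α • x + β • y).1 ∈ uIcc (G 0 p).1 (G 0 q).1 := by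
        rw [← segment_eq_uIcc, hp, hq]; exact ⟨α, β, hα, hβ, hαβ, rfl⟩
      obtain ⟨s, -, hs⟩ := intermediate_value_uIcc hf.curve.continuous_fst.continuousOn h1
      exact ⟨s, hs, hf.curve.le_snd_of_mem_segment hp hpx hq hqy hmem hs⟩
    · rw [chordGap_add _ _ _ _ _ _ _ hαβ]; nlinarith
  · obtain ⟨m, hm⟩ := exists_between hab
    have h1 := hf.chordGap_curve_neg hm
    have ho : IsOpen ({x : ℝ × ℝ | ∃ t, (G 0 t).1 = x.1 ∧ (G 0 t).2 < x.2} ∩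
        {x | chordGap G a b x < 0}) :=
      hf.curve.isOpen_epigraph.inter (isOpen_lt (continuous_chordGap G a b) continuous_const)
    have hsub := interior_maximal (t := {x : ℝ × ℝ | ∃ t, (G 0 t).1 = x.1 ∧ (G 0 t).2 < x.2} ∩
        {x | chordGap G a b x < 0}) (s := {x : ℝ × ℝ | (∃ p, (G 0 p).1 = x.1 ∧ (G 0 p).2 ≤ x.2) ∧
          chordGap G a b x ≤ 0})
      (fun x hx => ⟨hx.1.imp fun _ h => ⟨h.1, h.2.le⟩, le_of_lt hx.2⟩) ho
    refine ⟨((G 0 m).1, (G 0 m).2 - chordGap G a b (G 0 m) / 2), hsub ⟨⟨m, rfl, ?_⟩, ?_⟩⟩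
    · simp only; linarith
    · change chordGap G a b _ < 0
      have : chordGap G a b ((G 0 m).1, (G 0 m).2 - chordGap G a b (G 0 m) / 2) =
          chordGap G a b (G 0 m) / 2 := by
        simp only [chordGap]; ring
      rw [this]; linarith

end
end BellmanFoliation

namespace BellmanFoliation
noncomputable section

/-! ### The Bellman candidate of a foliation -/

variable {n : ℕ}

/-- A subdomain of one of the kinds allowed for a Bellman candidate. -/
def IsPatch (G : ℝ → ℝ → ℝ × ℝ) (B : ℝ × ℝ → ℝ) (ω : Set (ℝ × ℝ)) : Prop :=
  IsPlaneDomain ω ∧ (AffineOnSet B ω ∨ FoliatedBySegments G B ω)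

namespace FoliationData.Admissible

variable {D : FoliationData n} {εmax : EReal} {G : ℝ → ℝ → ℝ × ℝ} {f : ℝ → ℝ} {ε : ℝ}
  (H : D.Admissible εmax G f ε)
include H

lemma hasFDerivWithinAt_candidate {j : Piece n} {x : ℝ × ℝ} (hx : x ∈ D.region G ε j)
    {ω : Set (ℝ × ℝ)} (hω : ω ⊆ strip (G 0) (G ε)) :
    HasFDerivWithinAt (D.candidate G f ε) (planeGrad (D.planeOn G f ε j x)) ω x := by
  rw [← H.field_eq hx]
  exact (H.supports_field.hasFDerivWithinAt H.pair H.continuousOn_field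
    (D.region_subset j hx)).mono hω

lemma affineOnSet {j : Piece n} {ω : Set (ℝ × ℝ)} (hω : ω ⊆ D.region G ε j) {P : ℝ × ℝ × ℝ}
    (hP : ∀ x ∈ ω, D.planeOn G f ε j x = P) : AffineOnSet (D.candidate G f ε) ω :=
  ⟨P.1, P.2.1, P.2.2, fun x hx => by rw [H.candidate_eq (hω hx), hP x hx]; rfl⟩

/-- A tangent domain is foliated by tangents. -/
lemma foliated_tangents {j : Piece n} {σ : Side} {J : Set ℝ} {β : ℝ → ℝ}
    (hj : D.region G ε j = {x | x ∈ strip (G 0) (G ε) ∧ base (G 0) (G ε) σ x ∈ J})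
    (hP : ∀ x, D.planeOn G f ε j x =
      planeAt G f (base (G 0) (G ε) σ x) (β (base (G 0) (G ε) σ x))) :
    FoliatedBySegments G (D.candidate G f ε) (D.region G ε j) := by
  have hp := H.pair
  have hmem : ∀ {t : ℝ} {x : ℝ × ℝ}, x ∈ segment ℝ (G 0 t) (G ε (tanPar (G ε) σ (G 0 t))) ↔
      x ∈ strip (G 0) (G ε) ∧ base (G 0) (G ε) σ x = t := hp.mem_tangentSegment_iff
  refine ⟨(fun t => (G 0 t, G ε (tanPar (G ε) σ (G 0 t)))) '' J, ?_, ?_, ?_⟩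
  · rintro _ ⟨t, ht, rfl⟩
    have hsub : segment ℝ (G 0 t) (G ε (tanPar (G ε) σ (G 0 t))) ⊆ D.region G ε j := fun x hx => by
      obtain ⟨h1, h2⟩ := hmem.1 hx
      rw [hj]; exact ⟨h1, by rwa [h2]⟩
    refine ⟨fun h => ?_, hsub, planeGrad (planeAt G f t (β t)), fun x hx => ?_⟩
    · have := hp.tangency_fst_ne σ t
      exact this (sub_eq_zero.2 (congrArg Prod.fst h))
    · have := H.hasFDerivWithinAt_candidate (hsub hx) (D.region_subset j)
      rwa [hP, (hmem.1 hx).2] at this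
  · rintro _ ⟨t, ht, rfl⟩ _ ⟨τ, hτ, rfl⟩ hne
    refine Set.disjoint_left.2 fun x hx hx' => hne ?_
    rw [← (hmem.1 hx).2, ← (hmem.1 hx').2]
  · rintro x ⟨hx, -⟩
    rw [hj] at hx
    simp only [mem_iUnion]
    exact ⟨_, ⟨_, hx.2, rfl⟩, hmem.2 ⟨hx.1, rfl⟩⟩

/-- A full cup is foliated by chords. -/
lemma foliated_cup {i : Fin (n + 1)} {c b : ℝ} {s : ℝ → ℝ} (hi : D.core i = .cup c b s) :
    FoliatedBySegments G (D.candidate G f ε) (D.region G ε (.core i)) := by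
  have hf := H.boundary
  obtain ⟨hs, -⟩ := H.cup_spec hi
  refine ⟨(fun t => (G 0 (s t), G 0 t)) '' Ioc c b, ?_, ?_, ?_⟩
  · rintro _ ⟨t, ht, rfl⟩
    have ht' := Ioc_subset_Icc_self ht
    have hsub : segment ℝ (G 0 (s t)) (G 0 t) ⊆ D.region G ε (.core i) := fun x hx =>
      (H.mem_core_cup_iff hi).2 ⟨t, ht', hx⟩
    refine ⟨fun h => ?_, hsub, planeGrad (planeAt G f t (chordRatio G f (s t) t)), fun x hx => ?_⟩
    · exact (hs.map_lt_self ht).ne (hf.curve.fst_inj.1 (congrArg Prod.fst h))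
    · have := H.hasFDerivWithinAt_candidate (hsub hx) (D.region_subset (.core i))
      simpa only [planeOn, hi, Core.plane, hs.chordParam_eq hf ht' hx] using this
  · rintro _ ⟨t, ht, rfl⟩ _ ⟨τ, hτ, rfl⟩ hne
    refine Set.disjoint_left.2 fun x hx hx' => hne ?_
    rw [← hs.chordParam_eq hf (Ioc_subset_Icc_self ht) hx,
      ← hs.chordParam_eq hf (Ioc_subset_Icc_self hτ) hx']
  · rintro x ⟨hx, hx'⟩
    obtain ⟨t, ht, hxt⟩ := (H.mem_core_cup_iff hi).1 hx
    simp only [mem_iUnion]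
    rcases ht.1.eq_or_lt with h | h
    · rw [← h, hs.map_origin, segment_same] at hxt
      exact absurd ⟨c, hxt.symm⟩ hx'
    · exact ⟨_, ⟨t, ⟨h, ht.2⟩, rfl⟩, hxt⟩

lemma isPlaneDomain_interval (σ : Side) {l r : EReal} (h : l < r) :
    IsPlaneDomain {x | x ∈ strip (G 0) (G ε) ∧ base (G 0) (G ε) σ x ∈ realIcc l r} :=
  H.pair.isPlaneDomain_tangents σ (isConnected_realIoo h) (isOpen_realIoo l r)
    (fun _ ht => ⟨ht.1.le, ht.2.le⟩) (realIcc_subset_closure h)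

/-- A multicup splits into a part under a tangent line and a domain filled by tangents of one
type. -/
lemma exists_patches_multicup {i : Fin (n + 1)} {l r : EReal} (hi : D.core i = .multicup l r) :
    ∃ S : Set (Set (ℝ × ℝ)), S.Finite ∧ D.region G ε (.core i) = ⋃₀ S ∧
      ∀ ω ∈ S, IsPatch G (D.candidate G f ε) ω := by
  have hp := H.pair
  have hv := H.valid.core_valid i
  rw [hi] at hv
  obtain ⟨hlr, -, t₁, ht₁, t₂, ht₂, -, ht⟩ := hv
  have hreg : D.region G ε (.core i) = {x | x ∈ strip (G 0) (G ε) ∧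
      l ≤ base (G 0) (G ε) Side.L x ∧ base (G 0) (G ε) Side.R x ≤ r} := by
    simp only [region, hi, Core.left, Core.right]
  have haff : ∀ ω ⊆ D.region G ε (.core i), AffineOnSet (D.candidate G f ε) ω := fun ω hω =>
    H.affineOnSet hω (P := (Core.multicup l r).plane G f 0) fun x _ => by
      simp only [planeOn, hi, Core.plane]
  induction l with
  | top => exact absurd hlr not_top_lt
  | bot =>
    refine ⟨{D.region G ε (.core i)}, finite_singleton _, by simp, ?_⟩
    rintro _ rfl
    refine ⟨?_, Or.inl (haff _ le_rfl)⟩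
    rw [hreg]
    simpa only [realIcc, mem_ofPred_eq, bot_le, true_and] using H.isPlaneDomain_interval Side.R hlr
  | coe a =>
    obtain ⟨b, hb⟩ := hp.surjective_tangency Side.R (tanPar (G ε) Side.L (G 0 a))
    have hb : tanPar (G ε) Side.R (G 0 b) = tanPar (G ε) Side.L (G 0 a) := hb
    have hab : a < b := by
      rw [← (hp.strictMono_tangency Side.R).lt_iff_lt]
      change tanPar (G ε) Side.R (G 0 a) < tanPar (G ε) Side.R (G 0 b)
      rw [hb]; exact hp.tangency_lt a
    have hbr : (b : EReal) < r := by
      refine lt_of_lt_of_le (EReal.coe_lt_coe_iff.2 ?_) ht₂.2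
      rw [← (hp.strictMono_tangency Side.R).lt_iff_lt]
      change tanPar (G ε) Side.R (G 0 b) < tanPar (G ε) Side.R (G 0 t₂)
      rw [hb]
      exact ((hp.strictMono_tangency Side.L).monotone (EReal.coe_le_coe_iff.1 ht₁.1)).trans_lt ht
    have h1 : ∀ x ∈ strip (G 0) (G ε), b ≤ base (G 0) (G ε) Side.R x →
        a ≤ base (G 0) (G ε) Side.L x := by
      intro x hx h
      rw [hp.le_base_iff] at h ⊢
      rw [← hb]
      exact h.trans (hp.tanPar_le hx)
    have heq : D.region G ε (.core i) = {x | x ∈ strip (G 0) (G ε) ∧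
        a ≤ base (G 0) (G ε) Side.L x ∧ base (G 0) (G ε) Side.R x ≤ b} ∪
        {x | x ∈ strip (G 0) (G ε) ∧ base (G 0) (G ε) Side.R x ∈ realIcc b r} := by
      rw [hreg]
      ext x
      constructor
      · rintro ⟨hx, h2, h3⟩
        rcases le_total (base (G 0) (G ε) Side.R x) b with h | h
        · exact Or.inl ⟨hx, EReal.coe_le_coe_iff.1 h2, h⟩
        · exact Or.inr ⟨hx, EReal.coe_le_coe_iff.2 h, h3⟩
      · rintro (⟨hx, h2, h3⟩ | ⟨hx, h2, h3⟩)
        · exact ⟨hx, EReal.coe_le_coe_iff.2 h2, (EReal.coe_le_coe_iff.2 h3).trans hbr.le⟩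
        · exact ⟨hx, EReal.coe_le_coe_iff.2 (h1 x hx (EReal.coe_le_coe_iff.1 h2)), h3⟩
    refine ⟨{_, _}, toFinite _, heq.trans (sUnion_pair _ _).symm, ?_⟩
    rintro _ (rfl | rfl)
    · refine ⟨?_, Or.inl (haff _ (heq ▸ subset_union_left))⟩
      rw [← H.hull_eq hab hb.symm]
      exact H.boundary.isPlaneDomain_hull hab
    · exact ⟨H.isPlaneDomain_interval Side.R hbr, Or.inl (haff _ (heq ▸ subset_union_right))⟩

lemma exists_patches (j : Piece n) : ∃ S : Set (Set (ℝ × ℝ)), S.Finite ∧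
    D.region G ε j = ⋃₀ S ∧ ∀ ω ∈ S, IsPatch G (D.candidate G f ε) ω := by
  have hsingle : IsPatch G (D.candidate G f ε) (D.region G ε j) → ∃ S : Set (Set (ℝ × ℝ)),
      S.Finite ∧ D.region G ε j = ⋃₀ S ∧ ∀ ω ∈ S, IsPatch G (D.candidate G f ε) ω := fun h =>
    ⟨{D.region G ε j}, finite_singleton _, by simp, by rintro _ rfl; exact h⟩
  have hempty : (∀ x, x ∉ D.region G ε j) → ∃ S : Set (Set (ℝ × ℝ)),
      S.Finite ∧ D.region G ε j = ⋃₀ S ∧ ∀ ω ∈ S, IsPatch G (D.candidate G f ε) ω := fun h =>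
    ⟨∅, finite_empty, by rw [sUnion_empty]; exact eq_empty_of_forall_notMem h,
      fun _ h => h.elim⟩
  cases j with
  | angle k =>
    exact hsingle ⟨H.pair.isPlaneDomain_triangle (D.u k), Or.inl (H.affineOnSet le_rfl
      fun x _ => rfl)⟩
  | right i =>
    rcases eq_or_ne (D.core i).right ⊤ with h | h
    · refine hempty fun x hx => absurd hx.2.1 ?_
      rw [h]; exact not_le.2 (EReal.coe_lt_top _)
    · exact hsingle ⟨H.isPlaneDomain_interval Side.R (H.valid.right_lt i h),
        Or.inr (H.foliated_tangents rfl fun x => rfl)⟩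
  | left i =>
    rcases eq_or_ne (D.core i).left ⊥ with h | h
    · refine hempty fun x hx => absurd hx.2.2 ?_
      rw [h]; exact not_le.2 (EReal.bot_lt_coe _)
    · exact hsingle ⟨H.isPlaneDomain_interval Side.L (H.valid.lt_left i h),
        Or.inr (H.foliated_tangents rfl fun x => rfl)⟩
  | core i =>
    cases hi : D.core i with
    | cup c b s =>
      obtain ⟨hs, hw⟩ := H.cup_spec hi
      refine hsingle ⟨?_, Or.inr (H.foliated_cup hi)⟩
      have hlt := hs.map_lt_self (right_mem_Ioc.2 hs.lt)
      have := H.boundary.isPlaneDomain_hull hlt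
      rw [H.hull_eq hlt hw] at this
      simpa only [region, hi, Core.left, Core.right, EReal.coe_le_coe_iff] using this
    | multicup l r => exact H.exists_patches_multicup hi
    | minusInf => exact hempty fun x => core_infinite_empty (Or.inl hi) x
    | plusInf => exact hempty fun x => core_infinite_empty (Or.inr hi) x

theorem isBellmanCandidate : IsBellmanCandidate G f ε (D.candidate G f ε) := by
  have hΩ := H.family.Om_eq_strip H.mem H.pos
  refine ⟨H.contDiffOn_candidate.continuousOn, ?_, H.candidate_curve, ?_⟩
  · rw [hΩ]; exact H.supports_field.locallyConcaveOn
  · choose S hS hreg hpatch using H.exists_patches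
    obtain ⟨N, ω, -, hω⟩ := (finite_iUnion hS).fin_param
    have hun : Om G ε = ⋃ i, ω i := by
      rw [hΩ, ← H.iUnion_region, ← sUnion_range ω, hω, sUnion_iUnion]
      exact iUnion_congr hreg
    refine ⟨N, ω, hun, fun i => ?_⟩
    have hi : ω i ∈ ⋃ j, S j := hω ▸ mem_range_self i
    obtain ⟨j, hj⟩ := mem_iUnion.1 hi
    obtain ⟨h1, h2⟩ := hpatch j _ hj
    exact ⟨h1, H.contDiffOn_candidate.mono (hun ▸ subset_iUnion ω i), h2⟩

end FoliationData.Admissible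

end
end BellmanFoliation

namespace BellmanFoliation
noncomputable section

/-! ### The graph of a foliation -/

/-- A finite oriented graph is a tree if its edges join, in some order, every vertex but the root
with a vertex of smaller depth. -/
lemma isTree_of_child {V E : Type*} [Finite V] {src tgt : E → V} (root : V)
    (depth : V → ℕ) {parent child : E → V}
    (hpc : ∀ e, (src e = parent e ∧ tgt e = child e) ∨ (src e = child e ∧ tgt e = parent e))
    (hdepth : ∀ e, depth (parent e) < depth (child e)) (hroot : depth root = 0)
    (hinj : Function.Injective child) (hsurj : ∀ v ≠ root, ∃ e, child e = v) :
    (SimpleGraph.fromRel fun i j => ∃ e, src e = i ∧ tgt e = j).IsTree ∧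
      Function.Injective fun e => s(src e, tgt e) := by
  have hs : ∀ e, s(src e, tgt e) = s(parent e, child e) := by
    intro e
    rcases hpc e with ⟨h1, h2⟩ | ⟨h1, h2⟩
    · rw [h1, h2]
    · rw [h1, h2, Sym2.eq_swap]
  have hI : Function.Injective fun e => s(src e, tgt e) := by
    intro e e' h
    simp only [hs, Sym2.eq_iff] at h
    rcases h with ⟨-, h⟩ | ⟨h1, h2⟩
    · exact hinj h
    · have h3 := hdepth e
      have h4 := hdepth e'
      rw [h1, h2] at h3
      exact absurd h3 h4.not_gt
  have hroot' : ∀ e, child e ≠ root := fun e h => by have := hdepth e; rw [h, hroot] at this; omega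
  refine ⟨?_, hI⟩
  set Γ := SimpleGraph.fromRel fun i j => ∃ e, src e = i ∧ tgt e = j with hΓ
  have hne : ∀ e, parent e ≠ child e := fun e h => (hdepth e).ne (congrArg depth h)
  have hadj : ∀ e, Γ.Adj (parent e) (child e) := by
    intro e
    rw [hΓ, SimpleGraph.fromRel_adj]
    refine ⟨hne e, ?_⟩
    rcases hpc e with h | h
    · exact Or.inl ⟨e, h⟩
    · exact Or.inr ⟨e, h⟩
  have hreach : ∀ m, ∀ v, depth v = m → Γ.Reachable root v := by
    intro m
    induction m using Nat.strong_induction_on with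
    | _ m ih =>
      intro v hv
      rcases eq_or_ne v root with rfl | h
      · exact SimpleGraph.Reachable.refl _
      · obtain ⟨e, rfl⟩ := hsurj v h
        exact (ih _ (hv ▸ hdepth e) _ rfl).trans (hadj e).reachable
  rw [SimpleGraph.isTree_iff_connected_and_card]
  have : Nonempty V := ⟨root⟩
  -- connectedness by descent along the depth, and one edge for each vertex but the root
  refine ⟨⟨fun v w => (hreach _ v rfl).symm.trans (hreach _ w rfl)⟩, ?_⟩
  have hE : Γ.edgeSet = range fun e => s(src e, tgt e) := by
    ext z
    induction z using Sym2.ind with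
    | _ a b =>
      rw [SimpleGraph.mem_edgeSet, hΓ, SimpleGraph.fromRel_adj]
      constructor
      · rintro ⟨-, ⟨e, rfl, rfl⟩ | ⟨e, rfl, rfl⟩⟩
        · exact ⟨e, rfl⟩
        · exact ⟨e, Sym2.eq_swap⟩
      · rintro ⟨e, he⟩
        simp only [Sym2.eq_iff] at he
        refine ⟨?_, ?_⟩
        · rintro rfl
          rcases hpc e with ⟨h1, h2⟩ | ⟨h1, h2⟩ <;> rw [h1, h2] at he
          · exact hne e (by rcases he with h | h <;> rw [h.1, h.2])
          · exact hne e (by rcases he with h | h <;> rw [h.1, h.2])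
        · rcases he with h | h
          · exact Or.inl ⟨e, h⟩
          · exact Or.inr ⟨e, h⟩
  rw [hE, Nat.card_range_of_injective hI]
  have hC : range child = {root}ᶜ := by
    ext v
    exact ⟨by rintro ⟨e, rfl⟩; exact hroot' e, fun h => hsurj v h⟩
  rw [← Nat.card_range_of_injective hinj, hC, Nat.card_coe_set_eq,
    ← Set.ncard_singleton root, add_comm, Set.ncard_add_ncard_compl]

/-- Vertices of the graph of a foliation: upper borders of the central figures, angles, the two
infinities, and origins of cups. -/
inductive GVertex (n : ℕ)
  | source (i : Fin (n + 1))
  | angle (k : Fin n)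
  | minusInf
  | plusInf
  | origin (i : Fin (n + 1))

/-- Edges of the graph of a foliation. -/
inductive GEdge (n : ℕ)
  | right (i : Fin (n + 1))
  | left (i : Fin (n + 1))
  | cup (i : Fin (n + 1))

variable {n : ℕ}

instance : Finite (GVertex n) :=
  Finite.of_surjective (α := (Fin (n + 1) ⊕ Fin n) ⊕ Bool ⊕ Fin (n + 1))
    (fun x => match x with
      | .inl (.inl i) => .source i
      | .inl (.inr k) => .angle k
      | .inr (.inl true) => .minusInf
      | .inr (.inl false) => .plusInf
      | .inr (.inr i) => .origin i)
    (fun x => match x with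
      | .source i => ⟨.inl (.inl i), rfl⟩
      | .angle k => ⟨.inl (.inr k), rfl⟩
      | .minusInf => ⟨.inr (.inl true), rfl⟩
      | .plusInf => ⟨.inr (.inl false), rfl⟩
      | .origin i => ⟨.inr (.inr i), rfl⟩)

instance : Finite (GEdge n) :=
  Finite.of_surjective (α := Fin (n + 1) ⊕ Fin (n + 1) ⊕ Fin (n + 1))
    (fun x => match x with
      | .inl i => .right i
      | .inr (.inl i) => .left i
      | .inr (.inr i) => .cup i)
    (fun x => match x with
      | .right i => ⟨.inl i, rfl⟩
      | .left i => ⟨.inr (.inl i), rfl⟩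
      | .cup i => ⟨.inr (.inr i), rfl⟩)

namespace GEdge

/-- Every edge starts at the vertex of a central figure. -/
def src : GEdge n → GVertex n
  | right i => .source i
  | left i => .source i
  | cup i => .source i

/-- Tangent domains end at angles or, on the first and the last figure, at infinity. -/
def tgt : GEdge n → GVertex n
  | right i => Fin.lastCases .plusInf .angle i
  | left i => Fin.cases .minusInf .angle i
  | cup i => .origin i

/-- The endpoint that is closer to the leftmost central figure. -/
def parent : GEdge n → GVertex n
  | right i => .source i
  | left i => Fin.cases (.source 0) .angle i
  | cup i => .source i

/-- The endpoint that is farther from the leftmost central figure. -/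
def child : GEdge n → GVertex n
  | right i => Fin.lastCases .plusInf .angle i
  | left i => Fin.cases .minusInf (fun k => .source k.succ) i
  | cup i => .origin i

lemma src_tgt (e : GEdge n) :
    (e.src = e.parent ∧ e.tgt = e.child) ∨ (e.src = e.child ∧ e.tgt = e.parent) := by
  cases e with
  | right i => exact Or.inl ⟨rfl, rfl⟩
  | cup i => exact Or.inl ⟨rfl, rfl⟩
  | left i =>
    induction i using Fin.cases with
    | zero => exact Or.inl ⟨rfl, rfl⟩
    | succ k => exact Or.inr ⟨rfl, rfl⟩

lemma child_injective : Function.Injective (child (n := n)) := by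
  intro e e' h
  cases e with
  | right i =>
    cases e' with
    | right j =>
      induction i using Fin.lastCases <;> induction j using Fin.lastCases <;>
        simp_all [child]
    | left j =>
      induction i using Fin.lastCases <;> induction j using Fin.cases <;> simp_all [child]
    | cup j => induction i using Fin.lastCases <;> simp_all [child]
  | left i =>
    cases e' with
    | right j =>
      induction i using Fin.cases <;> induction j using Fin.lastCases <;> simp_all [child]
    | left j => induction i using Fin.cases <;> induction j using Fin.cases <;> simp_all [child]
    | cup j => induction i using Fin.cases <;> simp_all [child]
  | cup i =>
    cases e' with
    | right j => induction j using Fin.lastCases <;> simp_all [child]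
    | left j => induction j using Fin.cases <;> simp_all [child]
    | cup j => simp_all [child]

end GEdge

/-- Distance from the leftmost central figure. -/
def GVertex.depth : GVertex n → ℕ
  | source i => 2 * i
  | angle k => 2 * k + 1
  | minusInf => 1
  | plusInf => 2 * n + 1
  | origin i => 2 * i + 1

lemma GEdge.depth_lt (e : GEdge n) : e.parent.depth < e.child.depth := by
  cases e with
  | right i => induction i using Fin.lastCases <;> simp [parent, child, GVertex.depth]
  | left i =>
    induction i using Fin.cases <;> simp [parent, child, GVertex.depth]
    omega
  | cup i => simp [parent, child, GVertex.depth]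

namespace Core

/-- The central figure is a full cup. -/
def IsCup : Core → Prop
  | cup _ _ _ => True
  | _ => False

/-- The vertex that emits tangents from a central figure. -/
def vertex : Core → FVertex
  | cup _ b s => .longChord (s b) b
  | multicup l r => .multicup l r
  | minusInf => .minusInf
  | plusInf => .plusInf

/-- The origin of a cup; the value for the other figures is not used. -/
def origin : Core → ℝ
  | cup c _ _ => c
  | _ => 0

/-- The label of a cup; the value for the other figures is not used. -/
def edge : Core → FEdge
  | cup c b s => .cup c b s
  | _ => .cup 0 0 id

end Core

namespace FoliationData

variable (D : FoliationData n)

/-- Infinities are joined to tangent domains that reach them, and origins to cups. -/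
def HasVertex : GVertex n → Prop
  | .source _ => True
  | .angle _ => True
  | .minusInf => (D.core 0).left ≠ ⊥
  | .plusInf => (D.core (Fin.last n)).right ≠ ⊤
  | .origin i => (D.core i).IsCup

/-- Figures that reach infinity on one side have no tangent domain there. -/
def HasEdge : GEdge n → Prop
  | .right i => (D.core i).right ≠ ⊤
  | .left i => (D.core i).left ≠ ⊥
  | .cup i => (D.core i).IsCup

/-- The figure at a vertex of the graph. -/
def vertexLabel : GVertex n → FVertex
  | .source i => (D.core i).vertex
  | .angle k => .angle (D.u k)
  | .minusInf => .minusInf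
  | .plusInf => .plusInf
  | .origin i => .origin (D.core i).origin

/-- The figure on an edge of the graph. -/
def edgeLabel : GEdge n → FEdge
  | .right i => .tangents Side.R (D.core i).right (rightSink D.u i)
  | .left i => .tangents Side.L (leftSink D.u i) (D.core i).left
  | .cup i => (D.core i).edge

variable {D}

lemma hasVertex_tgt {e : GEdge n} (he : D.HasEdge e) : D.HasVertex e.tgt := by
  cases e with
  | right i =>
    induction i using Fin.lastCases with
    | last => simpa [GEdge.tgt, HasVertex, HasEdge] using he
    | cast k => simp [GEdge.tgt, HasVertex]
  | left i =>
    induction i using Fin.cases with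
    | zero => simpa [GEdge.tgt, HasVertex, HasEdge] using he
    | succ k => simp [GEdge.tgt, HasVertex]
  | cup i => exact he

lemma hasVertex_child {e : GEdge n} (he : D.HasEdge e) : D.HasVertex e.child := by
  rcases e.src_tgt with h | h
  · rw [← h.2]; exact hasVertex_tgt he
  · rw [← h.1]; cases e <;> trivial

variable (D)

/-- Numbering of the vertices. -/
def vNum : {v : GVertex n // D.HasVertex v} ≃ Fin (Nat.card {v : GVertex n // D.HasVertex v}) :=
  Finite.equivFin _

/-- Numbering of the edges. -/
def eNum : {e : GEdge n // D.HasEdge e} ≃ Fin (Nat.card {e : GEdge n // D.HasEdge e}) :=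
  Finite.equivFin _

/-- The graph of a foliation. -/
def graph : FoliationGraph where
  numV := Nat.card {v : GVertex n // D.HasVertex v}
  numE := Nat.card {e : GEdge n // D.HasEdge e}
  vertex i := D.vertexLabel (D.vNum.symm i).1
  edge e := D.edgeLabel (D.eNum.symm e).1
  src e := D.vNum ⟨(D.eNum.symm e).1.src, by cases (D.eNum.symm e).1 <;> trivial⟩
  tgt e := D.vNum ⟨(D.eNum.symm e).1.tgt, hasVertex_tgt (D.eNum.symm e).2⟩

variable {D}

/-- The vertex with a given number. -/
def vOf (i : Fin D.graph.numV) : GVertex n := (D.vNum.symm i).1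

/-- The edge with a given number. -/
def eOf (e : Fin D.graph.numE) : GEdge n := (D.eNum.symm e).1

lemma hasVertex_vOf (i : Fin D.graph.numV) : D.HasVertex (vOf i) := (D.vNum.symm i).2

lemma hasEdge_eOf (e : Fin D.graph.numE) : D.HasEdge (eOf e) := (D.eNum.symm e).2

lemma vOf_injective : Function.Injective (vOf (D := D)) := fun _ _ h =>
  D.vNum.symm.injective (Subtype.ext h)

lemma eOf_injective : Function.Injective (eOf (D := D)) := fun _ _ h =>
  D.eNum.symm.injective (Subtype.ext h)

lemma exists_vOf {v : GVertex n} (hv : D.HasVertex v) : ∃ i, vOf (D := D) i = v :=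
  ⟨D.vNum ⟨v, hv⟩, congrArg Subtype.val (D.vNum.symm_apply_apply ⟨v, hv⟩)⟩

lemma exists_eOf {e : GEdge n} (he : D.HasEdge e) : ∃ i, eOf (D := D) i = e :=
  ⟨D.eNum ⟨e, he⟩, congrArg Subtype.val (D.eNum.symm_apply_apply ⟨e, he⟩)⟩

lemma vOf_src (e : Fin D.graph.numE) : vOf (D.graph.src e) = (eOf e).src :=
  congrArg Subtype.val (D.vNum.symm_apply_apply _)

lemma vOf_tgt (e : Fin D.graph.numE) : vOf (D.graph.tgt e) = (eOf e).tgt :=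
  congrArg Subtype.val (D.vNum.symm_apply_apply _)

lemma src_eq_iff {e : Fin D.graph.numE} {i : Fin D.graph.numV} :
    D.graph.src e = i ↔ (eOf e).src = vOf i := by
  rw [← vOf_src, vOf_injective.eq_iff]

lemma tgt_eq_iff {e : Fin D.graph.numE} {i : Fin D.graph.numV} :
    D.graph.tgt e = i ↔ (eOf e).tgt = vOf i := by
  rw [← vOf_tgt, vOf_injective.eq_iff]

lemma graph_vertex (i : Fin D.graph.numV) : D.graph.vertex i = D.vertexLabel (vOf i) := rfl

lemma graph_edge (e : Fin D.graph.numE) : D.graph.edge e = D.edgeLabel (eOf e) := rfl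

lemma isSimple_graph : D.graph.IsSimple := by
  intro e e' h
  rw [tgt_eq_iff, vOf_src] at h
  cases h2 : eOf e with
  | right i => induction i using Fin.lastCases <;> cases h3 : eOf e' <;>
      simp_all [GEdge.tgt, GEdge.src]
  | left i => induction i using Fin.cases <;> cases h3 : eOf e' <;>
      simp_all [GEdge.tgt, GEdge.src]
  | cup i => cases h3 : eOf e' <;> simp_all [GEdge.tgt, GEdge.src]

lemma existsUnique_edge {P : GEdge n → Prop} (e₀ : GEdge n) (h₀ : D.HasEdge e₀) (hP : P e₀)
    (huniq : ∀ e, D.HasEdge e → P e → e = e₀) : ∃! e : Fin D.graph.numE, P (eOf e) := by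
  obtain ⟨e, rfl⟩ := exists_eOf h₀
  exact ⟨e, hP, fun e' he' => eOf_injective (huniq _ (hasEdge_eOf e') he')⟩

namespace Admissible

variable {εmax : EReal} {G : ℝ → ℝ → ℝ × ℝ} {f : ℝ → ℝ} {ε : ℝ}
  (H : D.Admissible εmax G f ε)
include H

lemma right_ne_top (k : Fin n) : (D.core k.castSucc).right ≠ ⊤ :=
  ((H.core_lt_u k).trans (EReal.coe_lt_top _)).ne

lemma left_ne_bot (k : Fin n) : (D.core k.succ).left ≠ ⊥ :=
  ((EReal.bot_lt_coe _).trans (H.u_lt_core k)).ne'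

lemma exists_child {v : GVertex n} (hv : D.HasVertex v) (hne : v ≠ .source 0) :
    ∃ e, D.HasEdge e ∧ e.child = v := by
  cases v with
  | source i =>
    induction i using Fin.cases with
    | zero => exact absurd rfl hne
    | succ k => exact ⟨.left k.succ, H.left_ne_bot k, rfl⟩
  | angle k => exact ⟨.right k.castSucc, H.right_ne_top k, by simp [GEdge.child]⟩
  | minusInf => exact ⟨.left 0, hv, rfl⟩
  | plusInf => exact ⟨.right (Fin.last n), hv, by simp [GEdge.child]⟩
  | origin i => exact ⟨.cup i, hv, rfl⟩

lemma isTree_graph : D.graph.underlying.IsTree ∧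
    Function.Injective fun e => s(D.graph.src e, D.graph.tgt e) := by
  have hpar : ∀ e : GEdge n, D.HasEdge e → D.HasVertex e.parent := by
    intro e he
    rcases e.src_tgt with h | h
    · rw [← h.1]; cases e <;> trivial
    · rw [← h.2]; exact hasVertex_tgt he
  choose par hpar' using fun e : Fin D.graph.numE => exists_vOf (hpar _ (hasEdge_eOf e))
  choose chi hchi using fun e : Fin D.graph.numE => exists_vOf (hasVertex_child (hasEdge_eOf e))
  obtain ⟨root, hroot⟩ := exists_vOf (D := D) (v := .source 0) trivial
  refine isTree_of_child root (fun i => (vOf i).depth) (parent := par) (child := chi)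
    (fun e => ?_) (fun e => ?_) ?_ ?_ fun v hv => ?_
  · rw [src_eq_iff, src_eq_iff, tgt_eq_iff, tgt_eq_iff, hpar', hchi]
    exact GEdge.src_tgt _
  · rw [hpar', hchi]; exact GEdge.depth_lt _
  · rw [hroot]; rfl
  · intro e e' h
    exact eOf_injective (GEdge.child_injective (by rw [← hchi, ← hchi, h]))
  · obtain ⟨e, he, h⟩ := H.exists_child (hasVertex_vOf v) fun h => hv (vOf_injective
      (h.trans hroot.symm))
    obtain ⟨e, rfl⟩ := exists_eOf he
    exact ⟨e, vOf_injective ((hchi e).trans h)⟩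

end Admissible

end FoliationData

end
end BellmanFoliation

namespace BellmanFoliation
noncomputable section

variable {n : ℕ}

namespace FoliationData.Admissible

variable {D : FoliationData n} {εmax : EReal} {G : ℝ → ℝ → ℝ × ℝ} {f : ℝ → ℝ} {ε : ℝ}
  (H : D.Admissible εmax G f ε)
include H

/-! ### The rules of a foliation graph -/

lemma vertexRule (i : Fin D.graph.numV) : D.graph.VertexRule i (D.graph.vertex i) := by
  have hv := D.hasVertex_vOf i
  rw [graph_vertex]
  cases hi : D.vOf i with
  | source j =>
    cases hc : D.core j with
    | cup c b s =>
      simp only [vertexLabel, hc, Core.vertex, FoliationGraph.VertexRule, src_eq_iff, graph_edge, hi]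
      refine ⟨existsUnique_edge (P := fun e => e.src = .source j ∧ (D.edgeLabel e).IsCup) (.cup j)
          ?_ ?_ ?_,
        existsUnique_edge (P := fun e => e.src = .source j ∧ (D.edgeLabel e).IsTangent Side.R)
          (.right j) ?_ ?_ ?_,
        existsUnique_edge (P := fun e => e.src = .source j ∧ (D.edgeLabel e).IsTangent Side.L)
          (.left j) ?_ ?_ ?_⟩
      · simp [HasEdge, hc, Core.IsCup]
      · simp [edgeLabel, hc, Core.edge, FEdge.IsCup, GEdge.src]
      · intro e he h; cases e <;> simp_all [edgeLabel, FEdge.IsCup, GEdge.src]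
      · simp [HasEdge, hc, Core.right]
      · simp [edgeLabel, FEdge.IsTangent, GEdge.src]
      · intro e he h
        cases e with
        | right k => simp_all [GEdge.src, edgeLabel, FEdge.IsTangent]
        | left k => simp_all [GEdge.src, edgeLabel, FEdge.IsTangent]
        | cup k =>
          obtain ⟨h1, h2⟩ := h
          obtain rfl : k = j := by simpa [GEdge.src] using h1
          simp [edgeLabel, hc, Core.edge, FEdge.IsTangent] at h2
      · simp [HasEdge, hc, Core.left]
      · simp [edgeLabel, FEdge.IsTangent, GEdge.src]
      · intro e he h
        cases e with
        | right k => simp_all [GEdge.src, edgeLabel, FEdge.IsTangent]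
        | left k => simp_all [GEdge.src, edgeLabel, FEdge.IsTangent]
        | cup k =>
          obtain ⟨h1, h2⟩ := h
          obtain rfl : k = j := by simpa [GEdge.src] using h1
          simp [edgeLabel, hc, Core.edge, FEdge.IsTangent] at h2
    | multicup l r =>
      simp only [vertexLabel, hc, Core.vertex, FoliationGraph.VertexRule, src_eq_iff, graph_edge, hi]
      refine ⟨fun h => existsUnique_edge
          (P := fun e => e.src = .source j ∧ (D.edgeLabel e).IsTangent Side.R) (.right j) ?_ ?_ ?_,
        fun h => existsUnique_edge
          (P := fun e => e.src = .source j ∧ (D.edgeLabel e).IsTangent Side.L) (.left j) ?_ ?_ ?_⟩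
      · simpa [HasEdge, hc, Core.right] using h
      · simp [edgeLabel, FEdge.IsTangent, GEdge.src]
      · intro e he h
        cases e <;> simp_all [edgeLabel, FEdge.IsTangent, GEdge.src, HasEdge, Core.IsCup]
      · simpa [HasEdge, hc, Core.left] using h
      · simp [edgeLabel, FEdge.IsTangent, GEdge.src]
      · intro e he h
        cases e <;> simp_all [edgeLabel, FEdge.IsTangent, GEdge.src, HasEdge, Core.IsCup]
    | minusInf =>
      simp only [vertexLabel, hc, Core.vertex, FoliationGraph.VertexRule, src_eq_iff, tgt_eq_iff, hi]
      refine existsUnique_edge (P := fun e => e.src = .source j ∨ e.tgt = .source j) (.right j)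
        (by simp [HasEdge, hc, Core.right]) (Or.inl rfl) fun e he h => ?_
      cases e with
      | right k => induction k using Fin.lastCases <;> simp_all [GEdge.src, GEdge.tgt]
      | left k =>
        induction k using Fin.cases <;> simp_all [GEdge.src, GEdge.tgt, HasEdge] <;>
          subst h <;> simp_all [Core.left]
      | cup k => simp_all [GEdge.src, GEdge.tgt, HasEdge, Core.IsCup]
    | plusInf =>
      simp only [vertexLabel, hc, Core.vertex, FoliationGraph.VertexRule, src_eq_iff, tgt_eq_iff, hi]
      refine existsUnique_edge (P := fun e => e.src = .source j ∨ e.tgt = .source j) (.left j)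
        (by simp [HasEdge, hc, Core.left]) (Or.inl rfl) fun e he h => ?_
      cases e with
      | left k => induction k using Fin.cases <;> simp_all [GEdge.src, GEdge.tgt]
      | right k =>
        induction k using Fin.lastCases <;> simp_all [GEdge.src, GEdge.tgt, HasEdge] <;>
          subst h <;> simp_all [Core.right]
      | cup k => simp_all [GEdge.src, GEdge.tgt, HasEdge, Core.IsCup]
  | angle k =>
    simp only [vertexLabel, FoliationGraph.VertexRule, tgt_eq_iff, graph_edge, hi]
    refine ⟨existsUnique_edge (P := fun e => e.tgt = .angle k ∧ (D.edgeLabel e).IsTangent Side.R)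
        (.right k.castSucc) (H.right_ne_top k) ?_ fun e he h => ?_,
      existsUnique_edge (P := fun e => e.tgt = .angle k ∧ (D.edgeLabel e).IsTangent Side.L)
        (.left k.succ) (H.left_ne_bot k) ?_ fun e he h => ?_⟩
    · simp [edgeLabel, FEdge.IsTangent, GEdge.tgt]
    · cases e with
      | right j => induction j using Fin.lastCases <;> simp_all [GEdge.tgt]
      | left j => simp_all [edgeLabel, FEdge.IsTangent]
      | cup j => simp_all [GEdge.tgt]
    · simp [edgeLabel, FEdge.IsTangent, GEdge.tgt]
    · cases e with
      | left j => induction j using Fin.cases <;> simp_all [GEdge.tgt]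
      | right j => simp_all [edgeLabel, FEdge.IsTangent]
      | cup j => simp_all [GEdge.tgt]
  | minusInf =>
    simp only [vertexLabel, FoliationGraph.VertexRule, src_eq_iff, tgt_eq_iff, hi]
    refine existsUnique_edge (P := fun e => e.src = .minusInf ∨ e.tgt = .minusInf) (.left 0)
      (by rwa [hi] at hv) (Or.inr rfl) fun e he h => ?_
    cases e with
    | right j => induction j using Fin.lastCases <;> simp_all [GEdge.src, GEdge.tgt]
    | left j => induction j using Fin.cases <;> simp_all [GEdge.src, GEdge.tgt]
    | cup j => simp_all [GEdge.src, GEdge.tgt]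
  | plusInf =>
    simp only [vertexLabel, FoliationGraph.VertexRule, src_eq_iff, tgt_eq_iff, hi]
    refine existsUnique_edge (P := fun e => e.src = .plusInf ∨ e.tgt = .plusInf)
      (.right (Fin.last n)) (by rwa [hi] at hv) (Or.inr (by simp [GEdge.tgt])) fun e he h => ?_
    cases e with
    | right j => induction j using Fin.lastCases <;> simp_all [GEdge.src, GEdge.tgt]
    | left j => induction j using Fin.cases <;> simp_all [GEdge.src, GEdge.tgt]
    | cup j => simp_all [GEdge.src, GEdge.tgt]
  | origin j =>
    simp only [vertexLabel, FoliationGraph.VertexRule, tgt_eq_iff, hi]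
    refine existsUnique_edge (P := fun e => e.tgt = .origin j) (.cup j)
      (by rwa [hi] at hv) rfl fun e he h => ?_
    cases e with
    | right j => induction j using Fin.lastCases <;> simp_all [GEdge.tgt]
    | left j => induction j using Fin.cases <;> simp_all [GEdge.tgt]
    | cup j => simp_all [GEdge.tgt]

omit H in
lemma emits_label {e : GEdge n} (he : D.HasEdge e) : Emits (D.vertexLabel e.src) (D.edgeLabel e) := by
  cases e with
  | right i =>
    cases hc : D.core i <;>
      simp_all [HasEdge, GEdge.src, vertexLabel, edgeLabel, Core.vertex, Core.right, Emits]
  | left i =>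
    cases hc : D.core i <;>
      simp_all [HasEdge, GEdge.src, vertexLabel, edgeLabel, Core.vertex, Core.left, Emits]
  | cup i =>
    cases hc : D.core i <;>
      simp_all [HasEdge, GEdge.src, vertexLabel, edgeLabel, Core.vertex, Core.edge, Core.IsCup, Emits]

omit H in
lemma receives_label {e : GEdge n} (he : D.HasEdge e) :
    Receives (D.vertexLabel e.tgt) (D.edgeLabel e) := by
  cases e with
  | right i =>
    induction i using Fin.lastCases <;> simp [GEdge.tgt, vertexLabel, edgeLabel, Receives]
  | left i =>
    induction i using Fin.cases <;> simp [GEdge.tgt, vertexLabel, edgeLabel, Receives]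
  | cup i =>
    cases hc : D.core i <;>
      simp_all [HasEdge, GEdge.tgt, vertexLabel, edgeLabel, Core.origin, Core.edge, Core.IsCup,
        Receives]

lemma Om_eq : Om G ε = strip (G 0) (G ε) := H.family.Om_eq_strip H.mem H.pos

lemma chord_subset {i : Fin (n + 1)} {c b : ℝ} {s : ℝ → ℝ} (hi : D.core i = .cup c b s) {t : ℝ}
    (ht : t ∈ Icc c b) : segment ℝ (G 0 (s t)) (G 0 t) ⊆ D.region G ε (.core i) := fun _ hx =>
  (H.mem_core_cup_iff hi).2 ⟨t, ht, hx⟩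

lemma vertexAdmissible {v : GVertex n} (hv : D.HasVertex v) :
    VertexAdmissible G f ε (D.vertexLabel v) := by
  have hf := H.boundary
  cases v with
  | source i =>
    cases hc : D.core i with
    | cup c b s =>
      obtain ⟨hs, hw⟩ := H.cup_spec hc
      simp only [vertexLabel, hc, Core.vertex, VertexAdmissible, H.family.tpar_eq H.mem, H.Om_eq]
      exact ⟨hs.map_lt_self (right_mem_Ioc.2 hs.lt),
        (H.chord_subset hc hs.right_mem).trans (D.region_subset _), hw,
        hs.cupEquation hf hs.right_mem, hs.differential_ne_zero hf⟩
    | multicup l r =>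
      have h := H.valid.core_valid i
      rw [hc] at h
      obtain ⟨hlr, -, t₁, ht₁, t₂, ht₂, -, ht⟩ := h
      simp only [vertexLabel, hc, Core.vertex, VertexAdmissible, H.Om_eq]
      refine ⟨hlr, fun hsub => ?_⟩
      exact ht.not_ge (H.pair.tanPar_le_of_segment_subset (((convex_convexHull ℝ _).segment_subset
        (subset_convexHull ℝ _ (mem_image_of_mem _ ht₂)) (subset_convexHull ℝ _ (mem_image_of_mem _ ht₁))).trans hsub))
    | minusInf => simp [vertexLabel, hc, Core.vertex, VertexAdmissible]
    | plusInf => simp [vertexLabel, hc, Core.vertex, VertexAdmissible]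
  | angle k => trivial
  | minusInf => trivial
  | plusInf => trivial
  | origin i => trivial

lemma edgeAdmissible {e : GEdge n} (he : D.HasEdge e) : EdgeAdmissible G ε (D.edgeLabel e) := by
  have hf := H.boundary
  cases e with
  | right i => exact H.valid.right_lt i he
  | left i => exact H.valid.lt_left i he
  | cup i =>
    cases hc : D.core i with
    | cup c b s =>
      obtain ⟨hs, hw⟩ := H.cup_spec hc
      have h := H.valid.core_valid i
      rw [hc] at h
      obtain ⟨⟨b', hb', hs'⟩, -, -⟩ := h
      simp only [edgeLabel, hc, Core.edge, EdgeAdmissible, H.Om_eq]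
      exact ⟨hs.lt, hs.map_origin, hs.strictAnti, hs.continuousOn, hs'.contDiffOn hf hb',
        fun t ht => (H.chord_subset hc ht).trans (D.region_subset _)⟩
    | multicup l r => simp [HasEdge, hc, Core.IsCup] at he
    | minusInf => simp [HasEdge, hc, Core.IsCup] at he
    | plusInf => simp [HasEdge, hc, Core.IsCup] at he

/-! ### Figures of the graph -/

omit H in
open Classical in
/-- The piece of the domain that corresponds to a vertex or an edge; degenerate figures have
none. -/
def figPiece (D : FoliationData n) : GVertex n ⊕ GEdge n → Option (Piece n)
  | .inl (.source i) => if (D.core i).IsCup then none else some (.core i)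
  | .inl (.angle k) => some (.angle k)
  | .inl _ => none
  | .inr (.right i) => some (.right i)
  | .inr (.left i) => some (.left i)
  | .inr (.cup i) => some (.core i)

omit H in
lemma figPiece_injective {x y : GVertex n ⊕ GEdge n}
    (hx : ∀ e, x = .inr e → D.HasEdge e) (hy : ∀ e, y = .inr e → D.HasEdge e) {p : Piece n}
    (h1 : figPiece D x = some p) (h2 : figPiece D y = some p) : x = y := by
  rcases x with (_ | _ | _ | _ | _) | (_ | _ | _) <;>
    rcases y with (_ | _ | _ | _ | _) | (_ | _ | _) <;>
    cases p <;> simp_all [figPiece, HasEdge] <;> grind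

lemma vertexRegion_label {v : GVertex n} (hv : D.HasVertex v) :
    (∃ p, figPiece D (.inl v) = some p ∧ vertexRegion G ε (D.vertexLabel v) = D.region G ε p) ∨
      (figPiece D (.inl v) = none ∧ interior (vertexRegion G ε (D.vertexLabel v)) = ∅ ∧
        vertexRegion G ε (D.vertexLabel v) ⊆ strip (G 0) (G ε)) := by
  have hf := H.boundary
  have hmem := fun σ t x => H.family.mem_tanSeg_iff H.mem H.pos (σ := σ) (t := t) (x := x)
  cases v with
  | source i =>
    cases hc : D.core i with
    | cup c b s =>
      obtain ⟨hs, -⟩ := H.cup_spec hc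
      simp only [vertexLabel, hc, Core.vertex, vertexRegion]
      refine Or.inr ⟨by simp [figPiece, hc, Core.IsCup], interior_eq_empty_of_graph (φ := fun y => (G 0 b).2 +
        chordSlope G (s b) b * (y - (G 0 b).1)) fun x hx => ?_,
        (H.chord_subset hc hs.right_mem).trans (D.region_subset _)⟩
      have := IsCup.chordGap_eq_zero hf hx
      rw [chordGap] at this
      linarith
    | multicup l r =>
      refine Or.inl ⟨.core i, by simp [figPiece, hc, Core.IsCup], ?_⟩
      ext x
      simp only [vertexLabel, hc, Core.vertex, vertexRegion, mem_inter_iff, mem_iUnion, hmem,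
        exists_prop, region, Core.left, Core.right, mem_ofPred_eq]
      constructor
      · rintro ⟨⟨t, ht, hx, rfl⟩, ⟨t', ht', -, rfl⟩⟩
        exact ⟨hx, ht.1, ht'.2⟩
      · rintro ⟨hx, h1, h2⟩
        exact ⟨⟨_, ⟨h1, (H.base_le hx).trans h2⟩, hx, rfl⟩,
          ⟨_, ⟨h1.trans (H.base_le hx), h2⟩, hx, rfl⟩⟩
    | minusInf =>
      refine Or.inl ⟨.core i, by simp [figPiece, hc, Core.IsCup], ?_⟩
      simp only [vertexLabel, hc, Core.vertex, vertexRegion]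
      exact (eq_empty_of_forall_notMem fun x => core_infinite_empty (Or.inl hc) x).symm
    | plusInf =>
      refine Or.inl ⟨.core i, by simp [figPiece, hc, Core.IsCup], ?_⟩
      simp only [vertexLabel, hc, Core.vertex, vertexRegion]
      exact (eq_empty_of_forall_notMem fun x => core_infinite_empty (Or.inr hc) x).symm
  | angle k =>
    refine Or.inl ⟨.angle k, rfl, ?_⟩
    ext x
    exact H.family.mem_curvTriangle_iff H.mem H.pos
  | minusInf => simp [vertexLabel, vertexRegion, figPiece]
  | plusInf => simp [vertexLabel, vertexRegion, figPiece]
  | origin i =>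
    right
    simp only [vertexLabel, vertexRegion, interior_singleton, singleton_subset_iff, true_and,
      figPiece]
    exact H.pair.curve_mem_strip _

lemma edgeRegion_label {e : GEdge n} (he : D.HasEdge e) :
    ∃ p, figPiece D (.inr e) = some p ∧ edgeRegion G ε (D.edgeLabel e) = D.region G ε p := by
  have hmem := fun σ t x => H.family.mem_tanSeg_iff H.mem H.pos (σ := σ) (t := t) (x := x)
  cases e with
  | right i =>
    refine ⟨.right i, rfl, ?_⟩
    ext x
    simp only [edgeLabel, edgeRegion, mem_iUnion, hmem, exists_prop, region, mem_ofPred_eq]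
    exact ⟨by rintro ⟨t, ht, hx, rfl⟩; exact ⟨hx, ht⟩, fun h => ⟨_, h.2, h.1, rfl⟩⟩
  | left i =>
    refine ⟨.left i, rfl, ?_⟩
    ext x
    simp only [edgeLabel, edgeRegion, mem_iUnion, hmem, exists_prop, region, mem_ofPred_eq]
    exact ⟨by rintro ⟨t, ht, hx, rfl⟩; exact ⟨hx, ht⟩, fun h => ⟨_, h.2, h.1, rfl⟩⟩
  | cup i =>
    refine ⟨.core i, rfl, ?_⟩
    cases hc : D.core i with
    | cup c b s =>
      ext x
      rw [H.mem_core_cup_iff hc]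
      simp only [edgeLabel, hc, Core.edge, edgeRegion, mem_iUnion, exists_prop]
    | multicup l r => simp [HasEdge, hc, Core.IsCup] at he
    | minusInf => simp [HasEdge, hc, Core.IsCup] at he
    | plusInf => simp [HasEdge, hc, Core.IsCup] at he

lemma interior_inter_eq_empty {p q : Piece n} (hpq : p ≠ q) :
    interior (D.region G ε p ∩ D.region G ε q) = ∅ := by
  obtain ⟨σ, t, h⟩ := (H.compat hpq).1
  refine interior_eq_empty_of_graph (φ := fun y => (G 0 t).2 +
    curveSlope (G ε) (tanPar (G ε) σ (G 0 t)) * (y - (G 0 t).1)) fun x hx => ?_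
  have h1 := h x hx.1 hx.2
  have h2 := H.pair.gap_tanPar (D.region_subset p hx.1) σ
  rw [H.pair.base_eq_iff.1 h1, H.pair.gap_eq_of_tangency] at h2
  linarith

lemma isFoliation_graph : D.graph.IsFoliation G f ε where
  tree := H.isTree_graph.1
  no_multi_edges := H.isTree_graph.2
  vertex_admissible i := H.vertexAdmissible (D.hasVertex_vOf i)
  edge_admissible e := H.edgeAdmissible (D.hasEdge_eOf e)
  emits e := by rw [graph_vertex, vOf_src]; exact emits_label (D.hasEdge_eOf e)
  receives e := by rw [graph_vertex, vOf_tgt]; exact receives_label (D.hasEdge_eOf e)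
  vertex_rule := H.vertexRule
  cover := by
    rw [H.Om_eq]
    refine subset_antisymm (iUnion_subset ?_) fun x hx => ?_
    · rintro (i | e)
      · rcases H.vertexRegion_label (D.hasVertex_vOf i) with ⟨p, -, h⟩ | ⟨-, -, h⟩
        · exact h.le.trans (D.region_subset p)
        · exact h
      · obtain ⟨p, -, h⟩ := H.edgeRegion_label (D.hasEdge_eOf e)
        exact h.le.trans (D.region_subset p)
    · have hV : ∀ v p, D.HasVertex v → figPiece D (.inl v) = some p → x ∈ D.region G ε p →
          x ∈ ⋃ y, D.graph.region G ε y := by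
        intro v p hv hp hxp
        obtain ⟨i, rfl⟩ := D.exists_vOf hv
        refine mem_iUnion.2 ⟨.inl i, ?_⟩
        rcases H.vertexRegion_label hv with ⟨q, hq, h⟩ | ⟨hq, -⟩
        · rw [hp, Option.some_inj] at hq
          exact h.ge (hq ▸ hxp)
        · rw [hp] at hq; exact absurd hq (Option.some_ne_none _)
      have hE : ∀ e p, D.HasEdge e → figPiece D (.inr e) = some p → x ∈ D.region G ε p →
          x ∈ ⋃ y, D.graph.region G ε y := by
        intro e p he hp hxp
        obtain ⟨i, rfl⟩ := D.exists_eOf he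
        obtain ⟨q, hq, h⟩ := H.edgeRegion_label he
        rw [hp, Option.some_inj] at hq
        exact mem_iUnion.2 ⟨.inr i, h.ge (hq ▸ hxp)⟩
      obtain ⟨j, hj⟩ := H.exists_piece hx
      cases j with
      | angle k => exact hV (.angle k) _ trivial rfl hj
      | right i =>
        refine hE (.right i) _ (fun h => ?_) rfl hj
        have := hj.2.1
        rw [h] at this
        exact absurd this (not_le.2 (EReal.coe_lt_top _))
      | left i =>
        refine hE (.left i) _ (fun h => ?_) rfl hj
        have := hj.2.2
        rw [h] at this
        exact absurd this (not_le.2 (EReal.bot_lt_coe _))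
      | core i =>
        by_cases hc : (D.core i).IsCup
        · exact hE (.cup i) _ hc rfl hj
        · exact hV (.source i) _ trivial (by simp [figPiece, hc]) hj
  disjoint := by
    have key : ∀ x, ∃ y, (∀ e, y = .inr e → D.HasEdge e) ∧
        y = Sum.map D.vOf D.eOf x ∧ ((∃ p, figPiece D y = some p ∧
          D.graph.region G ε x = D.region G ε p) ∨ interior (D.graph.region G ε x) = ∅) := by
      rintro (i | e)
      · refine ⟨.inl (D.vOf i), by simp, rfl, ?_⟩
        exact (H.vertexRegion_label (D.hasVertex_vOf i)).imp id fun h => h.2.1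
      · refine ⟨.inr (D.eOf e), ?_, rfl, Or.inl (H.edgeRegion_label (D.hasEdge_eOf e))⟩
        rintro e' h; rw [← Sum.inr_injective h]; exact D.hasEdge_eOf e
    intro x y hxy
    obtain ⟨x', hx', hxx', ⟨p, hp, hpx⟩ | h⟩ := key x
    · obtain ⟨y', hy', hyy', ⟨q, hq, hqy⟩ | h⟩ := key y
      · rw [hpx, hqy, disjoint_iff_inter_eq_empty, ← interior_inter]
        refine H.interior_inter_eq_empty fun hpq => hxy ?_
        subst hpq
        have := figPiece_injective hx' hy' hp hq
        rw [hxx', hyy'] at this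
        exact Sum.map_injective.2 ⟨D.vOf_injective, D.eOf_injective⟩ this
      · rw [h]; exact disjoint_empty _
    · rw [h]; exact empty_disjoint _

end FoliationData.Admissible

end
end BellmanFoliation

namespace BellmanFoliation
noncomputable section

variable {n : ℕ}

namespace FoliationData.Admissible

variable {D : FoliationData n} {εmax : EReal} {G : ℝ → ℝ → ℝ × ℝ} {f : ℝ → ℝ} {ε : ℝ}
  (H : D.Admissible εmax G f ε)
include H

/-! ### The function generated by the graph -/

lemma candidate_tangent {j : Piece n} {σ : Side} {β : ℝ → ℝ}
    (hP : ∀ x, D.planeOn G f ε j x =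
      planeAt G f (base (G 0) (G ε) σ x) (β (base (G 0) (G ε) σ x))) {t : ℝ} {x : ℝ × ℝ}
    (hx : x ∈ tanSeg G ε σ t) (hj : x ∈ D.region G ε j) :
    D.candidate G f ε x = f t + (x.1 - (G 0 t).1) *
      (kap3 G f t + (slope G ε σ t - kap2 G t) * β t) := by
  obtain ⟨hxS, rfl⟩ := (H.family.mem_tanSeg_iff H.mem H.pos).1 hx
  have h2 := H.pair.gap_tanPar hxS σ
  rw [H.candidate_eq hj, hP, planeEval_planeAt, H.family.slope_eq H.mem H.pos]
  rw [← H.pair.tangency_base, H.pair.gap_eq_of_tangency] at h2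
  linear_combination β (base (G 0) (G ε) σ x) * h2

lemma relaxation_eq {σ : Side} {β : ℝ → ℝ} (hβ : IsRelaxation (rate G ε σ) (tors G f) β) (s t : ℝ) :
    β t = Real.exp (-∫ x in s..t, rate G ε σ x) *
      ((∫ τ in s..t, Real.exp (∫ x in s..τ, rate G ε σ x) *
        (deriv (kap3 G f) τ / (kap2 G τ - slope G ε σ τ))) + β s) := by
  have hf := H.boundary
  have h : ∀ τ, deriv (kap3 G f) τ / (kap2 G τ - slope G ε σ τ) = rate G ε σ τ * tors G f τ := by
    intro τ
    rw [div_eq_iff (H.family.kap2_sub_slope_ne H.mem H.pos σ τ), hf.deriv_kap3]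
    linear_combination -tors G f τ * H.family.rate_mul H.mem H.pos σ τ
  simp only [h]
  exact hβ.eq_integral (H.family.continuous_rate H.mem H.pos σ) hf.continuous_tors s t

lemma standardOnEdge {e : GEdge n} (he : D.HasEdge e) :
    StandardOnEdge G f ε (D.candidate G f ε) (D.edgeLabel e) := by
  have hf := H.boundary
  have hθ := hf.continuous_tors
  have hρ := H.family.continuous_rate H.mem H.pos
  have hmem := fun σ t x => H.family.mem_tanSeg_iff H.mem H.pos (σ := σ) (t := t) (x := x)
  cases e with
  | right i =>
    have hβ := H.valid.solR i he
    refine ⟨D.βR i, fun t ht x hx => ?_, fun s _ t _ => H.relaxation_eq hβ s t, ?_, ?_⟩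
    · obtain ⟨h1, h2⟩ := (hmem _ _ _).1 hx
      exact H.candidate_tangent (j := .right i) (fun x => rfl) hx ⟨h1, by rwa [h2]⟩
    · intro hl t _
      have h1 := (H.valid.decayR i hl t).const_add (tors G f t - D.βR i t)
      rw [add_zero] at h1
      exact h1.congr fun s => (hβ.stieltjes_eq (hρ _) hθ s t).symm
    · intro t ht
      rw [(hβ t).deriv]
      exact mul_neg_of_pos_of_neg (H.family.rate_R_pos H.mem H.pos t)
        (sub_neg.2 (H.valid.ltR i t ht))
  | left i =>
    have hβ := H.valid.solL i he
    refine ⟨D.βL i, fun t ht x hx => ?_, fun s _ t _ => H.relaxation_eq hβ s t, ?_, ?_⟩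
    · obtain ⟨h1, h2⟩ := (hmem _ _ _).1 hx
      exact H.candidate_tangent (j := .left i) (fun x => rfl) hx ⟨h1, by rwa [h2]⟩
    · intro hl t _
      have h1 := (H.valid.decayL i hl t).const_add (tors G f t - D.βL i t)
      rw [add_zero] at h1
      exact h1.congr fun s => (hβ.stieltjes_eq (hρ _) hθ s t).symm
    · intro t ht
      rw [(hβ t).deriv]
      exact mul_pos_of_neg_of_neg (H.family.rate_L_neg H.mem H.pos t)
        (sub_neg.2 (H.valid.ltL i t ht))
  | cup i =>
    cases hc : D.core i with
    | cup c b s =>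
      obtain ⟨hs, -⟩ := H.cup_spec hc
      simp only [edgeLabel, hc, Core.edge, StandardOnEdge]
      refine ⟨fun t ht α hα => ?_, fun t ht => hs.cupEquation hf ht,
        fun t ht => hs.det3_pos hf (Ioo_subset_Ioc_self ht)⟩
      have hx : α • G 0 t + (1 - α) • G 0 (s t) ∈ segment ℝ (G 0 (s t)) (G 0 t) :=
        ⟨1 - α, α, by linarith [hα.2], hα.1, by ring, add_comm _ _⟩
      rw [H.candidate_eq (H.chord_subset hc ht hx)]
      simp only [planeOn, hc, Core.plane, hs.chordParam_eq hf ht hx]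
      have h1 := hs.planeEval_chord hf ht
      have h2 := planeEval_planeAt_self G f t (chordRatio G f (s t) t)
      simp only [planeEval, Prod.fst_add, Prod.snd_add, Prod.smul_fst, Prod.smul_snd,
        smul_eq_mul] at h1 h2 ⊢
      linear_combination α * h2 + (1 - α) * h1
    | multicup l r => simp [HasEdge, hc, Core.IsCup] at he
    | minusInf => simp [HasEdge, hc, Core.IsCup] at he
    | plusInf => simp [HasEdge, hc, Core.IsCup] at he

lemma standardOnVertex {v : GVertex n} (hv : D.HasVertex v) :
    StandardOnVertex G f ε (D.candidate G f ε) (D.vertexLabel v) := by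
  have hf := H.boundary
  cases v with
  | source i =>
    cases hc : D.core i with
    | cup c b s =>
      have h := H.standardOnEdge (e := .cup i) (by simp [HasEdge, hc, Core.IsCup])
      obtain ⟨hs, -⟩ := H.cup_spec hc
      simp only [edgeLabel, hc, Core.edge, StandardOnEdge] at h
      simp only [vertexLabel, hc, Core.vertex, StandardOnVertex]
      exact h.1 b hs.right_mem
    | multicup l r =>
      have hreg : vertexRegion G ε (.multicup l r) = D.region G ε (.core i) := by
        rcases H.vertexRegion_label (v := .source i) trivial with ⟨p, hp, h⟩ | ⟨h, -⟩
        · rw [figPiece, if_neg (by simp [hc, Core.IsCup]), Option.some_inj] at hp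
          rw [← hp] at h
          simpa only [vertexLabel, hc, Core.vertex] using h
        · simp [figPiece, hc, Core.IsCup] at h
      have hP : ∀ x ∈ D.region G ε (.core i), D.candidate G f ε x =
          planeEval ((Core.multicup l r).plane G f 0) x := fun x hx => by
        rw [H.candidate_eq hx]; simp only [planeOn, hc, Core.plane]
      simp only [vertexLabel, hc, Core.vertex]
      refine ⟨_, _, _, fun t ht => ?_, fun x hx => hP x (hreg ▸ hx)⟩
      rw [← H.candidate_curve t]
      refine hP _ ⟨H.pair.curve_mem_strip t, ?_⟩
      rw [H.pair.base_curve, H.pair.base_curve, hc]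
      exact ht
    | minusInf => simp [vertexLabel, hc, Core.vertex, StandardOnVertex]
    | plusInf => simp [vertexLabel, hc, Core.vertex, StandardOnVertex]
  | angle k =>
    set b := D.βR k.castSucc (D.u k)
    refine ⟨kap3 G f (D.u k) - b * kap2 G (D.u k), b, ?_, fun x hx => ?_⟩
    · rw [hf.deriv_snd, hf.deriv_eq]; ring
    · have hx' : x ∈ D.region G ε (.angle k) := (H.family.mem_curvTriangle_iff H.mem H.pos).1 hx
      rw [H.candidate_eq hx']
      exact planeEval_planeAt _ _ _ _ _
  | minusInf => trivial
  | plusInf => trivial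
  | origin i => exact H.candidate_curve _

lemma generates_graph : D.graph.Generates G f ε (D.candidate G f ε) :=
  ⟨fun i => H.standardOnVertex (D.hasVertex_vOf i), fun e => H.standardOnEdge (D.hasEdge_eOf e)⟩

omit H in
lemma exists_cup_iff {c : ℝ} : (∃ e b s, D.graph.edge e = FEdge.cup c b s) ↔
    ∃ i b s, D.core i = .cup c b s := by
  constructor
  · rintro ⟨e, b, s, h⟩
    have he := D.hasEdge_eOf e
    rw [graph_edge] at h
    cases h' : D.eOf e with
    | right i => rw [h'] at h; cases h
    | left i => rw [h'] at h; cases h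
    | cup i =>
      rw [h'] at h he
      refine ⟨i, b, s, ?_⟩
      cases hc : D.core i <;>
        simp_all [edgeLabel, Core.edge, HasEdge, Core.IsCup]
  · rintro ⟨i, b, s, h⟩
    obtain ⟨e, he⟩ := D.exists_eOf (e := .cup i) (by simp [HasEdge, h, Core.IsCup])
    exact ⟨e, b, s, by rw [graph_edge, he]; simp [edgeLabel, h, Core.edge]⟩

omit H in
lemma exists_multicup_iff {l r : EReal} : (∃ i, D.graph.vertex i = FVertex.multicup l r) ↔
    ∃ i, D.core i = .multicup l r := by
  constructor
  · rintro ⟨i, h⟩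
    rw [graph_vertex] at h
    cases h' : D.vOf i with
    | source j =>
      rw [h'] at h
      refine ⟨j, ?_⟩
      cases hc : D.core j <;> simp_all [vertexLabel, Core.vertex]
    | _ => rw [h'] at h; cases h
  · rintro ⟨i, h⟩
    obtain ⟨j, hj⟩ := D.exists_vOf (v := .source i) trivial
    exact ⟨j, by rw [graph_vertex, hj]; simp [vertexLabel, h, Core.vertex]⟩

omit H in
lemma exists_angle_iff {x : ℝ} : (∃ i, D.graph.vertex i = FVertex.angle x) ↔ ∃ k, D.u k = x := by
  constructor
  · rintro ⟨i, h⟩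
    rw [graph_vertex] at h
    cases h' : D.vOf i with
    | source j => rw [h'] at h; cases hc : D.core j <;> simp_all [vertexLabel, Core.vertex]
    | angle k => rw [h'] at h; exact ⟨k, FVertex.angle.inj h⟩
    | _ => rw [h'] at h; cases h
  · rintro ⟨k, rfl⟩
    obtain ⟨j, hj⟩ := D.exists_vOf (v := .angle k) trivial
    exact ⟨j, by rw [graph_vertex, hj]; rfl⟩

end FoliationData.Admissible

end
end BellmanFoliation

namespace BellmanFoliation
noncomputable section

/-! ### Existence of essential roots -/

lemma realIcc_mono {l r l' r' : EReal} (hl : l' ≤ l) (hr : r ≤ r') : realIcc l r ⊆ realIcc l' r' :=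
  fun _ h => ⟨hl.trans h.1, h.2.trans hr⟩

lemma realIcc_subsingleton (x : EReal) : (realIcc x x).Subsingleton := fun _ hs _ ht =>
  EReal.coe_injective ((le_antisymm hs.2 hs.1).trans (le_antisymm ht.1 ht.2))

lemma realIcc_coe (a b : ℝ) : realIcc a b = Icc a b := by
  ext t; simp only [realIcc, mem_ofPred_eq, EReal.coe_le_coe_iff, mem_Icc]

lemma ConstOn.mono {h : ℝ → ℝ} {I J : Set ℝ} (hI : ConstOn h I) (hJ : J ⊆ I) : ConstOn h J :=
  fun s hs t ht => hI s (hJ hs) t (hJ ht)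

lemma constOn_realIcc_self (h : ℝ → ℝ) (x : EReal) : ConstOn h (realIcc x x) := fun s hs t ht => by
  rw [realIcc_subsingleton x hs ht]

lemma AntitoneOn.glue_realIcc {h : ℝ → ℝ} {a b c : EReal} (hab : a ≤ b) (hbc : b ≤ c)
    (h1 : AntitoneOn h (realIcc a b)) (h2 : AntitoneOn h (realIcc b c)) :
    AntitoneOn h (realIcc a c) := by
  induction b with
  | bot => rwa [le_bot_iff.1 hab]
  | top => rwa [top_le_iff.1 hbc]
  | coe b =>
    refine (h1.union_right h2 (c := b) ⟨⟨hab, le_rfl⟩, fun x hx => EReal.coe_le_coe_iff.1 hx.2⟩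
      ⟨⟨le_rfl, hbc⟩, fun x hx => EReal.coe_le_coe_iff.1 hx.1⟩).mono fun x hx => ?_
    rcases le_total (x : EReal) b with h | h
    · exact Or.inl ⟨hx.1, h⟩
    · exact Or.inr ⟨h, hx.2⟩

lemma MonotoneOn.glue_realIcc {h : ℝ → ℝ} {a b c : EReal} (hab : a ≤ b) (hbc : b ≤ c)
    (h1 : MonotoneOn h (realIcc a b)) (h2 : MonotoneOn h (realIcc b c)) :
    MonotoneOn h (realIcc a c) := by
  have := AntitoneOn.glue_realIcc hab hbc h1.neg h2.neg
  simpa using this.neg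

lemma ConstOn.glue_realIcc {h : ℝ → ℝ} {a b c : EReal} (hab : a ≤ b) (hbc : b ≤ c)
    (h1 : ConstOn h (realIcc a b)) (h2 : ConstOn h (realIcc b c)) : ConstOn h (realIcc a c) := by
  have hm := MonotoneOn.glue_realIcc hab hbc (fun s hs t ht _ => (h1 s hs t ht).le)
    fun s hs t ht _ => (h2 s hs t ht).le
  have ha := AntitoneOn.glue_realIcc hab hbc (fun s hs t ht _ => (h1 t ht s hs).le)
    fun s hs t ht _ => (h2 t ht s hs).le
  intro s hs t ht
  rcases le_total s t with h | h
  · exact le_antisymm (hm hs ht h) (ha hs ht h)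
  · exact le_antisymm (ha ht hs h) (hm ht hs h)

section
variable {h : ℝ → ℝ} (hc : Continuous h)
include hc

lemma monotoneOn_closure {I : Set ℝ} (hI : MonotoneOn h I) : MonotoneOn h (closure I) := by
  intro x hx y hy hxy
  rcases hxy.eq_or_lt with rfl | hlt
  · exact le_rfl
  have h1 : (x, y) ∈ closure ({p : ℝ × ℝ | p.1 < p.2} ∩ I ×ˢ I) :=
    (isOpen_lt continuous_fst continuous_snd).inter_closure
      ⟨hlt, by rw [closure_prod_eq]; exact ⟨hx, hy⟩⟩
  exact closure_minimal (t := {p : ℝ × ℝ | h p.1 ≤ h p.2})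
    (fun p hp => hI hp.2.1 hp.2.2 (le_of_lt hp.1))
    (isClosed_le (hc.comp continuous_fst) (hc.comp continuous_snd)) h1

lemma ConstOn.closure {I : Set ℝ} (hI : ConstOn h I) : ConstOn h (closure I) := by
  intro x hx y hy
  have h1 : (x, y) ∈ _root_.closure (I ×ˢ I) := by rw [closure_prod_eq]; exact ⟨hx, hy⟩
  exact closure_minimal (t := {p : ℝ × ℝ | h p.1 = h p.2}) (fun p hp => hI _ hp.1 _ hp.2)
    (isClosed_eq (hc.comp continuous_fst) (hc.comp continuous_snd)) h1

/-- Left end of the maximal interval of constancy around a point. -/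
lemma exists_left_maximal (x : EReal) : ∃ l ≤ x, ConstOn h (realIcc l x) ∧
    ∀ t : ℝ, (t : EReal) < l → ¬ ConstOn h (realIcc t l) := by
  set A : Set EReal := {y | y ≤ x ∧ ConstOn h (realIcc y x)} with hA
  have hx : x ∈ A := ⟨le_rfl, constOn_realIcc_self h x⟩
  have hle : sInf A ≤ x := sInf_le hx
  have hconst : ConstOn h (realIcc (sInf A) x) := by
    rcases hle.eq_or_lt with h0 | h0
    · rw [h0]; exact constOn_realIcc_self h x
    refine ConstOn.mono (ConstOn.closure hc fun s hs t ht => ?_) (realIcc_subset_closure h0)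
    obtain ⟨y, hy, hy1⟩ := sInf_lt_iff.1 hs.1
    obtain ⟨z, hz, hz1⟩ := sInf_lt_iff.1 ht.1
    rcases le_total y z with hyz | hyz
    · exact hy.2 s ⟨hy1.le, hs.2.le⟩ t ⟨hyz.trans hz1.le, ht.2.le⟩
    · exact hz.2 s ⟨hyz.trans hy1.le, hs.2.le⟩ t ⟨hz1.le, ht.2.le⟩
  exact ⟨sInf A, hle, hconst, fun t ht h1 => ht.not_ge
    (sInf_le ⟨ht.le.trans hle, ConstOn.glue_realIcc ht.le hle h1 hconst⟩)⟩

omit hc in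
lemma constOn_comp_neg {l r : EReal} :
    ConstOn (fun t => h (-t)) (realIcc l r) ↔ ConstOn h (realIcc (-r) (-l)) := by
  have hmem : ∀ {a b : EReal} {t : ℝ}, t ∈ realIcc a b → -t ∈ realIcc (-b) (-a) := fun {a b t} ht => by
    refine ⟨?_, ?_⟩ <;> rw [EReal.coe_neg, EReal.neg_le_neg_iff]
    exacts [ht.2, ht.1]
  constructor
  · intro hh s hs t ht
    have := hh (-s) (by simpa using hmem hs) (-t) (by simpa using hmem ht)
    simpa using this
  · exact fun hh s hs t ht => hh _ (hmem hs) _ (hmem ht)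

lemma exists_right_maximal (x : EReal) : ∃ r ≥ x, ConstOn h (realIcc x r) ∧
    ∀ t : ℝ, r < (t : EReal) → ¬ ConstOn h (realIcc r t) := by
  obtain ⟨l, h1, h2, h3⟩ := exists_left_maximal (hc.comp continuous_neg) (-x)
  refine ⟨-l, EReal.le_neg_of_le_neg h1, ?_, fun t ht hcon => h3 (-t) ?_ ?_⟩
  · have := constOn_comp_neg.1 h2
    rwa [neg_neg] at this
  · rw [EReal.coe_neg]; exact EReal.neg_lt_of_neg_lt ht
  · refine constOn_comp_neg.2 ?_
    rwa [EReal.coe_neg, neg_neg]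

lemma exists_maximal (x : EReal) : ∃ l r : EReal, l ≤ x ∧ x ≤ r ∧ ConstOn h (realIcc l r) ∧
    (∀ t : ℝ, (t : EReal) < l → ¬ ConstOn h (realIcc t l)) ∧
    ∀ t : ℝ, r < (t : EReal) → ¬ ConstOn h (realIcc r t) := by
  obtain ⟨l, h1, h2, h3⟩ := exists_left_maximal hc x
  obtain ⟨r, h4, h5, h6⟩ := exists_right_maximal hc x
  exact ⟨l, r, h1, h4, ConstOn.glue_realIcc h1 h4 h2 h5, h3, h6⟩

end

/-- Points that separate intervals of monotonicity of `h`: `h` increases on `[V i, C i]` and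
decreases on `[C i, V (i + 1)]`; the intervals may degenerate. -/
structure Turning (h : ℝ → ℝ) (n : ℕ) (V C : ℕ → EReal) : Prop where
  first : V 0 = ⊥
  last : V (n + 1) = ⊤
  le_C : ∀ i ≤ n, V i ≤ C i
  C_le : ∀ i ≤ n, C i ≤ V (i + 1)
  mono : ∀ i ≤ n, MonotoneOn h (realIcc (V i) (C i))
  anti : ∀ i ≤ n, AntitoneOn h (realIcc (C i) (V (i + 1)))

/-- The `V i` are the break points of a decomposition into intervals of monotonicity, and `C i` is the
right or the left end of its interval if the function increases or decreases there. -/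
lemma exists_turning {h : ℝ → ℝ} (hc : Continuous h) (hp : PiecewiseMonotone h) :
    ∃ n V C, Turning h n V C := by
  classical
  obtain ⟨S, hS⟩ := hp
  set e := S.orderEmbOfFin rfl
  set V : ℕ → EReal := fun i => if i = 0 then ⊥ else
    if hi : i - 1 < S.card then ((e ⟨i - 1, hi⟩ : ℝ) : EReal) else ⊤ with hV
  have hlt : ∀ i ≤ S.card, V i < V (i + 1) := by
    intro i hi
    simp only [hV]
    rcases i with _ | i
    · simp only [if_true, zero_add, one_ne_zero, if_false]
      split_ifs
      · exact EReal.bot_lt_coe _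
      · exact bot_lt_top
    · have hi' : i < S.card := hi
      simp only [Nat.add_sub_cancel, hi', dif_pos, Nat.succ_ne_zero, if_false]
      split_ifs with h2
      · exact EReal.coe_lt_coe_iff.2 (e.strictMono (Fin.mk_lt_mk.2 (Nat.lt_succ_self i)))
      · exact EReal.coe_lt_top _
  have hmono : ∀ i ≤ S.card, MonotoneOn h (realIcc (V i) (V (i + 1))) ∨
      AntitoneOn h (realIcc (V i) (V (i + 1))) := by
    intro i hi
    have hd : Disjoint (realIoo (V i) (V (i + 1))) (S : Set ℝ) := by
      rw [Set.disjoint_left]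
      rintro t ⟨h1, h2⟩ ht
      rw [← Finset.range_orderEmbOfFin S rfl] at ht
      obtain ⟨j, rfl⟩ := ht
      change V i < (e j : EReal) at h1
      change (e j : EReal) < V (i + 1) at h2
      simp only [hV, Nat.add_sub_cancel, Nat.succ_ne_zero, if_false] at h1 h2
      have h3 : (j : ℕ) < i := by
        split_ifs at h2 with h4
        · exact Fin.lt_def.1 (e.lt_iff_lt.1 (EReal.coe_lt_coe_iff.1 h2))
        · omega
      rw [if_neg (by omega)] at h1
      split_ifs at h1 with h4
      · have := Fin.lt_def.1 (e.lt_iff_lt.1 (EReal.coe_lt_coe_iff.1 h1))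
        simp only at this
        omega
      · exact not_top_lt h1
    have hsub := realIcc_subset_closure (hlt i hi)
    rcases hS (realIoo (V i) (V (i + 1))) ⟨fun _ hx _ hy _ hz => ⟨hx.1.trans_le (EReal.coe_le_coe_iff.2 hz.1),
      (EReal.coe_le_coe_iff.2 hz.2).trans_lt hy.2⟩⟩ hd with h1 | h1
    · exact Or.inl ((monotoneOn_closure hc h1).mono hsub)
    · have := (monotoneOn_closure hc.neg h1.neg).mono hsub
      exact Or.inr (by simpa using this.neg)
  refine ⟨S.card, V, fun i => if MonotoneOn h (realIcc (V i) (V (i + 1))) then V (i + 1) else V i,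
    rfl, by simp [hV], fun i hi => ?_, fun i hi => ?_, fun i hi => ?_, fun i hi => ?_⟩ <;>
    have := hlt i hi <;> split_ifs with h1
  · exact this.le
  · exact le_rfl
  · exact le_rfl
  · exact this.le
  · exact h1
  · exact (realIcc_subsingleton _).monotoneOn _
  · exact (realIcc_subsingleton _).antitoneOn _
  · exact (hmono i hi).resolve_left h1

namespace Turning

variable {h : ℝ → ℝ} {n : ℕ} {V C : ℕ → EReal} (H : Turning h n V C)
include H

/-- An interval of increase on which the function is constant can be removed. -/
lemma merge_right {i : ℕ} (hi : 1 ≤ i) (hin : i ≤ n) (hconst : ConstOn h (realIcc (V i) (C i))) :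
    ∃ V C, Turning h (n - 1) V C := by
  obtain ⟨i, rfl⟩ := Nat.exists_eq_add_of_le' hi
  refine ⟨fun j => if j ≤ i then V j else V (j + 1), fun j => if j ≤ i then C j else C (j + 1),
    by simp [H.first], ?_, fun j hj => ?_, fun j hj => ?_, fun j hj => ?_, fun j hj => ?_⟩
  · rw [if_neg (by omega), Nat.sub_add_cancel (by omega), H.last]
  · split_ifs
    · exact H.le_C j (by omega)
    · exact H.le_C (j + 1) (by omega)
  · rcases lt_trichotomy j i with h1 | rfl | h1
    · rw [if_pos h1.le, if_pos (Nat.succ_le_of_lt h1)]; exact H.C_le j (by omega)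
    · rw [if_pos le_rfl, if_neg (by omega)]
      exact (H.C_le j (by omega)).trans ((H.le_C _ hin).trans (H.C_le _ hin))
    · rw [if_neg (by omega), if_neg (by omega)]; exact H.C_le (j + 1) (by omega)
  · split_ifs
    · exact H.mono j (by omega)
    · exact H.mono (j + 1) (by omega)
  · rcases lt_trichotomy j i with h1 | rfl | h1
    · rw [if_pos h1.le, if_pos (Nat.succ_le_of_lt h1)]; exact H.anti j (by omega)
    · rw [if_pos le_rfl, if_neg (by omega)]
      refine AntitoneOn.glue_realIcc (H.C_le j (by omega))
        ((H.le_C _ hin).trans (H.C_le _ hin)) (H.anti j (by omega)) ?_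
      exact AntitoneOn.glue_realIcc (H.le_C _ hin) (H.C_le _ hin)
        (fun s hs t ht _ => (hconst t ht s hs).le) (H.anti _ hin)
    · rw [if_neg (by omega), if_neg (by omega)]; exact H.anti (j + 1) (by omega)

/-- An interval of decrease on which the function is constant can be removed. -/
lemma merge_left {i : ℕ} (hin : i < n) (hconst : ConstOn h (realIcc (C i) (V (i + 1)))) :
    ∃ V C, Turning h (n - 1) V C := by
  have h0 : i ≤ n := hin.le
  have h1 : i + 1 ≤ n := hin
  refine ⟨fun j => if j ≤ i then V j else V (j + 1), fun j => if j < i then C j else C (j + 1),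
    by simp [H.first], ?_, fun j hj => ?_, fun j hj => ?_, fun j hj => ?_, fun j hj => ?_⟩
  · rw [if_neg (by omega), Nat.sub_add_cancel (by omega), H.last]
  · rcases lt_trichotomy j i with h2 | rfl | h2
    · rw [if_pos h2.le, if_pos h2]; exact H.le_C j (by omega)
    · rw [if_pos le_rfl, if_neg (lt_irrefl _)]
      exact (H.le_C j h0).trans ((H.C_le j h0).trans (H.le_C _ h1))
    · rw [if_neg (by omega), if_neg (by omega)]; exact H.le_C (j + 1) (by omega)
  · rcases lt_or_ge j i with h2 | h2
    · rw [if_pos h2, if_pos (by omega)]; exact H.C_le j (by omega)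
    · rw [if_neg (by omega), if_neg (by omega)]; exact H.C_le (j + 1) (by omega)
  · rcases lt_trichotomy j i with h2 | rfl | h2
    · rw [if_pos h2.le, if_pos h2]; exact H.mono j (by omega)
    · rw [if_pos le_rfl, if_neg (lt_irrefl _)]
      refine MonotoneOn.glue_realIcc (H.le_C j h0) ((H.C_le j h0).trans (H.le_C _ h1))
        (H.mono j h0) ?_
      exact MonotoneOn.glue_realIcc (H.C_le j h0) (H.le_C _ h1)
        (fun s hs t ht _ => (hconst s hs t ht).le) (H.mono _ h1)
    · rw [if_neg (by omega), if_neg (by omega)]; exact H.mono (j + 1) (by omega)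
  · rcases lt_or_ge j i with h2 | h2
    · rw [if_pos h2, if_pos (by omega)]; exact H.anti j (by omega)
    · rw [if_neg (by omega), if_neg (by omega)]; exact H.anti (j + 1) (by omega)

end Turning

/-- Intervals of constancy separated by points between which the function is not constant. -/
lemma lt_of_not_constOn {h : ℝ → ℝ} {x y r l : EReal}
    (hr : ConstOn h (realIcc x r)) (hl : ConstOn h (realIcc l y)) (hly : l ≤ y)
    (hne : ¬ ConstOn h (realIcc x y)) : r < l := by
  by_contra! hcon
  rcases le_total l x with h1 | h1
  · exact hne (hl.mono (realIcc_mono h1 le_rfl))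
  · exact hne (ConstOn.glue_realIcc h1 hly (hr.mono (realIcc_mono le_rfl hcon)) hl)

theorem exists_isEssential {h : ℝ → ℝ} (hc : Continuous h) (hp : PiecewiseMonotone h) :
    ∃ (n : ℕ) (R : RootSystem n), R.IsEssential h := by
  classical
  have hex := exists_turning hc hp
  -- a system with the least number of turning points has no removable intervals
  set n := Nat.find hex
  obtain ⟨V, C, H⟩ := Nat.find_spec hex
  have hmin : ∀ m < n, ¬ ∃ V C, Turning h m V C := fun m hm => Nat.find_min hex hm
  choose cl cr h1 h2 h3 h4 h5 using fun i => exists_maximal hc (C i)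
  choose vl vr g1 g2 g3 g4 g5 using fun i => exists_maximal hc (V i)
  have hcv : ∀ i < n, cr i < vl (i + 1) := fun i hi =>
    lt_of_not_constOn ((h3 i).mono (realIcc_mono (h1 i) le_rfl))
      ((g3 (i + 1)).mono (realIcc_mono le_rfl (g2 _))) (g1 _) fun hcon =>
      hmin (n - 1) (by omega) (H.merge_left hi hcon)
  have hvc : ∀ i < n, vr (i + 1) < cl (i + 1) := fun i hi =>
    lt_of_not_constOn ((g3 (i + 1)).mono (realIcc_mono (g1 _) le_rfl))
      ((h3 (i + 1)).mono (realIcc_mono le_rfl (h2 _))) (h1 _) fun hcon =>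
      hmin (n - 1) (by omega) (H.merge_right (by omega) hi hcon)
  have hvl : ∀ k : Fin n, ((vl (k + 1)).toReal : EReal) = vl (k + 1) := fun k =>
    EReal.coe_toReal (((g1 _).trans (g2 _)).trans_lt ((hvc k k.2).trans_le le_top)).ne
      (bot_le.trans_lt (hcv k k.2)).ne'
  have hvr : ∀ k : Fin n, ((vr (k + 1)).toReal : EReal) = vr (k + 1) := fun k =>
    EReal.coe_toReal ((hvc k k.2).trans_le le_top).ne
      ((bot_le.trans_lt (hcv k k.2)).trans_le ((g1 _).trans (g2 _))).ne'
  refine ⟨n, ⟨fun i => cl i, fun i => cr i, fun k => (vl (k + 1)).toReal,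
    fun k => (vr (k + 1)).toReal⟩, ?_⟩
  constructor
  · exact fun i => (h1 i).trans (h2 i)
  · intro k
    rw [← EReal.coe_le_coe_iff, hvl, hvr]; exact (g1 _).trans (g2 _)
  · intro k
    simp only [hvl, Fin.val_castSucc]; exact hcv k k.2
  · intro k
    simp only [hvr, Fin.val_succ]; exact hvc k k.2
  · exact fun i => h3 i
  · intro k
    simp only [← realIcc_coe, hvl, hvr]; exact g3 _
  · exact (H.mono 0 (Nat.zero_le _)).mono (by rw [H.first]; exact realIcc_mono le_rfl (h1 0))
  · intro k
    simp only [hvl, Fin.val_castSucc]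
    exact (H.anti k k.2.le).mono (realIcc_mono (h2 _) (g1 _))
  · intro k
    simp only [hvr, Fin.val_succ]
    exact (H.mono (k + 1) k.2).mono (realIcc_mono (g2 _) (h1 _))
  · refine (H.anti n le_rfl).mono ?_
    rw [H.last]; exact realIcc_mono (h2 n) le_rfl
  · exact fun i => h4 i
  · exact fun i => h5 i
  · intro k t ht
    have := g4 (k + 1) t
    rw [← hvl k, realIcc_coe] at this
    exact this (EReal.coe_lt_coe_iff.2 ht)
  · intro k t ht
    have := g5 (k + 1) t
    rw [← hvr k, realIcc_coe] at this
    exact this (EReal.coe_lt_coe_iff.2 ht)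

end
end BellmanFoliation

namespace BellmanFoliation
noncomputable section

/-! ### Solutions that start at a central figure -/

namespace IsRelaxation

variable {ρ θ β : ℝ → ℝ}

lemma lt_of_antitoneOn (h : IsRelaxation ρ θ β) (hρ : Continuous ρ) (hρ0 : ∀ x, 0 < ρ x) {b t : ℝ}
    (hbt : b ≤ t) (hanti : AntitoneOn θ (Icc b t)) (h0 : θ b ≤ β b)
    (h1 : θ b < β b ∨ ¬ ConstOn θ (Icc b t)) : θ t < β t := by
  have h2 := h.le_exp_mul hρ hbt hρ0 (c := θ t)
    fun x hx => hanti hx (right_mem_Icc.2 hbt) hx.2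
  have h3 : θ t ≤ θ b := hanti (left_mem_Icc.2 hbt) (right_mem_Icc.2 hbt) hbt
  have h4 : 0 < β b - θ t := by
    rcases h1 with h1 | h1
    · linarith
    · refine sub_pos.2 (lt_of_lt_of_le (h3.lt_of_ne fun heq => h1 ?_) h0)
      have key : ∀ s ∈ Icc b t, θ s = θ b := fun s hs => le_antisymm
        (hanti (left_mem_Icc.2 hbt) hs hs.1) (heq ▸ hanti hs (right_mem_Icc.2 hbt) hs.2)
      exact fun s hs s' hs' => (key s hs).trans (key s' hs').symm
  exact sub_pos.1 (pos_of_mul_pos_right (h4.trans_le h2) (Real.exp_pos _).le)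

lemma le_of_forall_le (h : IsRelaxation ρ θ β) (hρ : Continuous ρ) (hρ0 : ∀ x, 0 < ρ x) {b t M : ℝ}
    (hbt : b ≤ t) (hθ : ∀ x ∈ Icc b t, θ x ≤ M) (hb : β b ≤ M) : β t ≤ M := by
  have h2 := h.exp_mul_le hρ hbt hρ0 hθ
  by_contra! hcon
  exact absurd (mul_pos (Real.exp_pos (∫ x in b..t, ρ x)) (sub_pos.2 hcon)) (by linarith)

end IsRelaxation

/-- A solution along the tangents drawn to the right of a central figure with right end `B`:
it stays above `tors` up to `E` and is at most `M` at `E`. -/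
structure RightBranch (G : ℝ → ℝ → ℝ × ℝ) (f : ℝ → ℝ) (ε : ℝ) (B E : EReal) (val M : ℝ)
    (β : ℝ → ℝ) : Prop where
  sol : IsRelaxation (rate G ε Side.R) (tors G f) β
  init : ∀ b : ℝ, B = b → β b = val
  le_init : ∀ b : ℝ, B = b → tors G f b ≤ β b
  decay : B = ⊥ → ∀ t, Tendsto
    (fun s => Real.exp (-∫ x in s..t, rate G ε Side.R x) * (β s - tors G f s)) atBot (𝓝 0)
  lt : ∀ t : ℝ, B < t → (t : EReal) ≤ E → tors G f t < β t
  le : ∀ v : ℝ, E = v → β v ≤ M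

/-- A solution along the tangents drawn to the left of a central figure with left end `B`. -/
structure LeftBranch (G : ℝ → ℝ → ℝ × ℝ) (f : ℝ → ℝ) (ε : ℝ) (B E : EReal) (val M : ℝ)
    (β : ℝ → ℝ) : Prop where
  sol : IsRelaxation (rate G ε Side.L) (tors G f) β
  init : ∀ b : ℝ, B = b → β b = val
  le_init : ∀ b : ℝ, B = b → tors G f b ≤ β b
  decay : B = ⊤ → ∀ t, Tendsto
    (fun s => Real.exp (-∫ x in s..t, rate G ε Side.L x) * (β s - tors G f s)) atTop (𝓝 0)
  lt : ∀ t : ℝ, (t : EReal) < B → E ≤ (t : EReal) → tors G f t < β t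
  le : ∀ v : ℝ, E = v → β v ≤ M

namespace AdmissibleFamily

variable {εmax : EReal} {G : ℝ → ℝ → ℝ × ℝ} (hG : AdmissibleFamily εmax G) {f : ℝ → ℝ}
  (hf : BoundaryData G f)
include hG hf

section FixedParameter

variable {ε : ℝ} (hε : ε ∈ paramSet εmax) (h0 : 0 < ε)
include hε h0

/-- A solution with an initial value above `θ`, where `θ` is nonincreasing, stays above `θ`. -/
lemma exists_rightBranch {b val : ℝ} {E : EReal} (hbE : (b : EReal) < E)
    (hanti : AntitoneOn (tors G f) (realIcc b E)) (hval : tors G f b ≤ val)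
    (hne : tors G f b < val ∨ ∀ t : ℝ, (b : EReal) < t → ¬ ConstOn (tors G f) (realIcc b t))
    {M : ℝ} (hM : val ≤ M) : ∃ β, RightBranch G f ε b E val M β := by
  have hρ := hG.continuous_rate hε h0 Side.R
  have hρ0 := hG.rate_R_pos hε h0
  obtain ⟨β, hβ, hb⟩ := IsRelaxation.exists_solution hρ hf.continuous_tors b val
  have hanti' : ∀ t : ℝ, (t : EReal) ≤ E → AntitoneOn (tors G f) (Icc b t) := fun t ht => by
    rw [← realIcc_coe]; exact hanti.mono (realIcc_mono le_rfl ht)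
  refine ⟨β, hβ, fun b' h => ?_, fun b' h => ?_, fun h => absurd h (EReal.coe_ne_bot b),
    fun t ht htE => ?_, fun v hv => ?_⟩
  · rwa [← EReal.coe_eq_coe_iff.1 h]
  · rwa [← EReal.coe_eq_coe_iff.1 h, hb]
  · refine hβ.lt_of_antitoneOn hρ hρ0 (EReal.coe_lt_coe_iff.1 ht).le (hanti' t htE)
      (by rwa [hb]) ?_
    rw [hb, ← realIcc_coe]
    exact hne.imp id fun h => h t ht
  · rw [hv, EReal.coe_lt_coe_iff] at hbE
    exact hβ.le_of_forall_le hρ hρ0 hbE.le (fun x hx => (hanti' v hv.ge (left_mem_Icc.2 hbE.le)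
      hx hx.1).trans (hval.trans hM)) (by rwa [hb])

lemma exists_leftBranch {b val : ℝ} {E : EReal} (hbE : E < (b : EReal))
    (hmono : MonotoneOn (tors G f) (realIcc E b)) (hval : tors G f b ≤ val)
    (hne : tors G f b < val ∨ ∀ t : ℝ, (t : EReal) < b → ¬ ConstOn (tors G f) (realIcc t b))
    {M : ℝ} (hM : val ≤ M) : ∃ β, LeftBranch G f ε b E val M β := by
  have hρ := hG.continuous_rate hε h0 Side.L
  have hρ' : Continuous fun t => -rate G ε Side.L (-t) := (hρ.comp continuous_neg).neg
  have hρ0 : ∀ t, 0 < -rate G ε Side.L (-t) := fun t => neg_pos.2 (hG.rate_L_neg hε h0 _)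
  obtain ⟨β, hβ, hb⟩ := IsRelaxation.exists_solution hρ hf.continuous_tors b val
  have hmono' : ∀ t : ℝ, E ≤ (t : EReal) → AntitoneOn (fun t => tors G f (-t)) (Icc (-b) (-t)) := by
    intro t ht x hx y hy hxy
    refine hmono ?_ ?_ (neg_le_neg hxy)
    · exact ⟨ht.trans (EReal.coe_le_coe_iff.2 (le_neg.2 hy.2)),
        EReal.coe_le_coe_iff.2 (neg_le.2 hy.1)⟩
    · exact ⟨ht.trans (EReal.coe_le_coe_iff.2 (le_neg.2 hx.2)),
        EReal.coe_le_coe_iff.2 (neg_le.2 hx.1)⟩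
  refine ⟨β, hβ, fun b' h => ?_, fun b' h => ?_, fun h => absurd h (EReal.coe_ne_top b),
    fun t ht htE => ?_, fun v hv => ?_⟩
  · rwa [← EReal.coe_eq_coe_iff.1 h]
  · rwa [← EReal.coe_eq_coe_iff.1 h, hb]
  · have := hβ.reflect.lt_of_antitoneOn hρ' hρ0 (neg_le_neg (EReal.coe_lt_coe_iff.1 ht).le)
      (hmono' t htE) (by simpa only [neg_neg, hb] using hval) (by
        simp only [neg_neg, hb]
        refine hne.imp id fun h h' => h t ht ?_
        rw [realIcc_coe]
        intro x hx y hy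
        have := h' (-x) ⟨neg_le_neg hx.2, neg_le_neg hx.1⟩ (-y) ⟨neg_le_neg hy.2, neg_le_neg hy.1⟩
        simpa only [neg_neg] using this)
    simpa only [neg_neg] using this
  · rw [hv, EReal.coe_lt_coe_iff] at hbE
    have := hβ.reflect.le_of_forall_le hρ' hρ0 (neg_le_neg hbE.le) (M := M) (fun x hx =>
      (hmono' v hv.le (left_mem_Icc.2 (neg_le_neg hbE.le)) hx hx.1).trans
        (by simpa only [neg_neg] using hval.trans hM)) (by simpa only [neg_neg, hb] using hM)
    simpa only [neg_neg] using this

end FixedParameter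

/-- The solution from `-∞` at the given point grows with `ε`, so that it is bounded by its value for
one fixed parameter. -/
lemma eventually_exists_rightBranch_bot (hsum : SummabilityCondition εmax G f) {E : EReal}
    (hE : ⊥ < E) (hanti : AntitoneOn (tors G f) (realIcc ⊥ E))
    (hne : ∀ t : ℝ, ⊥ < (t : EReal) → ¬ ConstOn (tors G f) (realIcc ⊥ t)) (val : ℝ) :
    ∃ M, ∀ᶠ ε : ℝ in 𝓝[>] 0, ∃ β, RightBranch G f ε ⊥ E val M β := by
  obtain ⟨v, -, hvE⟩ := EReal.lt_iff_exists_real_btwn.1 hE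
  -- below the finite end of the interval the point `v` may be taken at this end
  obtain ⟨v, hvE, hv⟩ : ∃ v : ℝ, (v : EReal) ≤ E ∧ ∀ w : ℝ, E = w → w = v := by
    induction E with
    | bot => exact absurd hE (lt_irrefl _)
    | top => exact ⟨v, le_top, fun w hw => absurd hw.symm (EReal.coe_ne_top w)⟩
    | coe e => exact ⟨e, le_rfl, fun w hw => (EReal.coe_eq_coe_iff.1 hw).symm⟩
  have hanti' : AntitoneOn (tors G f) (Iic v) := hanti.mono fun t ht =>
    ⟨bot_le, (EReal.coe_le_coe_iff.2 ht).trans hvE⟩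
  have hne' : ∀ t ≤ v, ∃ s < t, tors G f t < tors G f s := by
    intro t ht
    by_contra! hcon
    have key : ∀ s ∈ realIcc ⊥ t, tors G f s = tors G f t := fun s hs => by
      have hst := EReal.coe_le_coe_iff.1 hs.2
      refine le_antisymm ?_ (hanti' (hst.trans ht) ht hst)
      rcases hst.eq_or_lt with rfl | h
      · exact le_rfl
      · exact hcon s h
    exact hne t (EReal.bot_lt_coe t) fun s hs s' hs' => (key s hs).trans (key s' hs').symm
  have hex := fun {ε : ℝ} (hε : ε ∈ paramSet εmax) (h0 : 0 < ε) =>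
    hG.exists_relaxation_from_bot hε h0 hf hsum hanti' hne'
  -- solutions grow with `ε`, so that one of them bounds all the others
  obtain ⟨ε', hε', h0'⟩ := hG.eventually_mem.exists
  obtain ⟨β', hβ', hlt', -⟩ := hex hε' h0'
  refine ⟨β' v, ?_⟩
  filter_upwards [hG.eventually_mem, Ioo_mem_nhdsGT h0'] with ε ⟨hε, h0⟩ hεε'
  have hρ := hG.continuous_rate hε h0 Side.R
  obtain ⟨β, hβ, hlt, hlim⟩ := hex hε h0
  refine ⟨β, hβ, fun b h => absurd h.symm (EReal.coe_ne_bot b),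
    fun b h => absurd h.symm (EReal.coe_ne_bot b), fun _ => hlim, fun t _ htE => ?_, fun w hw => ?_⟩
  · rcases le_total t v with h | h
    · exact hlt t h
    · refine hβ.lt_of_antitoneOn hρ (hG.rate_R_pos hε h0) h ?_ (hlt v le_rfl).le
        (Or.inl (hlt v le_rfl))
      exact hanti.mono fun x hx => ⟨bot_le, (EReal.coe_le_coe_iff.2 hx.2).trans htE⟩
  · rw [hv w hw]
    exact hβ.le_of_rate_le hβ' hρ (hG.rate_R_le hε h0 hε' hεε'.2) (fun t ht => (hlt' t ht).le)
      (hlim v)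

lemma eventually_exists_leftBranch_top (hsum : SummabilityCondition εmax G f) {E : EReal}
    (hE : E < ⊤) (hmono : MonotoneOn (tors G f) (realIcc E ⊤))
    (hne : ∀ t : ℝ, (t : EReal) < ⊤ → ¬ ConstOn (tors G f) (realIcc t ⊤)) (val : ℝ) :
    ∃ M, ∀ᶠ ε : ℝ in 𝓝[>] 0, ∃ β, LeftBranch G f ε ⊤ E val M β := by
  obtain ⟨v, hvE, -⟩ := EReal.lt_iff_exists_real_btwn.1 hE
  obtain ⟨v, hvE, hv⟩ : ∃ v : ℝ, E ≤ (v : EReal) ∧ ∀ w : ℝ, E = w → w = v := by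
    induction E with
    | top => exact absurd hE (lt_irrefl _)
    | bot => exact ⟨v, bot_le, fun w hw => absurd hw.symm (EReal.coe_ne_bot w)⟩
    | coe e => exact ⟨e, le_rfl, fun w hw => (EReal.coe_eq_coe_iff.1 hw).symm⟩
  have hmono' : MonotoneOn (tors G f) (Ici v) := hmono.mono fun t ht =>
    ⟨hvE.trans (EReal.coe_le_coe_iff.2 ht), le_top⟩
  have hne' : ∀ t ≥ v, ∃ s > t, tors G f t < tors G f s := by
    intro t ht
    by_contra! hcon
    have key : ∀ s ∈ realIcc t ⊤, tors G f s = tors G f t := fun s hs => by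
      have hst := EReal.coe_le_coe_iff.1 hs.1
      refine le_antisymm ?_ (hmono' ht (ht.trans hst) hst)
      rcases hst.eq_or_lt with rfl | h
      · exact le_rfl
      · exact hcon s h
    exact hne t (EReal.coe_lt_top t) fun s hs s' hs' => (key s hs).trans (key s' hs').symm
  have hex := fun {ε : ℝ} (hε : ε ∈ paramSet εmax) (h0 : 0 < ε) =>
    hG.exists_relaxation_from_top hε h0 hf hsum hmono' hne'
  obtain ⟨ε', hε', h0'⟩ := hG.eventually_mem.exists
  obtain ⟨β', hβ', hlt', -⟩ := hex hε' h0'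
  refine ⟨β' v, ?_⟩
  filter_upwards [hG.eventually_mem, Ioo_mem_nhdsGT h0'] with ε ⟨hε, h0⟩ hεε'
  have hρ := hG.continuous_rate hε h0 Side.L
  have hρ' : Continuous fun t => -rate G ε Side.L (-t) := (hρ.comp continuous_neg).neg
  obtain ⟨β, hβ, hlt, hlim⟩ := hex hε h0
  refine ⟨β, hβ, fun b h => absurd h.symm (EReal.coe_ne_top b),
    fun b h => absurd h.symm (EReal.coe_ne_top b), fun _ => hlim, fun t _ htE => ?_, fun w hw => ?_⟩
  · rcases le_total v t with h | h
    · exact hlt t h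
    · have := hβ.reflect.lt_of_antitoneOn hρ' (fun t => neg_pos.2 (hG.rate_L_neg hε h0 _))
        (neg_le_neg h) (fun x hx y hy hxy => hmono
          ⟨htE.trans (EReal.coe_le_coe_iff.2 (le_neg.2 hy.2)), le_top⟩
          ⟨htE.trans (EReal.coe_le_coe_iff.2 (le_neg.2 hx.2)), le_top⟩ (neg_le_neg hxy))
        (by simpa only [neg_neg] using (hlt v le_rfl).le)
        (Or.inl (by simpa only [neg_neg] using hlt v le_rfl))
      simpa only [neg_neg] using this
  · rw [hv w hw]
    have := hβ.reflect.le_of_rate_le (v := -v) hβ'.reflect hρ'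
      (fun t => neg_le_neg (hG.rate_L_ge hε h0 hε' hεε'.2 _))
      (fun t ht => (hlt' (-t) (le_neg.1 ht)).le) (by
        have h1 := (hlim v).comp tendsto_neg_atBot_atTop
        refine h1.congr fun s => ?_
        simp only [Function.comp]
        rw [intervalIntegral.integral_neg, intervalIntegral.integral_comp_neg
          (fun x => rate G ε Side.L x), neg_neg, neg_neg, intervalIntegral.integral_symm, neg_neg])
    simpa only [neg_neg] using this

/-- For small `ε` a solution on right tangents goes below an increasing function `tors`. -/
lemma eventually_lt_tors_right {v q : ℝ} (hvq : v < q) (hmono : MonotoneOn (tors G f) (Icc v q))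
    (hne : ¬ ConstOn (tors G f) (Icc v q)) (M : ℝ) : ∀ᶠ ε : ℝ in 𝓝[>] 0, ∀ β,
      IsRelaxation (rate G ε Side.R) (tors G f) β → β v ≤ M → β q < tors G f q := by
  have hlt : tors G f v < tors G f q := by
    refine (hmono (left_mem_Icc.2 hvq.le) (right_mem_Icc.2 hvq.le) hvq.le).lt_of_ne fun heq => hne ?_
    have key : ∀ s ∈ Icc v q, tors G f s = tors G f v := fun s hs => le_antisymm
      (heq ▸ hmono hs (right_mem_Icc.2 hvq.le) hs.2) (hmono (left_mem_Icc.2 hvq.le) hs hs.1)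
    exact fun s hs t ht => (key s hs).trans (key t ht).symm
  obtain ⟨x, hx, hvx, hxq⟩ : ∃ x, tors G f x < tors G f q ∧ v < x ∧ x < q :=
    (((hf.continuous_tors.tendsto v).eventually_lt_const hlt).filter_mono
      (nhdsWithin_le_nhds (s := Ioi v))).and (Ioo_mem_nhdsGT hvq) |>.exists
  -- the rate beyond which a solution starting below `M` at `v` falls under `tors` before `q`
  set N := (M - tors G f x) / ((tors G f q - tors G f x) * (x - v)) with hN
  filter_upwards [hG.eventually_mem, hG.eventually_large_rate Side.R v x N] with ε ⟨hε, h0⟩ hr β hβ hM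
  have hρ0 := hG.rate_R_pos hε h0
  refine hβ.lt_of_large_rate (hG.continuous_rate hε h0 Side.R) hvx.le hxq.le hρ0 hmono hx hM
    (N := N) ?_ fun t ht => by rw [← abs_of_pos (hρ0 t)]; exact hr t ht
  have h1 : 0 < tors G f q - tors G f x := sub_pos.2 hx
  have h2 : N * ((tors G f q - tors G f x) * (x - v)) = M - tors G f x :=
    div_mul_cancel₀ _ (mul_pos h1 (sub_pos.2 hvx)).ne'
  linarith

lemma eventually_lt_tors_left {p v : ℝ} (hpv : p < v) (hanti : AntitoneOn (tors G f) (Icc p v))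
    (hne : ¬ ConstOn (tors G f) (Icc p v)) (M : ℝ) : ∀ᶠ ε : ℝ in 𝓝[>] 0, ∀ β,
      IsRelaxation (rate G ε Side.L) (tors G f) β → β v ≤ M → β p < tors G f p := by
  have hlt : tors G f v < tors G f p := by
    refine (hanti (left_mem_Icc.2 hpv.le) (right_mem_Icc.2 hpv.le) hpv.le).lt_of_ne
      fun heq => hne ?_
    have key : ∀ s ∈ Icc p v, tors G f s = tors G f p := fun s hs => le_antisymm
      (hanti (left_mem_Icc.2 hpv.le) hs hs.1) (heq ▸ hanti hs (right_mem_Icc.2 hpv.le) hs.2)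
    exact fun s hs t ht => (key s hs).trans (key t ht).symm
  obtain ⟨x, hx, hpx, hxv⟩ : ∃ x, tors G f x < tors G f p ∧ p < x ∧ x < v :=
    (((hf.continuous_tors.tendsto v).eventually_lt_const hlt).filter_mono
      (nhdsWithin_le_nhds (s := Iio v))).and (Ioo_mem_nhdsLT hpv) |>.exists
  set N := (M - tors G f x) / ((tors G f p - tors G f x) * (v - x)) with hN
  filter_upwards [hG.eventually_mem, hG.eventually_large_rate Side.L x v N] with ε ⟨hε, h0⟩ hr β hβ hM
  have hρ0 := hG.rate_L_neg hε h0
  have := hβ.reflect.lt_of_large_rate ((hG.continuous_rate hε h0 Side.L).comp continuous_neg).neg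
    (neg_le_neg hxv.le) (neg_le_neg hpx.le) (fun t => neg_pos.2 (hρ0 _))
    (fun x hx y hy hxy => hanti ⟨le_neg.2 hy.2, neg_le.2 hy.1⟩ ⟨le_neg.2 hx.2, neg_le.2 hx.1⟩
      (neg_le_neg hxy)) (by simpa only [neg_neg] using hx) (M := M)
    (by simpa only [neg_neg] using hM) (N := N) ?_ fun t ht => ?_
  · simpa only [neg_neg] using this
  · simp only [neg_neg]
    have h1 : 0 < tors G f p - tors G f x := sub_pos.2 hx
    have h2 : N * ((tors G f p - tors G f x) * (v - x)) = M - tors G f x :=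
      div_mul_cancel₀ _ (mul_pos h1 (sub_pos.2 hxv)).ne'
    linarith
  · rw [← abs_of_neg (hρ0 _)]
    exact hr _ ⟨le_neg.2 ht.2, neg_le.2 ht.1⟩

end AdmissibleFamily

/-- The vertex of an angle: solutions coming from two sides cross before either of them
reaches `θ`. -/
lemma exists_angle {θ βR βL : ℝ → ℝ} (hθ : Continuous θ) (hR : Continuous βR) (hL : Continuous βL)
    {p q v w : ℝ} (hpv : p < v) (hvw : v ≤ w) (hwq : w < q)
    (h1 : ∀ t ∈ Icc p w, θ t < βR t) (h2 : ∀ t ∈ Icc v q, θ t < βL t)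
    (hq : βR q < θ q) (hp : βL p < θ p) :
    ∃ u ∈ Ioo p q, βR u = βL u ∧ (∀ t ∈ Icc p u, θ t < βR t) ∧ ∀ t ∈ Icc u q, θ t < βL t := by
  obtain ⟨z, ⟨hz, hz0⟩, hzmin⟩ : ∃ z, IsLeast {t | t ∈ Icc w q ∧ βR t ≤ θ t} z :=
    (isCompact_Icc.inter_right (isClosed_le hR hθ)).exists_isLeast ⟨q, right_mem_Icc.2 hwq.le, hq.le⟩
  obtain ⟨y, ⟨hy, hy0⟩, hymax⟩ : ∃ y, IsGreatest {t | t ∈ Icc p v ∧ βL t ≤ θ t} y :=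
    (isCompact_Icc.inter_right (isClosed_le hL hθ)).exists_isGreatest
      ⟨p, left_mem_Icc.2 hpv.le, hp.le⟩
  have hyz : y ≤ z := hy.2.trans (hvw.trans hz.1)
  have e1 : βR z < βL z := hz0.trans_lt (h2 z ⟨hvw.trans hz.1, hz.2⟩)
  have e2 : βL y < βR y := hy0.trans_lt (h1 y ⟨hy.1, hy.2.trans hvw⟩)
  obtain ⟨u, hu, hu0⟩ : (0 : ℝ) ∈ (fun t => βL t - βR t) '' Icc y z :=
    intermediate_value_Icc hyz (hL.sub hR).continuousOn ⟨(sub_neg.2 e2).le, (sub_pos.2 e1).le⟩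
  have hu0 : βL u = βR u := sub_eq_zero.1 hu0
  have hyu : y < u := hu.1.lt_of_ne (by rintro rfl; exact e2.ne hu0)
  have huz : u < z := hu.2.lt_of_ne (by rintro rfl; exact e1.ne hu0.symm)
  refine ⟨u, ⟨hy.1.trans_lt hyu, huz.trans_le hz.2⟩, hu0.symm, fun t ht => ?_, fun t ht => ?_⟩
  · rcases le_total t w with h | h
    · exact h1 t ⟨ht.1, h⟩
    · by_contra! hcon
      exact (ht.2.trans_lt huz).not_ge (hzmin ⟨⟨h, ht.2.trans (huz.le.trans hz.2)⟩, hcon⟩)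
  · rcases le_total v t with h | h
    · exact h2 t ⟨h, ht.2⟩
    · by_contra! hcon
      exact (hyu.trans_le ht.1).not_ge (hymax ⟨⟨hy.1.trans (hyu.le.trans ht.1), h⟩, hcon⟩)

end
end BellmanFoliation

namespace BellmanFoliation
noncomputable section

/-! ### Central figures for small values of the parameter -/

/-- The type of a central figure that grows from the interval of constancy with ends `cl`, `cr`:
a cup grows from a point, a multicup sits on a nondegenerate interval. -/
def Core.Shape (cl cr : EReal) : Core → Prop
  | cup c _ _ => cl = c ∧ cr = c
  | multicup l r => l < r ∧ cl = l ∧ cr = r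
  | minusInf => cl = ⊥ ∧ cr = ⊥
  | plusInf => cl = ⊤ ∧ cr = ⊤

/-- A central figure over a part of the interval `(lo, hi)`, together with solutions along the
tangents on both sides of it. -/
structure Core.Fits (G : ℝ → ℝ → ℝ × ℝ) (f : ℝ → ℝ) (ε : ℝ) (cl cr lo hi El Er : EReal) (M : ℝ)
    (K : Core) (βR βL : ℝ → ℝ) : Prop where
  shape : K.Shape cl cr
  valid : K.Valid G f ε
  lt_left : K.left ≠ ⊥ → lo < K.left
  right_lt : K.right ≠ ⊤ → K.right < hi
  right : K.right ≠ ⊤ → RightBranch G f ε K.right Er (K.val G f) M βR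
  left : K.left ≠ ⊥ → LeftBranch G f ε K.left El (K.val G f) M βL

lemma Core.Shape.left_eq_bot {cl cr : EReal} {K : Core} (h : K.Shape cl cr) (h' : K.left = ⊥) :
    cl = ⊥ := by
  cases K with
  | cup c b s => exact absurd h' (EReal.coe_ne_bot _)
  | multicup l r => exact h.2.1.trans h'
  | minusInf => exact h.1
  | plusInf => exact absurd h' (by simp [Core.left])

lemma Core.Shape.right_eq_top {cl cr : EReal} {K : Core} (h : K.Shape cl cr) (h' : K.right = ⊤) :
    cr = ⊤ := by
  cases K with
  | cup c b s => exact absurd h' (EReal.coe_ne_top _)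
  | multicup l r => exact h.2.2.trans h'
  | minusInf => exact absurd h' (by simp [Core.right])
  | plusInf => exact h.2

namespace AdmissibleFamily

variable {εmax : EReal} {G : ℝ → ℝ → ℝ × ℝ} (hG : AdmissibleFamily εmax G) {f : ℝ → ℝ}
  (hf : BoundaryData G f)
include hG hf

/-- From a point of strict maximum of `tors` a cup grows up to the chord tangent to the free
boundary. -/
lemma eventually_exists_cup {c lo hi : ℝ} {El Er : EReal} (hlo : lo < c) (hhi : c < hi)
    (hEl : El ≤ (lo : EReal)) (hEr : (hi : EReal) ≤ Er)
    (hmono : MonotoneOn (tors G f) (realIcc El c)) (hanti : AntitoneOn (tors G f) (realIcc c Er))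
    (hl : ∀ t : ℝ, t < c → ¬ ConstOn (tors G f) (Icc t c))
    (hr : ∀ t : ℝ, c < t → ¬ ConstOn (tors G f) (Icc c t)) :
    ∀ᶠ ε : ℝ in 𝓝[>] 0, ∃ K βR βL,
      Core.Fits G f ε c c lo hi El Er (tors G f c) K βR βL := by
  have hm : MonotoneOn (tors G f) (Icc lo c) := by
    rw [← realIcc_coe]; exact hmono.mono (realIcc_mono hEl le_rfl)
  have ha : AntitoneOn (tors G f) (Icc c hi) := by
    rw [← realIcc_coe]; exact hanti.mono (realIcc_mono le_rfl hEr)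
  obtain ⟨b', s, hb', hs, hsa⟩ := hf.exists_isCup hlo hhi hm ha hl hr
  filter_upwards [hG.eventually_mem, hG.eventually_tangency_lt (hs.map_lt_self ⟨hs.lt, le_rfl⟩)]
    with ε ⟨hε, h0⟩ hlt
  have hp := hG.isTangentPair hε h0
  -- The two ends of the chord have the same tangent when this difference vanishes. It is negative at
  -- the origin, where the left tangency point is to the right of the right one, and positive for a
  -- fixed chord once the tangents are short.
  have hcont : ContinuousOn (fun t => tanPar (G ε) Side.R (G 0 t) -
      tanPar (G ε) Side.L (G 0 (s t))) (Icc c b') :=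
    (hp.continuous_tangency Side.R).continuousOn.sub
      ((hp.continuous_tangency Side.L).comp_continuousOn hs.continuousOn)
  obtain ⟨b, hb, hb0⟩ := intermediate_value_Ioo hs.lt.le hcont
    (show (0 : ℝ) ∈ Ioo _ _ from ⟨by rw [hs.map_origin]; exact sub_neg.2 (hp.tangency_lt c),
      sub_pos.2 hlt⟩)
  have hbI : b ∈ Ioc c b' := ⟨hb.1, hb.2.le⟩
  have hsb : s b < c := hs.map_lt hbI
  have hlos : lo < s b := (hsa b' ⟨hs.lt.le, le_rfl⟩).trans_lt
    (hs.strictAnti ⟨hb.1.le, hb.2.le⟩ ⟨hs.lt.le, le_rfl⟩ hb.2)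
  have hbhi : b < hi := hb.2.trans_le hb'
  have hM : chordRatio G f (s b) b ≤ tors G f c := by
    obtain ⟨ξ, hξ, h⟩ := hf.exists_tors_eq_chordRatio (hsb.trans hb.1).le
    rw [← h]
    rcases le_total ξ c with h' | h'
    · exact hm ⟨hlos.le.trans hξ.1, h'⟩ ⟨hlo.le, le_rfl⟩ h'
    · exact ha ⟨le_rfl, hhi.le⟩ ⟨h', hξ.2.trans hbhi.le⟩ h'
  obtain ⟨βR, hβR⟩ := hG.exists_rightBranch hf hε h0 (b := b)
    ((EReal.coe_lt_coe_iff.2 hbhi).trans_le hEr)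
    (hanti.mono (realIcc_mono (EReal.coe_le_coe_iff.2 hb.1.le) le_rfl))
    (hs.tors_right b hbI).le (Or.inl (hs.tors_right b hbI)) hM
  obtain ⟨βL, hβL⟩ := hG.exists_leftBranch hf hε h0 (b := s b)
    (hEl.trans_lt (EReal.coe_lt_coe_iff.2 hlos))
    (hmono.mono (realIcc_mono le_rfl (EReal.coe_le_coe_iff.2 hsb.le)))
    (hs.tors_left b hbI).le (Or.inl (hs.tors_left b hbI)) hM
  exact ⟨.cup c b s, βR, βL, ⟨rfl, rfl⟩, ⟨⟨b', hb.2, hs⟩, hb.1, (sub_eq_zero.1 hb0).symm⟩,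
    fun _ => EReal.coe_lt_coe_iff.2 hlos, fun _ => EReal.coe_lt_coe_iff.2 hbhi,
    fun _ => hβR, fun _ => hβL⟩

/-- A multicup sits on an interval of constancy of `tors` as soon as the tangents are so short that
the convex hull of the arc leaves the domain. -/
lemma eventually_exists_multicup {cl cr lo hi El Er : EReal} (hlt : cl < cr)
    (hconst : ConstOn (tors G f) (realIcc cl cr))
    (hmono : MonotoneOn (tors G f) (realIcc El cl)) (hanti : AntitoneOn (tors G f) (realIcc cr Er))
    (hl : ∀ t : ℝ, (t : EReal) < cl → ¬ ConstOn (tors G f) (realIcc t cl))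
    (hr : ∀ t : ℝ, cr < (t : EReal) → ¬ ConstOn (tors G f) (realIcc cr t))
    (hlo : cl ≠ ⊥ → lo < cl) (hhi : cr ≠ ⊤ → cr < hi) (hEl : El ≤ lo) (hEr : hi ≤ Er) :
    ∀ᶠ ε : ℝ in 𝓝[>] 0, ∃ K βR βL, Core.Fits G f ε cl cr lo hi El Er
      (tors G f (Core.point cl cr)) K βR βL := by
  obtain ⟨t₁, h1, h1'⟩ := EReal.lt_iff_exists_real_btwn.1 hlt
  obtain ⟨t₂, h2, h2'⟩ := EReal.lt_iff_exists_real_btwn.1 h1'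
  have h12 := EReal.coe_lt_coe_iff.1 h2
  have hpt := Core.point_mem hlt
  filter_upwards [hG.eventually_mem, hG.eventually_tangency_lt h12] with ε ⟨hε, h0⟩ hlt'
  have hR : ∃ βR, cr ≠ ⊤ → RightBranch G f ε cr Er (tors G f (Core.point cl cr))
      (tors G f (Core.point cl cr)) βR := by
    induction cr with
    | bot => exact absurd hlt not_lt_bot
    | top => exact ⟨0, fun h => absurd rfl h⟩
    | coe b =>
      obtain ⟨β, hβ⟩ := hG.exists_rightBranch hf hε h0 ((hhi (EReal.coe_ne_top b)).trans_le hEr)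
        hanti (hconst b ⟨hlt.le, le_rfl⟩ _ hpt).le (Or.inr hr) le_rfl
      exact ⟨β, fun _ => hβ⟩
  have hL : ∃ βL, cl ≠ ⊥ → LeftBranch G f ε cl El (tors G f (Core.point cl cr))
      (tors G f (Core.point cl cr)) βL := by
    induction cl with
    | top => exact absurd hlt not_top_lt
    | bot => exact ⟨0, fun h => absurd rfl h⟩
    | coe b =>
      obtain ⟨β, hβ⟩ := hG.exists_leftBranch hf hε h0 (hEl.trans_lt (hlo (EReal.coe_ne_bot b)))
        hmono (hconst b ⟨le_rfl, hlt.le⟩ _ hpt).le (Or.inr hl) le_rfl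
      exact ⟨β, fun _ => hβ⟩
  obtain ⟨βR, hβR⟩ := hR
  obtain ⟨βL, hβL⟩ := hL
  exact ⟨.multicup cl cr, βR, βL, ⟨hlt, rfl, rfl⟩, ⟨hlt, hconst, t₁, ⟨h1.le, h1'.le⟩, t₂,
    ⟨(h1.trans h2).le, h2'.le⟩, h12, hlt'⟩, hlo, hhi, hβR, hβL⟩

/-- The bound `M` of the solutions is independent of `ε`; this is what makes the rate win over the
initial value as `ε` tends to zero. -/
lemma exists_eventually_fits (hsum : SummabilityCondition εmax G f) {cl cr lo hi El Er : EReal}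
    (hle : cl ≤ cr) (hconst : ConstOn (tors G f) (realIcc cl cr))
    (hmono : MonotoneOn (tors G f) (realIcc El cl)) (hanti : AntitoneOn (tors G f) (realIcc cr Er))
    (hl : ∀ t : ℝ, (t : EReal) < cl → ¬ ConstOn (tors G f) (realIcc t cl))
    (hr : ∀ t : ℝ, cr < (t : EReal) → ¬ ConstOn (tors G f) (realIcc cr t))
    (hlo : cl ≠ ⊥ → lo < cl) (hhi : cr ≠ ⊤ → cr < hi) (hEl : El ≤ lo) (hEr : hi ≤ Er) :
    ∃ M, ∀ᶠ ε : ℝ in 𝓝[>] 0, ∃ K βR βL, Core.Fits G f ε cl cr lo hi El Er M K βR βL := by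
  rcases hle.lt_or_eq with hlt | rfl
  · exact ⟨_, hG.eventually_exists_multicup hf hlt hconst hmono hanti hl hr hlo hhi hEl hEr⟩
  induction cl with
  | bot =>
    obtain ⟨M, h⟩ := hG.eventually_exists_rightBranch_bot hf hsum
      ((hhi bot_ne_top).trans_le hEr) hanti (fun t ht => hr t ht) 0
    refine ⟨M, h.mono fun ε ⟨β, hβ⟩ => ⟨.minusInf, β, 0, ⟨rfl, rfl⟩, trivial,
      fun h => absurd rfl h, fun _ => hhi bot_ne_top, fun _ => hβ, fun h => absurd rfl h⟩⟩
  | top =>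
    obtain ⟨M, h⟩ := hG.eventually_exists_leftBranch_top hf hsum
      (hEl.trans_lt (hlo top_ne_bot)) hmono (fun t ht => hl t ht) 0
    refine ⟨M, h.mono fun ε ⟨β, hβ⟩ => ⟨.plusInf, 0, β, ⟨rfl, rfl⟩, trivial,
      fun _ => hlo top_ne_bot, fun h => absurd rfl h, fun h => absurd rfl h, fun _ => hβ⟩⟩
  | coe c =>
    obtain ⟨lo', h1, h1'⟩ := EReal.lt_iff_exists_real_btwn.1 (hlo (EReal.coe_ne_bot c))
    obtain ⟨hi', h2, h2'⟩ := EReal.lt_iff_exists_real_btwn.1 (hhi (EReal.coe_ne_top c))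
    simp only [EReal.coe_lt_coe_iff, realIcc_coe] at hl hr h1' h2
    refine ⟨_, (hG.eventually_exists_cup hf h1' h2 (hEl.trans h1.le) (h2'.le.trans hEr) hmono hanti
      hl hr).mono fun ε ⟨K, βR, βL, h⟩ => ⟨K, βR, βL, h.shape, h.valid,
      fun h3 => h1.trans (h.lt_left h3), fun h3 => (h.right_lt h3).trans h2', h.right, h.left⟩⟩

end AdmissibleFamily

end
end BellmanFoliation

namespace BellmanFoliation
noncomputable section

/-! ### Foliations for small values of the parameter -/

/-- Foliation data adapted to a system of roots: the central figures grow from the roots `c i`, the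
angles lie near the roots `v k`, and the solutions are bounded at the ends of `v k` by numbers `M i`
that do not depend on `ε`. -/
structure FoliationData.Adapted {n : ℕ} (D : FoliationData n) (εmax : EReal) (G : ℝ → ℝ → ℝ × ℝ)
    (f : ℝ → ℝ) (ε : ℝ) (R : RootSystem n) (p q : Fin n → ℝ) (M : Fin (n + 1) → ℝ) : Prop where
  admissible : D.Admissible εmax G f ε
  shape : ∀ i, (D.core i).Shape (R.cl i) (R.cr i)
  right_lt : ∀ k : Fin n, (D.core k.castSucc).right < p k
  lt_left : ∀ k : Fin n, (q k : EReal) < (D.core k.succ).left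
  leR : ∀ k : Fin n, D.βR k.castSucc (R.vr k) ≤ M k.castSucc
  leL : ∀ k : Fin n, D.βL k.succ (R.vl k) ≤ M k.succ

namespace RootSystem.IsEssential

variable {n : ℕ} {R : RootSystem n}

lemma mono_left {h : ℝ → ℝ} (hR : R.IsEssential h) (i : Fin (n + 1)) :
    MonotoneOn h (realIcc (leftSink R.vl i) (R.cl i)) := by
  induction i using Fin.cases with
  | zero => exact hR.mono_first
  | succ k =>
    refine MonotoneOn.glue_realIcc (b := R.vr k) (EReal.coe_le_coe_iff.2 (hR.v_le k))
      (hR.v_lt_c k).le ?_ (hR.mono_v_c k)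
    rw [leftSink_succ, realIcc_coe]
    exact fun s hs t ht _ => (hR.const_v k s hs t ht).le

lemma anti_right {h : ℝ → ℝ} (hR : R.IsEssential h) (i : Fin (n + 1)) :
    AntitoneOn h (realIcc (R.cr i) (rightSink R.vr i)) := by
  induction i using Fin.lastCases with
  | last => rw [rightSink_last]; exact hR.anti_last
  | cast k =>
    refine AntitoneOn.glue_realIcc (b := R.vl k) (hR.c_lt_v k).le ?_ (hR.anti_c_v k) ?_
    · rw [rightSink_castSucc]; exact EReal.coe_le_coe_iff.2 (hR.v_le k)
    rw [rightSink_castSucc, realIcc_coe]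
    exact fun s hs t ht _ => (hR.const_v k t ht s hs).le

variable {εmax : EReal} {G : ℝ → ℝ → ℝ × ℝ} {f : ℝ → ℝ} (hR : R.IsEssential (tors G f))
  (hG : AdmissibleFamily εmax G) (hf : BoundaryData G f)
include hR hG hf

/-- For small `ε` the solutions on right tangents cannot stay above `tors` up to a point to the
right of `v k`, uniformly with respect to the bound for them. -/
lemma eventually_lt_right (k : Fin n) {q : ℝ} (hq : R.vr k < q) (hq' : (q : EReal) < R.cl k.succ)
    (M : ℝ) : ∀ᶠ ε : ℝ in 𝓝[>] 0, ∀ β, IsRelaxation (rate G ε Side.R) (tors G f) β →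
      β (R.vr k) ≤ M → β q < tors G f q := by
  refine hG.eventually_lt_tors_right hf hq ?_ (hR.max_v_right k q hq) M
  rw [← realIcc_coe]
  exact (hR.mono_v_c k).mono (realIcc_mono le_rfl hq'.le)

lemma eventually_lt_left (k : Fin n) {p : ℝ} (hp : p < R.vl k)
    (hp' : R.cr k.castSucc < (p : EReal)) (M : ℝ) : ∀ᶠ ε : ℝ in 𝓝[>] 0, ∀ β,
      IsRelaxation (rate G ε Side.L) (tors G f) β → β (R.vl k) ≤ M → β p < tors G f p := by
  refine hG.eventually_lt_tors_left hf hp ?_ (hR.max_v_left k p hp) M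
  rw [← realIcc_coe]
  exact (hR.anti_c_v k).mono (realIcc_mono hp'.le le_rfl)

/-- The central figures grow from the roots `c i` independently of each other, and two neighboring
ones are joined by an angle. -/
lemma exists_eventually_adapted (hsum : SummabilityCondition εmax G f) {p q : Fin n → ℝ}
    (hp : ∀ k, p k < R.vl k) (hp' : ∀ k : Fin n, R.cr k.castSucc < (p k : EReal))
    (hq : ∀ k, R.vr k < q k) (hq' : ∀ k : Fin n, (q k : EReal) < R.cl k.succ) :
    ∃ M, ∀ᶠ ε : ℝ in 𝓝[>] 0, ∃ D : FoliationData n, D.Adapted εmax G f ε R p q M := by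
  have hfit : ∀ i, ∃ M, ∀ᶠ ε : ℝ in 𝓝[>] 0, ∃ K βR βL, Core.Fits G f ε (R.cl i) (R.cr i)
      (leftSink q i) (rightSink p i) (leftSink R.vl i) (rightSink R.vr i) M K βR βL := by
    intro i
    refine hG.exists_eventually_fits hf hsum (hR.c_le i) (hR.const_c i) (hR.mono_left i)
      (hR.anti_right i) (hR.max_c_left i) (hR.max_c_right i) ?_ ?_ ?_ ?_
    · induction i using Fin.cases with
      | zero => exact fun h => bot_lt_iff_ne_bot.2 h
      | succ k => exact fun _ => hq' k
    · induction i using Fin.lastCases with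
      | last => rw [rightSink_last]; exact fun h => lt_top_iff_ne_top.2 h
      | cast k => rw [rightSink_castSucc]; exact fun _ => hp' k
    · induction i using Fin.cases with
      | zero => exact le_rfl
      | succ k => exact EReal.coe_le_coe_iff.2 ((hR.v_le k).trans (hq k).le)
    · induction i using Fin.lastCases with
      | last => rw [rightSink_last, rightSink_last]
      | cast k =>
        rw [rightSink_castSucc, rightSink_castSucc]
        exact EReal.coe_le_coe_iff.2 ((hp k).le.trans (hR.v_le k))
  choose M hM using hfit
  refine ⟨M, ?_⟩
  filter_upwards [hG.eventually_mem, eventually_all.2 hM,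
    eventually_all.2 fun k => hR.eventually_lt_right hG hf k (hq k) (hq' k) (M k.castSucc),
    eventually_all.2 fun k => hR.eventually_lt_left hG hf k (hp k) (hp' k) (M k.succ)]
    with ε ⟨hε, h0⟩ hfit hr hl
  choose K βR βL hK using hfit
  have hKr : ∀ k : Fin n, (K k.castSucc).right < p k := fun k => by
    have h := (hK k.castSucc).right_lt fun h => (((hp' k).trans (EReal.coe_lt_top _)).ne
      ((hK k.castSucc).shape.right_eq_top h))
    rwa [rightSink_castSucc] at h
  have hKl : ∀ k : Fin n, (q k : EReal) < (K k.succ).left := fun k =>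
    (hK k.succ).lt_left fun h => (((EReal.bot_lt_coe _).trans (hq' k)).ne'
      ((hK k.succ).shape.left_eq_bot h))
  have hbR : ∀ k : Fin n, RightBranch G f ε (K k.castSucc).right (R.vr k)
      ((K k.castSucc).val G f) (M k.castSucc) (βR k.castSucc) := fun k => by
    have h := (hK k.castSucc).right ((hKr k).trans (EReal.coe_lt_top _)).ne
    rwa [rightSink_castSucc] at h
  have hbL : ∀ k : Fin n, LeftBranch G f ε (K k.succ).left (R.vl k)
      ((K k.succ).val G f) (M k.succ) (βL k.succ) := fun k =>
    (hK k.succ).left ((EReal.bot_lt_coe _).trans (hKl k)).ne'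
  -- between neighboring central figures the solution from the left and the one from the right cross
  have hangle : ∀ k : Fin n, ∃ u ∈ Ioo (p k) (q k), βR k.castSucc u = βL k.succ u ∧
      (∀ t ∈ Icc (p k) u, tors G f t < βR k.castSucc t) ∧
      ∀ t ∈ Icc u (q k), tors G f t < βL k.succ t := fun k =>
    exists_angle hf.continuous_tors (hbR k).sol.continuous (hbL k).sol.continuous (hp k) (hR.v_le k)
      (hq k) (fun t ht => (hbR k).lt t ((hKr k).trans_le (EReal.coe_le_coe_iff.2 ht.1))
        (EReal.coe_le_coe_iff.2 ht.2))
      (fun t ht => (hbL k).lt t ((EReal.coe_le_coe_iff.2 ht.2).trans_lt (hKl k))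
        (EReal.coe_le_coe_iff.2 ht.1))
      (hr k _ (hbR k).sol ((hbR k).le _ rfl)) (hl k _ (hbL k).sol ((hbL k).le _ rfl))
  choose u hu hmatch huR huL using hangle
  have hur : ∀ k : Fin n, (K k.castSucc).right < u k := fun k =>
    (hKr k).trans (EReal.coe_lt_coe_iff.2 (hu k).1)
  have hul : ∀ k : Fin n, (u k : EReal) < (K k.succ).left := fun k =>
    (EReal.coe_lt_coe_iff.2 (hu k).2).trans (hKl k)
  have hltR : ∀ i, ∀ t : ℝ, (K i).right < t → (t : EReal) ≤ rightSink u i →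
      tors G f t < βR i t := by
    intro i t h1 h2
    induction i using Fin.lastCases with
    | last =>
      have h := (hK (Fin.last n)).right (h1.trans (EReal.coe_lt_top t)).ne
      rw [rightSink_last] at h
      exact h.lt t h1 le_top
    | cast k =>
      rw [rightSink_castSucc, EReal.coe_le_coe_iff] at h2
      rcases le_total t (R.vr k) with h | h
      · exact (hbR k).lt t h1 (EReal.coe_le_coe_iff.2 h)
      · exact huR k t ⟨(hp k).le.trans ((hR.v_le k).trans h), h2⟩
  have hltL : ∀ i, ∀ t : ℝ, (t : EReal) < (K i).left → leftSink u i ≤ (t : EReal) →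
      tors G f t < βL i t := by
    intro i t h1 h2
    induction i using Fin.cases with
    | zero => exact ((hK 0).left ((EReal.bot_lt_coe t).trans h1).ne').lt t h1 bot_le
    | succ k =>
      rw [leftSink_succ, EReal.coe_le_coe_iff] at h2
      rcases le_total (R.vl k) t with h | h
      · exact (hbL k).lt t h1 (EReal.coe_le_coe_iff.2 h)
      · exact huL k t ⟨h2, h.trans ((hR.v_le k).trans (hq k).le)⟩
  refine ⟨⟨K, u, βR, βL⟩, ⟨hG, hε, h0, hf, ?_⟩, fun i => (hK i).shape, hKr, hKl,
    fun k => (hbR k).le _ rfl, fun k => (hbL k).le _ rfl⟩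
  have hlt_left : ∀ i, (K i).left ≠ ⊥ → leftSink u i < (K i).left := by
    intro i hi
    induction i using Fin.cases with
    | zero => exact bot_lt_iff_ne_bot.2 hi
    | succ k => exact hul k
  have hright_lt : ∀ i, (K i).right ≠ ⊤ → (K i).right < rightSink u i := by
    intro i hi
    induction i using Fin.lastCases with
    | last => rw [rightSink_last]; exact lt_top_iff_ne_top.2 hi
    | cast k => rw [rightSink_castSucc]; exact hur k
  exact {
    core_valid := fun i => (hK i).valid
    le_left := fun i => by
      induction i using Fin.cases with
      | zero => exact bot_le
      | succ k => exact (hul k).le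
    lt_left := hlt_left
    right_le := fun i => by
      induction i using Fin.lastCases with
      | last => simp
      | cast k => rw [rightSink_castSucc]; exact (hur k).le
    right_lt := hright_lt
    solR := fun i hi => ((hK i).right hi).sol
    solL := fun i hi => ((hK i).left hi).sol
    initR := fun i b hb => ((hK i).right (by rw [hb]; exact EReal.coe_ne_top b)).init b hb
    initL := fun i b hb => ((hK i).left (by rw [hb]; exact EReal.coe_ne_bot b)).init b hb
    leR := fun i t ht => by
      rcases ht.1.eq_or_lt with h | h
      · exact ((hK i).right (by rw [h]; exact EReal.coe_ne_top t)).le_init t h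
      · exact (hltR i t h ht.2).le
    leL := fun i t ht => by
      rcases ht.2.eq_or_lt with h | h
      · exact ((hK i).left (by rw [← h]; exact EReal.coe_ne_bot t)).le_init t h.symm
      · exact (hltL i t h ht.1).le
    ltR := fun i t ht => hltR i t ht.1 ht.2.le
    ltL := fun i t ht => hltL i t ht.2 ht.1.le
    decayR := fun i hi => ((hK i).right (by rw [hi]; exact bot_ne_top)).decay hi
    decayL := fun i hi => ((hK i).left (by rw [hi]; exact top_ne_bot)).decay hi
    matching := hmatch }

/-- The angles approach the roots `v k`: at a fixed distance from `v k` the solutions of bounded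
size go below `tors` as soon as `ε` is small, while up to the angle they stay above it. -/
lemma tendsto_angle {p q : Fin n → ℝ} {M : Fin (n + 1) → ℝ}
    (hp' : ∀ k : Fin n, R.cr k.castSucc < (p k : EReal))
    (hq' : ∀ k : Fin n, (q k : EReal) < R.cl k.succ) (hp : ∀ k, p k < R.vl k)
    (hq : ∀ k, R.vr k < q k) {D : ℝ → FoliationData n}
    (hD : ∀ᶠ ε : ℝ in 𝓝[>] 0, (D ε).Adapted εmax G f ε R p q M) (k : Fin n) :
    Tendsto (fun ε => (D ε).u k) (𝓝[>] 0) (𝓝ˢ (Icc (R.vl k) (R.vr k))) := by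
  rw [(hasBasis_nhdsSet (Icc (R.vl k) (R.vr k))).tendsto_right_iff]
  rintro U ⟨hUo, hU⟩
  have hv := hR.v_le k
  obtain ⟨x, ⟨hx1, hx2⟩, hxU⟩ := exists_Ioc_subset_of_mem_nhds'
    (hUo.mem_nhds (hU (left_mem_Icc.2 hv))) (hp k)
  obtain ⟨y, ⟨hy1, hy2⟩, hyU⟩ := exists_Ico_subset_of_mem_nhds'
    (hUo.mem_nhds (hU (right_mem_Icc.2 hv))) (hq k)
  have hxp : (p k : EReal) ≤ x := EReal.coe_le_coe_iff.2 hx1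
  have hyq : (y : EReal) ≤ q k := EReal.coe_le_coe_iff.2 hy2
  filter_upwards [hD, hR.eventually_lt_right hG hf k hy1 (hyq.trans_lt (hq' k)) (M k.castSucc),
    hR.eventually_lt_left hG hf k hx2 ((hp' k).trans_le hxp) (M k.succ)] with ε H hr hl
  have hV := H.admissible.valid
  have huy : (D ε).u k < y := by
    by_contra! hcon
    refine (hr _ (hV.solR k.castSucc ((H.right_lt k).trans (EReal.coe_lt_top _)).ne)
      (H.leR k)).not_ge (hV.leR k.castSucc y ⟨?_, ?_⟩)
    · exact ((H.right_lt k).trans (EReal.coe_lt_coe_iff.2 ((hp k).trans_le (hv.trans hy1.le)))).le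
    · rw [rightSink_castSucc]; exact EReal.coe_le_coe_iff.2 hcon
  have hxu : x < (D ε).u k := by
    by_contra! hcon
    refine (hl _ (hV.solL k.succ ((EReal.bot_lt_coe _).trans (H.lt_left k)).ne')
      (H.leL k)).not_ge (hV.leL k.succ x ⟨EReal.coe_le_coe_iff.2 hcon, ?_⟩)
    exact ((EReal.coe_lt_coe_iff.2 (hx2.trans_le (hv.trans (hq k).le))).trans (H.lt_left k)).le
  rcases le_or_gt ((D ε).u k) (R.vl k) with h | h
  · exact hxU ⟨hxu, h⟩
  rcases le_or_gt (R.vr k) ((D ε).u k) with h' | h'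
  · exact hyU ⟨h', huy⟩
  · exact hU ⟨h.le, h'.le⟩

end RootSystem.IsEssential

namespace FoliationData.Adapted

variable {n : ℕ} {D : FoliationData n} {εmax : EReal} {G : ℝ → ℝ → ℝ × ℝ} {f : ℝ → ℝ} {ε : ℝ}
  {R : RootSystem n} {p q : Fin n → ℝ} {M : Fin (n + 1) → ℝ}
  (H : D.Adapted εmax G f ε R p q M)
include H

lemma exists_cup_iff (c : ℝ) : (∃ e b s, D.graph.edge e = .cup c b s) ↔
    ∃ i, R.cl i = (c : EReal) ∧ R.cr i = (c : EReal) := by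
  rw [FoliationData.Admissible.exists_cup_iff]
  refine exists_congr fun i => ⟨?_, fun ⟨h1, h2⟩ => ?_⟩
  · rintro ⟨b, s, h⟩
    have := H.shape i
    rwa [h] at this
  · have h := H.shape i
    rw [h1, h2] at h
    cases hK : D.core i with
    | cup c' b s =>
      rw [hK] at h
      rw [EReal.coe_eq_coe_iff.1 h.1]; exact ⟨b, s, rfl⟩
    | multicup l r => rw [hK] at h; exact absurd (h.2.1.symm.trans h.2.2) h.1.ne
    | minusInf => rw [hK] at h; exact absurd h.1 (EReal.coe_ne_bot c)
    | plusInf => rw [hK] at h; exact absurd h.1 (EReal.coe_ne_top c)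

lemma exists_multicup_iff (l r : EReal) : (∃ i, D.graph.vertex i = .multicup l r) ↔
    l < r ∧ ∃ i, R.cl i = l ∧ R.cr i = r := by
  rw [FoliationData.Admissible.exists_multicup_iff]
  constructor
  · rintro ⟨i, h⟩
    have := H.shape i
    rw [h] at this
    exact ⟨this.1, i, this.2⟩
  · rintro ⟨hlr, i, rfl, rfl⟩
    have h := H.shape i
    refine ⟨i, ?_⟩
    cases hK : D.core i with
    | cup c b s => rw [hK] at h; exact absurd (h.1.trans h.2.symm) hlr.ne
    | multicup l r => rw [hK] at h; rw [h.2.1, h.2.2]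
    | minusInf => rw [hK] at h; exact absurd (h.1.trans h.2.symm) hlr.ne
    | plusInf => rw [hK] at h; exact absurd (h.1.trans h.2.symm) hlr.ne

end FoliationData.Adapted

lemma le_of_forall_mem_paramSet {εmax : EReal} {ε₁ : ℝ}
    (h : ∀ ε : ℝ, 0 < ε → ε < ε₁ → ε ∈ paramSet εmax) (h0 : 0 < ε₁) : (ε₁ : EReal) ≤ εmax := by
  by_contra! hcon
  obtain ⟨x, hx, hx'⟩ := EReal.lt_iff_exists_real_btwn.1
    (max_lt hcon (EReal.coe_lt_coe_iff.2 h0 : ((0 : ℝ) : EReal) < ε₁))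
  exact (h x (EReal.coe_lt_coe_iff.1 ((le_max_right _ _).trans_lt hx))
    (EReal.coe_lt_coe_iff.1 hx')).2.not_ge ((le_max_left _ _).trans hx.le)

end
end BellmanFoliation

theorem mainTheorem4 (εmax : EReal) (G : ℝ → ℝ → ℝ × ℝ) (hG : AdmissibleFamily εmax G)
    (f : ℝ → ℝ) (hreg : RegularityCondition G f) (hsum : SummabilityCondition εmax G f) :
    (∃ (n : ℕ) (R : RootSystem n), R.IsEssential (tors G f)) ∧
    ∀ (n : ℕ) (R : RootSystem n), R.IsEssential (tors G f) →
      ∃ ε₁ : ℝ, 0 < ε₁ ∧ (ε₁ : EReal) ≤ εmax ∧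
      ∃ (Γ : ℝ → FoliationGraph) (B : ℝ → ℝ × ℝ → ℝ) (u : ℝ → Fin n → ℝ),
        (∀ ε : ℝ, 0 < ε → ε < ε₁ →
          (Γ ε).IsFoliation G f ε ∧ (Γ ε).IsSimple ∧ (Γ ε).Generates G f ε (B ε) ∧
          IsBellmanCandidate G f ε (B ε) ∧ ContDiffOn ℝ 1 (B ε) (Om G ε) ∧
          (∀ c : ℝ, (∃ e b s, (Γ ε).edge e = FEdge.cup c b s) ↔
            ∃ i, R.cl i = (c : EReal) ∧ R.cr i = (c : EReal)) ∧
          (∀ l r : EReal, (∃ i, (Γ ε).vertex i = FVertex.multicup l r) ↔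
            l < r ∧ ∃ i, R.cl i = l ∧ R.cr i = r) ∧
          StrictMono (u ε) ∧
          (∀ x : ℝ, (∃ i, (Γ ε).vertex i = FVertex.angle x) ↔ ∃ k, u ε k = x)) ∧
        ∀ k : Fin n, Tendsto (fun ε => u ε k) (𝓝[>] 0) (𝓝ˢ (Icc (R.vl k) (R.vr k))) := by
  have hf : BoundaryData G f := ⟨hG.isConvexCurve hG.zero_mem, hreg.1⟩
  refine ⟨exists_isEssential hf.continuous_tors hreg.2, fun n R hR => ?_⟩
  -- fixed neighborhoods `(p k, q k)` of the roots `v k` that contain no points of the roots `c i`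
  choose p hp' hp using fun k => EReal.lt_iff_exists_real_btwn.1 (hR.c_lt_v k)
  choose q hq hq' using fun k => EReal.lt_iff_exists_real_btwn.1 (hR.v_lt_c k)
  simp only [EReal.coe_lt_coe_iff] at hp hq
  obtain ⟨M, hM⟩ := hR.exists_eventually_adapted hG hf hsum hp hp' hq hq'
  obtain ⟨ε₁, h1, hsub⟩ := mem_nhdsGT_iff_exists_Ioo_subset.1 hM
  have hex : ∀ ε : ℝ, ∃ D : FoliationData n, ε ∈ Ioo 0 ε₁ → D.Adapted εmax G f ε R p q M := by
    intro ε
    by_cases hε : ε ∈ Ioo 0 ε₁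
    · obtain ⟨D, hD⟩ := hsub hε
      exact ⟨D, fun _ => hD⟩
    · exact ⟨⟨fun _ => .minusInf, 0, 0, 0⟩, fun h => absurd h hε⟩
  choose D hD using hex
  refine ⟨ε₁, h1, le_of_forall_mem_paramSet (fun ε h h' => (hD ε ⟨h, h'⟩).admissible.mem) h1,
    fun ε => (D ε).graph, fun ε => (D ε).candidate G f ε, fun ε => (D ε).u, fun ε h0 hlt => ?_,
    hR.tendsto_angle hG hf hp' hq' hp hq (by
      filter_upwards [Ioo_mem_nhdsGT h1] with ε hε using hD ε hε)⟩
  have H := hD ε ⟨h0, hlt⟩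
  have HA := H.admissible
  exact ⟨HA.isFoliation_graph, (D ε).isSimple_graph, HA.generates_graph, HA.isBellmanCandidate,
    HA.contDiffOn_candidate, H.exists_cup_iff, H.exists_multicup_iff, HA.strictMono_u,
    fun x => FoliationData.Admissible.exists_angle_iff⟩
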